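/- Let $k$ be an algebraically closed field. A *normal surface singularity* over $k$ is a $k$-algebra $A$ that is a complete noetherian local normal domain of Krull dimension $2$ such that $k\to A/\mathfrak m_A$ is an isomorphism. A *dualizing module* of such a ring is a finitely generated module $\omega$ with $\mathrm{Ext}^2_A(k,\omega)\cong k$ and $\mathrm{Ext}^i_A(k,\omega)=0$ for $i\ne 2$; $A$ is *Gorenstein* if $A$ is a dualizing module over itself. Let $B$ be a normal surface singularity over $k$ with field of fractions $K$, let $\omega\subset K$ be a dualizing (fractional) ideal of $B$, and put $\omega^{(m)}=\bigcap_{\mathrm{ht}\,\mathfrak p=1}\omega_{\mathfrak p}^m$ for $m\ge 0$. Suppose that $B$ is $\mathbb Q$-Gorenstein, i.e. $\omega^{(m)}$ is principal for some $m>0$ prime to $\mathrm{char}\,k$. Let $n$ be the smallest positive integer such that $\omega^{(n)}$ is principal, and let $\omega^{(n)}=\theta B$. Let $A=\bigoplus_{i=0}^{n-1}\omega^{(i)}$, with the $B$-algebra structure in which the product of $a\in\omega^{(i)}$ and $b\in\omega^{(j)}$ is $ab\in\omega^{(i+j)}$ if $i+j<n$ and $ab/\theta\in\omega^{(i+j-n)}$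 if $i+j\ge n$. Then: 1. $A$ is a normal surface singularity over $k$ and is Gorenstein. The map $B\to A$ is injective, and there is a cyclic group $G$ of order $n$ of $B$-algebra automorphisms of $A$ such that $A^G=B$ and $G$ acts freely in codimension $1$: if $\mathfrak P\subset A$ is a prime ideal of height $1$ and $g\in G$ satisfies $g\mathfrak P=\mathfrak P$ and acts trivially on $A/\mathfrak P$, then $g=1$. 2. $A$ is Cohen–Macaulay tame if and only if $B$ is; $A$ is tame bounded if and only if $B$ is; $A$ is tame of exponential growth if and only if $B$ is. Here, for a normal surface singularity $X$ (that is, a ring as above), a *family of Cohen–Macaulay $X$-modules* based on a smooth connected affine curve $\mathrm{Spec}\,R$ over $k$ is a finitely generated module $M$ over the $\mathfrak m_X$-adically completed tensor product $X\mathbin{\hat\otimes}_kR$ that is flat over $R$ and such that the fibre $M(c)=M\otimes_RR/\mathfrak m_c$ is a maximal Cohen–Macaulay $X$-module for every closed point $c$; it has rank $r$ if all $M(c)$ have rank $r$. $X$ is *Cohen–Macaulay finite* if it has only finitely many indecomposable maximal Cohen–Macaulay modules up to isomorphism. $X$ is *Cohen–Macaulay tame* if it is not Cohen–Macaulay finite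 and there is a *parametrizing set*, i.e. a set $\mathfrak M$ of families such that, for every $r$, the set $\mathfrak M_r$ of families of rank $r$ in $\mathfrak M$ is finite, and all indecomposable maximal Cohen–Macaulay $X$-modules of rank $r$, except finitely many isomorphism classes, are isomorphic to fibres $M(c)$ with $M\in\mathfrak M_r$. Let $d(r,X)$ be the minimum of $|\mathfrak M_r|$ over all parametrizing sets. A tame $X$ is *bounded* if $d(r,X)\le\varphi(r)$ for all $r$ with some polynomial $\varphi$, and *of exponential growth* if $\limsup_{r\to\infty}d(r,X)^{1/r}>1$, i.e. there is $q>1$ with $d(r,X)\ge q^r$ for infinitely many $r$. -/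

import Mathlib

open scoped TensorProduct nonZeroDivisors
open CategoryTheory

universe u

/-! ### Normal surface singularities -/

/-- The `k`-algebra `A` is (the ring of) a normal surface singularity: a complete noetherian local
normal domain of Krull dimension `2` whose residue field is `k`. -/
structure IsNormalSurfaceSingularity (k A : Type u) [Field k] [CommRing A] [IsLocalRing A]
    [Algebra k A] : Prop where
  isNoetherianRing : IsNoetherianRing A
  isDomain : IsDomain A
  isIntegrallyClosed : IsIntegrallyClosed A
  isAdicComplete : IsAdicComplete (IsLocalRing.maximalIdeal A) A
  ringKrullDim_eq_two : ringKrullDim A = 2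
  residue_bijective : Function.Bijective (algebraMap k (IsLocalRing.ResidueField A))

/-! ### Dualizing modules, Gorenstein rings -/

/-- `M` is a dualizing (canonical) module of the local ring `A` with residue field `κ`:
it is finitely generated, `Ext^d(κ, M) ≅ κ` for `d = dim A`, and `Ext^i(κ, M) = 0` for `i ≠ d`. -/
def IsDualizingModule (A M : Type u) [CommRing A] [IsLocalRing A] [AddCommGroup M] [Module A M] :
    Prop :=
  Module.Finite A M ∧ ∀ i : ℕ,
    ((i : WithBot ℕ∞) = ringKrullDim A →
      Nonempty (Abelian.Ext (ModuleCat.of A (IsLocalRing.ResidueField A)) (ModuleCat.of A M) i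
        ≃ₗ[A] IsLocalRing.ResidueField A)) ∧
    ((i : WithBot ℕ∞) ≠ ringKrullDim A →
      Subsingleton
        (Abelian.Ext (ModuleCat.of A (IsLocalRing.ResidueField A)) (ModuleCat.of A M) i))

/-- The local ring `A` is Gorenstein: `A` is a dualizing module over itself. -/
def IsGorensteinLocalRing (A : Type u) [CommRing A] [IsLocalRing A] : Prop :=
  IsDualizingModule A A

/-! ### Divisorial powers of a fractional ideal -/

section DivisorialPower

set_option linter.unusedSectionVars false

variable {B : Type u} [CommRing B] [IsDomain B]

/-- The localization `J_P` of a `B`-submodule `J` of the fraction field, as a submodule of the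
fraction field. -/
def localizationAt (P : Ideal B) [P.IsPrime] (J : Submodule B (FractionRing B)) :
    Submodule B (FractionRing B) where
  carrier := {x | ∃ s : B, s ∉ P ∧ s • x ∈ J}
  zero_mem' := ⟨1, P.primeCompl.one_mem, by simp⟩
  add_mem' := by
    rintro x y ⟨s, hs, hx⟩ ⟨t, ht, hy⟩
    refine ⟨s * t, P.primeCompl.mul_mem hs ht, ?_⟩
    have e : (s * t) • (x + y) = t • (s • x) + s • (t • y) := by
      rw [smul_add, mul_smul, mul_smul, smul_comm s t x]
    rw [e]
    exact J.add_mem (J.smul_mem _ hx) (J.smul_mem _ hy)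
  smul_mem' := by
    rintro b x ⟨s, hs, hx⟩
    exact ⟨s, hs, by rw [smul_comm]; exact J.smul_mem _ hx⟩

/-- `ω^{(m)} = ⋂_{ht P = 1} (ω^m)_P`. -/
def divisorialPower (ω : FractionalIdeal B⁰ (FractionRing B)) (m : ℕ) :
    Submodule B (FractionRing B) :=
  ⨅ (P : Ideal B) (_ : P.IsPrime) (_ : P.height = 1),
    localizationAt P ((ω ^ m : FractionalIdeal B⁰ (FractionRing B)) :
      Submodule B (FractionRing B))

theorem mem_divisorialPower {ω : FractionalIdeal B⁰ (FractionRing B)} {m : ℕ}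
    {x : FractionRing B} :
    x ∈ divisorialPower ω m ↔ ∀ P : Ideal B, P.IsPrime → P.height = 1 →
      ∃ s : B, s ∉ P ∧ s • x ∈ ω ^ m := by
  simp only [divisorialPower, Submodule.mem_iInf]
  rfl

theorem pow_le_divisorialPower (ω : FractionalIdeal B⁰ (FractionRing B)) (m : ℕ)
    {x : FractionRing B} (hx : x ∈ ω ^ m) : x ∈ divisorialPower ω m :=
  mem_divisorialPower.2 fun P hP _ => ⟨1, P.primeCompl.one_mem, by simpa using hx⟩

theorem mul_mem_divisorialPower {ω : FractionalIdeal B⁰ (FractionRing B)} {i j : ℕ}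
    {x y : FractionRing B} (hx : x ∈ divisorialPower ω i) (hy : y ∈ divisorialPower ω j) :
    x * y ∈ divisorialPower ω (i + j) := by
  rw [mem_divisorialPower] at *
  intro P hP h1
  obtain ⟨s, hs, hsx⟩ := hx P hP h1
  obtain ⟨t, ht, hty⟩ := hy P hP h1
  refine ⟨s * t, P.primeCompl.mul_mem hs ht, ?_⟩
  have e : (s * t) • (x * y) = (s • x) * (t • y) := by
    simp only [Algebra.smul_def, map_mul]; ring
  rw [e, pow_add]
  exact FractionalIdeal.mul_mem_mul hsx hty

theorem div_mem_divisorialPower {ω : FractionalIdeal B⁰ (FractionRing B)} {n j : ℕ}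
    {θ x : FractionRing B} (hθ : divisorialPower ω n = Submodule.span B {θ})
    (hx : x ∈ divisorialPower ω (n + j)) : x / θ ∈ divisorialPower ω j := by
  by_cases h0 : θ = 0
  · simp [h0]
  rw [mem_divisorialPower] at *
  intro P hP h1
  obtain ⟨s, hs, hsx⟩ := hx P hP h1
  refine ⟨s, hs, ?_⟩
  have key : ∀ z ∈ ω ^ n * ω ^ j, z / θ ∈ ω ^ j := by
    intro z hz
    refine FractionalIdeal.mul_induction_on hz ?_ ?_
    · intro a ha b hb
      have ha' := pow_le_divisorialPower ω n ha
      rw [hθ, Submodule.mem_span_singleton] at ha'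
      obtain ⟨c, rfl⟩ := ha'
      have e : c • θ * b / θ = c • b := by
        simp only [Algebra.smul_def]; field_simp
      rw [e]
      exact Submodule.smul_mem _ _ hb
    · intro a b ha hb
      rw [add_div]
      exact Submodule.add_mem _ ha hb
  have := key _ (by rw [← pow_add]; exact hsx)
  rwa [← smul_div_assoc]

end DivisorialPower

/-! ### The Gorenstein covering -/

/-- The vector space `K^n = ⊕_{i<n} K`, with the multiplication for which the product of `a` in
degree `i` and `b` in degree `j` is `ab` in degree `i + j` if `i + j < n`, and `ab/θ` in degree
`i + j - n` otherwise. -/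
def CyclicAlgebra (K : Type u) (n : ℕ) (_θ : K) : Type u := Fin n → K

namespace CyclicAlgebra

variable {K : Type u} [Field K] {n : ℕ} {θ : K}

instance : AddCommGroup (CyclicAlgebra K n θ) := inferInstanceAs (AddCommGroup (Fin n → K))

instance {S : Type*} [Semiring S] [Module S K] : Module S (CyclicAlgebra K n θ) :=
  inferInstanceAs (Module S (Fin n → K))

instance {S T : Type*} [Semiring S] [Semiring T] [SMul S T] [Module S K] [Module T K]
    [IsScalarTower S T K] : IsScalarTower S T (CyclicAlgebra K n θ) :=
  inferInstanceAs (IsScalarTower S T (Fin n → K))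

instance : Mul (CyclicAlgebra K n θ) where
  mul f g := fun m => ∑ i : Fin n, ∑ j : Fin n,
    if ((i : ℕ) + j) % n = m then
      (if (i : ℕ) + j < n then f i * g j else f i * g j / θ) else 0

instance : One (CyclicAlgebra K n θ) where
  one := fun m => if (m : ℕ) = 0 then 1 else 0

theorem mul_apply (f g : CyclicAlgebra K n θ) (m : Fin n) :
    (f * g) m = ∑ i : Fin n, ∑ j : Fin n,
      if ((i : ℕ) + j) % n = m then
        (if (i : ℕ) + j < n then f i * g j else f i * g j / θ) else 0 := rfl

theorem one_apply (m : Fin n) :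
    (1 : CyclicAlgebra K n θ) m = if (m : ℕ) = 0 then 1 else 0 := rfl

theorem add_apply (f g : CyclicAlgebra K n θ) (m : Fin n) : (f + g) m = f m + g m := rfl

theorem smul_apply {S : Type*} [Semiring S] [Module S K] (s : S) (f : CyclicAlgebra K n θ)
    (m : Fin n) : (s • f) m = s • f m := rfl

theorem mul_apply' (f g : CyclicAlgebra K n θ) (m : Fin n) :
    (f * g) m = ∑ i : Fin n, ∑ j : Fin n,
      if ((i : ℕ) + j) % n = m then f i * g j * (θ⁻¹) ^ (((i : ℕ) + j) / n) else 0 := by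
  rw [mul_apply]
  refine Finset.sum_congr rfl fun i _ => Finset.sum_congr rfl fun j _ => ?_
  have hi := i.2
  have hj := j.2
  split_ifs with h1 h2
  · rw [Nat.div_eq_of_lt h2]; simp
  · rw [show ((i : ℕ) + j) / n = 1 from Nat.div_eq_of_lt_le (by omega) (by omega)]
    simp [div_eq_mul_inv]
  · rfl

theorem mul_comm' (f g : CyclicAlgebra K n θ) : f * g = g * f := by
  funext m
  rw [mul_apply', mul_apply', Finset.sum_comm]
  refine Finset.sum_congr rfl fun i _ => Finset.sum_congr rfl fun j _ => ?_
  rw [add_comm (j : ℕ) i, mul_comm (f j)]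

theorem one_mul' (f : CyclicAlgebra K n θ) : 1 * f = f := by
  funext m
  have hm := m.2
  rw [mul_apply', Finset.sum_eq_single (⟨0, by omega⟩ : Fin n), Finset.sum_eq_single m]
  · simp [one_apply, Nat.mod_eq_of_lt hm, Nat.div_eq_of_lt hm]
  · intro j _ hj
    rw [if_neg]
    intro h
    apply hj
    ext
    simpa [Nat.mod_eq_of_lt j.2] using h
  · simp
  · intro i _ hi
    refine Finset.sum_eq_zero fun j _ => ?_
    have : (i : ℕ) ≠ 0 := fun h => hi (by ext; simpa using h)
    simp [one_apply, this]
  · simp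

theorem mul_mul_apply (f g h : CyclicAlgebra K n θ) (q : Fin n) :
    (f * g * h) q = ∑ i : Fin n, ∑ j : Fin n, ∑ l : Fin n,
      if ((i : ℕ) + j + l) % n = q then
        f i * g j * h l * (θ⁻¹) ^ (((i : ℕ) + j + l) / n) else 0 := by
  have hn : 0 < n := by have := q.2; omega
  have step : ∀ p l : Fin n,
      (if ((p : ℕ) + l) % n = q then
        (f * g) p * h l * (θ⁻¹) ^ (((p : ℕ) + l) / n) else 0) =
      ∑ i : Fin n, ∑ j : Fin n,
        if (⟨((i : ℕ) + j) % n, Nat.mod_lt _ hn⟩ : Fin n) = p then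
          (if ((i : ℕ) + j + l) % n = q then
            f i * g j * h l * (θ⁻¹) ^ (((i : ℕ) + j + l) / n) else 0) else 0 := by
    intro p l
    have e : (if ((p : ℕ) + l) % n = q then
        (f * g) p * h l * (θ⁻¹) ^ (((p : ℕ) + l) / n) else 0) =
        (f * g) p * (if ((p : ℕ) + l) % n = q then
          h l * (θ⁻¹) ^ (((p : ℕ) + l) / n) else 0) := by
      split_ifs <;> ring
    rw [e, mul_apply', Finset.sum_mul]
    refine Finset.sum_congr rfl fun i _ => ?_
    rw [Finset.sum_mul]
    refine Finset.sum_congr rfl fun j _ => ?_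
    by_cases hp : ((i : ℕ) + j) % n = p
    · have hp' : (⟨((i : ℕ) + j) % n, Nat.mod_lt _ hn⟩ : Fin n) = p := Fin.ext hp
      rw [if_pos hp, if_pos hp', ← hp, Nat.mod_add_mod]
      have hd : ((i : ℕ) + j + l) / n = ((i : ℕ) + j) / n + (((i : ℕ) + j) % n + l) / n := by
        conv_lhs => rw [← Nat.div_add_mod ((i : ℕ) + j) n, add_assoc,
          Nat.mul_add_div hn]
      rw [hd, pow_add]
      split_ifs <;> ring
    · have hp' : (⟨((i : ℕ) + j) % n, Nat.mod_lt _ hn⟩ : Fin n) ≠ p := fun h => hp (by rw [← h])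
      rw [if_neg hp, if_neg hp', zero_mul]
  rw [mul_apply', Finset.sum_comm]
  calc _ = ∑ l : Fin n, ∑ p : Fin n, ∑ i : Fin n, ∑ j : Fin n,
        if (⟨((i : ℕ) + j) % n, Nat.mod_lt _ hn⟩ : Fin n) = p then
          (if ((i : ℕ) + j + l) % n = q then
            f i * g j * h l * (θ⁻¹) ^ (((i : ℕ) + j + l) / n) else 0) else 0 :=
        Finset.sum_congr rfl fun l _ => Finset.sum_congr rfl fun p _ => step p l
    _ = ∑ l : Fin n, ∑ i : Fin n, ∑ j : Fin n,
          (if ((i : ℕ) + j + l) % n = q then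
            f i * g j * h l * (θ⁻¹) ^ (((i : ℕ) + j + l) / n) else 0) := by
        refine Finset.sum_congr rfl fun l _ => ?_
        rw [Finset.sum_comm]
        refine Finset.sum_congr rfl fun i _ => ?_
        rw [Finset.sum_comm]
        refine Finset.sum_congr rfl fun j _ => ?_
        rw [Finset.sum_ite_eq, if_pos (Finset.mem_univ _)]
    _ = _ := by
        rw [Finset.sum_comm]
        refine Finset.sum_congr rfl fun i _ => ?_
        rw [Finset.sum_comm]

theorem mul_assoc' (f g h : CyclicAlgebra K n θ) : f * g * h = f * (g * h) := by
  funext q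
  rw [mul_comm' f (g * h), mul_mul_apply, mul_mul_apply, Finset.sum_comm]
  refine Finset.sum_congr rfl fun j _ => ?_
  rw [Finset.sum_comm]
  refine Finset.sum_congr rfl fun l _ => Finset.sum_congr rfl fun i _ => ?_
  rw [show (i : ℕ) + j + l = j + l + i by omega,
    show f i * g j * h l = g j * h l * f i by ring]

theorem mul_add' (f g h : CyclicAlgebra K n θ) : f * (g + h) = f * g + f * h := by
  funext m
  rw [add_apply]
  simp only [mul_apply', add_apply, ← Finset.sum_add_distrib]
  refine Finset.sum_congr rfl fun i _ => Finset.sum_congr rfl fun j _ => ?_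
  split_ifs <;> ring

instance : CommRing (CyclicAlgebra K n θ) :=
  { (inferInstance : AddCommGroup (CyclicAlgebra K n θ)),
    (inferInstance : Mul (CyclicAlgebra K n θ)),
    (inferInstance : One (CyclicAlgebra K n θ)) with
    mul_assoc := mul_assoc'
    one_mul := one_mul'
    mul_one := fun f => by rw [mul_comm', one_mul']
    mul_comm := mul_comm'
    left_distrib := mul_add'
    right_distrib := fun f g h => by rw [mul_comm', mul_add', mul_comm' h f, mul_comm' h g]
    zero_mul := fun f => by
      have := mul_add' f 0 0
      rw [add_zero, left_eq_add] at this
      rw [mul_comm', this]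
    mul_zero := fun f => by
      have := mul_add' f 0 0
      rwa [add_zero, left_eq_add] at this }

theorem smul_mul' {S : Type*} [CommSemiring S] [Algebra S K] (s : S) (f g : CyclicAlgebra K n θ) :
    s • f * g = s • (f * g) := by
  funext m
  rw [smul_apply]
  simp only [mul_apply', smul_apply, Finset.smul_sum]
  refine Finset.sum_congr rfl fun i _ => Finset.sum_congr rfl fun j _ => ?_
  split_ifs
  · simp only [Algebra.smul_def]; ring
  · simp

instance {S : Type*} [CommSemiring S] [Algebra S K] : Algebra S (CyclicAlgebra K n θ) :=
  Algebra.ofModule smul_mul' fun s f g => by rw [mul_comm, smul_mul', mul_comm]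

end CyclicAlgebra

/-- The algebra `A = ⊕_{i<n} ω^{(i)}`, where `ω^{(n)} = θB`, with the multiplication
`a · b = ab ∈ ω^{(i+j)}` if `i + j < n` and `a · b = ab/θ ∈ ω^{(i+j-n)}` if `i + j ≥ n`,
for `a ∈ ω^{(i)}` and `b ∈ ω^{(j)}`. -/
def gorensteinCovering {B : Type u} [CommRing B] [IsDomain B]
    (ω : FractionalIdeal B⁰ (FractionRing B)) (n : ℕ) (θ : FractionRing B)
    (hθ : divisorialPower ω n = Submodule.span B {θ}) :
    Subalgebra B (CyclicAlgebra (FractionRing B) n θ) where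
  carrier := {f | ∀ i : Fin n, f i ∈ divisorialPower ω i}
  zero_mem' := fun i => Submodule.zero_mem _
  add_mem' := fun hf hg i => Submodule.add_mem _ (hf i) (hg i)
  mul_mem' := by
    intro f g hf hg m
    rw [CyclicAlgebra.mul_apply]
    refine Submodule.sum_mem _ fun i _ => Submodule.sum_mem _ fun j _ => ?_
    have hi := i.2
    have hj := j.2
    split_ifs with h1 h2
    · rw [← h1, Nat.mod_eq_of_lt h2]
      exact mul_mem_divisorialPower (hf i) (hg j)
    · have e : (m : ℕ) = i + j - n := by
        rw [← h1, Nat.mod_eq_sub_mod (by omega), Nat.mod_eq_of_lt (by omega)]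
      refine div_mem_divisorialPower hθ ?_
      rw [e, show n + ((i : ℕ) + j - n) = i + j by omega]
      exact mul_mem_divisorialPower (hf i) (hg j)
    · exact Submodule.zero_mem _
  algebraMap_mem' := by
    intro b i
    rw [Algebra.algebraMap_eq_smul_one, CyclicAlgebra.smul_apply, CyclicAlgebra.one_apply]
    split_ifs with h
    · rw [h]
      refine Submodule.smul_mem _ _ (pow_le_divisorialPower ω 0 ?_)
      rw [pow_zero]
      exact FractionalIdeal.one_mem_one _
    · rw [smul_zero]
      exact Submodule.zero_mem _

/-- `ω` is a dualizing ideal of `B`: a fractional ideal which is a dualizing module. -/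
def IsDualizingIdeal {B : Type u} [CommRing B] [IsDomain B] [IsLocalRing B]
    (ω : FractionalIdeal B⁰ (FractionRing B)) : Prop :=
  IsDualizingModule B (ω : Submodule B (FractionRing B))

/-- The condition on a dualizing ideal `ω` under which the singularity is `ℚ`-Gorenstein:
`ω^{(m)}` is principal for some `m > 0` prime to the characteristic of `k`. -/
def IsQGorenstein (k : Type u) {B : Type u} [Field k] [CommRing B] [IsDomain B]
    (ω : FractionalIdeal B⁰ (FractionRing B)) : Prop :=
  ∃ m : ℕ, 0 < m ∧ (m : k) ≠ 0 ∧ (divisorialPower ω m).IsPrincipal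

/-- The group `G` of automorphisms of `A` acts freely in codimension one: if `P` is a prime ideal
of height one and `g ∈ G` maps `P` to itself and acts trivially on `A / P`, then `g = 1`. -/
def ActsFreelyInCodimOne {B A : Type u} [CommRing B] [CommRing A] [Algebra B A]
    (G : Subgroup (A ≃ₐ[B] A)) : Prop :=
  ∀ P : Ideal A, P.IsPrime → P.height = 1 → ∀ g ∈ G,
    P.map (g : A →+* A) = P → (∀ a : A, g a - a ∈ P) → g = 1

/-! ### Cohen-Macaulay modules and their families -/

/-- `M` is a (maximal) Cohen-Macaulay module over the local ring `A` (the zero module included):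
`M` is finitely generated and its depth is the Krull dimension of `A`. -/
def IsMaximalCohenMacaulay (A M : Type u) [CommRing A] [IsLocalRing A] [AddCommGroup M]
    [Module A M] : Prop :=
  Module.Finite A M ∧ ∃ rs : List A, (rs.length : WithBot ℕ∞) = ringKrullDim A ∧
    (∀ r ∈ rs, r ∈ IsLocalRing.maximalIdeal A) ∧ RingTheory.Sequence.IsWeaklyRegular M rs

/-- Indecomposable modules. -/
def IsIndecomposableModule (A M : Type u) [CommRing A] [AddCommGroup M] [Module A M] : Prop :=
  Nontrivial M ∧ ∀ p q : Submodule A M, IsCompl p q → p = ⊥ ∨ q = ⊥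

/-- A family of maximal Cohen-Macaulay `A`-modules based on a smooth connected affine curve
`C = Spec R` over `k`. Over an algebraically closed field `k`, the coordinate rings of these curves
are the finitely generated `k`-algebras that are Dedekind domains and not fields.

The family itself is a coherent sheaf on the (formal) product of `Spec A` and `C` that is flat
over `C` and has maximal Cohen-Macaulay fibres at all closed points of `C`. It is given by its module
`M` of sections, a finitely generated module over the completed tensor product `A ⊗̂ R`. In other
words, `M` is an `A ⊗ R`-module which is complete in the topology defined by the maximal ideal `𝔪` of
`A`, and `M / 𝔪M` is finitely generated over `R`. -/
structure CMFamily (k A : Type u) [Field k] [CommRing A] [IsLocalRing A] [Algebra k A] where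
  /-- the coordinate ring of the base curve -/
  R : Type u
  [commRing : CommRing R]
  [algebra : Algebra k R]
  finiteType : Algebra.FiniteType k R
  isDedekindDomain : IsDedekindDomain R
  not_isField : ¬ IsField R
  /-- the module of sections of the family -/
  M : Type u
  [addCommGroup : AddCommGroup M]
  [moduleA : Module A M]
  [moduleR : Module R M]
  [smulCommClass : SMulCommClass A R M]
  [smulCommClass' : SMulCommClass R A M]
  algebraMap_smul : ∀ (t : k) (x : M), algebraMap k A t • x = algebraMap k R t • x
  complete : IsAdicComplete (IsLocalRing.maximalIdeal A) M
  finite : Module.Finite R (M ⊗[A] IsLocalRing.ResidueField A)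
  flat : Module.Flat R M
  cohenMacaulay : ∀ c : Ideal R, c.IsMaximal → IsMaximalCohenMacaulay A (M ⊗[R] (R ⧸ c))

namespace CMFamily

variable {k A : Type u} [Field k] [CommRing A] [IsLocalRing A] [Algebra k A]

attribute [instance] commRing algebra addCommGroup moduleA moduleR smulCommClass smulCommClass'

/-- The fibre `M(c) = M ⊗_R R/c` of the family at the closed point `c` of the base. -/
abbrev Fibre (F : CMFamily k A) (c : Ideal F.R) : Type u := F.M ⊗[F.R] (F.R ⧸ c)

/-- The family consists of modules of rank `r`. -/
def HasRank (F : CMFamily k A) (r : ℕ) : Prop :=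
  ∀ c : Ideal F.R, c.IsMaximal → Module.finrank A (F.Fibre c) = r

end CMFamily

/-! ### Tame singularities and their growth -/

section Tame

variable (k A : Type u) [Field k] [CommRing A] [IsLocalRing A] [Algebra k A]

/-- `A` is Cohen-Macaulay finite: up to isomorphism, there are finitely many indecomposable
maximal Cohen-Macaulay `A`-modules. -/
def IsCMFinite (A : Type u) [CommRing A] [IsLocalRing A] : Prop :=
  ∃ (s : ℕ) (E : Fin s → ModuleCat.{u} A), ∀ (N : Type u) [AddCommGroup N] [Module A N],
    IsMaximalCohenMacaulay A N → IsIndecomposableModule A N → ∃ i, Nonempty (N ≃ₗ[A] E i)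

variable {k A} in
/-- `𝔐` is a parametrizing set: for every `r` the set `𝔐_r` of its families of rank `r` is finite,
and all indecomposable maximal Cohen-Macaulay modules of rank `r`, except finitely many isomorphism
classes, are isomorphic to fibres of families from `𝔐_r` at closed points. -/
def IsParametrizingSet (𝔐 : Set (CMFamily k A)) : Prop :=
  ∀ r : ℕ, {F ∈ 𝔐 | F.HasRank r}.Finite ∧
    ∃ (s : ℕ) (E : Fin s → ModuleCat.{u} A), ∀ (N : Type u) [AddCommGroup N] [Module A N],
      IsMaximalCohenMacaulay A N → IsIndecomposableModule A N → Module.finrank A N = r →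
        (∃ F ∈ 𝔐, F.HasRank r ∧ ∃ c : Ideal F.R, c.IsMaximal ∧ Nonempty (N ≃ₗ[A] F.Fibre c)) ∨
        ∃ i, Nonempty (N ≃ₗ[A] E i)

/-- `A` is Cohen-Macaulay tame. -/
def IsCMTame : Prop :=
  ¬ IsCMFinite A ∧ ∃ 𝔐 : Set (CMFamily k A), IsParametrizingSet 𝔐

/-- `d(r, A)`: the minimal number of families of rank `r` in a parametrizing set. -/
noncomputable def familyCount (r : ℕ) : ℕ :=
  sInf {d : ℕ | ∃ 𝔐 : Set (CMFamily k A),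
    IsParametrizingSet 𝔐 ∧ {F ∈ 𝔐 | F.HasRank r}.ncard = d}

/-- `A` is tame bounded (of polynomial growth). -/
def IsCMTameBounded : Prop :=
  IsCMTame k A ∧ ∃ φ : Polynomial ℝ, ∀ r : ℕ, (familyCount k A r : ℝ) ≤ φ.eval (r : ℝ)

/-- `A` is tame of exponential growth: `limsup d(r, A)^(1/r) > 1`, that is, for some `q > 1` there
are arbitrarily large `r` with `d(r, A) ≥ q^r`. -/
def IsCMTameExponential : Prop :=
  IsCMTame k A ∧ ∃ q : ℝ, 1 < q ∧ ∃ᶠ r : ℕ in Filter.atTop, q ^ r ≤ (familyCount k A r : ℝ)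

end Tame

set_option linter.unusedSectionVars false


/-! ### Power series in two variables -/

/-! Part 1 is Kummer theory. Writing an element a of degree i as a·y^i with y^n = θ⁻¹ identifies
`CyclicAlgebra` with K[y]/(y^n − θ⁻¹). The central criterion is `HasClassOrder.mem_iff`: x lies in
ω^{(i)} exactly when x^n lies in θ^i B. Indeed, at a prime P of height one ω is generated by some a
with a^n equal to θ up to a unit, and B_P is integrally closed. It has several consequences.
Minimality of n means that θ⁻¹ has order n modulo n-th powers, so the cyclic algebra is a field. As
n is invertible in k, averaging over the n-th roots of unity separates the degrees of an integral
element, and the criterion then says that A is the integral closure of B. An element of degree 0 < i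
< n has a non-unit of B as its n-th power, so A is local with residue field k. The roots of unity t
act by t^i in degree i. A local generator of ω, placed in degree one, lies outside any prime of A
over P, and t ≠ 1 moves it modulo such a prime, so the action is free in codimension one.

For the Gorenstein property, the component of degree one induces A ≅ Hom_B(A, ω), because a
homogeneous map from ω^{(l)} to ω^{(1)} is multiplication by an element of "ω^{(1−l)}"
(`existsUnique_compOne`). Cohen-Macaulay modules have no higher extensions by ω, so dimension
shifting gives Ext_A(T, A) ≅ Ext_B(T, ω) for finitely generated T (`extOfTrace_bijective`), and T =
k yields the claim.

For part 2, Noether normalization makes both rings finite and free over S = k[[x, y]]. A finitely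
generated module is maximal Cohen-Macaulay iff x, y is regular on it, iff it is free over S; so it
is a matrix representation (`SeriesRep`). Endomorphisms are invertible iff their constant terms are,
and idempotents lift from constant terms (`PS.exists_isIdempotentElem_lift`). This reduces
Krull-Schmidt questions to finite-dimensional algebras.

The two rings are compared by restriction and by coinduction Hom_B(A, −). Since B is a direct
summand of A, every N is a B-summand of Hom_B(A, N). Conversely every Cohen-Macaulay A-module M is a
summand of Hom_B(A, M): a B-linear map A → M is in each degree i multiplication by an element z_i of
M, since elements of degree i generate an ideal containing powers of the parameters and M has depth
two, and the average of the z_i is a retraction. So each indecomposable on one side occurs in the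
image of one on the other side, with rank larger by a bounded factor at most.

A family is, over an open part of its curve, a representation over R[[x, y]]
(`CMFamily.exists_seriesRep`), and so is its restriction or coinduction. Over the algebraic closure
of the function field the algebra of constant terms of its endomorphisms is cut by primitive
idempotents. These are defined over a curve covering the given one, and the pieces have
indecomposable fibres outside finitely many points (`SeriesRep.exists_generic_decomposition`). A
family of rank r thus yields at most Cr families, and d(r, Y) ≤ Σ_{r' ≤ Cr} C r' d(r', X). With such
estimates in both directions, tameness, polynomial bounds and exponential growth are transferred
(`CMTransfer.tame_iff`). -/

/-- Power series in two variables. -/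
abbrev PS (R : Type*) [CommRing R] := MvPowerSeries (Fin 2) R

namespace PS

variable {R : Type*} [CommRing R]

/-- The ideal generated by the two variables. -/
noncomputable abbrev varIdeal (R : Type*) [CommRing R] : Ideal (PS R) := Ideal.span (Set.range MvPowerSeries.X)

theorem coeff_X_mul (d : Fin 2 →₀ ℕ) (s : Fin 2) (f : PS R) :
    MvPowerSeries.coeff d (MvPowerSeries.X s * f) =
      if 1 ≤ d s then MvPowerSeries.coeff (d - Finsupp.single s 1) f else 0 := by
  classical
  rw [MvPowerSeries.X_def, MvPowerSeries.coeff_monomial_mul]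
  simp [Finsupp.single_le_iff]

/-- Split off the monomials that contain the first variable. The remaining ones are powers of the
second variable, and the constant one is absent. -/
theorem exists_eq_X_mul_add (f : PS R) (h : MvPowerSeries.constantCoeff f = 0) :
    ∃ f₀ f₁ : PS R, f = MvPowerSeries.X 0 * f₀ + MvPowerSeries.X 1 * f₁ := by
  classical
  let g : PS R := fun d => if d 0 = 0 then 0 else MvPowerSeries.coeff d f
  have h0 : (MvPowerSeries.X 0 : PS R) ∣ g := by
    rw [MvPowerSeries.X_dvd_iff]
    intro m hm
    change (if m 0 = 0 then 0 else MvPowerSeries.coeff m f) = 0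
    rw [if_pos hm]
  have h1 : (MvPowerSeries.X 1 : PS R) ∣ f - g := by
    rw [MvPowerSeries.X_dvd_iff]
    intro m hm
    rw [map_sub]
    change MvPowerSeries.coeff m f - (if m 0 = 0 then 0 else MvPowerSeries.coeff m f) = 0
    split_ifs with h2
    · have : m = 0 := by
        ext i
        fin_cases i
        · exact h2
        · exact hm
      rw [this, sub_zero, MvPowerSeries.coeff_zero_eq_constantCoeff_apply, h]
    · rw [sub_self]
  obtain ⟨a, ha⟩ := h0
  obtain ⟨b, hb⟩ := h1
  exact ⟨a, b, by rw [← ha, ← hb]; ring⟩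

theorem exists_eq_C_add (f : PS R) :
    ∃ f₀ f₁ : PS R, f = MvPowerSeries.C (MvPowerSeries.constantCoeff f) +
      MvPowerSeries.X 0 * f₀ + MvPowerSeries.X 1 * f₁ := by
  obtain ⟨a, b, h⟩ := exists_eq_X_mul_add (f - MvPowerSeries.C (MvPowerSeries.constantCoeff f))
    (by simp)
  exact ⟨a, b, by rw [add_assoc, ← h]; ring⟩

theorem mem_varIdeal_iff {f : PS R} :
    f ∈ varIdeal R ↔ MvPowerSeries.constantCoeff f = 0 := by
  constructor
  · intro h
    have : varIdeal R ≤ RingHom.ker (MvPowerSeries.constantCoeff (σ := Fin 2) (R := R)) := by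
      rw [Ideal.span_le]
      rintro _ ⟨i, rfl⟩
      simp [RingHom.mem_ker]
    exact this h
  · intro h
    obtain ⟨a, b, rfl⟩ := exists_eq_X_mul_add f h
    exact Ideal.add_mem _ (Ideal.mul_mem_right _ _ (Ideal.subset_span ⟨0, rfl⟩))
      (Ideal.mul_mem_right _ _ (Ideal.subset_span ⟨1, rfl⟩))

/-- The matrix of constant coefficients. -/
noncomputable abbrev constMat {ι : Type*} [Fintype ι] [DecidableEq ι] :
    Matrix ι ι (PS R) →+* Matrix ι ι R :=
  (MvPowerSeries.constantCoeff (σ := Fin 2) (R := R)).mapMatrix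

variable {ι : Type*} [Fintype ι] [DecidableEq ι]

/-- The constant term of the determinant is the determinant of the constant matrix. -/
theorem isUnit_of_isUnit_constMat {φ : Matrix ι ι (PS R)} (h : IsUnit (constMat φ)) :
    IsUnit φ := by
  rw [Matrix.isUnit_iff_isUnit_det] at *
  rw [← RingHom.map_det] at h
  exact MvPowerSeries.isUnit_iff_constantCoeff.2 h

/-- The matrix `1 - φ` is invertible and annihilates `φ`. -/
theorem eq_zero_of_isIdempotentElem {φ : Matrix ι ι (PS R)} (h : IsIdempotentElem φ)
    (h0 : constMat φ = 0) : φ = 0 := by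
  have hu : IsUnit (1 - φ) := isUnit_of_isUnit_constMat (by rw [map_sub, h0, map_one, sub_zero]; exact isUnit_one)
  have : (1 - φ) * φ = 0 := by rw [sub_mul, one_mul, h.eq, sub_self]
  exact (hu.mul_right_eq_zero).1 this

theorem mul_entry_mem {I J : Ideal R} {a b : Matrix ι ι R} (ha : ∀ i j, a i j ∈ I)
    (hb : ∀ i j, b i j ∈ J) (i j : ι) : (a * b) i j ∈ I * J := by
  rw [Matrix.mul_apply]
  exact Ideal.sum_mem _ fun l _ => Ideal.mul_mem_mul (ha i l) (hb l j)

theorem mul_entry_mem_left {I : Ideal R} {a b : Matrix ι ι R} (ha : ∀ i j, a i j ∈ I)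
    (i j : ι) : (a * b) i j ∈ I := by
  rw [Matrix.mul_apply]
  exact Ideal.sum_mem _ fun l _ => Ideal.mul_mem_right _ _ (ha i l)

theorem mul_entry_mem_right {I : Ideal R} {a b : Matrix ι ι R} (hb : ∀ i j, b i j ∈ I)
    (i j : ι) : (a * b) i j ∈ I := by
  rw [Matrix.mul_apply]
  exact Ideal.sum_mem _ fun l _ => Ideal.mul_mem_left _ _ (hb l j)

/-- Newton's iteration for idempotents. -/
noncomputable def newton (φ : Matrix ι ι (PS R)) : ℕ → Matrix ι ι (PS R)
  | 0 => φ
  | n + 1 => 3 * (newton φ n * newton φ n) - 2 * (newton φ n * newton φ n * newton φ n)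

/-- With t = φ² − φ, the next iterate has defect t²(4t − 3), so the defect is squared at each step.
Only a linear rate of convergence is kept. -/
theorem newton_sq_sub_mem {φ : Matrix ι ι (PS R)} (h : IsIdempotentElem (constMat φ)) (n : ℕ) :
    ∀ i j, (newton φ n * newton φ n - newton φ n) i j ∈ varIdeal R ^ (n + 1) := by
  induction n with
  | zero =>
    intro i j
    rw [zero_add, pow_one, mem_varIdeal_iff]
    have : constMat (φ * φ - φ) = 0 := by rw [map_sub, map_mul, h.eq, sub_self]
    exact congrFun (congrFun this i) j
  | succ n ih =>
    intro i j
    set t := newton φ n * newton φ n - newton φ n with ht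
    have e : newton φ (n + 1) * newton φ (n + 1) - newton φ (n + 1) = t * t * (4 * t - 3) := by
      rw [ht, newton]
      noncomm_ring
    rw [e]
    refine mul_entry_mem_left (fun i j => ?_) i j
    have := mul_entry_mem ih ih i j
    rw [← pow_add] at this
    exact Ideal.pow_le_pow_right (by omega) this

/-- The correction is (φ² − φ)(1 − 2φ), a multiple of the defect; hence the iterates form a Cauchy
sequence. -/
theorem newton_succ_sub_mem {φ : Matrix ι ι (PS R)} (h : IsIdempotentElem (constMat φ)) (n : ℕ) :
    ∀ i j, (newton φ (n + 1) - newton φ n) i j ∈ varIdeal R ^ (n + 1) := by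
  intro i j
  have e : newton φ (n + 1) - newton φ n =
      (newton φ n * newton φ n - newton φ n) * (1 - 2 * newton φ n) := by
    rw [newton]
    noncomm_ring
  rw [e]
  exact mul_entry_mem_left (newton_sq_sub_mem h n) i j

/-- All iterates are integer polynomials in `φ`. This keeps the lifted idempotent inside the
endomorphism ring of a representation. -/
theorem commute_newton {φ A : Matrix ι ι (PS R)} (h : Commute A φ) (n : ℕ) :
    Commute A (newton φ n) := by
  induction n with
  | zero => exact h
  | succ n ih =>
    rw [newton]
    refine Commute.sub_right ?_ ?_
    · exact (Commute.ofNat_right A 3).mul_right (ih.mul_right ih)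
    · exact (Commute.ofNat_right A 2).mul_right ((ih.mul_right ih).mul_right ih)

theorem eq_zero_of_forall_mem_pow {f : PS R} (h : ∀ n, f ∈ varIdeal R ^ n) : f = 0 := by
  refine IsHausdorff.haus (inferInstance : IsHausdorff (varIdeal R) (PS R)) f fun n => ?_
  rw [SModEq.zero, smul_eq_mul, Ideal.mul_top]
  exact h n

/-- Idempotents lift along the constant coefficient map, inside the bicommutant. -/
theorem exists_isIdempotentElem_lift {φ : Matrix ι ι (PS R)}
    (h : IsIdempotentElem (constMat φ)) :
    ∃ ψ : Matrix ι ι (PS R), IsIdempotentElem ψ ∧ constMat ψ = constMat φ ∧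
      ∀ A, Commute A φ → Commute A ψ := by
  have hmn : ∀ {m n : ℕ}, m ≤ n → ∀ i j,
      (newton φ n - newton φ m) i j ∈ varIdeal R ^ (m + 1) := by
    intro m n hmn
    induction n, hmn using Nat.le_induction with
    | base => intro i j; rw [sub_self]; exact Ideal.zero_mem _
    | succ n hmn ih =>
      intro i j
      have e : newton φ (n + 1) - newton φ m =
        (newton φ (n + 1) - newton φ n) + (newton φ n - newton φ m) := by abel
      rw [e]
      exact Ideal.add_mem _ (Ideal.pow_le_pow_right (by omega) (newton_succ_sub_mem h n i j))
        (ih i j)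
  have hlim : ∀ i j, ∃ L : PS R, ∀ n, newton φ n i j - L ∈ varIdeal R ^ n := by
    intro i j
    obtain ⟨L, hL⟩ := IsPrecomplete.prec (inferInstance : IsPrecomplete (varIdeal R) (PS R))
      (f := fun n => newton φ n i j) (by
        intro m n hmn'
        have := hmn hmn' i j
        refine SModEq.symm ?_
        rw [SModEq.sub_mem, smul_eq_mul, Ideal.mul_top]
        exact Ideal.pow_le_pow_right (by omega) this)
    refine ⟨L, fun n => ?_⟩
    have := hL n
    rwa [SModEq.sub_mem, smul_eq_mul, Ideal.mul_top] at this
  choose L hL using hlim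
  let ψ : Matrix ι ι (PS R) := Matrix.of L
  have hψ : ∀ n i j, (newton φ n - ψ) i j ∈ varIdeal R ^ n := fun n i j => hL i j n
  have key : ∀ a : Matrix ι ι (PS R), (∀ n i j, a i j ∈ varIdeal R ^ n) → a = 0 := by
    intro a ha
    ext1 i j
    exact eq_zero_of_forall_mem_pow fun n => ha n i j
  -- The limit is idempotent and commutes with `A` because the errors, which are the defects of the
  -- iterates and multiples of `newton φ n - ψ`, lie in every power of the ideal.
  refine ⟨ψ, ?_, ?_, ?_⟩
  · refine sub_eq_zero.1 (key _ fun n i j => ?_)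
    have e : ψ * ψ - ψ = (newton φ n * newton φ n - newton φ n) -
        ((newton φ n - ψ) * newton φ n + ψ * (newton φ n - ψ) - (newton φ n - ψ)) := by
      noncomm_ring
    rw [e]
    refine Ideal.sub_mem _ (Ideal.pow_le_pow_right (by omega) (newton_sq_sub_mem h n i j)) ?_
    exact Ideal.sub_mem _ (Ideal.add_mem _ (mul_entry_mem_left (hψ n) i j)
      (mul_entry_mem_right (hψ n) i j)) (hψ n i j)
  · have h1 := hψ 1
    have h2 := hmn (zero_le_one)
    ext i j
    have h3 := Ideal.sub_mem _ (by simpa using h2 i j) (by simpa using h1 i j)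
    rw [mem_varIdeal_iff] at h3
    simp only [sub_sub_sub_cancel_left, map_sub, newton] at h3
    exact sub_eq_zero.1 h3
  · intro A hA
    refine sub_eq_zero.1 (key _ fun n i j => ?_)
    have e : A * ψ - ψ * A = (newton φ n - ψ) * A - A * (newton φ n - ψ) := by
      have := (commute_newton hA n).eq
      rw [sub_mul, mul_sub, this]
      abel
    rw [e]
    exact Ideal.sub_mem _ (mul_entry_mem_left (hψ n) i j) (mul_entry_mem_right (hψ n) i j)

end PS



/-! ### Regular systems of parameters in dimension two -/

/-- `x, y` is a weakly regular sequence on `M`. -/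
def IsParamRegular {X : Type*} [CommRing X] (x y : X) (M : Type*) [AddCommGroup M] [Module X M] :
    Prop :=
  (∀ m : M, x • m = 0 → m = 0) ∧ ∀ m m' : M, y • m = x • m' → ∃ m'' : M, m = x • m''

namespace IsParamRegular

variable {X : Type*} [CommRing X] {x y : X} {M : Type*} [AddCommGroup M] [Module X M]

theorem smul_left_cancel (h : IsParamRegular x y M) {m m' : M} (e : x • m = x • m') : m = m' :=
  sub_eq_zero.1 (h.1 _ (by rw [smul_sub, e, sub_self]))

theorem pow_right (h : IsParamRegular x y M) (b : ℕ) : IsParamRegular x (y ^ b) M := by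
  refine ⟨h.1, ?_⟩
  induction b with
  | zero => intro m m' e; exact ⟨m', by simpa using e⟩
  | succ b ih =>
    intro m m' e
    rw [pow_succ', mul_smul] at e
    obtain ⟨m₁, h₁⟩ := h.2 _ _ e
    exact ih _ _ h₁

theorem pow_left (h : IsParamRegular x y M) (a : ℕ) : IsParamRegular (x ^ a) y M := by
  induction a with
  | zero => exact ⟨fun m e => by simpa using e, fun m m' e => ⟨m, by simp⟩⟩
  | succ a ih =>
    refine ⟨fun m e => ih.1 _ (h.1 _ (by rwa [pow_succ', mul_smul] at e)), fun m m' e => ?_⟩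
    rw [pow_succ', mul_smul] at e
    obtain ⟨m₁, h₁⟩ := h.2 _ _ e
    rw [h₁, smul_comm] at e
    obtain ⟨m₂, h₂⟩ := ih.2 _ _ (h.smul_left_cancel e)
    exact ⟨m₂, by rw [h₁, h₂, pow_succ', mul_smul]⟩

theorem of_linearEquiv {M' : Type*} [AddCommGroup M'] [Module X M'] (h : IsParamRegular x y M)
    (e : M ≃ₗ[X] M') : IsParamRegular x y M' := by
  refine ⟨fun m hm => ?_, fun m m' hm => ?_⟩
  · rw [← e.symm.map_eq_zero_iff]
    exact h.1 _ (by rw [← map_smul, hm, map_zero])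
  · obtain ⟨z, hz⟩ := h.2 (e.symm m) (e.symm m') (by rw [← map_smul, hm, map_smul])
    exact ⟨e z, by rw [← map_smul, ← hz, e.apply_symm_apply]⟩

theorem of_retract {M' : Type*} [AddCommGroup M'] [Module X M'] (h : IsParamRegular x y M)
    (ι : M' →ₗ[X] M) (π : M →ₗ[X] M') (e : ∀ m, π (ι m) = m) : IsParamRegular x y M' := by
  refine ⟨fun m hm => ?_, fun m m' hm => ?_⟩
  · rw [← e m, h.1 (ι m) (by rw [← map_smul, hm, map_zero]), map_zero]
  · obtain ⟨z, hz⟩ := h.2 (ι m) (ι m') (by rw [← map_smul, hm, map_smul])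
    exact ⟨π z, by rw [← map_smul, ← hz, e]⟩

/-- Compatible local sections glue along an ideal containing powers of a regular sequence. -/
theorem glue (h : IsParamRegular x y M) {ι : Type*} (c : ι → X) (q : ι → M)
    (hc : ∀ i j, c i • q j = c j • q i) {N : ℕ} (hx : x ^ N ∈ Ideal.span (Set.range c))
    (hy : y ^ N ∈ Ideal.span (Set.range c)) : ∃ z : M, ∀ i, c i • z = q i := by
  have h' := (h.pow_left N).pow_right N
  -- Here `a` stands for `r` times the section that is to be found.
  have lift : ∀ r ∈ Ideal.span (Set.range c), ∃ a : M, ∀ j, c j • a = r • q j := by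
    intro r hr
    refine Submodule.span_induction ?_ ⟨0, by simp⟩ ?_ ?_ hr
    · rintro _ ⟨i, rfl⟩
      exact ⟨q i, fun j => hc j i⟩
    · rintro r s - - ⟨a, ha⟩ ⟨b, hb⟩
      exact ⟨a + b, fun j => by rw [smul_add, ha, hb, add_smul]⟩
    · rintro t r - ⟨a, ha⟩
      exact ⟨t • a, fun j => by rw [smul_comm, ha, smul_eq_mul, mul_smul]⟩
  have ext : ∀ r ∈ Ideal.span (Set.range c), ∀ a b : M, ∀ s : X, (∀ j, c j • a = s • c j • b) →
      r • a = s • r • b := by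
    intro r hr a b s hab
    refine Submodule.span_induction ?_ (by simp) ?_ ?_ hr
    · rintro _ ⟨i, rfl⟩
      exact hab i
    · rintro r s' - - h1 h2
      rw [add_smul, h1, h2, add_smul, smul_add]
    · rintro t r - h1
      rw [smul_eq_mul, mul_smul, h1, mul_smul, smul_comm]
  obtain ⟨a, ha⟩ := lift _ hx
  obtain ⟨b, hb⟩ := lift _ hy
  -- The elements `a` and `b` stand for `x ^ N • z` and `y ^ N • z`. Once they are known to be
  -- compatible, regularity of the powers divides `a` by `x ^ N` and so produces `z`.
  have hab : y ^ N • a = x ^ N • b := by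
    have h1 : ∀ j, c j • (y ^ N • a) = c j • (x ^ N • b) := fun j => by
      rw [smul_comm, ha, smul_comm (c j), hb, smul_comm]
    have h2 := ext _ hx (y ^ N • a) (x ^ N • b) 1 (fun j => by rw [h1, one_smul])
    rw [one_smul] at h2
    exact h'.smul_left_cancel h2
  obtain ⟨z, hz⟩ := h'.2 _ _ hab
  refine ⟨z, fun i => h'.smul_left_cancel ?_⟩
  rw [smul_comm, ← hz, ha]

end IsParamRegular

open RingTheory.Sequence Pointwise in
theorem isWeaklyRegular_pair_iff {X : Type*} [CommRing X] {x y : X} {M : Type*} [AddCommGroup M]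
    [Module X M] : IsWeaklyRegular M [x, y] ↔ IsParamRegular x y M := by
  rw [isWeaklyRegular_cons_iff, isWeaklyRegular_singleton_iff]
  refine and_congr ?_ ?_
  · rw [isSMulRegular_iff_right_eq_zero_of_smul]
  · have : IsSMulRegular (QuotSMulTop x M) y ↔ _ :=
      isSMulRegular_quotient_iff_mem_of_smul_mem (N := x • (⊤ : Submodule X M)) (r := y)
    rw [this]
    simp only [Submodule.mem_smul_pointwise_iff_exists, Submodule.mem_top, true_and]
    constructor
    · intro h m m' e
      obtain ⟨z, hz⟩ := h m ⟨m', e.symm⟩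
      exact ⟨z, hz.symm⟩
    · rintro h m ⟨m', e⟩
      obtain ⟨z, hz⟩ := h m m' e.symm
      exact ⟨z, hz.symm⟩

section DimTwo

variable {X : Type*} [CommRing X] [IsDomain X] [IsLocalRing X] [IsNoetherianRing X]

open IsLocalRing

theorem height_maximalIdeal_of_dim_two (hd : ringKrullDim X = 2) : (maximalIdeal X).height = 2 := by
  have := IsLocalRing.maximalIdeal_height_eq_ringKrullDim (R := X)
  rw [hd] at this
  exact WithBot.coe_injective this

theorem height_eq_one_of_ne (hd : ringKrullDim X = 2) {p : Ideal X} [hp : p.IsPrime]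
    (h0 : p ≠ ⊥) (hm : p ≠ maximalIdeal X) : p.height = 1 := by
  have h2 := height_maximalIdeal_of_dim_two hd
  have hlt : p < maximalIdeal X := lt_of_le_of_ne (le_maximalIdeal hp.ne_top) hm
  have h3 := Ideal.height_strict_mono_of_isPrime hlt
  rw [h2] at h3
  have h4 : p.height ≠ 0 := fun h => h0 (Ideal.height_eq_zero_iff_eq_bot.1 h)
  obtain ⟨n, hn⟩ := ENat.ne_top_iff_exists.1 h3.ne_top
  rw [← hn] at h3 h4 ⊢
  have h5 : n < 2 := by exact_mod_cast h3
  have h6 : n ≠ 0 := by exact_mod_cast h4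
  have : n = 1 := by omega
  rw [this, Nat.cast_one]

/-- A prime containing `J` is nonzero and not of height one, hence maximal. So the maximal ideal
lies in the radical of `J`. -/
theorem exists_pow_le_of_forall_height_one (hd : ringKrullDim X = 2) {J : Ideal X} (hJ : J ≠ ⊥)
    (h : ∀ p : Ideal X, p.IsPrime → p.height = 1 → ¬ J ≤ p) : ∃ N, maximalIdeal X ^ N ≤ J := by
  obtain ⟨N, hN⟩ := Ideal.exists_radical_pow_le_of_fg J (IsNoetherian.noetherian _)
  refine ⟨N, le_trans (Ideal.pow_right_mono ?_ N) hN⟩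
  rw [Ideal.radical_eq_sInf]
  refine le_sInf ?_
  rintro p ⟨hJp, hp⟩
  by_cases hpm : p = maximalIdeal X
  · exact hpm.ge
  · exact absurd hJp (h p hp (height_eq_one_of_ne hd
      (fun h0 => hJ (le_bot_iff.1 (h0 ▸ hJp))) hpm))

/-- A finitely generated module of depth two over a local domain of dimension two is
torsion-free. -/
theorem smul_ne_zero_of_isParamRegular (hd : ringKrullDim X = 2) {M : Type*} [AddCommGroup M]
    [Module X M] [Module.Finite X M] {r s : X} (hr : r ∈ maximalIdeal X) (hs : s ∈ maximalIdeal X)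
    (h : IsParamRegular r s M) {a : X} (ha : a ≠ 0) {m : M} (e : a • m = 0) : m = 0 := by
  by_contra hm
  obtain ⟨p, hpa, hle⟩ := exists_le_isAssociatedPrime_of_isNoetherianRing X m hm
  obtain ⟨hp, z, hz⟩ := isAssociatedPrime_iff.1 hpa
  have hpz : ∀ q, q ∈ p ↔ q • z = 0 := by
    intro q
    rw [hz, Submodule.mem_colon_singleton, Submodule.mem_bot]
  have hz0 : z ≠ 0 := by
    rintro rfl
    exact hp.ne_top ((Ideal.eq_top_iff_one _).2 ((hpz 1).2 (by simp)))
  have hp0 : p ≠ ⊥ := by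
    rintro rfl
    exact ha ((Submodule.mem_bot X).1 (hle (by simpa [Submodule.mem_colon_singleton] using e)))
  -- If `p` is not maximal it has height one, and any `t` of the maximal ideal outside `p` makes `p
  -- + (t)` contain a power of that ideal. If `p` is maximal, `t = 0` works.
  obtain ⟨t, ht, N, hN⟩ : ∃ t ∈ maximalIdeal X, ∃ N, maximalIdeal X ^ N ≤ p ⊔ Ideal.span {t} := by
    by_cases hpm : p = maximalIdeal X
    · exact ⟨0, Ideal.zero_mem _, 1, by rw [pow_one, ← hpm]; exact le_sup_left⟩
    · have hlt : p < maximalIdeal X := lt_of_le_of_ne (le_maximalIdeal hp.ne_top) hpm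
      obtain ⟨t, ht, htp⟩ := SetLike.exists_of_lt hlt
      refine ⟨t, ht, exists_pow_le_of_forall_height_one hd (fun h => ?_) ?_⟩
      · exact hp0 (le_bot_iff.1 (h ▸ le_sup_left))
      · intro q hq hq1 hle
        have hpq : p < q := lt_of_le_of_ne (le_sup_left.trans hle) (by
          rintro rfl
          exact htp (hle (Ideal.mem_sup_right (Ideal.mem_span_singleton_self t))))
        have h3 := Ideal.height_strict_mono_of_isPrime hpq
        rw [hq1, height_eq_one_of_ne hd hp0 hpm] at h3
        exact lt_irrefl _ h3
  let T : Submodule X M := Submodule.torsionBySet X M p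
  have hT : ∀ {u : M}, u ∈ T ↔ ∀ q ∈ p, q • u = 0 := by
    intro u
    rw [Submodule.mem_torsionBySet_iff]
    exact ⟨fun h q hq => h ⟨q, hq⟩, fun h q => h q q.2⟩
  -- For `u` killed by `p`, glue the section `u` over `t` with the section `0` over `p`: the result
  -- `v` is killed by `p` and satisfies `t • v = u`. By Nakayama `T` vanishes, although it contains
  -- `z`.
  have hle : T ≤ maximalIdeal X • T := by
    intro u hu
    rw [hT] at hu
    obtain ⟨v, hv⟩ := h.glue (N := N) (fun o : Option p => o.elim t (fun q => (q : X)))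
      (fun o => o.elim u (fun _ => 0)) (by
        rintro (_ | q) (_ | q')
        · rfl
        · simp [hu q' q'.2]
        · simp [hu q q.2]
        · simp) (by
        refine Ideal.span_mono ?_ (?_ : r ^ N ∈ Ideal.span ((p : Set X) ∪ {t}))
        · rintro w (hw | hw)
          · exact ⟨some ⟨w, hw⟩, rfl⟩
          · exact ⟨none, hw.symm⟩
        · rw [Ideal.span_union, Ideal.span_eq]
          exact hN (Ideal.pow_mem_pow hr N)) (by
        refine Ideal.span_mono ?_ (?_ : s ^ N ∈ Ideal.span ((p : Set X) ∪ {t}))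
        · rintro w (hw | hw)
          · exact ⟨some ⟨w, hw⟩, rfl⟩
          · exact ⟨none, hw.symm⟩
        · rw [Ideal.span_union, Ideal.span_eq]
          exact hN (Ideal.pow_mem_pow hs N))
    have hvT : v ∈ T := hT.2 fun q hq => hv (some ⟨q, hq⟩)
    have := hv none
    simp only [Option.elim] at this
    rw [← this]
    exact Submodule.smul_mem_smul ht hvT
  have hT0 : T = ⊥ := Submodule.eq_bot_of_le_smul_of_le_jacobson_bot (maximalIdeal X) T
    (IsNoetherian.noetherian _) hle (IsLocalRing.maximalIdeal_le_jacobson _)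
  exact hz0 ((Submodule.mem_bot X).1 (hT0 ▸ hT.2 fun q hq => (hpz q).1 hq))

/-- Depth two can be tested on any system of parameters. -/
theorem IsParamRegular.change (hd : ringKrullDim X = 2) {M : Type*} [AddCommGroup M]
    [Module X M] [Module.Finite X M] {r s : X} (hr : r ∈ maximalIdeal X) (hs : s ∈ maximalIdeal X)
    (h : IsParamRegular r s M) {x y : X} (hx : x ≠ 0) {N : ℕ}
    (hN : maximalIdeal X ^ N ≤ Ideal.span {x, y}) : IsParamRegular x y M := by
  refine ⟨fun m => smul_ne_zero_of_isParamRegular hd hr hs h hx, fun m m' e => ?_⟩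
  have hspan : Ideal.span (Set.range ![x, y]) = Ideal.span {x, y} := by
    rw [Matrix.range_cons_cons_empty]
  -- The relation `y • m = x • m'` says that `m` over `x` and `m'` over `y` are compatible sections;
  -- the glued element is the quotient of `m` by `x`.
  obtain ⟨z, hz⟩ := h.glue (N := N) ![x, y] ![m, m'] (by
    intro i j
    fin_cases i <;> fin_cases j <;> simp [e]) (hspan ▸ hN (Ideal.pow_mem_pow hr N))
    (hspan ▸ hN (Ideal.pow_mem_pow hs N))
  exact ⟨z, (hz 0).symm⟩

/-- The definition asks for some regular sequence of length two in the maximal ideal.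
`IsParamRegular.change` moves it to the fixed system of parameters, so that one pair tests all
modules. -/
theorem isMaximalCohenMacaulay_iff {X : Type u} [CommRing X] [IsDomain X] [IsLocalRing X]
    [IsNoetherianRing X] (hd : ringKrullDim X = 2) {M : Type u} [AddCommGroup M]
    [Module X M] {x y : X} (hx : x ≠ 0) (hxm : x ∈ maximalIdeal X) (hym : y ∈ maximalIdeal X) {N : ℕ}
    (hN : maximalIdeal X ^ N ≤ Ideal.span {x, y}) :
    IsMaximalCohenMacaulay X M ↔ Module.Finite X M ∧ IsParamRegular x y M := by
  refine and_congr_right fun hf => ⟨?_, fun h => ?_⟩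
  · rintro ⟨rs, hl, hrs, hreg⟩
    rw [hd] at hl
    have hl' : rs.length = 2 := by exact_mod_cast hl
    match rs, hl' with
    | [r, s], _ =>
      exact (isWeaklyRegular_pair_iff.1 hreg).change hd (hrs r (by simp)) (hrs s (by simp)) hx hN
  · refine ⟨[x, y], by rw [hd]; rfl, ?_, isWeaklyRegular_pair_iff.2 h⟩
    intro r hr
    simp only [List.mem_cons, List.not_mem_nil, or_false] at hr
    rcases hr with rfl | rfl
    exacts [hxm, hym]

end DimTwo

/-! ### Bases of modules over power series rings -/

section Basis

open MvPowerSeries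

variable {k : Type*} [Field k] {M : Type*} [AddCommGroup M] [Module (PS k) M]
  {ι : Type*} [Fintype ι]

theorem PS.varIdeal_le_jacobson : PS.varIdeal k ≤ Ideal.jacobson (⊥ : Ideal (PS k)) := by
  rw [IsLocalRing.jacobson_eq_maximalIdeal ⊥ bot_ne_top]
  refine IsLocalRing.le_maximalIdeal fun h => ?_
  have := (Ideal.eq_top_iff_one _).1 h
  rw [PS.mem_varIdeal_iff] at this
  simp at this

theorem surjective_linearCombination_of_mod [Module.Finite (PS k) M] (n : ι → M)
    (hs : ∀ m : M, ∃ (a : ι → k) (p q : M), m = ∑ j, (C (a j) : PS k) • n j +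
      (X 0 : PS k) • p + (X 1 : PS k) • q) :
    Function.Surjective (Fintype.linearCombination (PS k) n) := by
  rw [← LinearMap.range_eq_top, ← top_le_iff]
  refine Submodule.le_of_le_smul_of_le_jacobson_bot (Module.Finite.fg_top)
    (PS.varIdeal_le_jacobson (k := k)) fun m _ => ?_
  obtain ⟨a, p, q, rfl⟩ := hs m
  rw [add_assoc]
  refine Submodule.add_mem_sup ⟨fun j => C (a j), by
    simp [Fintype.linearCombination_apply]⟩ (Submodule.add_mem _ ?_ ?_)
  · exact Submodule.smul_mem_smul (Ideal.subset_span ⟨0, rfl⟩) trivial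
  · exact Submodule.smul_mem_smul (Ideal.subset_span ⟨1, rfl⟩) trivial

/-- Induction on the degree in the second variable. Independence modulo both variables kills the
constant terms; then `X 1` times a combination lies in `X 0 • M`, and regularity removes the factor
`X 1`. -/
theorem X_dvd_of_linearCombination_mem (h : IsParamRegular (X 0 : PS k) (X 1 : PS k) M) (n : ι → M)
    (hi : ∀ (a : ι → k) (p q : M), ∑ j, (C (a j) : PS k) • n j =
      (X 0 : PS k) • p + (X 1 : PS k) • q → ∀ j, a j = 0) (b : ℕ) :
    ∀ (f : ι → PS k) (m : M), ∑ j, f j • n j = (X 0 : PS k) • m →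
      ∀ j d, d 0 = 0 → d 1 < b → coeff d (f j) = 0 := by
  induction b with
  | zero => intro f m _ j d _ hd; omega
  | succ b ih =>
    intro f m e
    choose f₀ f₁ hf using fun j => PS.exists_eq_C_add (f j)
    have e2 : ∑ j, f j • n j = ∑ j, (C (constantCoeff (f j)) : PS k) • n j +
        (X 0 : PS k) • ∑ j, f₀ j • n j + (X 1 : PS k) • ∑ j, f₁ j • n j := by
      rw [Finset.smul_sum, Finset.smul_sum, ← Finset.sum_add_distrib, ← Finset.sum_add_distrib]
      refine Finset.sum_congr rfl fun j _ => ?_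
      conv_lhs => rw [hf j]
      simp only [add_smul, mul_smul]
    have hc : ∀ j, constantCoeff (f j) = 0 := by
      refine hi _ (m - ∑ j, f₀ j • n j) (-∑ j, f₁ j • n j) ?_
      rw [e2] at e
      rw [smul_sub, ← e, smul_neg]
      abel
    have e3 : (X 1 : PS k) • ∑ j, f₁ j • n j = (X 0 : PS k) • (m - ∑ j, f₀ j • n j) := by
      rw [smul_sub, ← e, e2]
      simp [hc]
    obtain ⟨m', hm'⟩ := h.2 _ _ e3
    intro j d h0 h1
    rw [hf j, hc j, map_zero, zero_add, map_add, PS.coeff_X_mul, PS.coeff_X_mul, h0, if_neg (by simp),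
      zero_add]
    split_ifs with h2
    · refine ih f₁ m' hm' j _ (by simp [h0]) ?_
      simp only [Finsupp.coe_tsub, Pi.sub_apply, Finsupp.single_eq_same]
      omega
    · rfl

/-- All coefficients of a relation are divisible by `X 0`, and the quotients again form a relation;
so they are divisible by every power of `X 0`. -/
theorem injective_linearCombination_of_mod (h : IsParamRegular (X 0 : PS k) (X 1 : PS k) M)
    (n : ι → M) (hi : ∀ (a : ι → k) (p q : M), ∑ j, (C (a j) : PS k) • n j =
      (X 0 : PS k) • p + (X 1 : PS k) • q → ∀ j, a j = 0) :
    Function.Injective (Fintype.linearCombination (PS k) n) := by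
  have key : ∀ a (f : ι → PS k), ∑ j, f j • n j = 0 → ∀ j d, d 0 < a → coeff d (f j) = 0 := by
    intro a
    induction a with
    | zero => intro f _ j d hd; omega
    | succ a ih =>
      intro f hf
      have : ∀ j, (X 0 : PS k) ∣ f j := fun j => by
        rw [X_dvd_iff]
        intro d hd
        exact X_dvd_of_linearCombination_mem h n hi (d 1 + 1) f 0 (by rw [hf, smul_zero]) j d hd
          (by omega)
      choose g hg using this
      have hg0 : ∑ j, g j • n j = 0 := h.1 _ (by
        rw [Finset.smul_sum, ← hf]
        exact Finset.sum_congr rfl fun j _ => by rw [smul_smul, ← hg])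
      intro j d hd
      rw [hg, PS.coeff_X_mul]
      split_ifs with h2
      · refine ih g hg0 j _ ?_
        simp only [Finsupp.coe_tsub, Pi.sub_apply, Finsupp.single_eq_same]
        omega
      · rfl
  rw [injective_iff_map_eq_zero]
  intro f hf
  rw [Fintype.linearCombination_apply] at hf
  funext j
  ext d
  simpa using key (d 0 + 1) f hf j d (by omega)

end Basis



/-! ### Noether normalization of surface singularities -/

section Normalization

open IsLocalRing MvPowerSeries

theorem mem_pow_smul_top_pi {R ι : Type*} [CommRing R] [Finite ι] {I : Ideal R} {n : ℕ} {v : ι → R} :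
    v ∈ (I ^ n • ⊤ : Submodule R (ι → R)) ↔ ∀ i, v i ∈ I ^ n := by
  classical
  have := Fintype.ofFinite ι
  constructor
  · intro hv i
    have := Submodule.mem_map_of_mem (f := LinearMap.proj (R := R) (φ := fun _ : ι => R) i) hv
    rw [Submodule.map_smul''] at this
    have h2 := Submodule.smul_mono (le_refl (I ^ n)) (le_top :
      Submodule.map (LinearMap.proj (R := R) (φ := fun _ : ι => R) i) ⊤ ≤ ⊤) this
    rwa [smul_eq_mul, Ideal.mul_top] at h2
  · intro hv
    rw [pi_eq_sum_univ' v]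
    refine Submodule.sum_mem _ fun i _ => Submodule.smul_mem_smul (hv i) trivial

theorem isPrecomplete_pi {R : Type*} [CommRing R] (I : Ideal R) [IsPrecomplete I R] (ι : Type*)
    [Finite ι] : IsPrecomplete I (ι → R) := by
  refine ⟨fun f hf => ?_⟩
  have hl : ∀ i, ∃ L : R, ∀ n, f n i - L ∈ I ^ n := by
    intro i
    obtain ⟨L, hL⟩ := IsPrecomplete.prec (inferInstance : IsPrecomplete I R)
      (f := fun n => f n i) (by
        intro m n hmn
        have := hf hmn
        rw [SModEq.sub_mem, mem_pow_smul_top_pi] at this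
        rw [SModEq.sub_mem, smul_eq_mul, Ideal.mul_top]
        exact this i)
    refine ⟨L, fun n => ?_⟩
    have := hL n
    rwa [SModEq.sub_mem, smul_eq_mul, Ideal.mul_top] at this
  choose L hL using hl
  refine ⟨L, fun n => ?_⟩
  rw [SModEq.sub_mem, mem_pow_smul_top_pi]
  exact fun i => hL i n

/-- Modulo `J ^ n` only the truncation of a series in total degree `n` matters. Evaluating
truncations gives compatible maps to the quotients, and completeness glues them. -/
theorem exists_powerSeries_ringHom (k : Type*) {B : Type*} [Field k] [CommRing B] [Algebra k B]
    (J : Ideal B) [IsAdicComplete J B] (x : Fin 2 → B) (hx : ∀ i, x i ∈ J) :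
    ∃ f : PS k →+* B, (∀ i, f (X i) = x i) ∧ ∀ a, f (C a) = algebraMap k B a := by
  have hle : ∀ n, MvPolynomial.idealOfVars (Fin 2) k ^ n ≤
      (J ^ n).comap (MvPolynomial.aeval x : MvPolynomial (Fin 2) k →ₐ[k] B).toRingHom := by
    intro n
    rw [← Ideal.map_le_iff_le_comap, Ideal.map_pow]
    refine Ideal.pow_right_mono ?_ n
    rw [MvPolynomial.idealOfVars, Ideal.map_span, Ideal.span_le]
    rintro _ ⟨_, ⟨i, rfl⟩, rfl⟩
    simpa using hx i
  let g : (n : ℕ) → PS k →+* B ⧸ J ^ n := fun n =>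
    (Ideal.quotientMap (J ^ n) _ (hle n)).comp
      (truncTotalAlgHom (Fin 2) k n : PS k →+* _)
  have hg : ∀ (n : ℕ) (p : PS k), g n p =
      Ideal.Quotient.mk (J ^ n) (MvPolynomial.aeval x (truncTotal n p)) := fun n p => rfl
  have hcomp : ∀ {m n : ℕ} (h : m ≤ n), (Ideal.Quotient.factorPow J h).comp (g n) = g m := by
    intro m n h
    ext1 p
    rw [RingHom.comp_apply, hg, hg]
    change Ideal.Quotient.mk (J ^ m) _ = Ideal.Quotient.mk (J ^ m) _
    rw [Ideal.Quotient.eq, ← map_sub]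
    exact hle m (truncTotal_sub_truncTotal_mem_pow_idealOfVars h le_rfl p)
  have hpoly : ∀ p : MvPolynomial (Fin 2) k,
      IsAdicComplete.liftRingHom J g hcomp (p : PS k) = MvPolynomial.aeval x p := by
    intro p
    rw [← sub_eq_zero]
    refine IsHausdorff.haus (inferInstance : IsHausdorff J B) _ fun n => ?_
    rw [SModEq.zero, smul_eq_mul, Ideal.mul_top, ← Ideal.Quotient.eq_zero_iff_mem, map_sub,
      IsAdicComplete.mk_liftRingHom, hg, ← map_sub, Ideal.Quotient.eq_zero_iff_mem, ← map_sub]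
    refine hle n ((MvPolynomial.mem_pow_idealOfVars_iff' _ _).2 fun d hd => ?_)
    simp [coeff_truncTotal _ hd]
  refine ⟨IsAdicComplete.liftRingHom J g hcomp, fun i => ?_, fun a => ?_⟩
  · simpa using hpoly (MvPolynomial.X i)
  · simpa using hpoly (MvPolynomial.C a)

variable {X : Type*} [CommRing X] [IsDomain X] [IsLocalRing X] [IsNoetherianRing X]

/-- A normal local domain of dimension two has depth two. -/
theorem isParamRegular_of_isIntegrallyClosed [IsIntegrallyClosed X] (hd : ringKrullDim X = 2)
    {x y : X} (hx : x ≠ 0) {N : ℕ} (hN : maximalIdeal X ^ N ≤ Ideal.span {x, y}) :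
    IsParamRegular x y X := by
  refine ⟨fun m h => (mul_eq_zero.1 h).resolve_left hx, ?_⟩
  by_contra! hcon
  obtain ⟨a, b, hab, ha⟩ := hcon
  have ha' : ¬ Ideal.span {a} ≤ Ideal.span {x} := by
    rw [Ideal.span_singleton_le_span_singleton]
    rintro ⟨c, hc⟩
    exact ha c hc
  have hNa : maximalIdeal X ^ N * Ideal.span {a} ≤ Ideal.span {x} := by
    refine (Ideal.mul_mono_left hN).trans ?_
    rw [Ideal.span_mul_span, Ideal.span_le]
    rintro _ ⟨r, hr, s, hs, rfl⟩
    rw [Set.mem_singleton_iff] at hs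
    subst hs
    rcases hr with rfl | hr
    · exact Ideal.mul_mem_right _ _ (Ideal.mem_span_singleton_self _)
    · rw [Set.mem_singleton_iff] at hr
      subst hr
      exact Ideal.mem_span_singleton.2 ⟨b, hab⟩
  -- Take the last power of the maximal ideal that does not carry `a` into `(x)`. It yields an
  -- element `c` outside `(x)` with `𝔪 c ⊆ (x)`.
  obtain ⟨j, hj, hj'⟩ : ∃ j, ¬ maximalIdeal X ^ j * Ideal.span {a} ≤ Ideal.span {x} ∧
      maximalIdeal X ^ (j + 1) * Ideal.span {a} ≤ Ideal.span {x} := by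
    by_contra! h
    have : ∀ j, ¬ maximalIdeal X ^ j * Ideal.span {a} ≤ Ideal.span {x} := by
      intro j
      induction j with
      | zero => rwa [pow_zero, one_mul]
      | succ j ih => exact h j ih
    exact this N hNa
  obtain ⟨c, hc, hcx⟩ := SetLike.not_le_iff_exists.1 hj
  have hmc : ∀ t ∈ maximalIdeal X, ∃ t', t * c = x * t' := by
    intro t ht
    refine Ideal.mem_span_singleton.1 (hj' ?_)
    rw [pow_succ', mul_assoc]
    exact Ideal.mul_mem_mul ht hc
  -- Multiplication by `c / x` maps the maximal ideal into `X`. If some value is a unit, the maximal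
  -- ideal is principal, contrary to its height being two. Otherwise the maximal ideal is mapped to
  -- itself, so `c / x` is integral and lies in `X`, contrary to the choice of `c`.
  by_cases hprin : ∃ t ∈ maximalIdeal X, ∃ e, IsUnit e ∧ t * c = x * e
  · obtain ⟨t, ht, e, he, hte⟩ := hprin
    have hm : maximalIdeal X = Ideal.span {t} := by
      refine le_antisymm (fun z hz => ?_) ((Ideal.span_singleton_le_iff_mem _).2 ht)
      obtain ⟨z', hz'⟩ := hmc z hz
      rw [Ideal.mem_span_singleton, ← he.dvd_mul_right]
      refine ⟨z', mul_left_cancel₀ hx ?_⟩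
      calc x * (z * e) = z * (x * e) := by ring
        _ = t * (z * c) := by rw [← hte]; ring
        _ = x * (t * z') := by rw [hz']; ring
    have h1 : (maximalIdeal X).height ≤ 1 :=
      Ideal.height_le_one_of_isPrincipal_of_mem_minimalPrimes (Ideal.span {t}) _ (by
        rw [← hm, Ideal.minimalPrimes_eq_subsingleton_self]
        rfl)
    rw [height_maximalIdeal_of_dim_two hd] at h1
    exact absurd h1 (by decide)
  · let K := FractionRing X
    have hxK : algebraMap X K x ≠ 0 := by simpa using hx
    let w : K := algebraMap X K c / algebraMap X K x
    have hw : ∀ t ∈ maximalIdeal X, ∃ t' ∈ maximalIdeal X, w * algebraMap X K t = algebraMap X K t' := by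
      intro t ht
      obtain ⟨t', ht'⟩ := hmc t ht
      refine ⟨t', fun hu => hprin ⟨t, ht, t', hu, ht'⟩, ?_⟩
      rw [div_mul_eq_mul_div, div_eq_iff hxK, ← map_mul, ← map_mul, mul_comm c, ht', mul_comm]
    have hm0 : maximalIdeal X ≠ ⊥ := fun h => by
      have := height_maximalIdeal_of_dim_two hd
      rw [h, Ideal.height_bot] at this
      exact absurd this (by decide)
    have hint : IsIntegral X w := by
      refine isIntegral_of_smul_mem_submodule (N := Submodule.map (Algebra.linearMap X K) (maximalIdeal X))
        ?_ ?_ w ?_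
      · obtain ⟨t, ht, ht0⟩ := Submodule.exists_mem_ne_zero_of_ne_bot hm0
        intro h
        have : algebraMap X K t ∈ Submodule.map (Algebra.linearMap X K) (maximalIdeal X) := ⟨t, ht, rfl⟩
        rw [h, Submodule.mem_bot] at this
        exact ht0 (by simpa using this)
      · exact (IsNoetherian.noetherian (maximalIdeal X)).map _
      · rintro _ ⟨t, ht, rfl⟩
        obtain ⟨t', ht', h⟩ := hw t ht
        exact ⟨t', ht', by rw [smul_eq_mul]; exact h.symm⟩
    obtain ⟨z, hz⟩ := IsIntegrallyClosed.isIntegral_iff.1 hint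
    apply hcx
    rw [Ideal.mem_span_singleton]
    refine ⟨z, IsFractionRing.injective X K ?_⟩
    rw [map_mul, hz, mul_div_cancel₀ _ hxK]

/-- By the converse of Krull's height theorem, the maximal ideal is minimal over an ideal with two
generators; all primes containing these are then maximal. -/
theorem exists_parameters (hd : ringKrullDim X = 2) : ∃ x y : X, x ≠ 0 ∧ x ∈ maximalIdeal X ∧
    y ∈ maximalIdeal X ∧ ∃ N, maximalIdeal X ^ N ≤ Ideal.span {x, y} := by
  classical
  obtain ⟨s, hs, hc⟩ := Ideal.exists_finset_card_eq_height_of_isNoetherianRing (maximalIdeal X)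
  rw [height_maximalIdeal_of_dim_two hd] at hc
  have hc' : s.card = 2 := by exact_mod_cast hc
  have hpow : ∃ N, maximalIdeal X ^ N ≤ Ideal.span (s : Set X) := by
    obtain ⟨N, hN⟩ := Ideal.exists_radical_pow_le_of_fg (Ideal.span (s : Set X))
      (IsNoetherian.noetherian _)
    refine ⟨N, le_trans (Ideal.pow_right_mono ?_ N) hN⟩
    rw [Ideal.radical_eq_sInf]
    refine le_sInf ?_
    rintro p ⟨hp, hp'⟩
    exact hs.2 ⟨hp', hp⟩ (le_maximalIdeal hp'.ne_top)
  obtain ⟨x, y, hxy, rfl⟩ := Finset.card_eq_two.1 hc'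
  have hmem : ∀ z ∈ ({x, y} : Finset X), z ∈ maximalIdeal X := fun z hz =>
    hs.1.2 (Ideal.subset_span hz)
  rw [Finset.coe_insert, Finset.coe_singleton] at hpow
  -- Only the first parameter has to be nonzero. The two generators are distinct, so at least one of
  -- them is.
  by_cases hx : x = 0
  · refine ⟨y, x, fun hy => hxy (hx.trans hy.symm), hmem y (by simp), hmem x (by simp), ?_⟩
    rwa [Set.pair_comm]
  · exact ⟨x, y, hx, hmem x (by simp), hmem y (by simp), hpow⟩

end Normalization

open IsLocalRing in
/-- The local domain `X` of dimension two is a finite free algebra over the ring of power series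
in two variables. -/
class SurfaceOver (k X : Type u) [Field k] [CommRing X] [IsDomain X] [IsLocalRing X] [Algebra k X]
    [Algebra (PS k) X] : Prop where
  isScalarTower : IsScalarTower k (PS k) X
  finite : Module.Finite (PS k) X
  dim : ringKrullDim X = 2
  mem : ∀ i, algebraMap (PS k) X (MvPowerSeries.X i) ∈ maximalIdeal X
  ne_zero : algebraMap (PS k) X (MvPowerSeries.X 0) ≠ 0
  pow_le : ∃ N, maximalIdeal X ^ N ≤ Ideal.span {algebraMap (PS k) X (MvPowerSeries.X 0),
    algebraMap (PS k) X (MvPowerSeries.X 1)}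
  regular : IsParamRegular (algebraMap (PS k) X (MvPowerSeries.X 0))
    (algebraMap (PS k) X (MvPowerSeries.X 1)) X

/-- As the residue field is `k`, generators of `𝔪 ^ i` as an ideal span `𝔪 ^ i` over `k` modulo `𝔪 ^
(i + 1)`. Collect them for all `i < N`. -/
theorem exists_span_add_pow {k B : Type*} [Field k] [CommRing B] [IsLocalRing B]
    [IsNoetherianRing B] [Algebra k B]
    (hres : Function.Surjective (algebraMap k (IsLocalRing.ResidueField B))) (N : ℕ) :
    ∃ T : Set B, T.Finite ∧ ∀ b : B, ∃ a ∈ Submodule.span k T,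
      b - a ∈ IsLocalRing.maximalIdeal B ^ N := by
  induction N with
  | zero => exact ⟨∅, Set.finite_empty, fun b => ⟨0, Submodule.zero_mem _, by simp⟩⟩
  | succ N ih =>
    obtain ⟨T, hT, h⟩ := ih
    obtain ⟨G, hG⟩ := IsNoetherian.noetherian (IsLocalRing.maximalIdeal B ^ N)
    refine ⟨T ∪ G, hT.union G.finite_toSet, fun b => ?_⟩
    obtain ⟨a, ha, hb⟩ := h b
    have : ∀ z ∈ Submodule.span B (G : Set B), ∃ a ∈ Submodule.span k (G : Set B),
        z - a ∈ IsLocalRing.maximalIdeal B ^ (N + 1) := by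
      intro z hz
      refine Submodule.span_induction ?_ ⟨0, Submodule.zero_mem _, by simp⟩ ?_ ?_ hz
      · intro g hg
        exact ⟨g, Submodule.subset_span hg, by simp⟩
      · rintro u v - - ⟨a, ha, hu⟩ ⟨a', ha', hv⟩
        refine ⟨a + a', Submodule.add_mem _ ha ha', ?_⟩
        rw [add_sub_add_comm]
        exact Ideal.add_mem _ hu hv
      · rintro c u hu ⟨a, ha, hua⟩
        obtain ⟨t, ht⟩ := hres (IsLocalRing.residue B c)
        have hct : c - algebraMap k B t ∈ IsLocalRing.maximalIdeal B := by
          rw [← Ideal.Quotient.eq]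
          exact ht.symm
        refine ⟨t • a, Submodule.smul_mem _ _ ha, ?_⟩
        have e : c • u - t • a = (c - algebraMap k B t) * u + algebraMap k B t * (u - a) := by
          rw [smul_eq_mul, Algebra.smul_def]
          ring
        rw [e]
        refine Ideal.add_mem _ ?_ (Ideal.mul_mem_left _ _ hua)
        rw [pow_succ']
        refine Ideal.mul_mem_mul hct ?_
        have : Submodule.span B (G : Set B) = IsLocalRing.maximalIdeal B ^ N := hG
        rwa [← this]
    obtain ⟨a', ha', hb'⟩ := this (b - a) (by
      have : Submodule.span B (G : Set B) = IsLocalRing.maximalIdeal B ^ N := hG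
      rwa [this])
    refine ⟨a + a', Submodule.add_mem _ (Submodule.span_mono Set.subset_union_left ha)
      (Submodule.span_mono Set.subset_union_right ha'), ?_⟩
    rwa [← sub_sub]

open IsLocalRing in
/-- Noether normalization. -/
theorem IsNormalSurfaceSingularity.exists_surfaceOver {k B : Type u} [Field k] [CommRing B]
    [IsDomain B] [IsLocalRing B] [Algebra k B] (hB : IsNormalSurfaceSingularity k B) :
    ∃ _ : Algebra (PS k) B, SurfaceOver k B := by
  have := hB.isNoetherianRing
  have := hB.isIntegrallyClosed
  have := hB.isAdicComplete
  obtain ⟨x, y, hx0, hx, hy, N, hN⟩ := exists_parameters hB.ringKrullDim_eq_two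
  have hxy : ∀ i, (![x, y] : Fin 2 → B) i ∈ maximalIdeal B := by
    intro i
    fin_cases i
    exacts [hx, hy]
  obtain ⟨f, hf, hfC⟩ := exists_powerSeries_ringHom k (maximalIdeal B) ![x, y] hxy
  let alg : Algebra (PS k) B := f.toAlgebra
  have h0 : algebraMap (PS k) B (MvPowerSeries.X 0) = x := hf 0
  have h1 : algebraMap (PS k) B (MvPowerSeries.X 1) = y := hf 1
  have htower : IsScalarTower k (PS k) B := IsScalarTower.of_algebraMap_eq fun a => (hfC a).symm
  refine ⟨alg, htower, ?_, hB.ringKrullDim_eq_two, fun i => ?_, by rwa [h0],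
    ⟨N, by rwa [h0, h1]⟩, ?_⟩
  · obtain ⟨T, hT, hspan⟩ := exists_span_add_pow hB.residue_bijective.2 N
    have hmap : (PS.varIdeal k).map (algebraMap (PS k) B) ≤ maximalIdeal B := by
      rw [Ideal.map_span, Ideal.span_le]
      rintro _ ⟨_, ⟨i, rfl⟩, rfl⟩
      exact (hf i).symm ▸ hxy i
    have hpow : maximalIdeal B ^ N ≤ (PS.varIdeal k).map (algebraMap (PS k) B) := by
      refine hN.trans (Ideal.span_le.2 ?_)
      rintro z (rfl | rfl)
      · rw [← h0]
        exact Ideal.mem_map_of_mem _ (Ideal.subset_span ⟨0, rfl⟩)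
      · rw [← h1]
        exact Ideal.mem_map_of_mem _ (Ideal.subset_span ⟨1, rfl⟩)
    have hH : IsHausdorff (PS.varIdeal k) B := by
      refine IsHausdorff.of_map (J := maximalIdeal B) hmap
    have := hT.to_subtype
    have := Fintype.ofFinite T
    have hpre := isPrecomplete_pi (PS.varIdeal k) T
    -- Modulo the parameters `B` is spanned over `k` by `T`, because they generate an ideal
    -- containing `𝔪 ^ N`. Completeness of the power series ring and separatedness of `B` lift this
    -- to generation over `k[[x,y]]`.
    have hsurj : Function.Surjective (Fintype.linearCombination (PS k) (fun t : T => (t : B))) := by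
      refine surjective_of_mkQ_comp_surjective (I := PS.varIdeal k) fun z => ?_
      obtain ⟨b, rfl⟩ := Submodule.mkQ_surjective _ z
      obtain ⟨a, ha, hb⟩ := hspan b
      have ha' : a ∈ LinearMap.range (Fintype.linearCombination (PS k) (fun t : T => (t : B))) := by
        rw [Fintype.range_linearCombination, Subtype.range_coe]
        exact Submodule.span_le_restrictScalars k (PS k) T ha
      obtain ⟨v, hv⟩ := ha'
      refine ⟨v, ?_⟩
      rw [LinearMap.comp_apply, hv, ← sub_eq_zero, ← map_sub, Submodule.mkQ_apply,
        Submodule.Quotient.mk_eq_zero, ← neg_mem_iff, neg_sub, Ideal.smul_top_eq_map]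
      exact hpow hb
    exact Module.Finite.of_surjective _ hsurj
  · exact (hf i).symm ▸ hxy i
  · rw [h0, h1]
    exact isParamRegular_of_isIntegrallyClosed hB.ringKrullDim_eq_two hx0 hN



/-! ### Matrix representations over power series rings -/

/-- A representation of the `k[[x,y]]`-algebra `X` on the free module of rank `l` over `R[[x,y]]`. -/
structure SeriesRep (k X R : Type u) [Field k] [CommRing X] [Algebra (PS k) X] [CommRing R] [Algebra k R]
    (l : ℕ) where
  toRingHom : X →+* Matrix (Fin l) (Fin l) (PS R)
  toRingHom_algebraMap : ∀ s : PS k, toRingHom (algebraMap (PS k) X s) =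
    Matrix.scalar (Fin l) (MvPowerSeries.map (algebraMap k R) s)

namespace SeriesRep

open MvPowerSeries

variable {k X R R' : Type u} [Field k] [CommRing X] [Algebra (PS k) X] [CommRing R] [Algebra k R]
  [CommRing R'] [Algebra k R'] {l l' : ℕ}

/-- The module underlying a representation. -/
def V (_ρ : SeriesRep k X R l) : Type u := Fin l → PS R

variable (ρ : SeriesRep k X R l)

instance : AddCommGroup ρ.V := inferInstanceAs (AddCommGroup (Fin l → PS R))

noncomputable instance : Module (PS R) ρ.V := inferInstanceAs (Module (PS R) (Fin l → PS R))

noncomputable instance : Module R ρ.V := inferInstanceAs (Module R (Fin l → PS R))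

/-- The action of a ring on column vectors through matrices. -/
noncomputable abbrev mulVecModule (f : X →+* Matrix (Fin l) (Fin l) (PS R)) :
    Module X (Fin l → PS R) where
  smul x v := (f x).mulVec v
  one_smul v := by
    change (f 1).mulVec v = v
    rw [map_one, Matrix.one_mulVec]
  mul_smul x y v := by
    change (f (x * y)).mulVec v = (f x).mulVec ((f y).mulVec v)
    rw [map_mul, Matrix.mulVec_mulVec]
  smul_zero x := Matrix.mulVec_zero _
  smul_add x v w := Matrix.mulVec_add _ _ _
  add_smul x y v := by
    change (f (x + y)).mulVec v = _
    rw [map_add]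
    exact Matrix.add_mulVec _ _ _
  zero_smul v := by
    change (f 0).mulVec v = 0
    rw [map_zero, Matrix.zero_mulVec]

noncomputable instance : Module X ρ.V := mulVecModule ρ.toRingHom

theorem smul_def (x : X) (v : ρ.V) : x • v = (ρ.toRingHom x).mulVec v := rfl

theorem algebraMap_smul (s : PS k) (v : ρ.V) :
    algebraMap (PS k) X s • v = MvPowerSeries.map (algebraMap k R) s • v := by
  rw [smul_def, ρ.toRingHom_algebraMap, Matrix.scalar_apply]
  funext i
  exact Matrix.mulVec_diagonal _ _ _

theorem r_smul_def (r : R) (v : ρ.V) : r • v = (C r : PS R) • v := by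
  funext i
  exact MvPowerSeries.smul_eq_C_mul _ _

instance : SMulCommClass X (PS R) ρ.V := ⟨fun x s v => by
  rw [smul_def, smul_def]
  exact Matrix.mulVec_smul _ _ _⟩

instance : SMulCommClass X R ρ.V := ⟨fun x r v => by
  rw [r_smul_def, r_smul_def, smul_comm]⟩

instance : SMulCommClass R X ρ.V := SMulCommClass.symm X R ρ.V

/-- Change of the coefficient ring. -/
noncomputable def map (φ : R →ₐ[k] R') : SeriesRep k X R' l where
  toRingHom := (MvPowerSeries.map (σ := Fin 2) (φ : R →+* R')).mapMatrix.comp ρ.toRingHom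
  toRingHom_algebraMap s := by
    rw [RingHom.comp_apply, ρ.toRingHom_algebraMap, Matrix.scalar_apply, RingHom.mapMatrix_apply,
      Matrix.diagonal_map (map_zero _), Matrix.scalar_apply]
    congr 1
    funext _
    rw [MvPowerSeries.map_map, AlgHom.comp_algebraMap]

theorem map_toRingHom_apply (φ : R →ₐ[k] R') (x : X) :
    (ρ.map φ).toRingHom x = (ρ.toRingHom x).map (MvPowerSeries.map (φ : R →+* R')) := rfl

theorem map_map {R'' : Type u} [CommRing R''] [Algebra k R''] (φ : R →ₐ[k] R')
    (ψ : R' →ₐ[k] R'') : (ρ.map φ).map ψ = ρ.map (ψ.comp φ) := by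
  unfold map
  congr 1

/-- The specialization map. -/
noncomputable def specialize (φ : R →ₐ[k] R') : ρ.V →ₗ[X] (ρ.map φ).V where
  toFun v := fun i => MvPowerSeries.map (φ : R →+* R') (v i)
  map_add' v w := by
    funext i
    exact map_add _ _ _
  map_smul' x v := by
    funext i
    change MvPowerSeries.map (φ : R →+* R') ((ρ.toRingHom x).mulVec v i) =
      ((ρ.toRingHom x).map (MvPowerSeries.map (φ : R →+* R'))).mulVec _ i
    simp only [Matrix.mulVec, dotProduct, map_sum, map_mul, Matrix.map_apply]

theorem specialize_apply (φ : R →ₐ[k] R') (v : ρ.V) (i : Fin l) :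
    ρ.specialize φ v i = MvPowerSeries.map (φ : R →+* R') (v i) := rfl

/-- Restriction along a homomorphism of `k[[x,y]]`-algebras. -/
noncomputable def comap {Y : Type u} [CommRing Y] [Algebra (PS k) Y] (f : Y →ₐ[PS k] X) : SeriesRep k Y R l where
  toRingHom := ρ.toRingHom.comp (f : Y →+* X)
  toRingHom_algebraMap s := by
    rw [RingHom.comp_apply, RingHom.coe_coe, AlgHom.commutes, ρ.toRingHom_algebraMap]

/-- An intertwining matrix defines a linear map. -/
noncomputable def linearOfMatrix {ρ : SeriesRep k X R l} {τ : SeriesRep k X R l'}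
    (A : Matrix (Fin l') (Fin l) (PS R))
    (h : ∀ x, A * ρ.toRingHom x = τ.toRingHom x * A) : ρ.V →ₗ[X] τ.V where
  toFun v := A.mulVec v
  map_add' v w := Matrix.mulVec_add _ _ _
  map_smul' x v := by
    have : ∀ v : Fin l → PS R,
        A.mulVec ((ρ.toRingHom x).mulVec v) = (τ.toRingHom x).mulVec (A.mulVec v) := fun v => by
      rw [Matrix.mulVec_mulVec, Matrix.mulVec_mulVec, h]
    exact this v

/-- A linear map over `X` is linear over the power series ring acting through `X`, hence is a
matrix; the intertwining relation expresses linearity over the rest of `X`. -/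
theorem exists_matrix {ρ : SeriesRep k X k l} {τ : SeriesRep k X k l'} (f : ρ.V →ₗ[X] τ.V) :
    ∃ A : Matrix (Fin l') (Fin l) (PS k), (∀ v, f v = A.mulVec v) ∧
      ∀ x, A * ρ.toRingHom x = τ.toRingHom x * A := by
  have hid : ∀ s : PS k, MvPowerSeries.map (algebraMap k k) s = s := fun s => by
    rw [Algebra.algebraMap_self, MvPowerSeries.map_id, RingHom.id_apply]
  let g : (Fin l → PS k) →ₗ[PS k] (Fin l' → PS k) :=
    { toFun := f
      map_add' := f.map_add
      map_smul' := fun s v => by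
        have h1 := ρ.algebraMap_smul s v
        have h2 := τ.algebraMap_smul s (f v)
        rw [hid] at h1 h2
        exact (congrArg f h1.symm).trans ((f.map_smul _ _).trans h2) }
  have hA : ∀ v : ρ.V, f v = (LinearMap.toMatrix' g).mulVec v := fun v =>
    (LinearMap.toMatrix'_mulVec g v).symm
  refine ⟨LinearMap.toMatrix' g, hA, fun x => ?_⟩
  refine Matrix.toLin'.injective (LinearMap.ext fun v => ?_)
  rw [Matrix.toLin'_apply, Matrix.toLin'_apply, ← Matrix.mulVec_mulVec, ← Matrix.mulVec_mulVec]
  let v' : ρ.V := v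
  have := f.map_smul x v'
  rw [hA, hA v'] at this
  exact this

/-- A module with a basis over `k[[x,y]]` on which `X` acts through the matrices of `ρ`. -/
noncomputable def equivOfBasis (ρ : SeriesRep k X k l) {N : Type u} [AddCommGroup N] [Module X N]
    (n : Fin l → N)
    (hb : Function.Bijective (fun f : Fin l → PS k => ∑ j, algebraMap (PS k) X (f j) • n j))
    (h : ∀ x j, x • n j = ∑ i, algebraMap (PS k) X (ρ.toRingHom x i j) • n i) : ρ.V ≃ₗ[X] N :=
  let g : (Fin l → PS k) → N := fun f => ∑ j, algebraMap (PS k) X (f j) • n j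
  have hadd : ∀ f f' : Fin l → PS k, g (f + f') = g f + g f' := fun f f' => by
    simp only [g, Pi.add_apply, map_add, add_smul, Finset.sum_add_distrib]
  have hsmul : ∀ (x : X) (f : Fin l → PS k), g ((ρ.toRingHom x).mulVec f) = x • g f :=
    fun x f => by
      simp only [g]
      rw [Finset.smul_sum]
      have : ∀ j, x • algebraMap (PS k) X (f j) • n j =
          ∑ i, (algebraMap (PS k) X (ρ.toRingHom x i j) * algebraMap (PS k) X (f j)) • n i := by
        intro j
        rw [smul_comm, h, Finset.smul_sum]
        refine Finset.sum_congr rfl fun i _ => ?_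
        rw [smul_smul, mul_comm]
      simp only [this]
      rw [Finset.sum_comm]
      refine Finset.sum_congr rfl fun i _ => ?_
      rw [← Finset.sum_smul]
      congr 1
      simp only [Matrix.mulVec, dotProduct, map_sum, map_mul]
  let g' : ρ.V →ₗ[X] N := { toFun := g, map_add' := hadd, map_smul' := hsmul }
  LinearEquiv.ofBijective g' hb

/-- Transport the action of `X` along the coordinates. The last clause keeps track of the basis,
which is needed where matrix entries are compared with coordinates. -/
theorem exists_equiv_of_basis {N : Type u} [AddCommGroup N] [Module X N] (n : Fin l → N)
    (hb : Function.Bijective (fun f : Fin l → PS k => ∑ j, algebraMap (PS k) X (f j) • n j)) :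
    ∃ (ρ : SeriesRep k X k l) (e : ρ.V ≃ₗ[X] N), ∀ f : Fin l → PS k,
      e f = ∑ j, algebraMap (PS k) X (f j) • n j := by
  let g : (Fin l → PS k) → N := fun f => ∑ j, algebraMap (PS k) X (f j) • n j
  have gadd : ∀ f f', g (f + f') = g f + g f' := fun f f' => by
    simp only [g, Pi.add_apply, map_add, add_smul, Finset.sum_add_distrib]
  have gsmul : ∀ (s : PS k) f, g (s • f) = algebraMap (PS k) X s • g f := fun s f => by
    simp only [g, Pi.smul_apply, smul_eq_mul, map_mul, mul_smul, Finset.smul_sum]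
  let e : (Fin l → PS k) ≃ N := Equiv.ofBijective g hb
  have he : ∀ f, e f = g f := fun _ => rfl
  have key : ∀ (x : X) f f', e.symm (x • e (f + f')) = e.symm (x • e f) + e.symm (x • e f') := by
    intro x f f'
    apply e.injective
    rw [e.apply_symm_apply, he (_ + _), he (_ + _), gadd, gadd, ← he, ← he, ← he, ← he,
      e.apply_symm_apply, e.apply_symm_apply, smul_add]
  have key2 : ∀ (x : X) (s : PS k) f, e.symm (x • e (s • f)) = s • e.symm (x • e f) := by
    intro x s f
    apply e.injective
    rw [e.apply_symm_apply, he (s • _), he (s • _), gsmul, gsmul, ← he, ← he, e.apply_symm_apply,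
      smul_comm]
  let act : X → ((Fin l → PS k) →ₗ[PS k] (Fin l → PS k)) := fun x =>
    { toFun := fun f => e.symm (x • e f)
      map_add' := key x
      map_smul' := key2 x }
  have hact : ∀ x f, e (act x f) = x • e f := fun x f => e.apply_symm_apply _
  let ρ : SeriesRep k X k l :=
    { toRingHom :=
        { toFun := fun x => LinearMap.toMatrix' (act x)
          map_one' := by
            rw [← LinearMap.toMatrix'_one]
            congr 1
            refine LinearMap.ext fun f => ?_
            apply e.injective
            rw [hact, one_smul]
            rfl
          map_mul' := fun x y => by
            rw [← LinearMap.toMatrix'_mul]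
            congr 1
            refine LinearMap.ext fun f => ?_
            apply e.injective
            rw [Module.End.mul_apply, hact, hact, hact, mul_smul]
          map_zero' := by
            rw [← map_zero LinearMap.toMatrix']
            congr 1
            refine LinearMap.ext fun f => ?_
            apply e.injective
            rw [hact, zero_smul, LinearMap.zero_apply, he]
            simp [g]
          map_add' := fun x y => by
            rw [← map_add]
            congr 1
            refine LinearMap.ext fun f => ?_
            apply e.injective
            rw [hact, add_smul, LinearMap.add_apply, he (_ + _), gadd, ← he, ← he, hact, hact] }
      toRingHom_algebraMap := fun s => by
        change LinearMap.toMatrix' (act (algebraMap (PS k) X s)) = _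
        rw [Algebra.algebraMap_self, MvPowerSeries.map_id, RingHom.id_apply]
        have : act (algebraMap (PS k) X s) = s • LinearMap.id := by
          refine LinearMap.ext fun f => ?_
          apply e.injective
          rw [hact, LinearMap.smul_apply, LinearMap.id_apply, he (s • f), gsmul, he]
        rw [this, map_smul, LinearMap.toMatrix'_id, Matrix.smul_one_eq_diagonal, Matrix.scalar_apply] }
  refine ⟨ρ, equivOfBasis ρ n hb fun x j => ?_, fun _ => rfl⟩
  have h1 := hact x (Pi.single j 1)
  have h2 : e (Pi.single j 1) = n j := by
    rw [he]
    simp only [g]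
    rw [Finset.sum_eq_single j]
    · simp
    · intro i _ hi
      simp [Pi.single_eq_of_ne hi]
    · simp
  rw [h2] at h1
  rw [← h1, he]
  refine Finset.sum_congr rfl fun i _ => ?_
  congr 2

end SeriesRep

section ModuleBasis

open MvPowerSeries

/-- A finitely generated module on which the variables form a regular sequence is free. -/
theorem exists_basis_of_isParamRegular {k N : Type*} [Field k] [AddCommGroup N] [Module (PS k) N]
    [Module.Finite (PS k) N] (h : IsParamRegular (X 0 : PS k) (X 1 : PS k) N) :
    ∃ (l : ℕ) (n : Fin l → N), Function.Bijective (Fintype.linearCombination (PS k) n) := by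
  classical
  let P : ℕ → Prop := fun l => ∃ n : Fin l → N, ∀ m : N, ∃ (a : Fin l → k) (p q : N),
    m = ∑ j, (C (a j) : PS k) • n j + (X 0 : PS k) • p + (X 1 : PS k) • q
  have hP : ∃ l, P l := by
    obtain ⟨l, n, hn⟩ := Module.Finite.exists_fin (R := PS k) (M := N)
    refine ⟨l, n, fun m => ?_⟩
    have hm : m ∈ Submodule.span (PS k) (Set.range n) := hn ▸ trivial
    obtain ⟨f, rfl⟩ := (Submodule.mem_span_range_iff_exists_fun (PS k)).1 hm
    choose f₀ f₁ hf using fun j => PS.exists_eq_C_add (f j)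
    refine ⟨fun j => constantCoeff (f j), ∑ j, f₀ j • n j, ∑ j, f₁ j • n j, ?_⟩
    rw [Finset.smul_sum, Finset.smul_sum, ← Finset.sum_add_distrib, ← Finset.sum_add_distrib]
    refine Finset.sum_congr rfl fun j _ => ?_
    conv_lhs => rw [hf j]
    simp only [add_smul, mul_smul]
  obtain ⟨n, hn⟩ := Nat.find_spec hP
  refine ⟨Nat.find hP, n, injective_linearCombination_of_mod h n ?_,
    surjective_linearCombination_of_mod n hn⟩
  intro a p q e
  by_contra! hne
  obtain ⟨j₀, hj₀⟩ := hne
  obtain ⟨l, hl⟩ : ∃ l, Nat.find hP = l + 1 := ⟨Nat.find hP - 1, by have := j₀.2; omega⟩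
  refine Nat.find_min hP (m := l) (by omega) ?_
  -- In a relation modulo the variables with `a j₀ ≠ 0`, the generator `n j₀` can be eliminated,
  -- contrary to the minimality of the number of generators. The length is a variable `l'` so that
  -- it can be replaced by a successor.
  have key : ∀ (l' : ℕ) (_ : l' = l + 1) (n : Fin l' → N) (_ : ∀ m : N, ∃ (a : Fin l' → k) (p q : N),
      m = ∑ j, (C (a j) : PS k) • n j + (X 0 : PS k) • p + (X 1 : PS k) • q) (a : Fin l' → k)
      (_ : ∑ j, (C (a j) : PS k) • n j = (X 0 : PS k) • p + (X 1 : PS k) • q) (j₀ : Fin l')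
      (_ : a j₀ ≠ 0), P l := by
    rintro _ rfl n hn a e j₀ hj₀
    refine ⟨fun j => n (j₀.succAbove j), fun m => ?_⟩
    obtain ⟨b, p', q', rfl⟩ := hn m
    rw [Fin.sum_univ_succAbove _ j₀] at e ⊢
    set t := b j₀ / a j₀ with ht
    refine ⟨fun j => b (j₀.succAbove j) - t * a (j₀.succAbove j), p' + (C t : PS k) • p,
      q' + (C t : PS k) • q, ?_⟩
    have h1 : (C (b j₀) : PS k) • n j₀ = (C t : PS k) • ((X 0 : PS k) • p + (X 1 : PS k) • q) -
        (C t : PS k) • ∑ j, (C (a (j₀.succAbove j)) : PS k) • n (j₀.succAbove j) := by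
      rw [← e, smul_add, add_sub_cancel_right, smul_smul, ← map_mul, ht, div_mul_cancel₀ _ hj₀]
    rw [h1]
    simp only [map_sub, map_mul, sub_smul, Finset.sum_sub_distrib, mul_smul,
      smul_add, smul_comm (C t : PS k), Finset.smul_sum]
    abel
  exact key _ hl n hn a e j₀ hj₀

end ModuleBasis



/-! ### Finite-dimensional algebras without idempotents -/

section TrivialIdempotents

variable {F E : Type*} [Field F] [Ring E] [Algebra F E] [FiniteDimensional F E]

/-- Fitting's lemma for left multiplication by `a`: for large `n`, `E` is the sum of the kernel and
the image of `a ^ n`, and the component `u` of 1 in the kernel is idempotent. If `u = 0` then `a` is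
invertible, and if `u = 1` then `a ^ n = 0`. -/
theorem isNilpotent_or_isUnit_of_idempotents (F : Type*) {E : Type*} [Field F] [Ring E] [Algebra F E]
    [FiniteDimensional F E] (h : ∀ e : E, IsIdempotentElem e → e = 0 ∨ e = 1)
    (a : E) : IsNilpotent a ∨ IsUnit a := by
  obtain ⟨n, hn, hc⟩ := ((Filter.eventually_gt_atTop 0).and
    (LinearMap.eventually_isCompl_ker_pow_range_pow (LinearMap.mulLeft F a))).exists
  rw [LinearMap.pow_mulLeft] at hc
  obtain ⟨u, hu, v, hv, huv⟩ := Submodule.mem_sup.1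
    (hc.sup_eq_top ▸ Submodule.mem_top : (1 : E) ∈ _)
  rw [LinearMap.mem_ker, LinearMap.mulLeft_apply] at hu
  obtain ⟨w, hw⟩ := hv
  rw [LinearMap.mulLeft_apply] at hw
  have hvu : v * u = 0 := by
    have h1 : v * u ∈ LinearMap.range (LinearMap.mulLeft F (a ^ n)) :=
      ⟨w * u, by rw [LinearMap.mulLeft_apply, ← mul_assoc, hw]⟩
    have h2 : v * u ∈ LinearMap.ker (LinearMap.mulLeft F (a ^ n)) := by
      have : v * u = u - u * u := by
        rw [eq_sub_iff_add_eq, add_comm, ← add_mul, huv, one_mul]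
      rw [LinearMap.mem_ker, LinearMap.mulLeft_apply, this, mul_sub, ← mul_assoc, hu, zero_mul,
        sub_zero]
    exact (Submodule.disjoint_def.1 hc.disjoint) _ h2 h1
  have huu : u * u = u := by
    calc u * u = (u + v) * u := by rw [add_mul, hvu, add_zero]
      _ = u := by rw [huv, one_mul]
  rcases h u huu with h0 | h1
  · right
    rw [h0, zero_add] at huv
    obtain ⟨m, rfl⟩ : ∃ m, n = m + 1 := ⟨n - 1, by omega⟩
    have haz : a * (a ^ m * w) = 1 := by rw [← mul_assoc, ← pow_succ', hw, huv]
    have hinj : ∀ z, a * z = 0 → z = 0 := fun z hz => by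
      refine (Submodule.disjoint_def.1 hc.disjoint) z ?_ ?_
      · rw [LinearMap.mem_ker, LinearMap.mulLeft_apply, pow_succ, mul_assoc, hz, mul_zero]
      · exact ⟨w * z, by rw [LinearMap.mulLeft_apply, ← mul_assoc, hw, huv, one_mul]⟩
    refine ⟨⟨a, a ^ m * w, haz, ?_⟩, rfl⟩
    refine sub_eq_zero.1 (hinj _ ?_)
    rw [mul_sub, ← mul_assoc, haz, one_mul, mul_one, sub_self]
  · left
    exact ⟨n, by rw [h1, mul_one] at hu; exact hu⟩

/-- If `a + b` had a left inverse `c'`, then `c' * a` and `c' * b` would be nilpotent with sum 1.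
But 1 minus a nilpotent element is a unit. -/
theorem isNilpotent_add_of_idempotents (F : Type*) {E : Type*} [Field F] [Ring E] [Algebra F E]
    [FiniteDimensional F E] [Nontrivial E] (h : ∀ e : E, IsIdempotentElem e → e = 0 ∨ e = 1)
    {a b : E} (ha : IsNilpotent a) (hb : IsNilpotent b) : IsNilpotent (a + b) := by
  refine (isNilpotent_or_isUnit_of_idempotents F h (a + b)).resolve_right fun hu => ?_
  obtain ⟨c, hc⟩ := hu.exists_right_inv
  obtain ⟨c', hc'⟩ := hu.exists_left_inv
  have hnu : ∀ {z : E}, IsNilpotent z → ¬ ∃ w, w * z = 1 := by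
    rintro z ⟨m, hm⟩ ⟨w, hw⟩
    have : ∀ i : ℕ, w ^ i * z ^ i = 1 := fun i => by
      induction i with
      | zero => simp
      | succ i ih => rw [pow_succ, pow_succ', mul_assoc, ← mul_assoc w, hw, one_mul, ih]
    exact one_ne_zero ((this m).symm.trans (by rw [hm, mul_zero]))
  have key : ∀ {z : E}, IsNilpotent z → IsNilpotent (c' * z) := fun {z} hz =>
    (isNilpotent_or_isUnit_of_idempotents F h _).resolve_right fun hu => by
      obtain ⟨w, hw⟩ := hu.exists_left_inv
      exact hnu hz ⟨w * c', by rw [mul_assoc, hw]⟩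
  have h1 : IsUnit (c' * b) := by
    have : c' * b = 1 - c' * a := by rw [eq_sub_iff_add_eq, add_comm, ← mul_add, hc']
    rw [this]
    exact (key ha).isUnit_one_sub
  obtain ⟨w, hw⟩ := h1.exists_left_inv
  exact hnu (key hb) ⟨w, hw⟩

/-- Subtract an element of the spectrum: the difference is not a unit, hence nilpotent. -/
theorem exists_isNilpotent_sub_algebraMap [IsAlgClosed F] [Nontrivial E]
    (h : ∀ e : E, IsIdempotentElem e → e = 0 ∨ e = 1) (a : E) :
    ∃ t : F, IsNilpotent (a - algebraMap F E t) := by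
  obtain ⟨t, ht⟩ := spectrum.nonempty_of_isAlgClosed_of_finiteDimensional F a
  refine ⟨t, (isNilpotent_or_isUnit_of_idempotents F h _).resolve_right fun hu => ht ?_⟩
  rw [spectrum.mem_resolventSet_iff, ← IsUnit.neg_iff, neg_sub]
  exact hu

end TrivialIdempotents

/-! ### Ranks in towers -/

/-- A maximal independent family spans a free submodule with torsion quotient. The quotient is
torsion over `P` too, since a nonzero element of the integral extension `X` divides a nonzero
element of `P`. -/
theorem finrank_mul_finrank_of_isDomain {P X N : Type u} [CommRing P] [IsDomain P] [CommRing X] [IsDomain X]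
    [Algebra P X] [Module.Finite P X] [Module.Free P X] [FaithfulSMul P X] [AddCommGroup N] [Module X N] [Module P N]
    [IsScalarTower P X N] [Module.Finite X N] :
    Module.finrank X N * Module.finrank P X = Module.finrank P N := by
  have : Module.Finite P N := Module.Finite.trans X N
  obtain ⟨f, hf⟩ := exists_linearIndependent_of_le_finrank (le_refl (Module.finrank X N))
  let W : Submodule X N := Submodule.span X (Set.range f)
  have e1 : Module.finrank X W = Module.finrank X N := by
    rw [finrank_span_eq_card hf, Fintype.card_fin]
  have e2 : Module.finrank X (N ⧸ W) = 0 := by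
    have := Submodule.finrank_quotient_add_finrank W
    omega
  have e3 : Module.finrank P (N ⧸ W) = 0 := by
    rw [Module.finrank_eq_zero_iff] at e2 ⊢
    intro m
    obtain ⟨a, ha, ham⟩ := e2 m
    obtain ⟨p, hp, q, hq⟩ := (Algebra.IsIntegral.isIntegral (R := P) a).isAlgebraic.exists_nonzero_dvd
      (mem_nonZeroDivisors_of_ne_zero ha)
    refine ⟨p, hp, ?_⟩
    rw [← algebraMap_smul X, hq, mul_comm, mul_smul, ham, smul_zero]
  have e4 : Module.finrank P (N ⧸ W) + Module.finrank P W = Module.finrank P N :=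
    Submodule.finrank_quotient_add_finrank (W.restrictScalars P)
  have e5 : Module.finrank P W = Module.finrank X N * Module.finrank P X := by
    have b := Module.Basis.span hf
    rw [(b.equivFun.restrictScalars P).finrank_eq, Module.finrank_pi_fintype, Finset.sum_const,
      Finset.card_univ, Fintype.card_fin, smul_eq_mul]
  omega

theorem PS.X_ne_zero {k : Type*} [Field k] (i : Fin 2) : (MvPowerSeries.X i : PS k) ≠ 0 := fun h => by
  have := congrArg (MvPowerSeries.coeff (Finsupp.single i 1)) h
  rw [MvPowerSeries.coeff_index_single_self_X, map_zero] at this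
  exact one_ne_zero this

instance {k : Type*} [Field k] : IsDomain (PS k) := NoZeroDivisors.to_isDomain _

/-! ### Cohen-Macaulay modules and representations over the ground field -/

namespace SurfaceOver

open MvPowerSeries

variable {k X : Type u} [Field k] [CommRing X] [IsDomain X] [IsLocalRing X] [Algebra k X]
  [Algebra (PS k) X] [SurfaceOver k X]

variable (k) in
theorem isMaximalCohenMacaulay_iff {N : Type u} [AddCommGroup N] [Module X N] :
    IsMaximalCohenMacaulay X N ↔ Module.Finite X N ∧
      IsParamRegular (algebraMap (PS k) X (MvPowerSeries.X 0)) (algebraMap (PS k) X (MvPowerSeries.X 1)) N := by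
  have := SurfaceOver.finite (k := k) (X := X)
  have : IsNoetherianRing X := IsNoetherianRing.of_finite (PS k) X
  obtain ⟨m, hm⟩ := SurfaceOver.pow_le (k := k) (X := X)
  exact _root_.isMaximalCohenMacaulay_iff (M := N) (SurfaceOver.dim (k := k))
    (SurfaceOver.ne_zero (k := k)) (SurfaceOver.mem (k := k) 0) (SurfaceOver.mem (k := k) 1) hm

theorem exists_basis {N : Type u} [AddCommGroup N] [Module X N]
    (h : IsMaximalCohenMacaulay X N) : ∃ (l : ℕ) (n : Fin l → N),
    Function.Bijective (fun f : Fin l → PS k => ∑ j, algebraMap (PS k) X (f j) • n j) := by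
  obtain ⟨h1, h2⟩ := (isMaximalCohenMacaulay_iff k).1 h
  let _ : Module (PS k) N := Module.compHom N (algebraMap (PS k) X)
  have : IsScalarTower (PS k) X N := ⟨fun s x m => by
    rw [Algebra.smul_def, mul_smul]; rfl⟩
  have := SurfaceOver.finite (k := k) (X := X)
  have : Module.Finite (PS k) N := Module.Finite.trans X N
  exact exists_basis_of_isParamRegular (N := N) h2

theorem exists_seriesRep {N : Type u} [AddCommGroup N] [Module X N]
    (h : IsMaximalCohenMacaulay X N) : ∃ (l : ℕ) (ρ : SeriesRep k X k l), Nonempty (ρ.V ≃ₗ[X] N) := by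
  obtain ⟨l, n, hn⟩ := exists_basis (k := k) h
  obtain ⟨ρ, e, -⟩ := SeriesRep.exists_equiv_of_basis n hn
  exact ⟨l, ρ, ⟨e⟩⟩

theorem map_self (s : PS k) : MvPowerSeries.map (algebraMap k k) s = s := by
  rw [Algebra.algebraMap_self, MvPowerSeries.map_id, RingHom.id_apply]

variable (k X) in
theorem free : Module.Free (PS k) X := by
  have hX : IsMaximalCohenMacaulay X X :=
    (isMaximalCohenMacaulay_iff k).2 ⟨inferInstance, SurfaceOver.regular⟩
  obtain ⟨l, n, hn⟩ := exists_basis (k := k) hX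
  let f : (Fin l → PS k) →ₗ[PS k] X := Fintype.linearCombination (PS k) n
  have hf : Function.Bijective f := by
    convert hn using 1
    funext v
    simp [f, Fintype.linearCombination_apply, Algebra.smul_def]
  exact Module.Free.of_equiv (LinearEquiv.ofBijective f hf)

variable (k X) in
theorem faithfulSMul : FaithfulSMul (PS k) X := by
  have hX : IsMaximalCohenMacaulay X X :=
    (isMaximalCohenMacaulay_iff k).2 ⟨inferInstance, SurfaceOver.regular⟩
  obtain ⟨l, n, hn⟩ := exists_basis (k := k) hX
  rw [faithfulSMul_iff_algebraMap_injective, injective_iff_map_eq_zero]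
  intro s hs
  rcases Nat.eq_zero_or_pos l with rfl | hl
  · exact (one_ne_zero (α := X) (hn.2.subsingleton.elim _ _)).elim
  · have := hn.1 (a₁ := fun _ => s) (a₂ := 0) (by simp [hs])
    exact congrFun this ⟨0, hl⟩

end SurfaceOver

namespace SeriesRep

open MvPowerSeries

variable {k X R : Type u} [Field k] [CommRing X] [IsDomain X] [IsLocalRing X] [Algebra k X]
  [Algebra (PS k) X] [SurfaceOver k X] {l l' : ℕ}

theorem isMaximalCohenMacaulay (ρ : SeriesRep k X k l) : IsMaximalCohenMacaulay X ρ.V := by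
  have hs : ∀ (s : PS k) (v : ρ.V), algebraMap (PS k) X s • v = s • v := fun s v => by
    rw [ρ.algebraMap_smul, SurfaceOver.map_self]
  refine (SurfaceOver.isMaximalCohenMacaulay_iff k).2 ⟨?_, ?_, ?_⟩
  · have : IsScalarTower (PS k) X ρ.V := ⟨fun s x m => by
      rw [Algebra.smul_def, mul_smul, hs]⟩
    have : Module.Finite (PS k) ρ.V := inferInstanceAs (Module.Finite (PS k) (Fin l → PS k))
    exact Module.Finite.of_restrictScalars_finite (PS k) X ρ.V
  · intro m hm
    rw [hs] at hm
    funext i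
    have := congrFun hm i
    exact (mul_eq_zero.1 this).resolve_left (PS.X_ne_zero 0)
  · intro m m' hm
    rw [hs, hs] at hm
    have : ∀ i, ∃ p : PS k, m i = MvPowerSeries.X 0 * p := fun i => by
      have h : (MvPowerSeries.X 1 : PS k) * m i = MvPowerSeries.X 0 * m' i := congrFun hm i
      refine MvPowerSeries.X_dvd_iff.2 fun d hd => ?_
      have h1 := congrArg (coeff (d + Finsupp.single 1 1)) h
      rw [PS.coeff_X_mul, PS.coeff_X_mul] at h1
      simpa [hd] using h1
    choose p hp using this
    exact ⟨(p : ρ.V), (funext hp).trans (hs _ (p : ρ.V)).symm⟩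

theorem finrank_mul (ρ : SeriesRep k X k l) :
    Module.finrank X ρ.V * Module.finrank (PS k) X = l := by
  have hs : ∀ (s : PS k) (v : ρ.V), algebraMap (PS k) X s • v = s • v := fun s v => by
    rw [ρ.algebraMap_smul, SurfaceOver.map_self]
  have : IsScalarTower (PS k) X ρ.V := ⟨fun s x m => by
    rw [Algebra.smul_def, mul_smul, hs]⟩
  have : Module.Finite (PS k) X := SurfaceOver.finite (k := k)
  have := SurfaceOver.faithfulSMul k X
  have : Module.Finite X ρ.V := ρ.isMaximalCohenMacaulay.1
  have := SurfaceOver.free k X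
  rw [finrank_mul_finrank_of_isDomain]
  exact Module.finrank_fin_fun (PS k)

theorem finrank_pos (k X : Type u) [Field k] [CommRing X] [IsDomain X] [IsLocalRing X] [Algebra k X]
  [Algebra (PS k) X] [SurfaceOver k X] : 0 < Module.finrank (PS k) X := by
  have : Module.Finite (PS k) X := SurfaceOver.finite (k := k)
  have := SurfaceOver.faithfulSMul k X
  have : IsDomain (PS k) := inferInstance
  have : Module.IsTorsionFree (PS k) X := inferInstance
  exact Module.finrank_pos

theorem finrank_eq (ρ : SeriesRep k X k l) :
    Module.finrank X ρ.V = l / Module.finrank (PS k) X := by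
  exact (Nat.div_eq_of_eq_mul_left (finrank_pos k X) ρ.finrank_mul.symm).symm

end SeriesRep



/-! ### Direct summands and the Krull-Schmidt property -/

/-- `N` is isomorphic to a direct summand of `M`. -/
def IsSummand (X N M : Type*) [CommRing X] [AddCommGroup N] [Module X N] [AddCommGroup M] [Module X M] :
    Prop :=
  ∃ (i : N →ₗ[X] M) (p : M →ₗ[X] N), p ∘ₗ i = LinearMap.id

namespace IsSummand

variable {X N M M' : Type*} [CommRing X] [AddCommGroup N] [Module X N] [AddCommGroup M] [Module X M]
  [AddCommGroup M'] [Module X M']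

theorem trans (h : IsSummand X N M) (h' : IsSummand X M M') : IsSummand X N M' := by
  obtain ⟨i, p, h⟩ := h
  obtain ⟨i', p', h'⟩ := h'
  refine ⟨i' ∘ₗ i, p ∘ₗ p', ?_⟩
  rw [LinearMap.comp_assoc, ← LinearMap.comp_assoc i, h', LinearMap.id_comp, h]

theorem of_equiv (e : N ≃ₗ[X] M) : IsSummand X N M := ⟨e, e.symm, e.symm_comp⟩

theorem nonempty_equiv {X N M : Type u} [CommRing X] [AddCommGroup N] [Module X N] [AddCommGroup M]
    [Module X M] (h : IsSummand X N M) [Nontrivial N] (hM : IsIndecomposableModule X M) :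
    Nonempty (N ≃ₗ[X] M) := by
  obtain ⟨i, p, h⟩ := h
  have hpi : ∀ n, p (i n) = n := fun n => LinearMap.congr_fun h n
  have hc : IsCompl (LinearMap.range i) (LinearMap.ker p) := by
    refine ⟨Submodule.disjoint_def.2 ?_, codisjoint_iff.2 (eq_top_iff.2 fun m _ => ?_)⟩
    · rintro _ ⟨n, rfl⟩ hn
      rw [LinearMap.mem_ker, hpi] at hn
      rw [hn, map_zero]
    · refine Submodule.mem_sup.2 ⟨i (p m), ⟨p m, rfl⟩, m - i (p m), ?_, by abel⟩
      rw [LinearMap.mem_ker, map_sub, hpi, sub_self]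
  rcases hM.2 _ _ hc with h0 | h0
  · obtain ⟨n, hn⟩ := exists_ne (0 : N)
    refine (hn ?_).elim
    have : i n = 0 := (Submodule.mem_bot X).1 (h0 ▸ ⟨n, rfl⟩)
    rw [← hpi n, this, map_zero]
  · refine ⟨LinearEquiv.ofLinearMap i p (LinearMap.ext fun m => ?_) h⟩
    have := LinearMap.ker_eq_bot.1 h0
    exact this (hpi (p m))

end IsSummand

theorem IsIndecomposableModule.eq_zero_or_one {X N : Type u} [CommRing X] [AddCommGroup N] [Module X N]
    (h : IsIndecomposableModule X N) {e : Module.End X N} (he : IsIdempotentElem e) : e = 0 ∨ e = 1 := by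
  rcases h.2 _ _ (LinearMap.IsIdempotentElem.isCompl he) with h0 | h0
  · exact Or.inl (LinearMap.range_eq_bot.1 h0)
  · right
    have hi := LinearMap.ker_eq_bot.1 h0
    exact LinearMap.ext fun n => hi (LinearMap.congr_fun he n)

theorem IsIndecomposableModule.of_equiv {X N N' : Type u} [CommRing X] [AddCommGroup N] [Module X N]
    [AddCommGroup N'] [Module X N'] (h : IsIndecomposableModule X N) (e : N ≃ₗ[X] N') :
    IsIndecomposableModule X N' := by
  have := h.1
  refine ⟨e.symm.toEquiv.nontrivial, fun p q hpq => ?_⟩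
  have := h.2 (p.map (e.symm : N' →ₗ[X] N)) (q.map (e.symm : N' →ₗ[X] N))
    (hpq.map (Submodule.orderIsoMapComap e.symm))
  simpa [Submodule.map_eq_bot_iff] using this

/-- In a sum decomposition of the identity of a module with local endomorphism ring,
some term splits. -/
theorem exists_isSummand_of_sum {X N ι : Type*} [CommRing X] [AddCommGroup N] [Module X N]
    [IsLocalRing (Module.End X N)] (s : Finset ι) (M : ι → Type*) [∀ j, AddCommGroup (M j)]
    [∀ j, Module X (M j)] (i : ∀ j, N →ₗ[X] M j) (p : ∀ j, M j →ₗ[X] N)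
    (h : IsUnit (∑ j ∈ s, p j ∘ₗ i j : Module.End X N)) : ∃ j ∈ s, IsSummand X N (M j) := by
  classical
  have key : ∃ j ∈ s, IsUnit (p j ∘ₗ i j : Module.End X N) := by
    induction s using Finset.induction_on with
    | empty => exact (not_isUnit_zero h).elim
    | insert j s hj ih =>
      rw [Finset.sum_insert hj] at h
      rcases IsLocalRing.isUnit_or_isUnit_of_isUnit_add h with h1 | h1
      · exact ⟨j, Finset.mem_insert_self _ _, h1⟩
      · obtain ⟨j', h2, h3⟩ := ih h1
        exact ⟨j', Finset.mem_insert_of_mem h2, h3⟩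
  obtain ⟨j, hj, u, hu⟩ := key
  refine ⟨j, hj, i j, (↑u⁻¹ : Module.End X N) ∘ₗ p j, ?_⟩
  rw [LinearMap.comp_assoc, ← hu]
  exact u.inv_mul

theorem IsMaximalCohenMacaulay.of_isSummand {k X : Type u} [Field k] [CommRing X] [IsDomain X]
    [IsLocalRing X] [Algebra k X] [Algebra (PS k) X] [SurfaceOver k X] {N M : Type u} [AddCommGroup N]
    [Module X N] [AddCommGroup M] [Module X M] (h : IsSummand X N M)
    (hM : IsMaximalCohenMacaulay X M) : IsMaximalCohenMacaulay X N := by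
  obtain ⟨i, p, h⟩ := h
  rw [SurfaceOver.isMaximalCohenMacaulay_iff k] at hM ⊢
  have := hM.1
  have hp : ∀ n, p (i n) = n := fun n => LinearMap.congr_fun h n
  exact ⟨Module.Finite.of_surjective p fun n => ⟨i n, hp n⟩, hM.2.of_retract i p hp⟩

theorem IsMaximalCohenMacaulay.finrank_pos {k X : Type u} [Field k] [CommRing X] [IsDomain X]
    [IsLocalRing X] [Algebra k X] [Algebra (PS k) X] [SurfaceOver k X] {N : Type u} [AddCommGroup N]
    [Module X N] [Nontrivial N] (h : IsMaximalCohenMacaulay X N) : 0 < Module.finrank X N := by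
  obtain ⟨l, ρ, ⟨e⟩⟩ := SurfaceOver.exists_seriesRep (k := k) h
  rw [← e.finrank_eq, Nat.pos_iff_ne_zero]
  intro h0
  have := ρ.finrank_mul
  rw [h0, zero_mul] at this
  subst this
  have : Subsingleton ρ.V := inferInstanceAs (Subsingleton (Fin 0 → PS k))
  exact not_subsingleton N e.symm.subsingleton

namespace SeriesRep

open MvPowerSeries

section Commutant

variable {k X R : Type u} [Field k] [CommRing X] [Algebra (PS k) X] [CommRing R] [Algebra k R] {l : ℕ}

/-- The algebra of constant terms of endomorphisms of a representation. -/
noncomputable def constEnd (ρ : SeriesRep k X R l) : Subalgebra R (Matrix (Fin l) (Fin l) R) where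
  carrier := {d | ∃ A : Matrix (Fin l) (Fin l) (PS R), (∀ x, A * ρ.toRingHom x = ρ.toRingHom x * A) ∧
    PS.constMat A = d}
  mul_mem' := by
    rintro _ _ ⟨A, hA, rfl⟩ ⟨A', hA', rfl⟩
    exact ⟨A * A', fun x => by rw [mul_assoc, hA', ← mul_assoc, hA, mul_assoc], map_mul _ _ _⟩
  add_mem' := by
    rintro _ _ ⟨A, hA, rfl⟩ ⟨A', hA', rfl⟩
    exact ⟨A + A', fun x => by rw [add_mul, hA', hA, mul_add], map_add _ _ _⟩
  algebraMap_mem' r := by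
    refine ⟨Matrix.scalar (Fin l) (C r), fun x => Matrix.scalar_commute _ (fun _ => Commute.all _ _) _, ?_⟩
    rw [Matrix.scalar_apply, RingHom.mapMatrix_apply, Matrix.diagonal_map (map_zero _)]
    simp only [constantCoeff_C]
    rfl

theorem isUnit_linearOfMatrix {τ : SeriesRep k X k l} {A : Matrix (Fin l) (Fin l) (PS k)}
    (h : ∀ x, A * τ.toRingHom x = τ.toRingHom x * A) (hA : IsUnit A) :
    IsUnit (linearOfMatrix A h : Module.End X τ.V) := by
  obtain ⟨u, rfl⟩ := hA
  rw [Module.End.isUnit_iff]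
  refine Function.bijective_iff_has_inverse.2 ⟨fun v => (↑u⁻¹ : Matrix _ _ _).mulVec v, fun v => ?_,
    fun v => ?_⟩
  · exact (Matrix.mulVec_mulVec _ _ _).trans (by rw [u.inv_mul, Matrix.one_mulVec])
  · exact (Matrix.mulVec_mulVec _ _ _).trans (by rw [u.mul_inv, Matrix.one_mulVec])

/-- An idempotent constant term lifts to an idempotent matrix commuting with everything that
commutes with a given lift. The lifted matrix is therefore an endomorphism, and indecomposability
applies to it. -/
theorem constEnd_idempotents {τ : SeriesRep k X k l} (h : IsIndecomposableModule X τ.V)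
    {d : Matrix (Fin l) (Fin l) k} (hd : d ∈ τ.constEnd) (hi : IsIdempotentElem d) : d = 0 ∨ d = 1 := by
  obtain ⟨A, hA, rfl⟩ := hd
  obtain ⟨ψ, h1, h2, h3⟩ := PS.exists_isIdempotentElem_lift hi
  have hψ : ∀ x, ψ * τ.toRingHom x = τ.toRingHom x * ψ := fun x => ((h3 _ (hA x).symm).eq).symm
  have hl : IsIdempotentElem (linearOfMatrix ψ hψ : Module.End X τ.V) := LinearMap.ext fun v =>
    (Matrix.mulVec_mulVec (v : Fin l → PS k) ψ ψ).trans
      (congrArg (fun B : Matrix (Fin l) (Fin l) (PS k) => B.mulVec v) h1.eq)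
  rw [← h2]
  rcases h.eq_zero_or_one hl with h0 | h0
  · left
    have : ψ = 0 := Matrix.mulVec_injective (funext fun v =>
      (LinearMap.congr_fun h0 (v : τ.V)).trans (Matrix.zero_mulVec v).symm)
    rw [this, map_zero]
  · right
    have : ψ = 1 := Matrix.mulVec_injective (funext fun v =>
      (LinearMap.congr_fun h0 (v : τ.V)).trans (Matrix.one_mulVec v).symm)
    rw [this, map_one]

/-- An endomorphism with invertible constant term is invertible. The constant terms form a
finite-dimensional algebra with trivial idempotents, in which the non-units are nilpotent and closed
under addition. -/
theorem isLocalRing_end {τ : SeriesRep k X k l} (h : IsIndecomposableModule X τ.V) :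
    IsLocalRing (Module.End X τ.V) := by
  have := h.1
  have hD : ∀ e : τ.constEnd, IsIdempotentElem e → e = 0 ∨ e = 1 := fun e he => by
    rcases constEnd_idempotents h e.2 (congrArg Subtype.val he) with h0 | h0
    · exact Or.inl (Subtype.ext h0)
    · exact Or.inr (Subtype.ext h0)
  have : Nontrivial (Matrix (Fin l) (Fin l) k) := by
    rcases Nat.eq_zero_or_pos l with rfl | hl
    · have : Subsingleton τ.V := inferInstanceAs (Subsingleton (Fin 0 → PS k))
      exact (not_subsingleton _ this).elim
    · have : Nonempty (Fin l) := ⟨⟨0, hl⟩⟩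
      infer_instance
  have key : ∀ f : Module.End X τ.V, IsUnit f ∨ ∃ (A : Matrix (Fin l) (Fin l) (PS k))
      (hA : PS.constMat A ∈ τ.constEnd), (∀ v, f v = A.mulVec v) ∧
      IsNilpotent (⟨PS.constMat A, hA⟩ : τ.constEnd) := fun f => by
    obtain ⟨A, hA, hc⟩ := exists_matrix f
    rcases isNilpotent_or_isUnit_of_idempotents k hD ⟨PS.constMat A, A, hc, rfl⟩ with h1 | h1
    · exact Or.inr ⟨A, _, hA, h1⟩
    · left
      have := isUnit_linearOfMatrix hc (PS.isUnit_of_isUnit_constMat (h1.map τ.constEnd.val))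
      convert this using 1
      exact LinearMap.ext hA
  refine IsLocalRing.of_isUnit_or_isUnit_of_isUnit_add fun f g hfg => ?_
  rcases key f with h1 | ⟨A, hA, h1, h2⟩
  · exact Or.inl h1
  rcases key g with h1' | ⟨A', hA', h1', h2'⟩
  · exact Or.inr h1'
  exfalso
  obtain ⟨u, hu⟩ := hfg
  obtain ⟨C, hC, -⟩ := exists_matrix (↑u⁻¹ : Module.End X τ.V)
  have hmul : (A + A') * C = 1 := Matrix.mulVec_injective (funext fun v => by
    let v' : τ.V := v
    have h3 : (f + g) ((↑u⁻¹ : Module.End X τ.V) v') = v' := by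
      rw [← hu, ← Module.End.mul_apply, u.mul_inv, Module.End.one_apply]
    rw [← Matrix.mulVec_mulVec, Matrix.one_mulVec, Matrix.add_mulVec]
    rw [LinearMap.add_apply, h1, h1', hC] at h3
    exact h3)
  have h4 := isNilpotent_add_of_idempotents k hD h2 h2'
  have h5 : IsNilpotent (PS.constMat (A + A')) := by
    rw [map_add]
    exact h4.map τ.constEnd.val
  have h6 : IsUnit (PS.constMat (A + A')) :=
    IsUnit.of_mul_eq_one _ (by rw [← map_mul, hmul, map_one])
  exact h6.not_isNilpotent h5

end Commutant

end SeriesRep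

section KrullSchmidt

theorem IsIndecomposableModule.isLocalRing_end (k : Type u) {X : Type u} [Field k] [CommRing X] [IsDomain X] [IsLocalRing X] [Algebra k X]
    [Algebra (PS k) X] [SurfaceOver k X]
    {N : Type u} [AddCommGroup N] [Module X N]
    (hN : IsMaximalCohenMacaulay X N) (hi : IsIndecomposableModule X N) :
    IsLocalRing (Module.End X N) := by
  obtain ⟨l, ρ, ⟨e⟩⟩ := SurfaceOver.exists_seriesRep (k := k) hN
  have := SeriesRep.isLocalRing_end (hi.of_equiv e.symm)
  have : Nontrivial (Module.End X N) := e.conjRingEquiv.symm.toEquiv.nontrivial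
  refine IsLocalRing.of_isUnit_or_isUnit_of_isUnit_add fun a b hab => ?_
  have h := hab.map e.conjRingEquiv.symm
  rw [map_add] at h
  exact (IsLocalRing.isUnit_or_isUnit_of_isUnit_add h).imp (MulEquiv.isUnit_map _).1
    (MulEquiv.isUnit_map _).1

/-- A Cohen-Macaulay module is a direct sum of indecomposable ones. -/
theorem exists_decomposition (k : Type u) {X : Type u} [Field k] [CommRing X] [IsDomain X] [IsLocalRing X] [Algebra k X]
    [Algebra (PS k) X] [SurfaceOver k X]
    (M : Type u) [AddCommGroup M] [Module X M]
    (hM : IsMaximalCohenMacaulay X M) : ∃ (s : ℕ) (N : Fin s → ModuleCat.{u} X)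
      (i : ∀ j, N j →ₗ[X] M) (p : ∀ j, M →ₗ[X] N j),
      (∀ j, IsIndecomposableModule X (N j)) ∧ (∀ j, p j ∘ₗ i j = LinearMap.id) ∧
      ∑ j, i j ∘ₗ p j = LinearMap.id := by
  induction hr : Module.finrank X M using Nat.strong_induction_on generalizing M with
  | _ r ih =>
  by_cases hs : Subsingleton M
  · exact ⟨0, fun j => j.elim0, fun j => j.elim0, fun j => j.elim0, fun j => j.elim0,
      fun j => j.elim0, LinearMap.ext fun m => Subsingleton.elim _ _⟩
  rw [not_subsingleton_iff_nontrivial] at hs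
  by_cases hi : IsIndecomposableModule X M
  · exact ⟨1, fun _ => ModuleCat.of X M, fun _ => LinearMap.id, fun _ => LinearMap.id, fun _ => hi,
      fun _ => rfl, by simp⟩
  obtain ⟨p, q, hpq, hp, hq⟩ : ∃ p q : Submodule X M, IsCompl p q ∧ p ≠ ⊥ ∧ q ≠ ⊥ := by
    by_contra! hc
    exact hi ⟨hs, fun p q h => or_iff_not_imp_left.2 fun h' => hc p q h h'⟩
  have hsum : ∀ p q : Submodule X M, IsCompl p q → IsSummand X p M := fun p q h =>
    ⟨p.subtype, Submodule.projectionOnto p q h, LinearMap.ext fun x => by simp⟩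
  have hmp := hM.of_isSummand (k := k) (hsum p q hpq)
  have hmq := hM.of_isSummand (k := k) (hsum q p hpq.symm)
  have : Nontrivial p := Submodule.nontrivial_iff_ne_bot.2 hp
  have : Nontrivial q := Submodule.nontrivial_iff_ne_bot.2 hq
  -- Nonzero Cohen-Macaulay modules have positive rank, so both summands have smaller rank than `M`
  -- and the induction applies to them.
  have h1 := hmp.finrank_pos (k := k)
  have h2 := hmq.finrank_pos (k := k)
  have := hM.1
  have h3 : Module.finrank X p + Module.finrank X q = Module.finrank X M := by
    have e := Submodule.quotientEquivOfIsCompl p q hpq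
    have := Submodule.finrank_quotient_add_finrank p
    rw [e.finrank_eq] at this
    omega
  obtain ⟨s, N, i, π, a1, a2, a3⟩ := ih _ (by omega) p hmp rfl
  obtain ⟨s', N', i', π', b1, b2, b3⟩ := ih _ (by omega) q hmq rfl
  let N'' : Fin s ⊕ Fin s' → ModuleCat.{u} X := Sum.elim N N'
  let i'' : ∀ j, N'' j →ₗ[X] M := fun j => match j with
    | .inl j => p.subtype ∘ₗ i j
    | .inr j => q.subtype ∘ₗ i' j
  let π'' : ∀ j, M →ₗ[X] N'' j := fun j => match j with
    | .inl j => π j ∘ₗ Submodule.projectionOnto p q hpq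
    | .inr j => π' j ∘ₗ Submodule.projectionOnto q p hpq.symm
  refine ⟨s + s', fun j => N'' (finSumFinEquiv.symm j), fun j => i'' _, fun j => π'' _, fun j => ?_,
    fun j => ?_, ?_⟩
  · have : ∀ j, IsIndecomposableModule X (N'' j) := fun j => match j with
      | .inl j => a1 j
      | .inr j => b1 j
    exact this _
  · have : ∀ j, π'' j ∘ₗ i'' j = LinearMap.id := ?_
    · exact this _
    clear j
    intro j
    cases j with
    | inl j =>
      have : ∀ m : N j, (π j ∘ₗ Submodule.projectionOnto p q hpq) ((p.subtype ∘ₗ i j) m) = m :=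
        fun m => by simpa using LinearMap.congr_fun (a2 j) m
      exact LinearMap.ext this
    | inr j =>
      have : ∀ m : N' j, (π' j ∘ₗ Submodule.projectionOnto q p hpq.symm) ((q.subtype ∘ₗ i' j) m) = m :=
        fun m => by simpa using LinearMap.congr_fun (b2 j) m
      exact LinearMap.ext this
  · rw [Equiv.sum_comp finSumFinEquiv.symm (fun j => i'' j ∘ₗ π'' j), Fintype.sum_sum_type]
    refine LinearMap.ext fun m => ?_
    have e1 := LinearMap.congr_fun a3 (Submodule.projectionOnto p q hpq m)
    have e2 := LinearMap.congr_fun b3 (Submodule.projectionOnto q p hpq.symm m)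
    have e3 := congrArg p.subtype e1
    have e4 := congrArg q.subtype e2
    simp only [LinearMap.sum_apply, map_sum, LinearMap.comp_apply, LinearMap.id_apply,
      LinearMap.add_apply] at e3 e4 ⊢
    have e5 := Submodule.projection_add_projection_eq_self hpq m
    exact (congrArg₂ (· + ·) e3 e4).trans e5

end KrullSchmidt



/-! ### Closed points of affine varieties -/

section ClosedPoints

variable {k R : Type*} [Field k] [IsAlgClosed k] [CommRing R] [Algebra k R]

/-- Nullstellensatz: the residue field at a closed point is finite over `k`, hence equal to `k`. -/
theorem exists_algHom_ker_eq [Algebra.FiniteType k R] (c : Ideal R) [hc : c.IsMaximal] :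
    ∃ ε : R →ₐ[k] k, RingHom.ker ε = c := by
  let _ : Field (R ⧸ c) := Ideal.Quotient.field c
  have : Module.Finite k (R ⧸ c) := finite_of_finite_type_of_isJacobsonRing k (R ⧸ c)
  have hb : Function.Bijective (algebraMap k (R ⧸ c)) := IsAlgClosed.algebraMap_bijective_of_isIntegral
  let e : k ≃ₐ[k] (R ⧸ c) := AlgEquiv.ofBijective (Algebra.ofId k _) hb
  refine ⟨(e.symm : (R ⧸ c) →ₐ[k] k).comp (Ideal.Quotient.mkₐ k c), ?_⟩
  ext r
  rw [RingHom.mem_ker, AlgHom.comp_apply, AlgEquiv.coe_toAlgHom, map_eq_zero_iff _ e.symm.injective,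
    Ideal.Quotient.mkₐ_eq_mk, Ideal.Quotient.eq_zero_iff_mem]

theorem isMaximal_ker_algHom {k R : Type*} [Field k] [CommRing R] [Algebra k R] (ε : R →ₐ[k] k) :
    (RingHom.ker ε).IsMaximal :=
  RingHom.ker_isMaximal_of_surjective ε fun t => ⟨algebraMap k R t, ε.commutes t⟩

/-- Any closed point of the nonempty open set where `f` is invertible will do. -/
theorem exists_algHom_ne_zero [IsDomain R] [Algebra.FiniteType k R] {f : R} (hf : f ≠ 0) :
    ∃ ε : R →ₐ[k] k, ε f ≠ 0 := by
  have : Nontrivial (Localization.Away f) := by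
    have : IsDomain (Localization.Away f) := IsLocalization.isDomain_localization
      (powers_le_nonZeroDivisors_of_noZeroDivisors hf)
    infer_instance
  have : Algebra.FiniteType R (Localization.Away f) := IsLocalization.finiteType_of_monoid_fg (Submonoid.powers f) _
  have : Algebra.FiniteType k (Localization.Away f) := Algebra.FiniteType.trans (S := R) inferInstance this
  obtain ⟨c, hc⟩ := Ideal.exists_maximal (Localization.Away f)
  obtain ⟨ε, -⟩ := exists_algHom_ker_eq (k := k) c
  refine ⟨ε.comp (IsScalarTower.toAlgHom k R _), fun h => ?_⟩
  have := (IsLocalization.Away.algebraMap_isUnit (S := Localization.Away f) f).map ε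
  rw [show ε (algebraMap R _ f) = 0 from h] at this
  exact not_isUnit_zero this

theorem eq_zero_of_forall_algHom [IsDomain R] [Algebra.FiniteType k R] {f : R}
    (h : ∀ ε : R →ₐ[k] k, ε f = 0) : f = 0 := by
  by_contra hf
  obtain ⟨ε, hε⟩ := exists_algHom_ne_zero (k := k) hf
  exact hε (h ε)

theorem algHom_ext_of_ker_le {k R : Type*} [Field k] [CommRing R] [Algebra k R] {ε ε' : R →ₐ[k] k}
    (h : ∀ r, ε r = 0 → ε' r = 0) : ε = ε' := by
  ext r
  have := h (r - algebraMap k R (ε r)) (by simp)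
  rw [map_sub, AlgHom.commutes, sub_eq_zero] at this
  exact this.symm

/-- The kernels are among the finitely many prime factors of the ideal `(g)`, and the kernel
determines the point. -/
theorem finite_algHom_of_dedekind {k R : Type*} [Field k] [CommRing R] [Algebra k R]
    [IsDedekindDomain R] (hR : ¬ IsField R) {g : R} (hg : g ≠ 0) : {ε : R →ₐ[k] k | ε g = 0}.Finite := by
  have h0 : Ideal.span {g} ≠ 0 := by simpa using hg
  have hmax := fun ε : R →ₐ[k] k => isMaximal_ker_algHom ε
  let F : (R →ₐ[k] k) → IsDedekindDomain.HeightOneSpectrum R := fun ε =>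
    ⟨RingHom.ker ε, (hmax ε).isPrime, Ring.ne_bot_of_isMaximal_of_not_isField (hmax ε) hR⟩
  refine Set.Finite.of_finite_image (f := F) ((Ideal.finite_factors h0).subset ?_) ?_
  · rintro _ ⟨ε, hε, rfl⟩
    exact Ideal.dvd_span_singleton.2 hε
  · intro ε _ ε' _ h
    refine algHom_ext_of_ker_le fun r hr => ?_
    have h1 : RingHom.ker ε = RingHom.ker ε' := congrArg IsDedekindDomain.HeightOneSpectrum.asIdeal h
    have : r ∈ RingHom.ker ε := hr
    rw [h1] at this
    exact this

/-- A local equation of a closed point of a smooth curve. -/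
theorem exists_local_equation {k R : Type*} [Field k] [CommRing R] [Algebra k R]
    [IsDedekindDomain R] (ε : R →ₐ[k] k) :
    ∃ s π : R, ε s ≠ 0 ∧ ε π = 0 ∧ ∀ r, ε r = 0 → ∃ t, s * r = π * t := by
  have hmax := isMaximal_ker_algHom ε
  by_cases h0 : RingHom.ker ε = ⊥
  · refine ⟨1, 0, by simp, by simp, fun r hr => ⟨0, ?_⟩⟩
    have : r ∈ RingHom.ker ε := hr
    rw [h0, Ideal.mem_bot] at this
    simp [this]
  -- Choose `π` in the ideal `𝔠` of the point but not in `𝔠²`. Then `(π) = 𝔠𝔞` with `𝔞` not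
  -- contained in `𝔠`, and any `s` in `𝔞` outside `𝔠` has `s𝔠 ⊆ (π)`.
  obtain ⟨π, h1, h2⟩ := Ideal.exists_mem_pow_notMem_pow_succ _ h0 hmax.ne_top 1
  rw [pow_one] at h1
  obtain ⟨a, ha⟩ := Ideal.dvd_span_singleton.2 h1
  obtain ⟨s, hs, hs'⟩ : ∃ s ∈ a, s ∉ RingHom.ker ε := by
    refine Set.not_subset.1 fun hle => h2 ?_
    rw [pow_succ, pow_one]
    exact Ideal.mul_mono_right hle (ha ▸ Ideal.mem_span_singleton_self π)
  refine ⟨s, π, hs', h1, fun r hr => ?_⟩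
  have : s * r ∈ Ideal.span {π} := by
    rw [ha, mul_comm s r]
    exact Ideal.mul_mem_mul (show r ∈ RingHom.ker ε from hr) hs
  obtain ⟨t, ht⟩ := Ideal.mem_span_singleton.1 this
  exact ⟨t, ht⟩

end ClosedPoints

/-! ### Specialization of kernels -/

section KernelLift

open MvPowerSeries

/-- The elements that are torsion modulo `W` form a finitely generated module; the product of
scalars that kill its generators modulo `W` works for all of them at once. -/
theorem exists_ne_zero_smul_mem_of_torsion {R P V : Type*} [CommRing R] [IsDomain R] [CommRing P]
    [IsNoetherianRing P] [Algebra R P] [AddCommGroup V] [Module P V] [Module.Finite P V] (W : Submodule P V) :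
    ∃ g : R, g ≠ 0 ∧ ∀ u : V, (∃ r : R, r ≠ 0 ∧ algebraMap R P r • u ∈ W) → algebraMap R P g • u ∈ W := by
  classical
  let T : Submodule P V :=
    { carrier := {u | ∃ r : R, r ≠ 0 ∧ algebraMap R P r • u ∈ W}
      zero_mem' := ⟨1, one_ne_zero, by simp⟩
      add_mem' := by
        rintro u v ⟨r, hr, h⟩ ⟨r', hr', h'⟩
        refine ⟨r * r', mul_ne_zero hr hr', ?_⟩
        rw [map_mul, smul_add]
        refine W.add_mem ?_ ?_
        · rw [mul_comm, mul_smul]; exact W.smul_mem _ h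
        · rw [mul_smul]; exact W.smul_mem _ h'
      smul_mem' := by
        rintro p u ⟨r, hr, h⟩
        exact ⟨r, hr, by rw [smul_comm]; exact W.smul_mem _ h⟩ }
  obtain ⟨n, t, ht⟩ := Submodule.fg_iff_exists_fin_generating_family.1 (IsNoetherian.noetherian T)
  have htm : ∀ i, t i ∈ T := fun i => ht ▸ Submodule.subset_span ⟨i, rfl⟩
  choose r hr hrt using htm
  refine ⟨∏ i, r i, Finset.prod_ne_zero_iff.2 fun i _ => hr i, fun u hu => ?_⟩
  have hu' : u ∈ Submodule.span P (Set.range t) := by rw [ht]; exact hu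
  refine Submodule.span_induction ?_ (by simp) ?_ ?_ hu'
  · rintro _ ⟨i, rfl⟩
    rw [← Finset.prod_erase_mul _ _ (Finset.mem_univ i), map_mul, mul_smul]
    exact W.smul_mem _ (hrt i)
  · intro x y _ _ hx hy
    rw [smul_add]
    exact W.add_mem hx hy
  · intro p x _ hx
    rw [smul_comm]
    exact W.smul_mem _ hx

variable {k R : Type*} [Field k] [CommRing R] [Algebra k R] [IsDedekindDomain R]
  {ι κ : Type*} [Finite ι] [Finite κ]

/-- Apply the local equation to each coefficient. One `s` serves all of the infinitely many
coefficients. -/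
theorem exists_mul_eq_of_map_eq_zero {ε : R →ₐ[k] k} {s π : R}
    (h : ∀ r, ε r = 0 → ∃ t, s * r = π * t) (w : ι → PS R)
    (hw : ∀ i, MvPowerSeries.map (ε : R →+* k) (w i) = 0) :
    ∃ w' : ι → PS R, (C s : PS R) • w = (C π : PS R) • w' := by
  have : ∀ i d, ∃ t, s * coeff d (w i) = π * t := fun i d => h _ (by
    have := congrArg (coeff d) (hw i)
    rwa [coeff_map, map_zero] at this)
  choose t ht using this
  let w' : ι → PS R := fun i d => t i d
  refine ⟨w', funext fun i => MvPowerSeries.ext fun d => ?_⟩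
  rw [Pi.smul_apply, Pi.smul_apply, smul_eq_mul, smul_eq_mul, coeff_C_mul, coeff_C_mul, ht]
  rfl

/-- The formation of kernels of matrices commutes with specialization, outside a proper closed
subset of the curve. -/
theorem exists_kernel_lift (T : (ι → PS R) →ₗ[PS R] (κ → PS R)) :
    ∃ g : R, g ≠ 0 ∧ ∀ ε : R →ₐ[k] k, ε g ≠ 0 → ∀ w₀ : ι → PS R,
      (∀ j, MvPowerSeries.map (ε : R →+* k) (T w₀ j) = 0) → ∃ w, T w = 0 ∧
        ∀ i, MvPowerSeries.map (ε : R →+* k) (w i) = MvPowerSeries.map (ε : R →+* k) (w₀ i) := by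
  obtain ⟨g, hg, H⟩ := exists_ne_zero_smul_mem_of_torsion (R := R) (LinearMap.range T)
  refine ⟨g, hg, fun ε hε w₀ hw₀ => ?_⟩
  obtain ⟨s, π, hs, hπ, hsπ⟩ := exists_local_equation ε
  have hs0 : s ≠ 0 := fun h => hs (by rw [h, map_zero])
  obtain ⟨u, hu⟩ := exists_mul_eq_of_map_eq_zero hsπ (T w₀) hw₀
  -- Since `T w₀` vanishes at the point, `s` times it is `π u`. For `π ≠ 0` the vector `u` is
  -- torsion modulo the image of `T`, so `g` brings it into the image.
  obtain ⟨w₁, hw₁⟩ : ∃ w₁, (C (g * s) : PS R) • T w₀ = (C π : PS R) • T w₁ := by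
    by_cases h0 : π = 0
    · refine ⟨0, ?_⟩
      rw [map_mul, mul_smul, hu, h0]
      simp
    · obtain ⟨w₁, h⟩ := H u ⟨π, h0, by
        rw [MvPowerSeries.algebraMap_apply, Algebra.algebraMap_self, RingHom.id_apply, ← hu, ← map_smul]
        exact ⟨_, rfl⟩⟩
      refine ⟨w₁, ?_⟩
      rw [h, MvPowerSeries.algebraMap_apply, Algebra.algebraMap_self, RingHom.id_apply, map_mul,
        mul_smul, hu, smul_comm]
  have hgs : ε (g * s) ≠ 0 := by rw [map_mul]; exact mul_ne_zero hε hs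
  -- The vector `g s w₀ − π w₁` lies in the kernel. At the point `π` vanishes, so after division by
  -- the value of `g s` it specializes as `w₀` does.
  refine ⟨(C (algebraMap k R (ε (g * s))⁻¹) : PS R) • ((C (g * s) : PS R) • w₀ - (C π : PS R) • w₁), ?_,
    fun i => ?_⟩
  · rw [map_smul, map_sub, map_smul, map_smul, hw₁, sub_self, smul_zero]
  · rw [Pi.smul_apply, Pi.sub_apply, Pi.smul_apply, Pi.smul_apply, smul_eq_mul, smul_eq_mul, smul_eq_mul,
      map_mul (MvPowerSeries.map _), map_sub, map_mul (MvPowerSeries.map _), map_mul (MvPowerSeries.map _),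
      map_C, map_C, map_C]
    simp only [RingHom.coe_coe, AlgHom.commutes, hπ, map_zero, zero_mul, sub_zero]
    rw [← mul_assoc, ← map_mul, Algebra.algebraMap_self, RingHom.id_apply, inv_mul_cancel₀ hgs, map_one,
      one_mul]

/-- A vector in the kernel that vanishes at a point is a combination of vectors in the kernel with
coefficients that vanish at the point. -/
theorem exists_eq_smul_add_smul_of_map_eq_zero (T : (ι → PS R) →ₗ[PS R] (κ → PS R)) (ε : R →ₐ[k] k)
    (w : ι → PS R) (hw : T w = 0) (h : ∀ i, MvPowerSeries.map (ε : R →+* k) (w i) = 0) :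
    ∃ (s π : R) (w' : ι → PS R), ε s = 0 ∧ ε π = 0 ∧ T w' = 0 ∧
      w = (C s : PS R) • w + (C π : PS R) • w' := by
  obtain ⟨s, π, hs, hπ, hsπ⟩ := exists_local_equation ε
  by_cases h0 : π = 0
  · have hs0 : s ≠ 0 := fun h => hs (by rw [h, map_zero])
    obtain ⟨u, hu⟩ := exists_mul_eq_of_map_eq_zero hsπ w h
    have hw0 : w = 0 := by
      rw [h0, map_zero, zero_smul] at hu
      refine funext fun i => (mul_eq_zero.1 (congrFun hu i)).resolve_left fun h => hs0 ?_
      exact C_injective (h.trans (map_zero C).symm)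
    exact ⟨0, 0, 0, map_zero _, map_zero _, map_zero _, by simp [hw0]⟩
  obtain ⟨u, hu⟩ := exists_mul_eq_of_map_eq_zero hsπ w h
  have hTu : T u = 0 := by
    have : (C π : PS R) • T u = 0 := by rw [← map_smul, ← hu, map_smul, hw, smul_zero]
    exact funext fun i => (mul_eq_zero.1 (congrFun this i)).resolve_left fun h => h0 (C_injective (h.trans (map_zero C).symm))
  -- After scaling `s` to have value 1 at the point, `s w = π u` gives `w = (1 − s) w + π u` with
  -- both coefficients vanishing there.
  refine ⟨1 - algebraMap k R (ε s)⁻¹ * s, algebraMap k R (ε s)⁻¹ * π, u, ?_, ?_, hTu, ?_⟩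
  · rw [map_sub, map_mul, AlgHom.commutes, map_one, Algebra.algebraMap_self, RingHom.id_apply,
      inv_mul_cancel₀ hs, sub_self]
  · rw [map_mul, hπ, mul_zero]
  · rw [map_mul, mul_smul, ← hu, map_sub, map_mul, map_one, sub_smul, one_smul, mul_smul, sub_add_cancel]

end KernelLift



/-! ### Finite coverings of curves -/

section Curves

/-- Choose a maximal ideal lying over the kernel. Its residue field is integral over the
algebraically closed field `k`, hence equals `k`. -/
theorem AlgHom.exists_extension_of_isIntegral {k A C : Type*} [Field k] [IsAlgClosed k] [CommRing A]
    [CommRing C] [Algebra k A] [Algebra A C] [Algebra.IsIntegral A C] [FaithfulSMul A C]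
    (ε : A →ₐ[k] k) : ∃ ε' : C →+* k, ∀ a, ε' (algebraMap A C a) = ε a := by
  have hmax := isMaximal_ker_algHom ε
  obtain ⟨Q, hQ, hQc⟩ := Ideal.exists_ideal_over_maximal_of_isIntegral (S := C) (RingHom.ker ε) (by
    rw [(RingHom.injective_iff_ker_eq_bot _).1 (FaithfulSMul.algebraMap_injective A C)]
    exact bot_le)
  have hk : ∀ a, ε a = 0 → algebraMap A C a ∈ Q := fun a ha => by
    have : a ∈ Ideal.comap (algebraMap A C) Q := by rw [hQc]; exact ha
    exact this
  let f : k →+* C ⧸ Q := (Ideal.Quotient.mk Q).comp ((algebraMap A C).comp (algebraMap k A))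
  have hf : ∀ a, Ideal.Quotient.mk Q (algebraMap A C a) = f (ε a) := fun a => by
    refine Ideal.Quotient.eq.2 ?_
    rw [RingHom.comp_apply, ← map_sub]
    exact hk _ (by simp)
  have hint : f.IsIntegral := fun c => by
    obtain ⟨c, rfl⟩ := Ideal.Quotient.mk_surjective c
    obtain ⟨p, hp, hpc⟩ := Algebra.IsIntegral.isIntegral (R := A) c
    refine ⟨p.map ε, hp.map _, ?_⟩
    rw [Polynomial.eval₂_map]
    have h1 : f.comp (ε : A →+* k) = (Ideal.Quotient.mk Q).comp (algebraMap A C) :=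
      RingHom.ext fun a => (hf a).symm
    have h2 : (Ideal.Quotient.mk Q) (Polynomial.eval₂ (algebraMap A C) c p) = 0 := by
      rw [hpc, map_zero]
    rw [Polynomial.hom_eval₂, ← h1] at h2
    exact h2
  have hQ' := hQ.isPrime
  have hb : Function.Bijective f := IsAlgClosed.ringHom_bijective_of_isIntegral f hint
  let e := RingEquiv.ofBijective f hb
  refine ⟨(e.symm : C ⧸ Q →+* k).comp (Ideal.Quotient.mk Q), fun a => ?_⟩
  rw [RingHom.comp_apply, hf]
  exact e.symm_apply_apply (ε a)

variable {k R : Type u} [Field k] [IsAlgClosed k] [CommRing R] [Algebra k R] [IsDedekindDomain R]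

/-- Points of the curve `Spec R` extend to finitely generated algebraic extensions of `R`, with
finitely many exceptions. -/
theorem exists_algHom_extension {Ω R' : Type u} [Field Ω] [Algebra k Ω]
    [Algebra R Ω] [IsScalarTower k R Ω] [FaithfulSMul R Ω] [Algebra.IsAlgebraic R Ω]
    [CommRing R'] [Algebra k R'] [Algebra.FiniteType k R'] (j : R' →ₐ[k] Ω) (i : R →ₐ[k] R')
    (hij : ∀ r, j (i r) = algebraMap R Ω r) :
    ∃ h : R, h ≠ 0 ∧ ∀ ε : R →ₐ[k] k, ε h ≠ 0 → ∃ ε' : R' →ₐ[k] k, ε'.comp i = ε := by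
  classical
  have : ∀ z : Ω, ∃ h : R, h ≠ 0 ∧ IsIntegral R (h • z) := fun z => by
    obtain ⟨h, hh, hz⟩ := (Algebra.IsAlgebraic.isAlgebraic (R := R) z).exists_integral_multiple
    exact ⟨h, hh, hz⟩
  choose h hh hz using this
  obtain ⟨S, hS⟩ := (inferInstance : Algebra.FiniteType k R').out
  refine ⟨∏ z ∈ S, h (j z), Finset.prod_ne_zero_iff.2 fun z _ => hh _, fun ε hε => ?_⟩
  set g := ∏ z ∈ S, h (j z) with hg
  have hg0 : g ≠ 0 := Finset.prod_ne_zero_iff.2 fun z _ => hh _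
  -- Over `R[1/g]` the generators of `R'` become integral, so `R'` maps to the integral closure of
  -- `R[1/g]` in `Ω`, to which the point extends.
  let A := Localization.Away g
  let φ : A →+* Ω := IsLocalization.Away.lift (S := A) g (g := algebraMap R Ω)
    (isUnit_iff_ne_zero.2 fun h => hg0 (FaithfulSMul.algebraMap_injective R Ω (h.trans (map_zero _).symm)))
  let _ : Algebra A Ω := φ.toAlgebra
  have hjr : ∀ r, algebraMap A Ω (algebraMap R A r) = algebraMap R Ω r := fun r =>
    IsLocalization.Away.lift_eq _ _ _
  have : IsScalarTower R A Ω := IsScalarTower.of_algebraMap_eq fun r => (hjr r).symm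
  have hsurj := fun a => IsLocalization.Away.surj (S := A) g a
  have hgu : IsUnit (algebraMap R A g) := IsLocalization.Away.algebraMap_isUnit (S := A) g
  have : FaithfulSMul A Ω := by
    rw [faithfulSMul_iff_algebraMap_injective, injective_iff_map_eq_zero]
    intro a ha
    obtain ⟨n, r, hr⟩ := hsurj a
    have h1 := congrArg (algebraMap A Ω) hr
    rw [map_mul, ha, zero_mul, hjr] at h1
    have h2 : r = 0 := FaithfulSMul.algebraMap_injective R Ω (h1.symm.trans (map_zero _).symm)
    rw [h2, map_zero] at hr
    exact (hgu.pow n).mul_left_eq_zero.1 hr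
  let ε₀ : R →+* k := ε
  have hu : IsUnit (ε₀ g) := isUnit_iff_ne_zero.2 hε
  let εA₀ : A →+* k := IsLocalization.Away.lift (S := A) g hu
  have hεA₀ : ∀ r, εA₀ (algebraMap R A r) = ε r := fun r => IsLocalization.Away.lift_eq g hu r
  let εA : A →ₐ[k] k := { εA₀ with
    commutes' := fun t => by
      change εA₀ (algebraMap k A t) = _
      rw [IsScalarTower.algebraMap_apply k R A, hεA₀]
      exact ε.commutes t }
  have : FaithfulSMul A (integralClosure A Ω) := (faithfulSMul_iff_algebraMap_injective _ _).2
    fun a b h => FaithfulSMul.algebraMap_injective A Ω (congrArg Subtype.val h)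
  obtain ⟨ε', hε'⟩ := AlgHom.exists_extension_of_isIntegral (C := integralClosure A Ω) εA
  have hint : ∀ a, IsIntegral A (j a) := by
    intro a
    have ha : a ∈ Algebra.adjoin k (S : Set R') := hS ▸ trivial
    refine Algebra.adjoin_induction (fun z hzS => ?_) (fun t => ?_) (fun x y _ _ hx hy => ?_)
      (fun x y _ _ hx hy => ?_) ha
    · have h1 : IsUnit (algebraMap R A (h (j z))) := isUnit_of_dvd_unit
        (map_dvd _ (Finset.dvd_prod_of_mem (fun z => h (j z)) hzS)) hgu
      obtain ⟨b, hb⟩ := h1.exists_left_inv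
      have h2 : j z = b • (h (j z) • j z) := by
        rw [← algebraMap_smul A (h (j z)) (j z), smul_smul, hb, one_smul]
      rw [h2]
      exact ((hz (j z)).tower_top).smul b
    · rw [AlgHom.commutes, IsScalarTower.algebraMap_apply k R Ω, ← hjr]
      exact isIntegral_algebraMap
    · rw [map_add]
      exact hx.add hy
    · rw [map_mul]
      exact hx.mul hy
  let j' : R' →+* integralClosure A Ω := (j : R' →+* Ω).codRestrict _ hint
  have key : ∀ r, ε' (j' (i r)) = ε r := fun r => by
    have h1 : j' (i r) = algebraMap A (integralClosure A Ω) (algebraMap R A r) :=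
      Subtype.ext ((hij r).trans (hjr r).symm)
    rw [h1, hε']
    exact hεA₀ r
  refine ⟨AlgHom.mk (ε'.comp j') fun t => ?_, AlgHom.ext key⟩
  change ε' (j' (algebraMap k R' t)) = _
  rw [← i.commutes, key]
  exact ε.commutes t

/-- By Noether normalization `R` is integral over a polynomial ring in `s` variables. Lying over
bounds the dimension of the latter by one, and `s = 0` would make `R` a field. -/
theorem exists_transcendental_basis (k R : Type u) [Field k] [IsAlgClosed k] [CommRing R]
    [Algebra k R] [IsDedekindDomain R] [Algebra.FiniteType k R] (hR : ¬ IsField R) :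
    ∃ x : Fin 1 → R, IsTranscendenceBasis k x := by
  obtain ⟨s, f, hf, hfi⟩ := exists_integral_inj_algHom_of_fg k R
  let _ : Algebra (MvPolynomial (Fin s) k) R := f.toRingHom.toAlgebra
  have : Algebra.IsIntegral (MvPolynomial (Fin s) k) R := ⟨hfi⟩
  have : IsScalarTower k (MvPolynomial (Fin s) k) R := IsScalarTower.of_algebraMap_eq fun t =>
    (f.commutes t).symm
  have hinj : Function.Injective (algebraMap (MvPolynomial (Fin s) k) R) := hf
  have hdim : Ring.KrullDimLE 1 (MvPolynomial (Fin s) k) := by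
    rw [Ring.krullDimLE_one_iff_of_isPrime_bot]
    intro p hp hpp
    obtain ⟨Q, -, hQ, hQp⟩ := Ideal.exists_ideal_over_prime_of_isIntegral p (⊥ : Ideal R) (by
      rw [← RingHom.ker_eq_comap_bot, (RingHom.injective_iff_ker_eq_bot _).1 hinj]
      exact bot_le)
    have hQ0 : Q ≠ ⊥ := by
      rintro rfl
      rw [← RingHom.ker_eq_comap_bot, (RingHom.injective_iff_ker_eq_bot _).1 hinj] at hQp
      exact hp hQp.symm
    have := Ring.DimensionLEOne.maximalOfPrime hQ0 hQ
    rw [← hQp]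
    exact Ideal.isMaximal_comap_of_isIntegral_of_isMaximal Q
  have hs : s = 1 := by
    have h1 : s ≤ 1 := by
      have := (Order.krullDimLE_iff _ _).1 hdim
      have h2 := MvPolynomial.ringKrullDim_of_isNoetherianRing (R := k) (ι := Fin s)
      rw [ringKrullDim_eq_zero_of_field, zero_add, Nat.card_fin] at h2
      have h3 := h2.symm.trans_le this
      exact_mod_cast h3
    have h2 : s ≠ 0 := by
      rintro rfl
      refine hR ?_
      have : IsField (MvPolynomial (Fin 0) k) :=
        (MvPolynomial.isEmptyAlgEquiv k (Fin 0)).toMulEquiv.isField (Field.toIsField k)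
      exact isField_of_isIntegral_of_isField' this
    omega
  subst hs
  have : FaithfulSMul (MvPolynomial (Fin 1) k) R := (faithfulSMul_iff_algebraMap_injective _ _).2 hinj
  exact ⟨_, (IsTranscendenceBasis.mvPolynomial (Fin 1) k).algebraMap_comp (A := R)⟩

/-- A function field in one variable is the field of fractions of a smooth affine curve. -/
theorem exists_dedekind_model (k L : Type u) [Field k] [IsAlgClosed k] [Field L] [Algebra k L]
    [Algebra.EssFiniteType k L] {x : Fin 1 → L} (hx : IsTranscendenceBasis k x) :
    ∃ (C : Type u) (_ : CommRing C) (_ : Algebra k C) (_ : Algebra C L), IsScalarTower k C L ∧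
      Algebra.FiniteType k C ∧ IsDedekindDomain C ∧ IsFractionRing C L := by
  classical
  -- Algebraically closed fields are perfect, so `L` is separable over `k(t)` for a suitable `t`.
  -- Separability makes the integral closure of `k[t]` in `L` finite over `k[t]`.
  obtain ⟨s, hs, hsep⟩ := exists_isTranscendenceBasis_and_isSeparable_of_perfectField k L
  have hcard : Fintype.card s = 1 := by
    have := hs.lift_cardinalMk_eq hx
    simpa using this
  obtain ⟨t, rfl⟩ := Finset.card_eq_one.1 ((Fintype.card_coe s).symm.trans hcard)
  rw [Finset.coe_singleton] at hsep
  have htr : Transcendental k t := hs.1.transcendental ⟨t, Finset.mem_singleton_self t⟩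
  let K := IntermediateField.adjoin k {t}
  let gen : K := IntermediateField.AdjoinSimple.gen k t
  let _ : Algebra (Polynomial k) K := (Polynomial.aeval gen).toRingHom.toAlgebra
  let _ : Algebra (Polynomial k) L := (Polynomial.aeval t).toRingHom.toAlgebra
  have hpk : ∀ p : Polynomial k, algebraMap (Polynomial k) L p = Polynomial.aeval t p := fun _ => rfl
  have : IsScalarTower (Polynomial k) K L := IsScalarTower.of_algebraMap_eq fun p => by
    change Polynomial.aeval t p = algebraMap K L (Polynomial.aeval gen p)
    rw [← Polynomial.aeval_algebraMap_apply]
    rfl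
  have : IsScalarTower k (Polynomial k) L := IsScalarTower.of_algebraMap_eq fun c =>
    ((Polynomial.aeval t).commutes c).symm
  have hinj : Function.Injective (algebraMap (Polynomial k) L) :=
    transcendental_iff_injective.1 htr
  have : FaithfulSMul (Polynomial k) K := (faithfulSMul_iff_algebraMap_injective _ _).2 fun p q h => hinj (by
    rw [IsScalarTower.algebraMap_apply (Polynomial k) K L, h, ← IsScalarTower.algebraMap_apply])
  have : IsFractionRing (Polynomial k) K := IsFractionRing.of_field _ _ fun z => by
    obtain ⟨p, q, hpq⟩ := (IntermediateField.mem_adjoin_simple_iff k (z : L)).1 z.2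
    refine ⟨p, q, Subtype.ext ?_⟩
    rw [hpq, ← hpk, ← hpk, IsScalarTower.algebraMap_apply (Polynomial k) K L,
      IsScalarTower.algebraMap_apply (Polynomial k) K L]
    rfl
  have : FiniteDimensional K L := by
    have : Algebra.EssFiniteType K L := Algebra.EssFiniteType.of_comp k K L
    obtain ⟨T, hT⟩ := IntermediateField.fg_top K L
    have h1 : FiniteDimensional K (IntermediateField.adjoin K (T : Set L)) :=
      IntermediateField.finiteDimensional_adjoin fun z _ => Algebra.IsIntegral.isIntegral z
    rw [hT] at h1
    exact Module.Finite.equiv IntermediateField.topEquiv.toLinearEquiv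
  let C := integralClosure (Polynomial k) L
  have h1 : IsDedekindDomain C := integralClosure.isDedekindDomain (Polynomial k) K L
  have h2 : Module.Finite (Polynomial k) C := IsIntegralClosure.finite (Polynomial k) K L C
  have h3 : IsFractionRing C L :=
    IsIntegralClosure.isFractionRing_of_finite_extension (Polynomial k) K L C
  have h4 : Algebra.FiniteType k C := Algebra.FiniteType.trans (S := Polynomial k) inferInstance inferInstance
  exact ⟨C, inferInstance, inferInstance, inferInstance, inferInstance, h4, h1, h3⟩

/-- Finitely many elements of a function field are regular on a smooth affine model. -/
theorem exists_dedekind_model_of_finset {k L : Type u} [Field k] [IsAlgClosed k] [Field L] [Algebra k L]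
    [Algebra.EssFiniteType k L] {x : Fin 1 → L} (hx : IsTranscendenceBasis k x) (T : Finset L) :
    ∃ (R' : Type u) (_ : CommRing R') (_ : Algebra k R') (j : R' →ₐ[k] L), Algebra.FiniteType k R' ∧
      IsDedekindDomain R' ∧ Function.Injective j ∧ (T : Set L) ⊆ Set.range j := by
  obtain ⟨C, _, _, _, _, _, _, _⟩ := exists_dedekind_model k L hx
  -- Inverting a common denominator `b` of the elements of `T` makes them regular and keeps the
  -- curve affine and smooth.
  obtain ⟨b, hb⟩ := IsLocalization.exist_integer_multiples_of_finset C⁰ T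
  have hb0 : (b : C) ≠ 0 := nonZeroDivisors.coe_ne_zero b
  let R' := Localization.Away (b : C)
  have hdom : IsDomain R' := IsLocalization.isDomain_localization
    (powers_le_nonZeroDivisors_of_noZeroDivisors hb0)
  have : IsDedekindDomain R' := IsLocalization.isDedekindDomain C
    (powers_le_nonZeroDivisors_of_noZeroDivisors hb0) R'
  have : Algebra.FiniteType C R' := IsLocalization.finiteType_of_monoid_fg (Submonoid.powers (b : C)) _
  have : Algebra.FiniteType k R' := Algebra.FiniteType.trans (S := C) inferInstance inferInstance
  have hφ : Function.Injective (algebraMap C L) := IsFractionRing.injective C L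
  have hφb : IsUnit (algebraMap C L b) := isUnit_iff_ne_zero.2 fun h => hb0 (hφ (h.trans (map_zero _).symm))
  let j₀ : R' →+* L := IsLocalization.Away.lift (S := R') (b : C) (g := algebraMap C L) hφb
  have hj₀ : ∀ c, j₀ (algebraMap C R' c) = algebraMap C L c := fun c => IsLocalization.Away.lift_eq _ _ _
  have hj₀inj : Function.Injective j₀ := by
    rw [injective_iff_map_eq_zero]
    intro a ha
    obtain ⟨n, r, hr⟩ := IsLocalization.Away.surj (S := R') (b : C) a
    have h1 := congrArg j₀ hr
    rw [map_mul, ha, zero_mul, hj₀] at h1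
    have h2 : r = 0 := hφ (h1.symm.trans (map_zero _).symm)
    rw [h2, map_zero] at hr
    exact ((IsLocalization.Away.algebraMap_isUnit (S := R') (b : C)).pow n).mul_left_eq_zero.1 hr
  let j : R' →ₐ[k] L := AlgHom.mk j₀ fun t => by
      change j₀ (algebraMap k R' t) = _
      rw [IsScalarTower.algebraMap_apply k C R', hj₀, ← IsScalarTower.algebraMap_apply]
  refine ⟨R', inferInstance, inferInstance, j, inferInstance, inferInstance, hj₀inj, fun z hz => ?_⟩
  obtain ⟨c, hc⟩ := hb z hz
  obtain ⟨y, hy⟩ := (IsLocalization.Away.algebraMap_isUnit (S := R') (b : C)).exists_right_inv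
  refine ⟨algebraMap C R' c * y, ?_⟩
  change j₀ _ = z
  rw [map_mul, hj₀]
  have h1 : algebraMap C L b * j₀ y = 1 := by rw [← hj₀, ← map_mul, hy, map_one]
  have h2 : algebraMap C L c = algebraMap C L b * z := hc.trans (Algebra.smul_def _ _)
  rw [h2, mul_right_comm, h1, one_mul]

/-- Finitely many elements of an algebraic extension of the function field of a smooth affine curve
are functions on a smooth affine curve over it. -/
theorem exists_curve_extension (hR : ¬ IsField R) [Algebra.FiniteType k R] {Ω : Type u} [Field Ω]
    [Algebra k Ω] [Algebra R Ω] [IsScalarTower k R Ω] [FaithfulSMul R Ω] [Algebra.IsAlgebraic R Ω]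
    (T : Finset Ω) :
    ∃ (R' : Type u) (_ : CommRing R') (_ : Algebra k R') (j : R' →ₐ[k] Ω) (i : R →ₐ[k] R') (h : R),
      Algebra.FiniteType k R' ∧ IsDedekindDomain R' ∧ ¬ IsField R' ∧ Function.Injective j ∧
      (T : Set Ω) ⊆ Set.range j ∧ (∀ r, j (i r) = algebraMap R Ω r) ∧ h ≠ 0 ∧
      ∀ ε : R →ₐ[k] k, ε h ≠ 0 → ∃ ε' : R' →ₐ[k] k, ε'.comp i = ε := by
  classical
  obtain ⟨x, hx⟩ := exists_transcendental_basis k R hR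
  obtain ⟨G, hG⟩ := (inferInstance : Algebra.FiniteType k R).out
  -- The generators of `R` are included, so that `R` itself maps to the new curve.
  let T' : Finset Ω := T ∪ G.image (algebraMap R Ω)
  let L := IntermediateField.adjoin k (T' : Set Ω)
  have hTL : ∀ z ∈ T', z ∈ L := fun z hz => IntermediateField.subset_adjoin k _ hz
  have hadj : ∀ D : Subalgebra k Ω, (T' : Set Ω) ⊆ D → ∀ r, algebraMap R Ω r ∈ D := fun D hD r => by
    have : (Algebra.adjoin k (G : Set R)).map (IsScalarTower.toAlgHom k R Ω) ≤ D := by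
      rw [AlgHom.map_adjoin]
      refine Algebra.adjoin_le ?_
      rintro _ ⟨z, hz, rfl⟩
      exact hD (Finset.mem_coe.2 (Finset.mem_union_right _ (Finset.mem_image_of_mem _ hz)))
    rw [hG] at this
    exact this ⟨r, trivial, rfl⟩
  have hRL : ∀ r, algebraMap R Ω r ∈ L := hadj L.toSubalgebra hTL
  let f : R →+* L := (algebraMap R Ω).codRestrict L hRL
  let _ : Algebra R L := f.toAlgebra
  have : IsScalarTower R L Ω := IsScalarTower.of_algebraMap_eq fun _ => rfl
  have : IsScalarTower k R L := IsScalarTower.of_algebraMap_eq fun t => Subtype.ext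
    (IsScalarTower.algebraMap_apply k R Ω t)
  have : FaithfulSMul R L := (faithfulSMul_iff_algebraMap_injective _ _).2 fun a b h =>
    FaithfulSMul.algebraMap_injective R Ω (congrArg Subtype.val h)
  have : Algebra.IsAlgebraic R L := Algebra.IsAlgebraic.tower_bot R L Ω
  have : Algebra.EssFiniteType k L := IntermediateField.essFiniteType_iff.2 ⟨T', rfl⟩
  obtain ⟨R', _, _, j₁, h1, h2, hj₁, hT₁⟩ := exists_dedekind_model_of_finset (k := k)
    (hx.algebraMap_comp (A := L)) (Finset.image (fun z : {z // z ∈ T'} => (⟨z.1, hTL z.1 z.2⟩ : L)) T'.attach)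
  let j : R' →ₐ[k] Ω := L.val.comp j₁
  have hj : Function.Injective j := Subtype.val_injective.comp hj₁
  have hT : (T' : Set Ω) ⊆ Set.range j := fun z hz => by
    obtain ⟨a, ha⟩ := hT₁ (Finset.mem_coe.2 (Finset.mem_image.2 ⟨⟨z, hz⟩, Finset.mem_attach _ _, rfl⟩))
    exact ⟨a, congrArg Subtype.val ha⟩
  have hRj : ∀ r, ∃ a, j a = algebraMap R Ω r := hadj j.range hT
  choose i₀ hi₀ using hRj
  let i : R →ₐ[k] R' :=
    { toFun := i₀
      map_one' := hj (by simp [hi₀])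
      map_mul' := fun a b => hj (by simp [hi₀])
      map_zero' := hj (by simp [hi₀])
      map_add' := fun a b => hj (by simp [hi₀])
      commutes' := fun t => hj (by rw [hi₀, j.commutes, ← IsScalarTower.algebraMap_apply]) }
  have hi : ∀ r, j (i r) = algebraMap R Ω r := hi₀
  obtain ⟨h, hh, H⟩ := exists_algHom_extension j i hi
  refine ⟨R', _, _, j, i, h, h1, h2, fun hF => hR ?_, hj,
    fun z hz => hT (Finset.mem_coe.2 (Finset.mem_union_left _ hz)), hi, hh, H⟩
  let _ : Field R' := hF.toField
  have : Module.Finite k R' := finite_of_finite_type_of_isJacobsonRing k R'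
  have hinj : Function.Injective i := fun a b hab => FaithfulSMul.algebraMap_injective R Ω (by
    rw [← hi, ← hi, hab])
  have : Algebra.IsIntegral k R := ⟨fun r =>
    (isIntegral_algHom_iff i hinj).1 (Algebra.IsIntegral.isIntegral (R := k) (i r))⟩
  exact isField_of_isIntegral_of_isField' (Field.toIsField k)

end Curves



/-! ### Primitive idempotents of matrix algebras -/

section PrimitiveSplitting

variable {F : Type u} [Field F]

theorem Matrix.exists_split_of_isIdempotentElem {l : ℕ} {e : Matrix (Fin l) (Fin l) F}
    (he : IsIdempotentElem e) : ∃ (s : ℕ) (α : Matrix (Fin s) (Fin l) F) (β : Matrix (Fin l) (Fin s) F),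
      β * α = e ∧ α * β = 1 ∧ s = Module.finrank F (LinearMap.range (Matrix.toLin' e)) := by
  let f := Matrix.toLin' e
  let b := Module.finBasis F (LinearMap.range f)
  let inc : (Fin _ → F) →ₗ[F] (Fin l → F) := (LinearMap.range f).subtype ∘ₗ b.equivFun.symm.toLinearMap
  let pr : (Fin l → F) →ₗ[F] (Fin _ → F) := b.equivFun.toLinearMap ∘ₗ f.rangeRestrict
  have hff : ∀ v, f (f v) = f v := fun v => by
    simp only [f, Matrix.toLin'_apply, Matrix.mulVec_mulVec, he.eq]
  refine ⟨_, LinearMap.toMatrix' pr, LinearMap.toMatrix' inc, ?_, ?_, rfl⟩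
  · rw [← LinearMap.toMatrix'_comp]
    have : inc ∘ₗ pr = f := LinearMap.ext fun v => by
      simp only [inc, pr, LinearMap.comp_apply, LinearEquiv.coe_coe, LinearEquiv.symm_apply_apply]
      rfl
    rw [this]
    exact LinearMap.toMatrix'_toLin' e
  · rw [← LinearMap.toMatrix'_comp]
    have : pr ∘ₗ inc = LinearMap.id := LinearMap.ext fun v => by
      simp only [inc, pr, LinearMap.comp_apply, LinearEquiv.coe_coe, LinearMap.id_apply]
      rw [← LinearEquiv.eq_symm_apply]
      obtain ⟨w, hw⟩ := (b.equivFun.symm v).2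
      refine Subtype.ext ?_
      change f ((b.equivFun.symm v : LinearMap.range f) : Fin l → F) = _
      rw [← hw, hff]
    rw [this, LinearMap.toMatrix'_id]

theorem Matrix.finrank_range_add_finrank_range_one_sub {l : ℕ} {e : Matrix (Fin l) (Fin l) F}
    (he : IsIdempotentElem e) : Module.finrank F (LinearMap.range (Matrix.toLin' e)) +
      Module.finrank F (LinearMap.range (Matrix.toLin' (1 - e))) = l := by
  have h1 : IsIdempotentElem (Matrix.toLin' (1 - e)) := by
    have : Matrix.toLin' (1 - e) * Matrix.toLin' (1 - e) = Matrix.toLin' (1 - e) := by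
      rw [Module.End.mul_eq_comp, ← Matrix.toLin'_mul, he.one_sub.eq]
    exact this
  have h2 : 1 - Matrix.toLin' (1 - e) = Matrix.toLin' e := by
    rw [map_sub, Matrix.toLin'_one]
    exact sub_sub_cancel _ _
  rw [LinearMap.IsIdempotentElem.range_eq_ker_one_sub h1, h2, LinearMap.finrank_range_add_finrank_ker,
    Module.finrank_fin_fun]

/-- The corner `α D β` of a matrix algebra. -/
def Subalgebra.corner {l s : ℕ} (D : Subalgebra F (Matrix (Fin l) (Fin l) F))
    (α : Matrix (Fin s) (Fin l) F) (β : Matrix (Fin l) (Fin s) F) (h : α * β = 1) (hD : β * α ∈ D) :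
    Subalgebra F (Matrix (Fin s) (Fin s) F) where
  carrier := {c | ∃ d ∈ D, α * d * β = c}
  mul_mem' := by
    rintro _ _ ⟨d, hd, rfl⟩ ⟨d', hd', rfl⟩
    exact ⟨d * (β * α) * d', D.mul_mem (D.mul_mem hd hD) hd', by simp only [Matrix.mul_assoc]⟩
  add_mem' := by
    rintro _ _ ⟨d, hd, rfl⟩ ⟨d', hd', rfl⟩
    exact ⟨d + d', D.add_mem hd hd', by rw [Matrix.mul_add, Matrix.add_mul]⟩
  algebraMap_mem' t := by
    refine ⟨algebraMap F _ t, D.algebraMap_mem t, ?_⟩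
    rw [Algebra.algebraMap_eq_smul_one, Algebra.algebraMap_eq_smul_one, Matrix.mul_smul, Matrix.mul_one,
      Matrix.smul_mul, h]

/-- A nontrivial idempotent of rank `s` divides the identity into two corners of sizes `s` and `l -
s`, both smaller, and induction applies to them. The idempotents are kept as products `β i * α i` of
rectangular matrices, and no corner has size zero; hence there are at most `l` of them. -/
theorem exists_primitive_splitting {l : ℕ} (D : Subalgebra F (Matrix (Fin l) (Fin l) F)) :
    ∃ (ι : Type) (_ : Fintype ι) (s : ι → ℕ) (α : ∀ i, Matrix (Fin (s i)) (Fin l) F)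
      (β : ∀ i, Matrix (Fin l) (Fin (s i)) F), Fintype.card ι ≤ l ∧ (∀ i, s i ≠ 0) ∧
      (∀ i, α i * β i = 1) ∧ (∀ i, β i * α i ∈ D) ∧ ∑ i, β i * α i = 1 ∧
      ∀ i, ∀ d ∈ D, IsIdempotentElem (α i * d * β i) → α i * d * β i = 0 ∨ α i * d * β i = 1 := by
  classical
  induction l using Nat.strong_induction_on with
  | _ l ih =>
  by_cases hl : l = 0
  · subst hl
    exact ⟨Empty, inferInstance, fun i => i.elim, fun i => i.elim, fun i => i.elim, by simp,
      fun i => i.elim, fun i => i.elim, fun i => i.elim, Subsingleton.elim _ _, fun i => i.elim⟩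
  by_cases hD : ∀ e ∈ D, IsIdempotentElem e → e = 0 ∨ e = 1
  · refine ⟨Unit, inferInstance, fun _ => l, fun _ => 1, fun _ => 1, by simp; omega, fun _ => hl,
      fun _ => by simp, fun _ => by simp [D.one_mem], by simp, fun _ d hd h => ?_⟩
    rw [Matrix.one_mul, Matrix.mul_one] at *
    exact hD d hd h
  push Not at hD
  obtain ⟨e, heD, he, he0, he1⟩ := hD
  obtain ⟨s, α, β, hβα, hαβ, hs⟩ := Matrix.exists_split_of_isIdempotentElem he
  obtain ⟨s', α', β', hβα', hαβ', hs'⟩ := Matrix.exists_split_of_isIdempotentElem he.one_sub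
  have hss : s + s' = l := by rw [hs, hs']; exact Matrix.finrank_range_add_finrank_range_one_sub he
  have hs0 : s ≠ 0 := by
    rintro rfl
    exact he0 (by rw [← hβα]; exact Matrix.ext fun i j => by simp [Matrix.mul_apply])
  have hs0' : s' ≠ 0 := by
    rintro rfl
    refine he1 (sub_eq_zero.1 ?_).symm
    rw [← hβα']
    exact Matrix.ext fun i j => by simp [Matrix.mul_apply]
  have hm : β * α ∈ D := hβα ▸ heD
  have hm' : β' * α' ∈ D := hβα' ▸ D.sub_mem D.one_mem heD
  obtain ⟨ι, _, t, a, b, c1, c2, c3, c4, c5, c6⟩ := ih s (by omega) (D.corner α β hαβ hm)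
  obtain ⟨ι', _, t', a', b', c1', c2', c3', c4', c5', c6'⟩ :=
    ih s' (by omega) (D.corner α' β' hαβ' hm')
  have aux : ∀ {s r : ℕ} {α : Matrix (Fin s) (Fin l) F} {β : Matrix (Fin l) (Fin s) F}
      (hαβ : α * β = 1) (hm : β * α ∈ D) {a : Matrix (Fin r) (Fin s) F} {b : Matrix (Fin s) (Fin r) F},
      (a * b = 1 → a * α * (β * b) = 1) ∧ (b * a ∈ D.corner α β hαβ hm → β * b * (a * α) ∈ D) := by
    intro s r α β hαβ hm a b
    refine ⟨fun h => ?_, ?_⟩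
    · rw [Matrix.mul_assoc, ← Matrix.mul_assoc α, hαβ, Matrix.one_mul, h]
    · rintro ⟨d, hd, h⟩
      have : β * b * (a * α) = β * α * d * (β * α) := by
        calc β * b * (a * α) = β * (b * a) * α := by simp only [Matrix.mul_assoc]
          _ = _ := by rw [← h]; simp only [Matrix.mul_assoc]
      rw [this]
      exact D.mul_mem (D.mul_mem hm hd) hm
  refine ⟨ι ⊕ ι', inferInstance, Sum.elim t t',
    fun i => match i with
      | .inl i => a i * α
      | .inr i => a' i * α',
    fun i => match i with
      | .inl i => β * b i
      | .inr i => β' * b' i, ?_, ?_, ?_, ?_, ?_, ?_⟩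
  · rw [Fintype.card_sum]
    omega
  · rintro (i | i)
    · exact c2 i
    · exact c2' i
  · rintro (i | i)
    · exact (aux hαβ hm).1 (c3 i)
    · exact (aux hαβ' hm').1 (c3' i)
  · rintro (i | i)
    · exact (aux hαβ hm).2 (c4 i)
    · exact (aux hαβ' hm').2 (c4' i)
  · rw [Fintype.sum_sum_type]
    have h1 : ∀ i, β * b i * (a i * α) = β * (b i * a i) * α := fun i => by
      simp only [Matrix.mul_assoc]
    have h2 : ∀ i, β' * b' i * (a' i * α') = β' * (b' i * a' i) * α' := fun i => by
      simp only [Matrix.mul_assoc]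
    have h3 : ∑ i, β * b i * (a i * α) = e := by
      simp only [h1]
      rw [← Matrix.sum_mul, ← Matrix.mul_sum, c5, Matrix.mul_one, hβα]
    have h4 : ∑ i, β' * b' i * (a' i * α') = 1 - e := by
      simp only [h2]
      rw [← Matrix.sum_mul, ← Matrix.mul_sum, c5', Matrix.mul_one, hβα']
    exact (congrArg₂ (· + ·) h3 h4).trans (by abel)
  · rintro (i | i) d hd h
    · have e1 : a i * α * d * (β * b i) = a i * (α * d * β) * b i := by simp only [Matrix.mul_assoc]
      have e2 := c6 i _ ⟨d, hd, rfl⟩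
      rw [← e1] at e2
      exact e2 h
    · have e1 : a' i * α' * d * (β' * b' i) = a' i * (α' * d * β') * b' i := by
        simp only [Matrix.mul_assoc]
      have e2 := c6' i _ ⟨d, hd, rfl⟩
      rw [← e1] at e2
      exact e2 h

/-- In a matrix algebra without idempotents, all elements are sums of scalars and
elements of a nilpotent space. -/
theorem exists_scalar_of_corner [IsAlgClosed F] {l s p : ℕ} (hs : s ≠ 0)
    {D : Subalgebra F (Matrix (Fin l) (Fin l) F)}
    {α : Matrix (Fin s) (Fin l) F} {β : Matrix (Fin l) (Fin s) F} (h : α * β = 1) (hD : β * α ∈ D)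
    (hi : ∀ d ∈ D, IsIdempotentElem (α * d * β) → α * d * β = 0 ∨ α * d * β = 1)
    (d : Fin p → Matrix (Fin l) (Fin l) F) (hd : ∀ j, d j ∈ D) :
    ∃ c : Fin p → F, ∀ t : Fin p → F, (∑ j, t j • (α * d j * β - Matrix.scalar (Fin s) (c j))) ^ s = 0 := by
  have : Nonempty (Fin s) := ⟨⟨0, Nat.pos_of_ne_zero hs⟩⟩
  let E := D.corner α β h hD
  have hE : ∀ e : E, IsIdempotentElem e → e = 0 ∨ e = 1 := by
    rintro ⟨_, d, hd, rfl⟩ he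
    rcases hi d hd (congrArg Subtype.val he) with h0 | h0
    · exact Or.inl (Subtype.ext h0)
    · exact Or.inr (Subtype.ext h0)
  choose c hc using fun j => exists_isNilpotent_sub_algebraMap (F := F) hE
    (⟨α * d j * β, d j, hd j, rfl⟩ : E)
  refine ⟨c, fun t => ?_⟩
  have hnil : IsNilpotent (∑ j, t j • ((⟨α * d j * β, d j, hd j, rfl⟩ : E) - algebraMap F E (c j))) := by
    refine Finset.sum_induction _ IsNilpotent (fun a b => isNilpotent_add_of_idempotents F hE)
      IsNilpotent.zero fun j _ => ?_
    exact (hc j).smul _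
  have := hnil.map E.val
  rw [map_sum] at this
  have h2 : ∑ j, E.val (t j • ((⟨α * d j * β, d j, hd j, rfl⟩ : E) - algebraMap F E (c j))) =
      ∑ j, t j • (α * d j * β - Matrix.scalar (Fin s) (c j)) := Finset.sum_congr rfl fun j _ => by
    rw [map_smul, map_sub, AlgHom.commutes]
    rfl
  rw [h2] at this
  -- Nilpotent matrices of size `s` have characteristic polynomial X^s. The exponent `s`,
  -- independent of the matrix, turns nilpotency into an equation that can be specialized.
  have hc := (Matrix.isNilpotent_charpoly_sub_pow_of_isNilpotent this).eq_zero
  have hCH := Matrix.aeval_self_charpoly (∑ j, t j • (α * d j * β - Matrix.scalar (Fin s) (c j)))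
  rwa [sub_eq_zero.1 hc, map_pow, Polynomial.aeval_X, Fintype.card_fin] at hCH

end PrimitiveSplitting



/-! ### Generic decomposition of families -/

namespace SeriesRep

open MvPowerSeries

variable {k X R R' : Type u} [Field k] [CommRing X] [Algebra (PS k) X] [CommRing R] [Algebra k R]
  [CommRing R'] [Algebra k R'] {l s : ℕ}

/-- The subrepresentation cut out by a split idempotent. -/
noncomputable def compress (ρ : SeriesRep k X R l) (α : Matrix (Fin s) (Fin l) (PS R))
    (β : Matrix (Fin l) (Fin s) (PS R)) (h : α * β = 1)
    (hc : ∀ x, β * α * ρ.toRingHom x = ρ.toRingHom x * (β * α)) : SeriesRep k X R s where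
  toRingHom :=
    { toFun := fun x => α * ρ.toRingHom x * β
      map_one' := by rw [map_one, Matrix.mul_one, h]
      map_zero' := by rw [map_zero, Matrix.mul_zero, Matrix.zero_mul]
      map_add' := fun x y => by rw [map_add, Matrix.mul_add, Matrix.add_mul]
      map_mul' := fun x y => by
        calc α * ρ.toRingHom (x * y) * β = (α * β) * (α * ρ.toRingHom (x * y) * β) := by
              rw [h, Matrix.one_mul]
          _ = α * (β * α * ρ.toRingHom x) * ρ.toRingHom y * β := by
              rw [map_mul]; simp only [Matrix.mul_assoc]
          _ = _ := by rw [hc]; simp only [Matrix.mul_assoc] }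
  toRingHom_algebraMap t := by
    change α * ρ.toRingHom _ * β = _
    rw [ρ.toRingHom_algebraMap, Matrix.scalar_apply, Matrix.scalar_apply, ← Matrix.smul_one_eq_diagonal,
      Matrix.mul_smul, Matrix.mul_one, Matrix.smul_mul, h, Matrix.smul_one_eq_diagonal]

theorem compress_toRingHom_apply (ρ : SeriesRep k X R l) (α : Matrix (Fin s) (Fin l) (PS R))
    (β : Matrix (Fin l) (Fin s) (PS R)) (h : α * β = 1)
    (hc : ∀ x, β * α * ρ.toRingHom x = ρ.toRingHom x * (β * α)) (x : X) :
    (ρ.compress α β h hc).toRingHom x = α * ρ.toRingHom x * β := rfl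

theorem mul_compress_left (ρ : SeriesRep k X R l) (α : Matrix (Fin s) (Fin l) (PS R))
    (β : Matrix (Fin l) (Fin s) (PS R)) (h : α * β = 1)
    (hc : ∀ x, β * α * ρ.toRingHom x = ρ.toRingHom x * (β * α)) (x : X) :
    α * ρ.toRingHom x = (ρ.compress α β h hc).toRingHom x * α := by
  rw [compress_toRingHom_apply]
  calc α * ρ.toRingHom x = α * β * α * ρ.toRingHom x := by rw [h, Matrix.one_mul]
    _ = α * (β * α * ρ.toRingHom x) := by simp only [Matrix.mul_assoc]
    _ = _ := by rw [hc]; simp only [Matrix.mul_assoc]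

theorem mul_compress_right (ρ : SeriesRep k X R l) (α : Matrix (Fin s) (Fin l) (PS R))
    (β : Matrix (Fin l) (Fin s) (PS R)) (h : α * β = 1)
    (hc : ∀ x, β * α * ρ.toRingHom x = ρ.toRingHom x * (β * α)) (x : X) :
    β * (ρ.compress α β h hc).toRingHom x = ρ.toRingHom x * β := by
  rw [compress_toRingHom_apply]
  calc β * (α * ρ.toRingHom x * β) = (β * α * ρ.toRingHom x) * β := by simp only [Matrix.mul_assoc]
    _ = ρ.toRingHom x * β * (α * β) := by rw [hc]; simp only [Matrix.mul_assoc]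
    _ = _ := by rw [h, Matrix.mul_one]

theorem ext_toRingHom {ρ τ : SeriesRep k X R l} (h : ∀ x, ρ.toRingHom x = τ.toRingHom x) : ρ = τ := by
  cases ρ
  cases τ
  congr
  exact RingHom.ext h

/-- Constant coefficients of a rectangular matrix. -/
noncomputable abbrev const {m n : Type*} (A : Matrix m n (PS R)) : Matrix m n R :=
  A.map (constantCoeff (σ := Fin 2) (R := R))

theorem const_mul {m n o : Type*} [Fintype n] (A : Matrix m n (PS R)) (B : Matrix n o (PS R)) :
    const (A * B) = const A * const B := Matrix.map_mul

/-- Split idempotents lift from constant terms to endomorphisms. -/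
theorem exists_split_lift (ρ : SeriesRep k X R l) {a : Matrix (Fin s) (Fin l) R}
    {b : Matrix (Fin l) (Fin s) R} (h : a * b = 1) (hD : b * a ∈ ρ.constEnd) :
    ∃ (α : Matrix (Fin s) (Fin l) (PS R)) (β : Matrix (Fin l) (Fin s) (PS R)), α * β = 1 ∧
      (∀ x, β * α * ρ.toRingHom x = ρ.toRingHom x * (β * α)) ∧ const α = a ∧ const β = b := by
  obtain ⟨A, hA, hAc⟩ := hD
  have hid : IsIdempotentElem (PS.constMat A) := by
    rw [hAc]
    change b * a * (b * a) = b * a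
    rw [Matrix.mul_assoc, ← Matrix.mul_assoc a, h, Matrix.one_mul]
  obtain ⟨e, he, hec, hcomm⟩ := PS.exists_isIdempotentElem_lift hid
  have hec' : const e = b * a := hec.trans hAc
  have he2 : ∀ x, e * ρ.toRingHom x = ρ.toRingHom x * e := fun x => ((hcomm _ (hA x).symm).eq).symm
  let a' : Matrix (Fin s) (Fin l) (PS R) := a.map (C : R →+* PS R)
  let b' : Matrix (Fin l) (Fin s) (PS R) := b.map (C : R →+* PS R)
  have ha' : const a' = a := Matrix.ext fun i j => constantCoeff_C (σ := Fin 2) (a i j)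
  have hb' : const b' = b := Matrix.ext fun i j => constantCoeff_C (σ := Fin 2) (b i j)
  -- The constant term of `v` is 1, so `v` has an inverse `w`, and `α = w a' e`, `β = e b'` satisfy
  -- `α β = 1`.
  let v := a' * e * b'
  have hv : const v = 1 := by
    rw [const_mul, const_mul, ha', hb', hec', Matrix.mul_assoc, Matrix.mul_assoc b, h, Matrix.mul_one, h]
  have hvu : IsUnit v := PS.isUnit_of_isUnit_constMat (by
    have : PS.constMat v = 1 := hv
    rw [this]
    exact isUnit_one)
  obtain ⟨w, hw⟩ := hvu.exists_left_inv
  have hwc : const w = 1 := by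
    have := congrArg const hw
    rw [const_mul, hv, Matrix.mul_one] at this
    rw [this]
    exact map_one PS.constMat
  have hαβ : w * a' * e * (e * b') = 1 := by
    calc w * a' * e * (e * b') = w * (a' * (e * e) * b') := by simp only [Matrix.mul_assoc]
      _ = 1 := by rw [he.eq]; exact hw
  have hα : const (w * a' * e) = a := by
    rw [const_mul, const_mul, hwc, ha', hec', Matrix.one_mul, ← Matrix.mul_assoc, h, Matrix.one_mul]
  have hβ : const (e * b') = b := by
    rw [const_mul, hb', hec', Matrix.mul_assoc, h, Matrix.mul_one]
  refine ⟨w * a' * e, e * b', hαβ, fun x => ?_, hα, hβ⟩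
  -- The product `p = β α` is an idempotent with `e p = p e = p`, so `e − p` is idempotent. Its
  -- constant term is zero, whence `p = e`.
  have hp : e * b' * (w * a' * e) = e := by
    obtain ⟨p, hp⟩ : ∃ p, p = e * b' * (w * a' * e) := ⟨_, rfl⟩
    have h1 : e * p = p := by
      calc e * p = e * e * b' * (w * a' * e) := by rw [hp]; simp only [Matrix.mul_assoc]
        _ = p := by rw [he.eq, hp]
    have h2 : p * e = p := by
      calc p * e = e * b' * (w * a' * (e * e)) := by rw [hp]; simp only [Matrix.mul_assoc]
        _ = p := by rw [he.eq, hp]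
    have h3 : p * p = p := by
      calc p * p = e * b' * (w * a' * e * (e * b')) * (w * a' * e) := by
            rw [hp]; simp only [Matrix.mul_assoc]
        _ = p := by rw [hαβ, Matrix.mul_one, hp]
    have h4 : IsIdempotentElem (e - p) := by
      change (e - p) * (e - p) = e - p
      rw [sub_mul, mul_sub, mul_sub, he.eq, h1, h2, h3]
      abel
    have h5 : PS.constMat (e - p) = 0 := by
      rw [map_sub, sub_eq_zero]
      change const e = const p
      rw [hp, const_mul, hα, hβ, hec']
    rw [← hp]
    exact (sub_eq_zero.1 (PS.eq_zero_of_isIdempotentElem h4 h5)).symm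
  rw [hp, he2]

/-- The endomorphisms of the fibres lift, outside a proper closed subset of the curve. -/
theorem exists_commutant_lift [Module.Finite (PS k) X] [IsDedekindDomain R] (ρ : SeriesRep k X R l) :
    ∃ g : R, g ≠ 0 ∧ ∀ ε : R →ₐ[k] k, ε g ≠ 0 → ∀ A : Matrix (Fin l) (Fin l) (PS k),
      (∀ x, A * (ρ.map ε).toRingHom x = (ρ.map ε).toRingHom x * A) →
      ∃ A' : Matrix (Fin l) (Fin l) (PS R), (∀ x, A' * ρ.toRingHom x = ρ.toRingHom x * A') ∧
        A'.map (MvPowerSeries.map (ε : R →+* k)) = A := by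
  obtain ⟨t, b, hb⟩ := Module.Finite.exists_fin (R := PS k) (M := X)
  let M : (Fin l × Fin l → PS R) → Matrix (Fin l) (Fin l) (PS R) := fun w => Matrix.of fun i j => w (i, j)
  -- The commutant is the kernel of one matrix: it is enough to commute with finitely many
  -- generators of `X` as a module over the power series.
  let T : (Fin l × Fin l → PS R) →ₗ[PS R] (Fin t × Fin l × Fin l → PS R) :=
    { toFun := fun w q => (M w * ρ.toRingHom (b q.1) - ρ.toRingHom (b q.1) * M w) q.2.1 q.2.2
      map_add' := fun w w' => by
        funext q
        have : M (w + w') = M w + M w' := rfl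
        simp only [this, Matrix.add_mul, Matrix.mul_add, Matrix.sub_apply, Matrix.add_apply, Pi.add_apply]
        ring
      map_smul' := fun c w => by
        funext q
        have : M (c • w) = c • M w := rfl
        simp only [this, Matrix.smul_mul, Matrix.mul_smul, Matrix.sub_apply, Matrix.smul_apply,
          Pi.smul_apply, RingHom.id_apply, smul_sub] }
  have hT : ∀ w, T w = 0 ↔ ∀ x, M w * ρ.toRingHom x = ρ.toRingHom x * M w := fun w => by
    refine ⟨fun h x => ?_, fun h => funext fun q => ?_⟩
    · have hx : x ∈ Submodule.span (PS k) (Set.range b) := hb ▸ trivial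
      refine Submodule.span_induction ?_ (by simp) ?_ ?_ hx
      · rintro _ ⟨i, rfl⟩
        rw [← sub_eq_zero]
        refine Matrix.ext fun j j' => ?_
        exact congrFun h (i, j, j')
      · intro x y _ _ hx hy
        rw [map_add, mul_add, hx, hy, add_mul]
      · intro c x _ hx
        rw [Algebra.smul_def, map_mul, ρ.toRingHom_algebraMap, ← mul_assoc,
          ← (Matrix.scalar_commute _ (fun _ => Commute.all _ _) (M w)).eq, mul_assoc, hx, mul_assoc]
    · change (M w * ρ.toRingHom (b q.1) - ρ.toRingHom (b q.1) * M w) q.2.1 q.2.2 = 0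
      rw [h, sub_self, Matrix.zero_apply]
  obtain ⟨g, hg, H⟩ := exists_kernel_lift (k := k) T
  refine ⟨g, hg, fun ε hε A hA => ?_⟩
  have hsurj : ∀ i j, ∃ f : PS R, MvPowerSeries.map (ε : R →+* k) f = A i j := fun i j =>
    ⟨MvPowerSeries.map (algebraMap k R) (A i j), by
      rw [MvPowerSeries.map_map, AlgHom.comp_algebraMap, Algebra.algebraMap_self, MvPowerSeries.map_id,
        RingHom.id_apply]⟩
  choose f hf using hsurj
  have hM : ∀ w : Fin l × Fin l → PS R, (∀ q, MvPowerSeries.map (ε : R →+* k) (w q) = A q.1 q.2) →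
      (M w).map (MvPowerSeries.map (ε : R →+* k)) = A := fun w hw => by
    ext1 i j
    exact hw (i, j)
  let w₀ : Fin l × Fin l → PS R := fun q => f q.1 q.2
  have h1 : (M w₀).map (MvPowerSeries.map (ε : R →+* k)) = A := hM w₀ fun q => hf _ _
  have hw₀ : ∀ q, MvPowerSeries.map (ε : R →+* k) (T w₀ q) = 0 := fun q => by
    have hTq : T w₀ q = (M w₀ * ρ.toRingHom (b q.1)) q.2.1 q.2.2 - (ρ.toRingHom (b q.1) * M w₀) q.2.1 q.2.2 :=
      rfl
    have h2 := hA (b q.1)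
    rw [← h1, map_toRingHom_apply, ← Matrix.map_mul, ← Matrix.map_mul] at h2
    have h3 := congrFun (congrFun h2 q.2.1) q.2.2
    rw [Matrix.map_apply, Matrix.map_apply] at h3
    rw [hTq, map_sub, h3, sub_self]
  obtain ⟨w, hw, hwf⟩ := H ε hε w₀ hw₀
  exact ⟨M w, (hT w).1 hw, hM w fun q => (hwf q).trans (hf _ _)⟩

end SeriesRep



theorem IsIndecomposableModule.of_idempotents {X N : Type u} [CommRing X] [AddCommGroup N] [Module X N]
    [Nontrivial N] (h : ∀ e : Module.End X N, IsIdempotentElem e → e = 0 ∨ e = 1) :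
    IsIndecomposableModule X N := by
  refine ⟨inferInstance, fun p q hpq => ?_⟩
  have hid : IsIdempotentElem (Submodule.projection p q hpq : Module.End X N) :=
    Submodule.isIdempotentElem_projection hpq
  have hr : LinearMap.range (Submodule.projection p q hpq) = p := Submodule.range_projection hpq
  have hk : LinearMap.ker (Submodule.projection p q hpq) = q := Submodule.ker_projection hpq
  rcases h _ hid with h0 | h0
  · left
    rw [← hr, h0]
    exact LinearMap.range_zero
  · right
    rw [← hk, h0]
    exact LinearMap.ker_id

namespace SeriesRep

open MvPowerSeries

section

variable {k X R R' : Type u} [Field k] [CommRing X] [Algebra (PS k) X] [CommRing R] [Algebra k R]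
  [CommRing R'] [Algebra k R'] {l : ℕ}

theorem map_mem_constEnd {ρ : SeriesRep k X R l} (φ : R →ₐ[k] R') {d : Matrix (Fin l) (Fin l) R}
    (hd : d ∈ ρ.constEnd) : d.map φ ∈ (ρ.map φ).constEnd := by
  obtain ⟨A, hA, rfl⟩ := hd
  refine ⟨A.map (MvPowerSeries.map (φ : R →+* R')), fun x => ?_, ?_⟩
  · rw [map_toRingHom_apply, ← Matrix.map_mul, ← Matrix.map_mul, hA]
  · refine Matrix.ext fun i j => ?_
    exact MvPowerSeries.constantCoeff_map (φ : R →+* R') (A i j)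

/-- Matrices whose constant terms are of the form `scalar + nilpotent` have no nontrivial idempotents. -/
theorem isIndecomposable_of_const {s : ℕ} (hs : s ≠ 0) (τ : SeriesRep k X k s)
    (h : ∀ A : Matrix (Fin s) (Fin s) (PS k), (∀ x, A * τ.toRingHom x = τ.toRingHom x * A) →
      ∃ c : k, (const A - Matrix.scalar (Fin s) c) ^ s = 0) : IsIndecomposableModule X τ.V := by
  have : Nonempty (Fin s) := ⟨⟨0, Nat.pos_of_ne_zero hs⟩⟩
  have : Nontrivial τ.V := inferInstanceAs (Nontrivial (Fin s → PS k))
  refine IsIndecomposableModule.of_idempotents fun e he => ?_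
  obtain ⟨A, hA, hc⟩ := exists_matrix e
  have hAA : A * A = A := Matrix.mulVec_injective (funext fun v => by
    let v' : τ.V := v
    have h1 := LinearMap.congr_fun he v'
    rw [Module.End.mul_apply, hA, hA] at h1
    exact (Matrix.mulVec_mulVec v A A).symm.trans h1)
  have h0 : A = 0 → e = 0 := fun h => LinearMap.ext fun v => (hA v).trans (by
    rw [h]; exact Matrix.zero_mulVec _)
  have h1 : A = 1 → e = 1 := fun h => LinearMap.ext fun v => (hA v).trans (by
    rw [h]; exact Matrix.one_mulVec _)
  have key : ∀ A : Matrix (Fin s) (Fin s) (PS k), A * A = A → IsNilpotent (const A) → A = 0 :=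
    fun A hA hn => by
      refine PS.eq_zero_of_isIdempotentElem hA ?_
      have hB : IsIdempotentElem (const A) := (const_mul A A).symm.trans (congrArg const hA)
      obtain ⟨m, hm⟩ := hn
      have := hB.pow_succ_eq m
      rw [pow_succ, hm, zero_mul] at this
      exact this.symm
  obtain ⟨c, hcn⟩ := h A hc
  set B := const A with hB
  have hBB : B * B = B := (const_mul A A).symm.trans (congrArg const hAA)
  -- For idempotent `B` one has `c² − c = (B − c)(1 − B − c)`, and the first factor is nilpotent. So
  -- `c` is 0 or 1, and `B` or `1 − B` is nilpotent.
  have hcc : IsNilpotent ((c * c - c)) := by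
    have hcomm : Commute (Matrix.scalar (Fin s) c) B := Matrix.scalar_commute _ (fun _ => Commute.all _ _) _
    have h2 : Matrix.scalar (Fin s) (c * c - c) =
        (B - Matrix.scalar (Fin s) c) * (1 - B - Matrix.scalar (Fin s) c) := by
      rw [map_sub, map_mul, sub_mul, mul_sub, mul_sub, mul_sub, mul_sub, mul_one, mul_one, hBB, ← hcomm.eq]
      abel
    have h3 : Commute (B - Matrix.scalar (Fin s) c) (1 - B - Matrix.scalar (Fin s) c) := by
      refine Commute.sub_left ?_ ?_
      · exact Commute.sub_right (Commute.sub_right (Commute.one_right _) (Commute.refl _)) hcomm.symm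
      · exact Commute.sub_right (Commute.sub_right (Commute.one_right _) hcomm) (Commute.refl _)
    have h4 : IsNilpotent (Matrix.scalar (Fin s) (c * c - c)) := by
      rw [h2]
      exact h3.isNilpotent_mul_right ⟨s, hcn⟩
    obtain ⟨m, hm⟩ := h4
    refine ⟨m, ?_⟩
    rw [← map_pow] at hm
    exact Matrix.scalar_inj.1 (hm.trans (map_zero _).symm)
  have hc01 : c * (c - 1) = 0 := by
    rw [mul_sub, mul_one]
    exact hcc.eq_zero
  rcases mul_eq_zero.1 hc01 with hc0 | hc1
  · left
    refine h0 (key A hAA ⟨s, ?_⟩)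
    rwa [hc0, map_zero, sub_zero] at hcn
  · right
    refine h1 (sub_eq_zero.1 (key (1 - A) (IsIdempotentElem.one_sub hAA) ⟨s, ?_⟩)).symm
    have h5 : const (1 - A) = 1 - B := (map_sub PS.constMat 1 A).trans (by rw [map_one]; rfl)
    rw [sub_eq_zero.1 hc1, map_one, ← neg_sub, neg_pow] at hcn
    rw [h5]
    rcases neg_one_pow_eq_or (Matrix (Fin s) (Fin s) k) s with h6 | h6
    · rwa [h6, one_mul] at hcn
    · rwa [h6, neg_one_mul, neg_eq_zero] at hcn

end

variable {k X R : Type u} [Field k] [CommRing X] [IsDomain X] [IsLocalRing X] [Algebra k X]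
  [Algebra (PS k) X] [SurfaceOver k X] {l : ℕ}

theorem exists_equiv_of_isSummand (τ : SeriesRep k X k l) {ι : Type} [Fintype ι] {s : ι → ℕ}
    (a : ∀ i, Matrix (Fin (s i)) (Fin l) (PS k)) (b : ∀ i, Matrix (Fin l) (Fin (s i)) (PS k))
    (hab : ∀ i, a i * b i = 1)
    (hc : ∀ i x, b i * a i * τ.toRingHom x = τ.toRingHom x * (b i * a i))
    (hsum : ∑ i, const (b i) * const (a i) = 1)
    (hi : ∀ i, IsIndecomposableModule X (τ.compress (a i) (b i) (hab i) (hc i)).V)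
    {N : Type u} [AddCommGroup N] [Module X N] (hN : IsMaximalCohenMacaulay X N)
    (hNi : IsIndecomposableModule X N) (h : IsSummand X N τ.V) :
    ∃ i, Nonempty (N ≃ₗ[X] (τ.compress (a i) (b i) (hab i) (hc i)).V) := by
  have := hNi.isLocalRing_end k hN
  have := hNi.1
  have ha : ∀ i x, a i * τ.toRingHom x = (τ.compress (a i) (b i) (hab i) (hc i)).toRingHom x * a i :=
    fun i x => mul_compress_left _ _ _ _ _ x
  have hb : ∀ i x, b i * (τ.compress (a i) (b i) (hab i) (hc i)).toRingHom x = τ.toRingHom x * b i :=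
    fun i x => mul_compress_right _ _ _ _ _ x
  have hAu : IsUnit (∑ i, b i * a i) := PS.isUnit_of_isUnit_constMat (by
    rw [map_sum]
    have : ∑ i, PS.constMat (b i * a i) = 1 := by
      rw [← hsum]
      exact Finset.sum_congr rfl fun i _ => const_mul _ _
    rw [this]
    exact isUnit_one)
  have hAc : ∀ x, (∑ i, b i * a i) * τ.toRingHom x = τ.toRingHom x * ∑ i, b i * a i := fun x => by
    rw [Finset.sum_mul, Finset.mul_sum]
    exact Finset.sum_congr rfl fun i _ => hc i x
  obtain ⟨U, hU⟩ := isUnit_linearOfMatrix hAc hAu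
  have hUsum : (U : Module.End X τ.V) = ∑ i, linearOfMatrix (b i) (hb i) ∘ₗ linearOfMatrix (a i) (ha i) := by
    rw [hU]
    refine LinearMap.ext fun v => ?_
    rw [LinearMap.sum_apply]
    have : ∀ v : Fin l → PS k, (∑ i, b i * a i).mulVec v = ∑ i, (b i).mulVec ((a i).mulVec v) := fun v => by
      rw [Matrix.sum_mulVec]
      exact Finset.sum_congr rfl fun i _ => (Matrix.mulVec_mulVec _ _ _).symm
    exact this v
  obtain ⟨i, p, hip⟩ := h
  obtain ⟨j, -, hj⟩ := exists_isSummand_of_sum (X := X) (N := N) Finset.univ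
    (fun i => (τ.compress (a i) (b i) (hab i) (hc i)).V)
    (fun j => linearOfMatrix (a j) (ha j) ∘ₗ (↑U⁻¹ : Module.End X τ.V) ∘ₗ i)
    (fun j => p ∘ₗ linearOfMatrix (b j) (hb j)) (by
      have : (∑ j, (p ∘ₗ linearOfMatrix (b j) (hb j)) ∘ₗ
          (linearOfMatrix (a j) (ha j) ∘ₗ (↑U⁻¹ : Module.End X τ.V) ∘ₗ i)) = LinearMap.id := by
        refine LinearMap.ext fun n => ?_
        have h1 := LinearMap.congr_fun hUsum ((↑U⁻¹ : Module.End X τ.V) (i n))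
        rw [← Module.End.mul_apply, U.mul_inv, Module.End.one_apply, LinearMap.sum_apply] at h1
        have h2 := congrArg p h1
        rw [map_sum] at h2
        rw [LinearMap.sum_apply]
        exact h2.symm.trans (LinearMap.congr_fun hip n)
      rw [this]
      exact isUnit_one)
  exact ⟨j, hj.nonempty_equiv (hi j)⟩

end SeriesRep



theorem exists_span_fin {R M Ω W : Type*} [CommRing R] [AddCommGroup M] [Module R M]
    [IsNoetherian R M] [CommRing Ω] [AddCommGroup W] [Module Ω W] [Algebra R Ω] [Module R W]
    [IsScalarTower R Ω W] (D : Submodule R M) (φ : M →ₗ[R] W) :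
    ∃ (p : ℕ) (d : Fin p → M), (∀ j, d j ∈ D) ∧ (∀ m ∈ D, ∃ r : Fin p → R, m = ∑ j, r j • d j) ∧
      ∀ w ∈ Submodule.span Ω (φ '' D), ∃ t : Fin p → Ω, w = ∑ j, t j • φ (d j) := by
  obtain ⟨p, d, hd⟩ := Submodule.fg_iff_exists_fin_generating_family.1 (IsNoetherian.noetherian D)
  have h : ∀ m ∈ D, ∃ r : Fin p → R, m = ∑ j, r j • d j := fun m hm => by
    rw [← hd] at hm
    obtain ⟨r, hr⟩ := (Submodule.mem_span_range_iff_exists_fun R).1 hm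
    exact ⟨r, hr.symm⟩
  refine ⟨p, d, fun j => hd ▸ Submodule.subset_span ⟨j, rfl⟩, h, fun w hw => ?_⟩
  have hle : Submodule.span Ω (φ '' D) ≤ Submodule.span Ω (Set.range fun j => φ (d j)) := by
    refine Submodule.span_le.2 ?_
    rintro _ ⟨m, hm, rfl⟩
    obtain ⟨r, rfl⟩ := h m hm
    rw [map_sum]
    refine Submodule.sum_mem _ fun j _ => ?_
    rw [map_smul, ← algebraMap_smul Ω]
    exact Submodule.smul_mem _ _ (Submodule.subset_span ⟨j, rfl⟩)
  obtain ⟨t, ht⟩ := (Submodule.mem_span_range_iff_exists_fun Ω).1 (hle hw)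
  exact ⟨t, ht.symm⟩

namespace SeriesRep

open MvPowerSeries

/-- The subalgebra over an extension spanned by a matrix algebra. -/
theorem exists_extension_subalgebra {R Ω : Type*} [CommRing R] [CommRing Ω] [Algebra R Ω] {l : ℕ}
    (D : Subalgebra R (Matrix (Fin l) (Fin l) R)) : ∃ DΩ : Subalgebra Ω (Matrix (Fin l) (Fin l) Ω),
      (∀ d ∈ D, d.map (algebraMap R Ω) ∈ DΩ) ∧
      ∀ w ∈ DΩ, w ∈ Submodule.span Ω ((fun d : Matrix (Fin l) (Fin l) R => d.map (algebraMap R Ω)) '' D) := by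
  let φ : Matrix (Fin l) (Fin l) R →+* Matrix (Fin l) (Fin l) Ω := (algebraMap R Ω).mapMatrix
  let S : Submonoid (Matrix (Fin l) (Fin l) Ω) := D.toSubsemiring.toSubmonoid.map (φ : _ →* _)
  refine ⟨Algebra.adjoin Ω (S : Set _), fun d hd => Algebra.subset_adjoin
    (show φ d ∈ (S : Set _) from ⟨d, hd, rfl⟩), fun w hw => ?_⟩
  have : w ∈ Subalgebra.toSubmodule (Algebra.adjoin Ω (S : Set (Matrix (Fin l) (Fin l) Ω))) := hw
  rw [Algebra.adjoin_eq_span, Submonoid.closure_eq] at this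
  exact this

variable {k X R : Type u} [Field k] [IsAlgClosed k] [CommRing X] [IsDomain X] [IsLocalRing X] [Algebra k X]
  [Algebra (PS k) X] [SurfaceOver k X] [CommRing R] [Algebra k R] [IsDedekindDomain R]
  [Algebra.FiniteType k R] {l : ℕ}

/-- Outside finitely many points of the curve and after a covering, the indecomposable
summands of the fibres of a family are the fibres of finitely many families. -/
theorem exists_generic_decomposition (hR : ¬ IsField R) (ρ : SeriesRep k X R l) :
    ∃ (ι : Type) (_ : Fintype ι) (R' : Type u) (_ : CommRing R') (_ : Algebra k R') (s : ι → ℕ)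
      (ρ' : ∀ i, SeriesRep k X R' (s i)) (g : R), Fintype.card ι ≤ l ∧ Algebra.FiniteType k R' ∧
      IsDedekindDomain R' ∧ ¬ IsField R' ∧ g ≠ 0 ∧ ∀ ε : R →ₐ[k] k, ε g ≠ 0 → ∃ ε' : R' →ₐ[k] k,
        ∀ (N : Type u) [AddCommGroup N] [Module X N], IsMaximalCohenMacaulay X N →
          IsIndecomposableModule X N → IsSummand X N (ρ.map ε).V →
          ∃ i, Nonempty (N ≃ₗ[X] ((ρ' i).map ε').V) := by
  classical
  have : Module.Finite (PS k) X := SurfaceOver.finite (k := k)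
  -- The decomposition is made at the geometric generic point, where primitive idempotents have
  -- corners consisting of scalars plus nilpotents.
  let Ω := AlgebraicClosure (FractionRing R)
  have : FaithfulSMul R Ω := FaithfulSMul.trans R (FractionRing R) Ω
  have : Algebra.IsAlgebraic R (FractionRing R) := IsLocalization.isAlgebraic (S := FractionRing R) R⁰
  have : Algebra.IsAlgebraic R Ω := Algebra.IsAlgebraic.trans R (FractionRing R) Ω
  obtain ⟨DΩ, hD1, hD2⟩ := exists_extension_subalgebra (Ω := Ω) ρ.constEnd
  let φ : Matrix (Fin l) (Fin l) R →ₗ[R] Matrix (Fin l) (Fin l) Ω := (Algebra.linearMap R Ω).mapMatrix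
  have : IsNoetherian R (Matrix (Fin l) (Fin l) R) := isNoetherian_of_isNoetherianRing_of_finite R _
  obtain ⟨p, d, hdD, hdspan, hdΩ⟩ := exists_span_fin (Ω := Ω) (Subalgebra.toSubmodule ρ.constEnd) φ
  obtain ⟨ι, _, s, α, β, hcard, hs0, hαβ, hβα, hsum, hprim⟩ := exists_primitive_splitting DΩ
  choose c hc using fun i => hdΩ _ (hD2 _ (hβα i))
  choose e he using fun i => exists_scalar_of_corner (hs0 i) (hαβ i) (hβα i) (hprim i)
    (fun j => φ (d j)) (fun j => hD1 _ (hdD j))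
  -- All data of the splitting: the entries of the matrices `α`, `β`, the coefficients of the
  -- idempotents in terms of the constant endomorphisms `d`, and the eigenvalues of the `d j` on the
  -- corners.
  let T : Finset Ω :=
    (Finset.univ : Finset (Σ i, Fin (s i) × Fin l)).image (fun q => α q.1 q.2.1 q.2.2) ∪
    (Finset.univ : Finset (Σ i, Fin (s i) × Fin l)).image (fun q => β q.1 q.2.2 q.2.1) ∪
    (Finset.univ : Finset (ι × Fin p)).image (fun q => c q.1 q.2) ∪
    (Finset.univ : Finset (ι × Fin p)).image (fun q => e q.1 q.2)
  obtain ⟨R', _, _, j, i₀, h, hft, hded, hnf, hj, hT, hi₀, hh0, hH⟩ :=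
    exists_curve_extension (k := k) hR T
  have hα : ∀ i x y, ∃ z, j z = α i x y := fun i x y => hT (by
    simp only [T, Finset.coe_union, Set.mem_union, Finset.coe_image, Finset.coe_univ]
    exact Or.inl (Or.inl (Or.inl ⟨⟨i, x, y⟩, trivial, rfl⟩)))
  have hβ : ∀ i x y, ∃ z, j z = β i x y := fun i x y => hT (by
    simp only [T, Finset.coe_union, Set.mem_union, Finset.coe_image, Finset.coe_univ]
    exact Or.inl (Or.inl (Or.inr ⟨⟨i, y, x⟩, trivial, rfl⟩)))
  have hc' : ∀ i x, ∃ z, j z = c i x := fun i x => hT (by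
    simp only [T, Finset.coe_union, Set.mem_union, Finset.coe_image, Finset.coe_univ]
    exact Or.inl (Or.inr ⟨⟨i, x⟩, trivial, rfl⟩))
  have he' : ∀ i x, ∃ z, j z = e i x := fun i x => hT (by
    simp only [T, Finset.coe_union, Set.mem_union, Finset.coe_image, Finset.coe_univ]
    exact Or.inr ⟨⟨i, x⟩, trivial, rfl⟩)
  choose α₀ hα₀ using hα
  choose β₀ hβ₀ using hβ
  choose c₀ hc₀ using hc'
  choose e₀ he₀ using he'
  let α' : ∀ i, Matrix (Fin (s i)) (Fin l) R' := fun i => Matrix.of (α₀ i)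
  let β' : ∀ i, Matrix (Fin l) (Fin (s i)) R' := fun i => Matrix.of (β₀ i)
  let d' : Fin p → Matrix (Fin l) (Fin l) R' := fun q => (d q).map i₀
  have hα' : ∀ i, (α' i).map j = α i := fun i => Matrix.ext fun x y => hα₀ i x y
  have hβ' : ∀ i, (β' i).map j = β i := fun i => Matrix.ext fun x y => hβ₀ i x y
  have hd' : ∀ q, (d' q).map j = φ (d q) := fun q => Matrix.ext fun x y => hi₀ _
  have hinj : ∀ {m n : ℕ} {A B : Matrix (Fin m) (Fin n) R'}, A.map j = B.map j → A = B :=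
    fun {m n A B} h => Matrix.map_injective hj h
  have hab : ∀ i, α' i * β' i = 1 := fun i => hinj (by
    rw [Matrix.map_mul, hα', hβ', hαβ, Matrix.map_one _ (map_zero _) (map_one _)])
  have hba : ∀ i, β' i * α' i = ∑ q, c₀ i q • d' q := fun i => hinj (by
    rw [Matrix.map_mul, hα', hβ', hc]
    have := map_sum (AlgHom.mapMatrix j : Matrix (Fin l) (Fin l) R' →ₐ[k] _) (fun q => c₀ i q • d' q)
      Finset.univ
    rw [AlgHom.mapMatrix_apply] at this
    rw [this]
    refine Finset.sum_congr rfl fun q _ => ?_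
    rw [AlgHom.mapMatrix_apply, ← hd', ← hc₀]
    exact Matrix.ext fun x y => (map_mul j _ _).symm)
  have hsum' : ∑ i, β' i * α' i = 1 := hinj (by
    rw [Matrix.map_one _ (map_zero _) (map_one _), ← hsum]
    have := map_sum (AlgHom.mapMatrix j : Matrix (Fin l) (Fin l) R' →ₐ[k] _) (fun i => β' i * α' i)
      Finset.univ
    rw [AlgHom.mapMatrix_apply] at this
    rw [this]
    refine Finset.sum_congr rfl fun i _ => ?_
    rw [AlgHom.mapMatrix_apply, Matrix.map_mul, hα', hβ'])
  -- The nilpotency relations hold over `Ω` for all coefficients. As `R'` embeds in `Ω`, they hold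
  -- over `R'` and hence at every point.
  have hnil : ∀ i (t : Fin p → R'),
      (∑ q, t q • (α' i * d' q * β' i - Matrix.scalar (Fin (s i)) (e₀ i q))) ^ (s i) = 0 := fun i t => hinj (by
    have h1 : ∀ A : Matrix (Fin (s i)) (Fin (s i)) R', A.map j = AlgHom.mapMatrix j A := fun _ => rfl
    have h2 : ∀ t A, (AlgHom.mapMatrix j (t • A) : Matrix (Fin (s i)) (Fin (s i)) Ω) =
      j t • AlgHom.mapMatrix j A := fun t A => Matrix.ext fun x y => map_mul j _ _
    rw [h1, h1, map_pow, map_sum, map_zero, ← he i fun q => j (t q)]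
    congr 1
    refine Finset.sum_congr rfl fun q _ => ?_
    rw [h2, map_sub]
    congr 2
    · rw [← h1, Matrix.map_mul, Matrix.map_mul, hα', hβ', hd']
    · rw [← h1, Matrix.scalar_apply, Matrix.scalar_apply, Matrix.diagonal_map (map_zero j)]
      congr 1
      funext _
      exact he₀ i q)
  have hmem : ∀ i, β' i * α' i ∈ (ρ.map i₀).constEnd := fun i => by
    rw [hba]
    exact Subalgebra.sum_mem _ fun q _ => Subalgebra.smul_mem _ (map_mem_constEnd i₀ (hdD q)) _
  choose a b hab' hcomm hac hbc using fun i => (ρ.map i₀).exists_split_lift (hab i) (hmem i)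
  -- Where `g` does not vanish no new endomorphisms appear in the fibres, so information at the
  -- generic point determines the endomorphisms of the fibres.
  obtain ⟨g, hg, hG⟩ := exists_commutant_lift ρ
  refine ⟨ι, inferInstance, R', inferInstance, inferInstance, s,
    fun i => (ρ.map i₀).compress (a i) (b i) (hab' i) (hcomm i), g * h, hcard, hft, hded, hnf,
    mul_ne_zero hg hh0, fun ε hε => ?_⟩
  rw [map_mul] at hε
  obtain ⟨ε', rfl⟩ := hH ε (right_ne_zero_of_mul hε)
  refine ⟨ε', fun N _ _ hN hNi hsumm => ?_⟩
  rw [← map_map] at hsumm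
  let μ := MvPowerSeries.map (σ := Fin 2) (ε' : R' →+* k)
  have hab2 : ∀ i, (a i).map μ * (b i).map μ = 1 := fun i => by
    rw [← Matrix.map_mul, hab', Matrix.map_one _ (map_zero _) (map_one _)]
  have hcomm2 : ∀ i x, (b i).map μ * (a i).map μ * ((ρ.map i₀).map ε').toRingHom x =
      ((ρ.map i₀).map ε').toRingHom x * ((b i).map μ * (a i).map μ) := fun i x => by
    rw [map_toRingHom_apply, ← Matrix.map_mul, ← Matrix.map_mul, hcomm, Matrix.map_mul]
  have hcm : ∀ {m n : ℕ} (A : Matrix (Fin m) (Fin n) (PS R')), const (A.map μ) = (const A).map ε' :=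
    fun A => Matrix.ext fun x y => MvPowerSeries.constantCoeff_map (ε' : R' →+* k) (A x y)
  have heq : ∀ i, ((ρ.map i₀).compress (a i) (b i) (hab' i) (hcomm i)).map ε' =
      ((ρ.map i₀).map ε').compress ((a i).map μ) ((b i).map μ) (hab2 i) (hcomm2 i) := fun i =>
    ext_toRingHom fun x => by
      rw [map_toRingHom_apply, compress_toRingHom_apply, compress_toRingHom_apply, Matrix.map_mul,
        Matrix.map_mul, map_toRingHom_apply]
      rfl
  suffices h : _ ∧ _ by
    obtain ⟨i, hiso⟩ := exists_equiv_of_isSummand ((ρ.map i₀).map ε') (fun i => (a i).map μ)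
      (fun i => (b i).map μ) hab2 hcomm2 h.1 h.2 hN hNi hsumm
    exact ⟨i, by rw [heq]; exact hiso⟩
  refine ⟨?_, ?_⟩
  · have h1 : ∀ i, const ((b i).map μ) * const ((a i).map μ) = (ε' : R' →+* k).mapMatrix (β' i * α' i) :=
      fun i => by
        rw [hcm, hcm, hac, hbc]
        exact Matrix.map_mul.symm
    simp only [h1]
    rw [← map_sum, hsum', map_one]
  · intro i
    refine isIndecomposable_of_const (hs0 i) _ fun A hA => ?_
    set τ := (ρ.map i₀).map ε' with hτ
    set ak := (a i).map μ
    set bk := (b i).map μ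
    -- An endomorphism `A` of a piece extends by zero to the whole fibre and lifts to the family.
    -- Its constant term is a combination of the `d q`, so on the corner it is a scalar plus a
    -- nilpotent; hence the piece is indecomposable.
    have hA2 : ∀ x, bk * A * ak * (ρ.map (ε'.comp i₀)).toRingHom x =
        (ρ.map (ε'.comp i₀)).toRingHom x * (bk * A * ak) := fun x => by
      rw [← map_map, ← hτ]
      calc bk * A * ak * τ.toRingHom x = bk * A * (ak * τ.toRingHom x) := by simp only [Matrix.mul_assoc]
        _ = bk * (A * (τ.compress ak bk (hab2 i) (hcomm2 i)).toRingHom x) * ak := by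
            rw [mul_compress_left τ ak bk (hab2 i) (hcomm2 i)]; simp only [Matrix.mul_assoc]
        _ = bk * (τ.compress ak bk (hab2 i) (hcomm2 i)).toRingHom x * A * ak := by
            rw [hA]; simp only [Matrix.mul_assoc]; rfl
        _ = _ := by rw [mul_compress_right]; simp only [Matrix.mul_assoc]
    obtain ⟨A', hA', hA'A⟩ := hG (ε'.comp i₀) (left_ne_zero_of_mul hε) _ hA2
    obtain ⟨r, hr⟩ := hdspan (const A') ⟨A', hA', rfl⟩
    refine ⟨ε' (∑ q, i₀ (r q) * e₀ i q), ?_⟩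
    have h1 : const (bk * A * ak) = (∑ q, i₀ (r q) • d' q).map ε' := by
      have h2 : const (bk * A * ak) = (const A').map (ε'.comp i₀) := by
        rw [← hA'A]
        exact Matrix.ext fun x y =>
          MvPowerSeries.constantCoeff_map ((ε'.comp i₀ : R →ₐ[k] k) : R →+* k) (A' x y)
      rw [h2, hr]
      refine Matrix.ext fun x y => ?_
      simp only [Matrix.map_apply, Matrix.sum_apply, Matrix.smul_apply, smul_eq_mul, AlgHom.comp_apply,
        map_sum, map_mul, d']
    have h3 : const A = (α' i * (∑ q, i₀ (r q) • d' q) * β' i).map ε' := by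
      have h4 : A = ak * (bk * A * ak) * bk := by
        calc A = ak * bk * A * (ak * bk) := by rw [hab2, Matrix.one_mul, Matrix.mul_one]
          _ = _ := by simp only [Matrix.mul_assoc]
      rw [h4, const_mul, const_mul, h1, hcm, hcm, hac, hbc, Matrix.map_mul, Matrix.map_mul]
    have h5 : const A - Matrix.scalar (Fin (s i)) (ε' (∑ q, i₀ (r q) * e₀ i q)) =
        (ε' : R' →+* k).mapMatrix
          (∑ q, i₀ (r q) • (α' i * d' q * β' i - Matrix.scalar (Fin (s i)) (e₀ i q))) := by
      have h6 : ∑ q, i₀ (r q) • (α' i * d' q * β' i - Matrix.scalar (Fin (s i)) (e₀ i q)) =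
          α' i * (∑ q, i₀ (r q) • d' q) * β' i - Matrix.scalar (Fin (s i)) (∑ q, i₀ (r q) * e₀ i q) := by
        rw [Matrix.mul_sum, Matrix.sum_mul, map_sum, ← Finset.sum_sub_distrib]
        refine Finset.sum_congr rfl fun q _ => ?_
        rw [smul_sub, Matrix.mul_smul, Matrix.smul_mul]
        congr 1
        exact Matrix.ext fun x y => by simp [Matrix.diagonal_apply]
      rw [h6, map_sub, h3]
      congr 1
      rw [RingHom.mapMatrix_apply, Matrix.scalar_apply, Matrix.scalar_apply, Matrix.diagonal_map (map_zero _)]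
      rfl
    rw [h5, ← map_pow, hnil, map_zero]

end SeriesRep



/-! ### Criterion for a family to be given by matrices -/

/-- A finitely generated module over a domain is free up to torsion. -/
theorem exists_linearIndependent_smul_eq_sum (R W : Type*) [CommRing R] [IsDomain R] [AddCommGroup W]
    [Module R W] [Module.Finite R W] :
    ∃ (l : ℕ) (w : Fin l → W) (g : R), g ≠ 0 ∧ LinearIndependent R w ∧
      ∀ m, ∃ r : Fin l → R, g • m = ∑ j, r j • w j := by
  obtain ⟨w, hw⟩ := exists_linearIndependent_of_le_finrank (R := R) (M := W) le_rfl
  have h1 : ∀ m : W, ∃ g : R, g ≠ 0 ∧ g • m ∈ Submodule.span R (Set.range w) := by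
    intro m
    by_contra! h
    have h2 : LinearIndependent R (Fin.cons m w : Fin (Module.finrank R W + 1) → W) := by
      refine hw.finCons' _ _ fun c y hy he => ?_
      by_contra hc
      refine h c hc ?_
      rw [eq_neg_of_add_eq_zero_left he]
      exact Submodule.neg_mem _ hy
    have := h2.fintype_card_le_finrank
    simp at this
  choose g hg hgm using h1
  obtain ⟨n, t, ht⟩ := Module.Finite.exists_fin (R := R) (M := W)
  refine ⟨_, w, ∏ i, g (t i), Finset.prod_ne_zero_iff.2 fun i _ => hg _, hw, fun m => ?_⟩
  have hm : m ∈ Submodule.span R (Set.range t) := ht ▸ trivial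
  suffices h : (∏ i, g (t i)) • m ∈ Submodule.span R (Set.range w) by
    obtain ⟨r, hr⟩ := (Submodule.mem_span_range_iff_exists_fun R).1 h
    exact ⟨r, hr.symm⟩
  have hle : Submodule.span R (Set.range t) ≤
      (Submodule.span R (Set.range w)).comap (LinearMap.lsmul R W (∏ i, g (t i))) := by
    refine Submodule.span_le.2 ?_
    rintro _ ⟨i, rfl⟩
    rw [SetLike.mem_coe, Submodule.mem_comap, LinearMap.lsmul_apply, ← Finset.prod_erase_mul _ _ (Finset.mem_univ i), mul_smul]
    exact Submodule.smul_mem _ _ (hgm _)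
  exact hle hm

section

open MvPowerSeries

variable {k X R : Type u} [Field k] [CommRing X] [IsDomain X] [IsLocalRing X] [Algebra k X]
  [Algebra (PS k) X] [SurfaceOver k X] [CommRing R] [Algebra k R]

theorem SurfaceOver.algebraMap_C (a : k) : algebraMap (PS k) X (C a) = algebraMap k X a := by
  have := SurfaceOver.isScalarTower (k := k) (X := X)
  rw [IsScalarTower.algebraMap_apply k (PS k) X]
  rfl

theorem SurfaceOver.bijective_of_mod {N : Type u} [AddCommGroup N] [Module X N]
    (h : IsMaximalCohenMacaulay X N) {l : ℕ} (n : Fin l → N)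
    (hs : ∀ m : N, ∃ (a : Fin l → k) (p q : N), m = ∑ j, algebraMap k X (a j) • n j +
      algebraMap (PS k) X (MvPowerSeries.X 0) • p + algebraMap (PS k) X (MvPowerSeries.X 1) • q)
    (hi : ∀ (a : Fin l → k) (p q : N), ∑ j, algebraMap k X (a j) • n j =
      algebraMap (PS k) X (MvPowerSeries.X 0) • p + algebraMap (PS k) X (MvPowerSeries.X 1) • q →
        ∀ j, a j = 0) :
    Function.Bijective (fun f : Fin l → PS k => ∑ j, algebraMap (PS k) X (f j) • n j) := by
  obtain ⟨h1, h2⟩ := (SurfaceOver.isMaximalCohenMacaulay_iff k).1 h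
  let _ : Module (PS k) N := Module.compHom N (algebraMap (PS k) X)
  have : IsScalarTower (PS k) X N := ⟨fun s x m => by
    rw [Algebra.smul_def, mul_smul]; rfl⟩
  have := SurfaceOver.finite (k := k) (X := X)
  have : Module.Finite (PS k) N := Module.Finite.trans X N
  simp only [← SurfaceOver.algebraMap_C] at hs hi
  exact ⟨injective_linearCombination_of_mod (k := k) (M := N) h2 n hi,
    surjective_linearCombination_of_mod (k := k) (M := N) n hs⟩

/-- A compatible family of coordinate functions has coefficients in the base ring. -/
theorem exists_coeff_of_recursion {M R' : Type*} {l : ℕ} [CommRing R'] [Algebra k R'] (g : R')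
    (hg : IsUnit g) (c : (R' →ₐ[k] k) → M → Fin l → PS k)
    (h : ∀ m, ∃ (r : Fin l → R') (m₁ m₂ : M), ∀ ε j, C (ε g) * c ε m j =
      C (ε (r j)) + MvPowerSeries.X 0 * c ε m₁ j + MvPowerSeries.X 1 * c ε m₂ j) (j : Fin l) :
    ∀ (n : ℕ) (d : Fin 2 →₀ ℕ), d.degree = n → ∀ m, ∃ f : R', ∀ ε : R' →ₐ[k] k,
      ε f = coeff d (c ε m j) := by
  obtain ⟨v, hv⟩ := hg.exists_right_inv
  intro n
  induction n with
  | zero =>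
    intro d hd m
    obtain ⟨r, m₁, m₂, hr⟩ := h m
    have hd0 : d = 0 := (Finsupp.degree_eq_zero_iff d).1 hd
    refine ⟨v * r j, fun ε => ?_⟩
    have e := congrArg (coeff d) (hr ε j)
    rw [map_add, map_add, PS.coeff_X_mul, PS.coeff_X_mul, coeff_C_mul, hd0] at e
    simp at e
    have hv' : ε g * ε v = 1 := by rw [← map_mul, hv, map_one]
    rw [hd0, map_mul, ← e, ← mul_assoc, mul_comm (ε v), hv', one_mul]
    rfl
  | succ n ih =>
    intro d hd m
    obtain ⟨r, m₁, m₂, hr⟩ := h m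
    -- Up to the unit `g`, a coefficient of positive degree is a sum of coefficients of `m₁` and
    -- `m₂` of degree one less.
    have key : ∀ (s : Fin 2) (m' : M), ∃ f : R', ∀ ε : R' →ₐ[k] k,
        ε f = if 1 ≤ d s then coeff (d - Finsupp.single s 1) (c ε m' j) else 0 := by
      intro s m'
      by_cases hs : 1 ≤ d s
      · obtain ⟨f, hf⟩ := ih (d - Finsupp.single s 1) (by
          have h1 : d = d - Finsupp.single s 1 + Finsupp.single s 1 :=
            (tsub_add_cancel_of_le (Finsupp.single_le_iff.2 hs)).symm
          rw [h1, map_add, Finsupp.degree_single] at hd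
          omega) m'
        exact ⟨f, fun ε => by rw [if_pos hs, hf]⟩
      · exact ⟨0, fun ε => by rw [if_neg hs, map_zero]⟩
    obtain ⟨f₁, hf₁⟩ := key 0 m₁
    obtain ⟨f₂, hf₂⟩ := key 1 m₂
    have hd0 : d ≠ 0 := by
      rintro rfl
      simp at hd
    refine ⟨v * (f₁ + f₂), fun ε => ?_⟩
    have e := congrArg (coeff d) (hr ε j)
    classical
    rw [map_add, map_add, PS.coeff_X_mul, PS.coeff_X_mul, coeff_C_mul, coeff_C, if_neg hd0, zero_add,
      ← hf₁, ← hf₂] at e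
    have hv' : ε g * ε v = 1 := by rw [← map_mul, hv, map_one]
    rw [map_mul, map_add, ← e, ← mul_assoc, mul_comm (ε v), hv', one_mul]

variable [IsDomain R] [IsAlgClosed k] [Algebra.FiniteType k R]

theorem PS.ext_algHom {f g : PS R} (h : ∀ ε : R →ₐ[k] k,
    MvPowerSeries.map (ε : R →+* k) f = MvPowerSeries.map (ε : R →+* k) g) : f = g := by
  refine MvPowerSeries.ext fun d => ?_
  rw [← sub_eq_zero]
  refine eq_zero_of_forall_algHom (k := k) fun ε => ?_
  have := congrArg (coeff d) (h ε)
  rw [coeff_map, coeff_map] at this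
  rw [map_sub, sub_eq_zero]
  exact this

/-- A family of representations whose matrix coefficients are regular functions comes from one over
the base ring. -/
theorem SeriesRep.exists_of_coeff {l : ℕ} (τ : (R →ₐ[k] k) → SeriesRep k X k l)
    (h : ∀ x i j d, ∃ f : R, ∀ ε, ε f = coeff d ((τ ε).toRingHom x i j)) :
    ∃ ρ : SeriesRep k X R l, ∀ ε, ρ.map ε = τ ε := by
  choose f hf using h
  let F : X → Matrix (Fin l) (Fin l) (PS R) := fun x => Matrix.of fun i j => fun d => f x i j d
  have hF : ∀ (ε : R →ₐ[k] k) x, (F x).map (MvPowerSeries.map (ε : R →+* k)) = (τ ε).toRingHom x :=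
    fun ε x => Matrix.ext fun i j => MvPowerSeries.ext fun d => by
      rw [Matrix.map_apply, coeff_map, ← hf]
      rfl
  -- An element of `R` that vanishes at all closed points is zero, so the axioms of a representation
  -- may be checked pointwise.
  have hext : ∀ A B : Matrix (Fin l) (Fin l) (PS R), (∀ ε : R →ₐ[k] k,
      A.map (MvPowerSeries.map (ε : R →+* k)) = B.map (MvPowerSeries.map (ε : R →+* k))) → A = B :=
    fun A B h => Matrix.ext fun i j => PS.ext_algHom (k := k) fun ε => congrFun (congrFun (h ε) i) j
  refine ⟨⟨⟨⟨⟨F, ?_⟩, ?_⟩, ?_, ?_⟩, ?_⟩, fun ε => ext_toRingHom fun x => hF ε x⟩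
  · refine hext _ _ fun ε => ?_
    rw [hF, map_one, Matrix.map_one _ (map_zero _) (map_one _)]
  · refine fun x y => hext _ _ fun ε => ?_
    change (F (x * y)).map _ = (F x * F y).map _
    rw [hF, Matrix.map_mul, hF, hF, map_mul]
  · refine hext _ _ fun ε => ?_
    change (F 0).map _ = _
    rw [hF, map_zero, Matrix.map_zero _ (map_zero _)]
  · refine fun x y => hext _ _ fun ε => ?_
    change (F (x + y)).map _ = (F x + F y).map _
    rw [hF, Matrix.map_add _ (map_add _), hF, hF, map_add]
  · refine fun s => hext _ _ fun ε => ?_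
    change (F _).map _ = _
    rw [hF, (τ ε).toRingHom_algebraMap, Matrix.scalar_apply, Matrix.scalar_apply,
      Matrix.diagonal_map (map_zero _)]
    congr 1
    funext _
    rw [MvPowerSeries.map_map, AlgHom.comp_algebraMap]

end



open MvPowerSeries in
/-- A family of Cohen-Macaulay modules over a curve is given, over an open part of the curve, by a matrix
representation. -/
theorem SeriesRep.exists_of_family {k X R M : Type u} [Field k] [IsAlgClosed k] [CommRing X] [IsDomain X]
    [IsLocalRing X] [Algebra k X] [Algebra (PS k) X] [SurfaceOver k X] [CommRing R] [Algebra k R]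
    [IsDomain R] [Algebra.FiniteType k R] [AddCommGroup M] [Module X M] [Module R M]
    [SMulCommClass X R M] {p : ℕ} (t : Fin p → M)
    (ht : ∀ m, ∃ (r : Fin p → R) (m₁ m₂ : M), m = ∑ j, r j • t j +
      algebraMap (PS k) X (MvPowerSeries.X 0) • m₁ + algebraMap (PS k) X (MvPowerSeries.X 1) • m₂)
    {g₀ : R} (hg₀ : g₀ ≠ 0) (N : (R →ₐ[k] k) → Type u) [∀ ε, AddCommGroup (N ε)] [∀ ε, Module X (N ε)]
    (σ : ∀ ε, M →ₗ[X] N ε)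
    (hN : ∀ ε : R →ₐ[k] k, ε g₀ ≠ 0 → IsMaximalCohenMacaulay X (N ε) ∧ Function.Surjective (σ ε) ∧
      (∀ (r : R) m, σ ε (r • m) = algebraMap k X (ε r) • σ ε m) ∧
      ∀ m, σ ε m = 0 → m ∈ (RingHom.ker ε) • (⊤ : Submodule R M)) :
    ∃ g : R, g ≠ 0 ∧ ∃ (l : ℕ) (ρ : SeriesRep k X (Localization.Away g) l),
      ∀ ε' : Localization.Away g →ₐ[k] k,
        Nonempty (N (ε'.comp (IsScalarTower.toAlgHom k R _)) ≃ₗ[X] (ρ.map ε').V) := by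
  set x := algebraMap (PS k) X (MvPowerSeries.X 0) with hx
  set y := algebraMap (PS k) X (MvPowerSeries.X 1) with hy
  let P : Submodule R M :=
    { carrier := {m | ∃ m₁ m₂ : M, m = x • m₁ + y • m₂}
      zero_mem' := ⟨0, 0, by simp⟩
      add_mem' := by
        rintro _ _ ⟨a, b, rfl⟩ ⟨a', b', rfl⟩
        exact ⟨a + a', b + b', by rw [smul_add, smul_add]; abel⟩
      smul_mem' := by
        rintro r _ ⟨a, b, rfl⟩
        exact ⟨r • a, r • b, by rw [smul_add, smul_comm x r a, smul_comm y r b]⟩ }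
  have hP : ∀ m, m ∈ P ↔ ∃ m₁ m₂ : M, m = x • m₁ + y • m₂ := fun _ => Iff.rfl
  have hfin : Module.Finite R (M ⧸ P) := by
    refine Module.Finite.of_surjective (Fintype.linearCombination R fun j => P.mkQ (t j)) fun w => ?_
    obtain ⟨m, rfl⟩ := P.mkQ_surjective w
    obtain ⟨r, m₁, m₂, e⟩ := ht m
    refine ⟨r, ?_⟩
    rw [Fintype.linearCombination_apply]
    simp only [← map_smul, ← map_sum]
    rw [← sub_eq_zero, ← map_sub, Submodule.mkQ_apply, Submodule.Quotient.mk_eq_zero]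
    refine (hP _).2 ⟨-m₁, -m₂, ?_⟩
    rw [e, smul_neg, smul_neg]
    abel
  -- Here `P` is the submodule `xM + yM`, and `M / P` is finitely generated over `R`. After
  -- inverting `g₁` it becomes free; lifts of its basis are the candidates for a basis over the
  -- power series.
  obtain ⟨l, w, g₁, hg₁, hw, hspan⟩ := exists_linearIndependent_smul_eq_sum R (M ⧸ P)
  choose m hm using fun j => P.mkQ_surjective (w j)
  have hmk : ∀ r : Fin l → R, ∑ j, r j • w j = P.mkQ (∑ j, r j • m j) := fun r => by
    rw [map_sum]
    exact Finset.sum_congr rfl fun j _ => by rw [map_smul, hm]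
  have hspan' : ∀ a : M, ∃ (r : Fin l → R) (m₁ m₂ : M),
      g₁ • a = ∑ j, r j • m j + x • m₁ + y • m₂ := fun a => by
    obtain ⟨r, hr⟩ := hspan (P.mkQ a)
    rw [hmk, ← map_smul, ← sub_eq_zero, ← map_sub, Submodule.mkQ_apply,
      Submodule.Quotient.mk_eq_zero] at hr
    obtain ⟨m₁, m₂, e⟩ := (hP _).1 hr
    exact ⟨r, m₁, m₂, by rw [add_assoc, ← e]; abel⟩
  have hind : ∀ r : Fin l → R, ∑ j, r j • m j ∈ P → ∀ j, r j = 0 := fun r hr => by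
    rw [← Submodule.Quotient.mk_eq_zero, ← Submodule.mkQ_apply, ← hmk] at hr
    exact Fintype.linearIndependent_iff.1 hw r hr
  -- Needed for independence in the fibres: a combination vanishing in the fibre lies in `cM`, so up
  -- to `g₁` it has coefficients in `c` modulo `P`.
  have hind' : ∀ (c : Ideal R) (u : M), u ∈ c • (⊤ : Submodule R M) →
      ∃ r : Fin l → R, (∀ j, r j ∈ c) ∧ g₁ • u - ∑ j, r j • m j ∈ P := by
    intro c u hu
    refine Submodule.smul_induction_on hu ?_ ?_
    · intro r hr a _
      obtain ⟨s, m₁, m₂, e⟩ := hspan' a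
      refine ⟨fun j => r * s j, fun j => Ideal.mul_mem_right _ _ hr, (hP _).2 ⟨r • m₁, r • m₂, ?_⟩⟩
      simp only [mul_smul]
      rw [← Finset.smul_sum, smul_comm, e, smul_add, smul_add, smul_comm x r, smul_comm y r]
      abel
    · rintro a b ⟨r, hr, hr'⟩ ⟨s, hs, hs'⟩
      refine ⟨fun j => r j + s j, fun j => Ideal.add_mem _ (hr j) (hs j), ?_⟩
      have := P.add_mem hr' hs'
      simp only [add_smul, Finset.sum_add_distrib, smul_add]
      convert this using 1
      abel
  set g := g₀ * g₁ with hg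
  let i : R →ₐ[k] Localization.Away g := IsScalarTower.toAlgHom k R _
  have hunit : IsUnit (i g) := IsLocalization.Away.algebraMap_isUnit g
  have hig : i g = i g₀ * i g₁ := map_mul i g₀ g₁
  have hunit₁ : IsUnit (i g₁) := by
    rw [hig] at hunit
    exact isUnit_of_mul_isUnit_right hunit
  have hε₀ : ∀ ε' : Localization.Away g →ₐ[k] k, ε'.comp i g₀ ≠ 0 := fun ε' => by
    have := (hunit.map ε').ne_zero
    rw [hig, map_mul] at this
    exact left_ne_zero_of_mul this
  have hε₁ : ∀ ε' : Localization.Away g →ₐ[k] k, ε'.comp i g₁ ≠ 0 := fun ε' => (hunit₁.map ε').ne_zero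
  have hk : ∀ a b : k, algebraMap k X (a * b) = algebraMap k X a * algebraMap k X b := map_mul _
  -- At each point where `g₀` and `g₁` do not vanish, the images of the `m j` are a basis modulo the
  -- parameters, and so a basis of the fibre over the power series.
  have hbij : ∀ ε' : Localization.Away g →ₐ[k] k,
      Function.Bijective (fun f : Fin l → PS k => ∑ j, algebraMap (PS k) X (f j) •
        σ (ε'.comp i) (m j)) := by
    intro ε'
    obtain ⟨hcm, hsurj, hr, hker⟩ := hN _ (hε₀ ε')
    refine SurfaceOver.bijective_of_mod hcm _ ?_ ?_
    · intro n
      obtain ⟨a, rfl⟩ := hsurj n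
      obtain ⟨r, m₁, m₂, e⟩ := hspan' a
      set u := (ε'.comp i g₁)⁻¹ with hu
      have e1 : a = a := rfl
      refine ⟨fun j => u * ε'.comp i (r j), algebraMap k X u • σ _ m₁, algebraMap k X u • σ _ m₂, ?_⟩
      have e2 := congrArg (fun z => algebraMap k X u • σ (ε'.comp i) z) e
      rw [hr, smul_smul, ← map_mul, hu, inv_mul_cancel₀ (hε₁ ε'), map_one, one_smul, map_add, map_add,
        map_sum, map_smul, map_smul] at e2
      simp only [hr] at e2
      rw [e2, smul_add, smul_add, Finset.smul_sum, smul_comm x, smul_comm y]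
      simp only [hk, mul_smul, hu]
    · intro a p q e j
      obtain ⟨m₁, rfl⟩ := hsurj p
      obtain ⟨m₂, rfl⟩ := hsurj q
      have h1 : σ (ε'.comp i) (∑ j, algebraMap k R (a j) • m j - x • m₁ - y • m₂) = 0 := by
        rw [map_sub, map_sub, map_sum, map_smul, map_smul]
        simp only [hr, AlgHom.commutes]
        rw [Algebra.algebraMap_self]
        simp only [RingHom.id_apply]
        rw [e]
        abel
      obtain ⟨r, hrc, hrP⟩ := hind' _ _ (hker _ h1)
      have h2 := hind (fun j => g₁ * algebraMap k R (a j) - r j) (by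
        obtain ⟨b₁, b₂, hb⟩ := (hP _).1 hrP
        refine (hP _).2 ⟨b₁ + g₁ • m₁, b₂ + g₁ • m₂, ?_⟩
        simp only [sub_smul, mul_smul, Finset.sum_sub_distrib]
        rw [← Finset.smul_sum, smul_add, smul_add, smul_comm x g₁, smul_comm y g₁]
        rw [smul_sub, smul_sub] at hb
        rw [add_add_add_comm, ← hb]
        abel) j
      have h3 := congrArg (ε'.comp i) h2
      rw [map_sub, map_mul, (RingHom.mem_ker).1 (hrc j), AlgHom.commutes, sub_zero, map_zero] at h3
      exact (mul_eq_zero.1 h3).resolve_left (hε₁ ε')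
  choose τ e he using fun ε' => exists_equiv_of_basis _ (hbij ε')
  choose c hc using fun ε' a => (hbij ε').2 (σ (ε'.comp i) a)
  have hloc : IsDomain (Localization.Away g) := IsLocalization.isDomain_localization
    (powers_le_nonZeroDivisors_of_noZeroDivisors (mul_ne_zero hg₀ hg₁))
  have : Algebra.FiniteType R (Localization.Away g) :=
    IsLocalization.finiteType_of_monoid_fg (Submonoid.powers g) _
  have : Algebra.FiniteType k (Localization.Away g) := Algebra.FiniteType.trans (S := R) inferInstance this
  -- Expanding an element over the `m j` modulo `xM + yM` relates its coordinates to those of two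
  -- further elements, uniformly in the point. So all coefficients are regular functions.
  have hcoeff := fun j d a => exists_coeff_of_recursion (i g₁) hunit₁ c (by
    intro a
    obtain ⟨r, m₁, m₂, e⟩ := hspan' a
    refine ⟨fun j => i (r j), m₁, m₂, fun ε' => ?_⟩
    obtain ⟨hcm, hsurj, hr, hker⟩ := hN _ (hε₀ ε')
    have h1 : (C (ε' (i g₁)) : PS k) • c ε' a = (fun j => C (ε' (i (r j)))) +
        (MvPowerSeries.X 0 : PS k) • c ε' m₁ + (MvPowerSeries.X 1 : PS k) • c ε' m₂ := by
      apply (hbij ε').1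
      have e2 := congrArg (σ (ε'.comp i)) e
      rw [hr, map_add, map_add, map_sum, map_smul, map_smul, ← hc ε' a, ← hc ε' m₁, ← hc ε' m₂] at e2
      simp only [hr] at e2
      simp only [Pi.add_apply, Pi.smul_apply, smul_eq_mul, map_add, map_mul, add_smul, mul_smul,
        Finset.sum_add_distrib, SurfaceOver.algebraMap_C, ← Finset.smul_sum]
      exact e2
    intro j
    exact congrFun h1 j) j _ d rfl a
  obtain ⟨ρ, hρ⟩ := exists_of_coeff τ (fun b i' j d => by
    obtain ⟨f, hf⟩ := hcoeff i' d (b • m j)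
    refine ⟨f, fun ε' => ?_⟩
    rw [hf]
    congr 1
    suffices h : c ε' (b • m j) = ((τ ε').toRingHom b).col j from congrFun h i'
    apply (hbij ε').1
    refine (hc _ _).trans (Eq.trans ?_ (he ε' _))
    rw [map_smul]
    have h1 : σ (ε'.comp i) (m j) = e ε' (Pi.single j 1) := by
      rw [he, Finset.sum_eq_single j]
      · rw [Pi.single_eq_same, map_one, one_smul]
      · intro i _ hi
        rw [Pi.single_eq_of_ne hi, map_zero, zero_smul]
      · simp
    have h2 : ((τ ε').toRingHom b).mulVec (Pi.single j 1) = ((τ ε').toRingHom b).col j := by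
      rw [Matrix.mulVec_single_one]
    rw [h1]
    exact ((e ε').map_smul b (Pi.single j 1 : Fin l → PS k)).symm.trans (congrArg (e ε') h2))
  refine ⟨g, mul_ne_zero hg₀ hg₁, l, ρ, fun ε' => ⟨?_⟩⟩
  rw [hρ]
  exact (e ε').symm



/-! ### Fibres, and the family attached to a representation -/

section Fibre

variable {X R M : Type*} [CommRing X] [CommRing R] [AddCommGroup M] [Module X M] [Module R M]
  [SMulCommClass X R M] [SMulCommClass R X M]

/-- The reduction map `M → M ⊗ R/c`. -/
noncomputable def fibreMk (X M : Type*) [CommRing X] [AddCommGroup M] [Module X M] [Module R M]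
    [SMulCommClass R X M] (c : Ideal R) : M →ₗ[X] M ⊗[R] (R ⧸ c) where
  toFun m := m ⊗ₜ 1
  map_add' _ _ := TensorProduct.add_tmul _ _ _
  map_smul' _ _ := rfl

theorem fibreMk_apply (c : Ideal R) (m : M) : fibreMk X M c m = m ⊗ₜ 1 := rfl

theorem tmul_mk_eq_fibreMk (c : Ideal R) (m : M) (r : R) :
    m ⊗ₜ[R] (Ideal.Quotient.mk c r) = fibreMk X M c (r • m) := by
  rw [fibreMk_apply, TensorProduct.smul_tmul]
  congr 1
  rw [Algebra.smul_def, mul_one]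
  rfl

theorem fibreMk_surjective (c : Ideal R) : Function.Surjective (fibreMk X M c) := by
  intro w
  induction w with
  | zero => exact ⟨0, map_zero _⟩
  | add a b ha hb =>
    obtain ⟨a, rfl⟩ := ha
    obtain ⟨b, rfl⟩ := hb
    exact ⟨a + b, map_add _ _ _⟩
  | tmul m r =>
    obtain ⟨r, rfl⟩ := Ideal.Quotient.mk_surjective r
    exact ⟨r • m, (tmul_mk_eq_fibreMk c m r).symm⟩

theorem fibreMk_eq_zero_iff (c : Ideal R) (m : M) :
    fibreMk X M c m = 0 ↔ m ∈ (c • ⊤ : Submodule R M) := by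
  rw [fibreMk_apply, ← (TensorProduct.comm R M (R ⧸ c)).map_eq_zero_iff, TensorProduct.comm_tmul,
    ← (TensorProduct.quotTensorEquivQuotSMul M c).map_eq_zero_iff,
    TensorProduct.quotTensorEquivQuotSMul_mk_one_tmul, Submodule.Quotient.mk_eq_zero]

theorem nonempty_equiv_of_ker_eq {N N' : Type*} [AddCommGroup N] [Module X N] [AddCommGroup N']
    [Module X N'] (f : M →ₗ[X] N) (g : M →ₗ[X] N') (hf : Function.Surjective f)
    (hg : Function.Surjective g) (h : ∀ m, f m = 0 ↔ g m = 0) : Nonempty (N ≃ₗ[X] N') :=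
  ⟨(f.quotKerEquivOfSurjective hf).symm ≪≫ₗ Submodule.quotEquivOfEq _ _ (by
    ext m
    exact h m) ≪≫ₗ g.quotKerEquivOfSurjective hg⟩

end Fibre

namespace SeriesRep

open MvPowerSeries

variable {k X R : Type u} [Field k] [CommRing X] [IsDomain X]
    [IsLocalRing X] [Algebra k X] [Algebra (PS k) X] [SurfaceOver k X] [CommRing R] [Algebra k R]
    {l : ℕ} (ρ : SeriesRep k X R l)

theorem specialize_surjective (ε : R →ₐ[k] k) : Function.Surjective (ρ.specialize ε) := fun w =>
  ⟨fun i => MvPowerSeries.map (algebraMap k R) (w i), by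
    have h : ∀ f : PS k, MvPowerSeries.map (ε : R →+* k) (MvPowerSeries.map (algebraMap k R) f) = f :=
      fun f => by rw [MvPowerSeries.map_map, AlgHom.comp_algebraMap, SurfaceOver.map_self]
    funext i
    exact h (w i)⟩

theorem specialize_smul (ε : R →ₐ[k] k) (r : R) (v : ρ.V) :
    ρ.specialize ε (r • v) = algebraMap k X (ε r) • ρ.specialize ε v := by
  rw [← SurfaceOver.algebraMap_C, algebraMap_smul, r_smul_def, SurfaceOver.map_self]
  funext i
  exact (map_mul (MvPowerSeries.map (ε : R →+* k)) (C r) (v i)).trans (by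
    rw [MvPowerSeries.map_C]; rfl)

/-- The ideal of the point is finitely generated, so the infinitely many coefficients of `v` are
written in the same generators and the expressions can be collected into series. -/
theorem mem_ker_smul_top [IsNoetherianRing R] (ε : R →ₐ[k] k) {v : ρ.V} (h : ρ.specialize ε v = 0) :
    v ∈ (RingHom.ker ε • ⊤ : Submodule R ρ.V) := by
  obtain ⟨q, c, hc⟩ := Submodule.fg_iff_exists_fin_generating_family.1
    (IsNoetherian.noetherian (RingHom.ker ε))
  have h1 : ∀ i d, ∃ a : Fin q → R, coeff d (v i) = ∑ j, a j * c j := by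
    intro i d
    have h2 : coeff d (v i) ∈ RingHom.ker ε := by
      have := congrArg (coeff d) (congrFun h i)
      rw [specialize_apply, coeff_map] at this
      exact this
    rw [← hc] at h2
    obtain ⟨a, ha⟩ := (Submodule.mem_span_range_iff_exists_fun R).1 h2
    exact ⟨a, ha.symm⟩
  choose a ha using h1
  let b : Fin q → Fin l → PS R := fun j i d => a i d j
  have hb : ∀ i d, coeff d ((∑ j, c j • b j) i) = ∑ j, a i d j * c j := fun i d => by
    rw [Finset.sum_apply, map_sum]
    refine Finset.sum_congr rfl fun j _ => ?_
    rw [Pi.smul_apply, coeff_smul, mul_comm]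
    rfl
  have h3 : v = ∑ j, c j • b j := funext fun i => MvPowerSeries.ext fun d => (ha i d).trans (hb i d).symm
  rw [h3]
  exact Submodule.sum_mem _ fun j _ =>
    Submodule.smul_mem_smul (hc ▸ Submodule.subset_span ⟨j, rfl⟩) trivial

theorem specialize_eq_zero_of_mem (ε : R →ₐ[k] k) {v : ρ.V}
    (h : v ∈ (RingHom.ker ε • ⊤ : Submodule R ρ.V)) : ρ.specialize ε v = 0 := by
  refine Submodule.smul_induction_on h ?_ ?_
  · intro r hr w _
    rw [specialize_smul, (RingHom.mem_ker).1 hr, map_zero, zero_smul]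
  · intro a b ha hb
    rw [map_add, ha, hb, add_zero]

/-- The fibre at a closed point is the specialization. -/
theorem nonempty_fibre_equiv [IsNoetherianRing R] (ε : R →ₐ[k] k) :
    Nonempty (ρ.V ⊗[R] (R ⧸ RingHom.ker ε) ≃ₗ[X] (ρ.map ε).V) :=
  nonempty_equiv_of_ker_eq (fibreMk X ρ.V (RingHom.ker ε)) (ρ.specialize ε)
    (fibreMk_surjective _) (ρ.specialize_surjective ε) fun _ =>
      (fibreMk_eq_zero_iff _ _).trans ⟨ρ.specialize_eq_zero_of_mem ε, ρ.mem_ker_smul_top ε⟩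

theorem _root_.pow_succ_smul_top {S M : Type*} [CommRing S] [AddCommGroup M] [Module S M] (I : Ideal S) (n : ℕ) :
    (I ^ (n + 1) • ⊤ : Submodule S M) = I • (I ^ n • ⊤ : Submodule S M) := by
  rw [pow_succ', mul_smul]

theorem X_smul (i : Fin 2) (v : ρ.V) :
    algebraMap (PS k) X (MvPowerSeries.X i) • v = (MvPowerSeries.X i : PS R) • v := by
  rw [algebraMap_smul, MvPowerSeries.map_X]

/-- Together with `mem_varIdeal_pow_of_mem` it shows that the filtrations by the maximal ideal of
`X` and by the variables are cofinal. -/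
theorem mem_maximalIdeal_pow_of_mem (n : ℕ) : ∀ {v : ρ.V},
    v ∈ (PS.varIdeal R ^ n • ⊤ : Submodule (PS R) ρ.V) →
      v ∈ (IsLocalRing.maximalIdeal X ^ n • ⊤ : Submodule X ρ.V) := by
  induction n with
  | zero => intro v _; simp
  | succ n ih =>
    intro v hv
    rw [pow_succ_smul_top] at hv ⊢
    refine Submodule.smul_induction_on hv ?_ fun a b ha hb => Submodule.add_mem _ ha hb
    intro a ha w hw
    obtain ⟨a₀, a₁, rfl⟩ := PS.exists_eq_X_mul_add a (PS.mem_varIdeal_iff.1 ha)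
    rw [add_smul, mul_smul, mul_smul, ← X_smul, ← X_smul]
    exact Submodule.add_mem _
      (Submodule.smul_mem_smul (SurfaceOver.mem 0) (ih (Submodule.smul_mem _ _ hw)))
      (Submodule.smul_mem_smul (SurfaceOver.mem 1) (ih (Submodule.smul_mem _ _ hw)))

theorem smul_mem_varIdeal_pow (n : ℕ) (x : X) {v : ρ.V}
    (hv : v ∈ (PS.varIdeal R ^ n • ⊤ : Submodule (PS R) ρ.V)) :
    x • v ∈ (PS.varIdeal R ^ n • ⊤ : Submodule (PS R) ρ.V) := by
  refine Submodule.smul_induction_on hv ?_ ?_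
  · intro a ha w _
    rw [smul_comm]
    exact Submodule.smul_mem_smul ha trivial
  · intro a b ha hb
    rw [smul_add]
    exact Submodule.add_mem _ ha hb

theorem mem_varIdeal_pow_of_mem {N : ℕ} (hN : IsLocalRing.maximalIdeal X ^ N ≤
      Ideal.span {algebraMap (PS k) X (MvPowerSeries.X 0), algebraMap (PS k) X (MvPowerSeries.X 1)})
    (n : ℕ) : ∀ {v : ρ.V}, v ∈ (IsLocalRing.maximalIdeal X ^ (N * n) • ⊤ : Submodule X ρ.V) →
      v ∈ (PS.varIdeal R ^ n • ⊤ : Submodule (PS R) ρ.V) := by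
  induction n with
  | zero => intro v _; simp
  | succ n ih =>
    intro v hv
    rw [mul_add, mul_one, add_comm, pow_add, mul_smul] at hv
    refine Submodule.smul_induction_on hv ?_ fun a b ha hb => Submodule.add_mem _ ha hb
    intro a ha w hw
    obtain ⟨c, d, rfl⟩ := Ideal.mem_span_pair.1 (hN ha)
    rw [mul_comm c, mul_comm d, add_smul, mul_smul, mul_smul, X_smul, X_smul, pow_succ_smul_top]
    have hX : ∀ i, (MvPowerSeries.X i : PS R) ∈ PS.varIdeal R := fun i => Ideal.subset_span ⟨i, rfl⟩
    exact Submodule.add_mem _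
      (Submodule.smul_mem_smul (hX 0) (ρ.smul_mem_varIdeal_pow _ _ (ih hw)))
      (Submodule.smul_mem_smul (hX 1) (ρ.smul_mem_varIdeal_pow _ _ (ih hw)))

/-- Completeness for the powers of the variables holds coordinatewise, and the two filtrations are
cofinal. -/
theorem isAdicComplete : IsAdicComplete (IsLocalRing.maximalIdeal X) ρ.V := by
  obtain ⟨N, hN⟩ := SurfaceOver.pow_le (k := k) (X := X)
  -- Replacing `N` by `N + 1` excludes a zero exponent, so that the sequence `f ((N + 1) * n)` is a
  -- genuine subsequence.
  have hN' : IsLocalRing.maximalIdeal X ^ (N + 1) ≤ Ideal.span {algebraMap (PS k) X (MvPowerSeries.X 0),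
    algebraMap (PS k) X (MvPowerSeries.X 1)} := (Ideal.pow_le_pow_right (Nat.le_succ N)).trans hN
  refine { haus' := fun v hv => ?_, prec' := fun f hf => ?_ }
  · funext i
    refine PS.eq_zero_of_forall_mem_pow fun n => ?_
    have := ρ.mem_varIdeal_pow_of_mem hN n (SModEq.zero.1 (hv (N * n)))
    exact mem_pow_smul_top_pi.1 this i
  · have := isPrecomplete_pi (PS.varIdeal R) (Fin l)
    obtain ⟨L, hL⟩ := this.prec (f := fun n => (f ((N + 1) * n) : Fin l → PS R)) (fun {m n} hmn => by
      have h1 := hf (Nat.mul_le_mul_left (N + 1) hmn)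
      exact SModEq.sub_mem.2 (ρ.mem_varIdeal_pow_of_mem hN' m (SModEq.sub_mem.1 h1)))
    refine ⟨L, fun n => ?_⟩
    have h1 : f ((N + 1) * n) ≡ L [SMOD (IsLocalRing.maximalIdeal X ^ n • ⊤ : Submodule X ρ.V)] := by
      exact SModEq.sub_mem.2 (ρ.mem_maximalIdeal_pow_of_mem n (SModEq.sub_mem.1 (hL n)))
    exact (hf (Nat.le_mul_of_pos_left n (Nat.succ_pos N))).trans h1

/-- Vectors with constant entries already generate, because the variables act through the maximal
ideal and vanish in the residue field. -/
theorem finite_tensor_residueField :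
    Module.Finite R (ρ.V ⊗[X] IsLocalRing.ResidueField X) := by
  let f : (Fin l → R) →ₗ[R] ρ.V ⊗[X] IsLocalRing.ResidueField X :=
    { toFun := fun r => (show ρ.V from fun i => (C (r i) : PS R)) ⊗ₜ 1
      map_add' := fun a b => by
        rw [← TensorProduct.add_tmul]
        congr 1
        funext i
        exact map_add C (a i) (b i)
      map_smul' := fun a b => by
        rw [RingHom.id_apply, TensorProduct.smul_tmul']
        congr 1
        funext i
        exact (map_mul C a (b i)).trans (MvPowerSeries.smul_eq_C_mul _ _).symm }
  refine Module.Finite.of_surjective f fun w => ?_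
  have hx : ∀ (i : Fin 2) (v : ρ.V), ((MvPowerSeries.X i : PS R) • v) ⊗ₜ[X]
      (1 : IsLocalRing.ResidueField X) = 0 := fun i v => by
    rw [← X_smul, TensorProduct.smul_tmul, Algebra.smul_def, mul_one]
    have : algebraMap X (IsLocalRing.ResidueField X) (algebraMap (PS k) X (MvPowerSeries.X i)) = 0 :=
      (IsLocalRing.residue_eq_zero_iff _).2 (SurfaceOver.mem i)
    rw [this, TensorProduct.tmul_zero]
  have h1 : ∀ v : ρ.V, ∃ r, f r = v ⊗ₜ 1 := fun v => by
    choose f₀ f₁ hf using fun j => PS.exists_eq_C_add (v j)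
    refine ⟨fun j => constantCoeff (v j), ?_⟩
    have e : v = (show ρ.V from fun j => C (constantCoeff (v j))) +
        (MvPowerSeries.X 0 : PS R) • (show ρ.V from f₀) +
        (MvPowerSeries.X 1 : PS R) • (show ρ.V from f₁) := funext hf
    conv_rhs => rw [e]
    rw [TensorProduct.add_tmul, TensorProduct.add_tmul, hx, hx, add_zero, add_zero]
    rfl
  induction w with
  | zero => exact ⟨0, map_zero _⟩
  | add a b ha hb =>
    obtain ⟨a, rfl⟩ := ha
    obtain ⟨b, rfl⟩ := hb
    exact ⟨a + b, map_add _ _ _⟩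
  | tmul v z =>
    obtain ⟨b, rfl⟩ := IsLocalRing.residue_surjective z
    obtain ⟨r, hr⟩ := h1 (b • v)
    refine ⟨r, hr.trans ?_⟩
    rw [TensorProduct.smul_tmul, Algebra.smul_def, mul_one]
    rfl

theorem flat [IsDedekindDomain R] : Module.Flat R ρ.V := by
  have : Module.IsTorsionFree R (Fin l → PS R) := by
    refine Module.IsTorsionFree.of_smul_eq_zero fun r v hv => ?_
    by_contra! h
    refine h.2 (funext fun i => MvPowerSeries.ext fun d => ?_)
    have := congrArg (coeff d) (congrFun hv i)
    rw [Pi.smul_apply, coeff_smul, Pi.zero_apply, map_zero] at this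
    exact (mul_eq_zero.1 this).resolve_left h.1
  exact (inferInstance : Module.Flat R (Fin l → PS R))

/-- The family of Cohen-Macaulay modules defined by a matrix representation over a curve. -/
noncomputable def family [IsAlgClosed k] (hft : Algebra.FiniteType k R) (hd : IsDedekindDomain R)
    (hnf : ¬ IsField R) : CMFamily k X where
  R := R
  finiteType := hft
  isDedekindDomain := hd
  not_isField := hnf
  M := ρ.V
  algebraMap_smul t x := by
    rw [← SurfaceOver.algebraMap_C, algebraMap_smul, MvPowerSeries.map_C, r_smul_def]
  complete := ρ.isAdicComplete
  finite := ρ.finite_tensor_residueField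
  flat := ρ.flat
  cohenMacaulay c hc := by
    obtain ⟨ε, rfl⟩ := exists_algHom_ker_eq (k := k) c
    obtain ⟨e⟩ := ρ.nonempty_fibre_equiv ε
    exact (ρ.map ε).isMaximalCohenMacaulay.of_isSummand (k := k) (IsSummand.of_equiv e)

theorem family_hasRank [IsAlgClosed k] (hft : Algebra.FiniteType k R) (hd : IsDedekindDomain R)
    (hnf : ¬ IsField R) : (ρ.family hft hd hnf).HasRank (l / Module.finrank (PS k) X) := by
  intro (c : Ideal R) (hc : c.IsMaximal)
  obtain ⟨ε, rfl⟩ := exists_algHom_ker_eq (k := k) c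
  obtain ⟨e⟩ := ρ.nonempty_fibre_equiv ε
  exact e.finrank_eq.trans (ρ.map ε).finrank_eq

end SeriesRep



/-! ### From families to representations -/

section

open MvPowerSeries

variable {k X R M : Type u} [Field k] [CommRing X] [IsDomain X] [IsLocalRing X] [Algebra k X]
  [CommRing R] [Algebra k R] [AddCommGroup M] [Module X M] [Module R M]
  [SMulCommClass X R M] [SMulCommClass R X M]

/-- Multiply lifts of generators of `M / 𝔪M` over `R` by generators of `𝔪`, repeatedly, and collect
the results. -/
theorem exists_span_add_maximalIdeal_pow [IsNoetherianRing X]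
    (hfin : Module.Finite R (M ⊗[X] IsLocalRing.ResidueField X)) (n : ℕ) :
    ∃ T : Set M, T.Finite ∧ ∀ m : M, ∃ a ∈ Submodule.span R T,
      m - a ∈ (IsLocalRing.maximalIdeal X ^ n • ⊤ : Submodule X M) := by
  have h1 : ∃ T : Set M, T.Finite ∧ ∀ m : M, ∃ a ∈ Submodule.span R T,
      m - a ∈ (IsLocalRing.maximalIdeal X • ⊤ : Submodule X M) := by
    let q : M →ₗ[R] M ⊗[X] IsLocalRing.ResidueField X := fibreMk R M (IsLocalRing.maximalIdeal X)
    have hq : Function.Surjective q := fibreMk_surjective _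
    obtain ⟨p, w, hw⟩ := Module.Finite.exists_fin (R := R) (M := M ⊗[X] IsLocalRing.ResidueField X)
    choose t ht using fun j => hq (w j)
    refine ⟨Set.range t, Set.finite_range t, fun m => ?_⟩
    have hm : q m ∈ Submodule.span R (Set.range w) := hw ▸ trivial
    obtain ⟨r, hr⟩ := (Submodule.mem_span_range_iff_exists_fun R).1 hm
    refine ⟨∑ j, r j • t j, Submodule.sum_mem _ fun j _ => Submodule.smul_mem _ _
      (Submodule.subset_span ⟨j, rfl⟩), ?_⟩
    rw [← fibreMk_eq_zero_iff (X := R)]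
    change q _ = 0
    rw [map_sub, map_sum, sub_eq_zero, ← hr]
    exact Finset.sum_congr rfl fun j _ => by rw [map_smul, ht]
  obtain ⟨T₁, hT₁, h1⟩ := h1
  induction n with
  | zero => exact ⟨∅, Set.finite_empty, fun m => ⟨0, Submodule.zero_mem _, by simp⟩⟩
  | succ n ih =>
    obtain ⟨T, hT, h⟩ := ih
    obtain ⟨q, b, hb⟩ := Submodule.fg_iff_exists_fin_generating_family.1
      (IsNoetherian.noetherian (IsLocalRing.maximalIdeal X))
    refine ⟨T₁ ∪ Set.image2 (fun j t => b j • t) Set.univ T, hT₁.union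
      (Set.finite_univ.image2 _ hT), fun m => ?_⟩
    have h2 : ∀ u ∈ (IsLocalRing.maximalIdeal X • ⊤ : Submodule X M),
        ∃ a ∈ Submodule.span R (Set.image2 (fun j t => b j • t) Set.univ T),
          u - a ∈ (IsLocalRing.maximalIdeal X ^ (n + 1) • ⊤ : Submodule X M) := by
      intro u hu
      have h3 : ∀ j v, ∃ a ∈ Submodule.span R (Set.image2 (fun j t => b j • t) Set.univ T),
          b j • v - a ∈ (IsLocalRing.maximalIdeal X ^ (n + 1) • ⊤ : Submodule X M) := by
        intro j v
        obtain ⟨a, ha, ha'⟩ := h v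
        refine ⟨b j • a, ?_, ?_⟩
        · have : Submodule.span R T ≤ (Submodule.span R (Set.image2 (fun j t => b j • t) Set.univ T)).comap
              (DistribSMul.toLinearMap R M (b j)) :=
            Submodule.span_le.2 fun t ht => Submodule.subset_span ⟨j, trivial, t, ht, rfl⟩
          exact this ha
        · rw [← smul_sub, pow_succ_smul_top]
          exact Submodule.smul_mem_smul (hb ▸ Submodule.subset_span ⟨j, rfl⟩) ha'
      refine Submodule.smul_induction_on hu ?_ ?_
      · intro c hc v _
        rw [← hb] at hc
        obtain ⟨r, rfl⟩ := (Submodule.mem_span_range_iff_exists_fun X).1 hc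
        choose a ha ha' using fun j => h3 j (r j • v)
        refine ⟨∑ j, a j, Submodule.sum_mem _ fun j _ => ha j, ?_⟩
        rw [Finset.sum_smul, ← Finset.sum_sub_distrib]
        refine Submodule.sum_mem _ fun j _ => ?_
        have := ha' j
        rwa [smul_smul, mul_comm, ← smul_eq_mul] at this
      · rintro u v ⟨a, ha, ha'⟩ ⟨b, hb, hb'⟩
        refine ⟨a + b, Submodule.add_mem _ ha hb, ?_⟩
        rw [add_sub_add_comm]
        exact Submodule.add_mem _ ha' hb'
    obtain ⟨a, ha, ha'⟩ := h1 m
    obtain ⟨a₂, ha₂, ha₂'⟩ := h2 _ ha'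
    refine ⟨a + a₂, Submodule.add_mem _ (Submodule.span_mono Set.subset_union_left ha)
      (Submodule.span_mono Set.subset_union_right ha₂), ?_⟩
    rwa [← sub_sub]

theorem exists_generators [Algebra (PS k) X] [SurfaceOver k X]
    (hfin : Module.Finite R (M ⊗[X] IsLocalRing.ResidueField X)) :
    ∃ (p : ℕ) (t : Fin p → M), ∀ m, ∃ (r : Fin p → R) (m₁ m₂ : M), m = ∑ j, r j • t j +
      algebraMap (PS k) X (MvPowerSeries.X 0) • m₁ + algebraMap (PS k) X (MvPowerSeries.X 1) • m₂ := by
  have := SurfaceOver.finite (k := k) (X := X)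
  have : IsNoetherianRing X := IsNoetherianRing.of_finite (PS k) X
  obtain ⟨N, hN⟩ := SurfaceOver.pow_le (k := k) (X := X)
  obtain ⟨T, hT, h⟩ := exists_span_add_maximalIdeal_pow (X := X) (M := M) hfin N
  obtain ⟨p, t, -, rfl⟩ := hT.fin_param
  refine ⟨p, t, fun m => ?_⟩
  obtain ⟨a, ha, ha'⟩ := h m
  obtain ⟨r, rfl⟩ := (Submodule.mem_span_range_iff_exists_fun R).1 ha
  suffices h2 : ∃ m₁ m₂ : M, m - ∑ j, r j • t j = algebraMap (PS k) X (MvPowerSeries.X 0) • m₁ +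
      algebraMap (PS k) X (MvPowerSeries.X 1) • m₂ by
    obtain ⟨m₁, m₂, e⟩ := h2
    exact ⟨r, m₁, m₂, by rw [add_assoc, ← e]; abel⟩
  refine Submodule.smul_induction_on ha' ?_ ?_
  · intro c hc v _
    obtain ⟨a, b, rfl⟩ := Ideal.mem_span_pair.1 (hN hc)
    exact ⟨a • v, b • v, by rw [mul_comm a, mul_comm b, add_smul, mul_smul, mul_smul]⟩
  · rintro _ _ ⟨a, b, rfl⟩ ⟨c, d, rfl⟩
    exact ⟨a + c, b + d, by rw [smul_add, smul_add]; abel⟩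

/-- Every family of Cohen-Macaulay modules is given, over an open part of the curve, by a matrix
representation. -/
theorem CMFamily.exists_seriesRep [IsAlgClosed k] [Algebra (PS k) X] [SurfaceOver k X]
    (F : CMFamily k X) :
    ∃ g : F.R, g ≠ 0 ∧ ∃ (l : ℕ) (ρ : SeriesRep k X (Localization.Away g) l),
      ∀ ε' : Localization.Away g →ₐ[k] k,
        Nonempty (F.Fibre (RingHom.ker (ε'.comp (IsScalarTower.toAlgHom k F.R _))) ≃ₗ[X]
          (ρ.map ε').V) := by
  have := F.isDedekindDomain
  have := F.finiteType
  obtain ⟨p, t, ht⟩ := exists_generators (k := k) F.finite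
  refine SeriesRep.exists_of_family t ht (one_ne_zero) (fun ε : F.R →ₐ[k] k => F.Fibre (RingHom.ker ε))
    (fun ε => fibreMk X F.M (RingHom.ker ε)) fun ε _ =>
      ⟨F.cohenMacaulay _ (isMaximal_ker_algHom ε), fibreMk_surjective _, fun r m => ?_,
        fun m hm => (fibreMk_eq_zero_iff _ _).1 hm⟩
  rw [← map_smul, F.algebraMap_smul, ← sub_eq_zero, ← map_sub, fibreMk_eq_zero_iff, ← sub_smul]
  refine Submodule.smul_mem_smul ?_ trivial
  rw [RingHom.mem_ker, map_sub, AlgHom.commutes, Algebra.algebraMap_self, RingHom.id_apply, sub_self]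

end



/-! ### Finiteness up to isomorphism and minimal parametrizing sets -/

section FinitelyMany

variable {Y : Type u} [CommRing Y]

/-- Up to isomorphism, finitely many modules satisfy `P`. -/
def FinitelyMany (P : ModuleCat.{u} Y → Prop) : Prop :=
  ∃ (s : ℕ) (E : Fin s → ModuleCat.{u} Y), ∀ N, P N → ∃ i, Nonempty (N ≃ₗ[Y] E i)

theorem FinitelyMany.mono {P Q : ModuleCat.{u} Y → Prop} (hQ : FinitelyMany Q)
    (h : ∀ N, P N → Q N) : FinitelyMany P := by
  obtain ⟨s, E, hE⟩ := hQ
  exact ⟨s, E, fun N hN => hE N (h N hN)⟩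

theorem FinitelyMany.exists {ι : Type*} [Finite ι] {P : ι → ModuleCat.{u} Y → Prop}
    (h : ∀ i, FinitelyMany (P i)) : FinitelyMany fun N => ∃ i, P i N := by
  choose s E hE using h
  obtain ⟨n, ⟨e⟩⟩ := Finite.exists_equiv_fin (Σ i, Fin (s i))
  let E' : (Σ i, Fin (s i)) → ModuleCat.{u} Y := fun p => E p.1 p.2
  refine ⟨n, fun j => E' (e.symm j), fun N ⟨i, hi⟩ => ?_⟩
  obtain ⟨j, hj⟩ := hE i N hi
  refine ⟨e ⟨i, j⟩, ?_⟩
  have h : E' (e.symm (e ⟨i, j⟩)) = E i j := congrArg E' (e.symm_apply_apply ⟨i, j⟩)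
  change Nonempty (N ≃ₗ[Y] E' (e.symm (e ⟨i, j⟩)))
  rwa [h]

theorem FinitelyMany.or {P Q : ModuleCat.{u} Y → Prop} (hP : FinitelyMany P) (hQ : FinitelyMany Q) :
    FinitelyMany fun N => P N ∨ Q N :=
  (FinitelyMany.exists (ι := Bool) (P := fun b => bif b then P else Q)
    (by rintro (_ | _); exacts [hQ, hP])).mono fun N hN =>
      hN.elim (fun h => ⟨true, h⟩) fun h => ⟨false, h⟩

theorem isCMFinite_iff [IsLocalRing Y] : IsCMFinite Y ↔ FinitelyMany (Y := Y) fun N =>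
    IsMaximalCohenMacaulay Y N ∧ IsIndecomposableModule Y N :=
  ⟨fun ⟨s, E, h⟩ => ⟨s, E, fun N hN => h N hN.1 hN.2⟩,
    fun ⟨s, E, h⟩ => ⟨s, E, fun N _ _ h1 h2 => h (ModuleCat.of Y N) ⟨h1, h2⟩⟩⟩

end FinitelyMany

section Count

variable {k Y : Type u} [Field k] [CommRing Y] [IsLocalRing Y] [Algebra k Y]

/-- `N` is a fibre of the family `F`. -/
def CMFamily.IsFibre (F : CMFamily k Y) (N : ModuleCat.{u} Y) : Prop :=
  ∃ c : Ideal F.R, c.IsMaximal ∧ Nonempty (N ≃ₗ[Y] F.Fibre c)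

theorem CMFamily.HasRank.finrank_eq {F : CMFamily k Y} {r : ℕ} (h : F.HasRank r)
    {N : ModuleCat.{u} Y} (hN : F.IsFibre N) : Module.finrank Y N = r := by
  obtain ⟨c, hc, ⟨e⟩⟩ := hN
  rw [e.finrank_eq, h c hc]

theorem CMFamily.HasRank.unique {F : CMFamily k Y} {r r' : ℕ} (h : F.HasRank r) (h' : F.HasRank r') :
    r = r' := by
  have := F.isDedekindDomain
  obtain ⟨c, hc⟩ := Ideal.exists_maximal F.R
  rw [← h c hc, h' c hc]

theorem isParametrizingSet_iff {𝔐 : Set (CMFamily k Y)} : IsParametrizingSet 𝔐 ↔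
    ∀ r : ℕ, {F ∈ 𝔐 | F.HasRank r}.Finite ∧ FinitelyMany (Y := Y) fun N =>
      IsMaximalCohenMacaulay Y N ∧ IsIndecomposableModule Y N ∧ Module.finrank Y N = r ∧
        ¬ ∃ F ∈ 𝔐, F.HasRank r ∧ F.IsFibre N := by
  refine forall_congr' fun r => and_congr_right fun _ => ⟨?_, ?_⟩
  · rintro ⟨s, E, h⟩
    exact ⟨s, E, fun N hN => (h N hN.1 hN.2.1 hN.2.2.1).resolve_left hN.2.2.2⟩
  · rintro ⟨s, E, h⟩
    refine ⟨s, E, fun N _ _ h1 h2 h3 => ?_⟩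
    by_cases h4 : ∃ F ∈ 𝔐, F.HasRank r ∧ F.IsFibre (ModuleCat.of Y N)
    · exact Or.inl h4
    · exact Or.inr (h (ModuleCat.of Y N) ⟨h1, h2, h3, h4⟩)

theorem familyCount_le {𝔐 : Set (CMFamily k Y)} (h : IsParametrizingSet 𝔐) (r : ℕ) :
    familyCount k Y r ≤ {F ∈ 𝔐 | F.HasRank r}.ncard := Nat.sInf_le ⟨𝔐, h, rfl⟩

/-- There is a parametrizing set which is minimal in all ranks. -/
theorem exists_minimal_parametrizingSet (h : ∃ 𝔐 : Set (CMFamily k Y), IsParametrizingSet 𝔐) :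
    ∃ 𝔐 : Set (CMFamily k Y), IsParametrizingSet 𝔐 ∧
      ∀ r, {F ∈ 𝔐 | F.HasRank r}.ncard = familyCount k Y r := by
  obtain ⟨𝔐₀, h₀⟩ := h
  have key : ∀ r, ∃ 𝔐 : Set (CMFamily k Y), IsParametrizingSet 𝔐 ∧
      {F ∈ 𝔐 | F.HasRank r}.ncard = familyCount k Y r := fun r =>
    Nat.sInf_mem (s := {d : ℕ | ∃ 𝔐 : Set (CMFamily k Y),
      IsParametrizingSet 𝔐 ∧ {F ∈ 𝔐 | F.HasRank r}.ncard = d}) ⟨_, 𝔐₀, h₀, rfl⟩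
  choose 𝔐 h1 h2 using key
  -- From the set that is minimal in rank `r` only the families of rank `r` are used. A family has
  -- at most one rank, so the choices for different `r` do not interfere.
  have h3 : ∀ r, {F ∈ {F : CMFamily k Y | ∃ r, F ∈ 𝔐 r ∧ F.HasRank r} | F.HasRank r} =
      {F ∈ 𝔐 r | F.HasRank r} := fun r => by
    ext F
    constructor
    · rintro ⟨⟨r', h4, h5⟩, h6⟩
      rw [h6.unique h5]
      exact ⟨h4, h5⟩
    · rintro ⟨h4, h5⟩
      exact ⟨⟨r, h4, h5⟩, h5⟩
  refine ⟨{F | ∃ r, F ∈ 𝔐 r ∧ F.HasRank r}, isParametrizingSet_iff.2 fun r => ⟨?_, ?_⟩, fun r => ?_⟩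
  · rw [h3]
    exact (h1 r r).1
  · refine ((isParametrizingSet_iff.1 (h1 r)) r).2.mono fun N hN => ⟨hN.1, hN.2.1, hN.2.2.1, ?_⟩
    rintro ⟨F, hF, hr, hN'⟩
    exact hN.2.2.2 ⟨F, ⟨r, hF, hr⟩, hr, hN'⟩
  · rw [h3, h2]

end Count

/-! ### Correspondences between singularities and the estimate of the numbers of families -/

/-- A correspondence from Cohen-Macaulay `X`-modules to Cohen-Macaulay `Y`-modules which multiplies
ranks and numbers of families at most linearly: `S M N` says that `N` occurs in the module attached
to `M`. -/
structure CMTransfer (k X Y : Type u) [Field k] [CommRing X] [IsLocalRing X] [Algebra k X]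
    [CommRing Y] [IsLocalRing Y] [Algebra k Y] (S : ModuleCat.{u} X → ModuleCat.{u} Y → Prop) (C : ℕ) :
    Prop where
  pos : 0 < C
  of_equiv : ∀ (M M' : ModuleCat.{u} X) N, Nonempty (M ≃ₗ[X] M') → S M N → S M' N
  exists_source : ∀ N : ModuleCat.{u} Y, IsMaximalCohenMacaulay Y N → IsIndecomposableModule Y N →
    ∃ M : ModuleCat.{u} X, IsMaximalCohenMacaulay X M ∧ IsIndecomposableModule X M ∧
      Module.finrank X M ≤ C * Module.finrank Y N ∧ S M N
  finite_targets : ∀ M : ModuleCat.{u} X, IsMaximalCohenMacaulay X M → FinitelyMany fun N =>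
    IsMaximalCohenMacaulay Y N ∧ IsIndecomposableModule Y N ∧ S M N
  families : ∀ (F : CMFamily k X) (r : ℕ), F.HasRank r → ∃ (ι : Type) (_ : Fintype ι)
    (G : ι → CMFamily k Y), Fintype.card ι ≤ C * r ∧ (∀ i, ∃ r', (G i).HasRank r') ∧
      FinitelyMany fun N => IsMaximalCohenMacaulay Y N ∧ IsIndecomposableModule Y N ∧
        (∃ M, F.IsFibre M ∧ S M N) ∧ ¬ ∃ i, (G i).IsFibre N

namespace CMTransfer

variable {k X Y : Type u} [Field k] [CommRing X] [IsLocalRing X] [Algebra k X] [CommRing Y]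
  [IsLocalRing Y] [Algebra k Y] {S : ModuleCat.{u} X → ModuleCat.{u} Y → Prop} {C : ℕ}

theorem finite_targets_of (T : CMTransfer k X Y S C) {P : ModuleCat.{u} X → Prop} (hP : FinitelyMany P) :
    FinitelyMany fun N => IsMaximalCohenMacaulay Y N ∧ IsIndecomposableModule Y N ∧
      ∃ M, P M ∧ IsMaximalCohenMacaulay X M ∧ S M N := by
  obtain ⟨s, E, hE⟩ := hP
  have key : FinitelyMany fun N => ∃ i, (∃ M : ModuleCat.{u} X, IsMaximalCohenMacaulay X M ∧
      Nonempty (M ≃ₗ[X] E i) ∧ S M N) ∧ IsMaximalCohenMacaulay Y N ∧ IsIndecomposableModule Y N := by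
    refine FinitelyMany.exists fun i => ?_
    by_cases hi : ∃ M : ModuleCat.{u} X, IsMaximalCohenMacaulay X M ∧ Nonempty (M ≃ₗ[X] E i)
    · obtain ⟨M₀, hM₀, ⟨e₀⟩⟩ := hi
      refine (T.finite_targets _ hM₀).mono fun N ⟨⟨M, hM, ⟨e⟩, hS⟩, h1, h2⟩ => ⟨h1, h2, ?_⟩
      exact T.of_equiv M M₀ N ⟨e.trans e₀.symm⟩ hS
    · exact ⟨0, Fin.elim0, fun N ⟨⟨M, hM, he, _⟩, _⟩ => absurd ⟨M, hM, he⟩ hi⟩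
  refine key.mono fun N ⟨h1, h2, M, hM, hMcm, hS⟩ => ?_
  obtain ⟨i, hi⟩ := hE M hM
  exact ⟨i, ⟨M, hMcm, hi, hS⟩, h1, h2⟩

theorem isCMFinite (T : CMTransfer k X Y S C) (h : IsCMFinite X) : IsCMFinite Y := by
  rw [isCMFinite_iff] at h ⊢
  refine (T.finite_targets_of h).mono fun N ⟨h1, h2⟩ => ?_
  obtain ⟨M, hM, hMi, -, hS⟩ := T.exists_source N h1 h2
  exact ⟨h1, h2, M, ⟨hM, hMi⟩, hM, hS⟩

theorem exists_finset (T : CMTransfer k X Y S C) (F : CMFamily k X) (r : ℕ) :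
    ∃ 𝔊 : Finset (CMFamily k Y), F.HasRank r → 𝔊.card ≤ C * r ∧ (∀ G ∈ 𝔊, ∃ r', G.HasRank r') ∧
      FinitelyMany fun N => IsMaximalCohenMacaulay Y N ∧ IsIndecomposableModule Y N ∧
        (∃ M, F.IsFibre M ∧ S M N) ∧ ¬ ∃ G ∈ 𝔊, G.IsFibre N := by
  classical
  by_cases h : F.HasRank r
  · obtain ⟨ι, _, G, h1, h2, h3⟩ := T.families F r h
    refine ⟨Finset.univ.image G, fun _ => ⟨Finset.card_image_le.trans h1, ?_, ?_⟩⟩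
    · intro G' hG'
      obtain ⟨i, -, rfl⟩ := Finset.mem_image.1 hG'
      exact h2 i
    · refine h3.mono fun N ⟨h4, h5, h6, h7⟩ => ⟨h4, h5, h6, fun ⟨i, hi⟩ => h7 ⟨G i, ?_, hi⟩⟩
      exact Finset.mem_image_of_mem _ (Finset.mem_univ _)
  · exact ⟨∅, fun h' => absurd h' h⟩

/-- Replace each family of a minimal parametrizing set for `X` by the families attached to it. A
module of rank `r` over `Y` comes from an indecomposable of rank at most `C * r`. The latter is one
of finitely many exceptions, or a fibre of a listed family; either way all but finitely many targets
are fibres of the new families. -/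
theorem exists_parametrizingSet (T : CMTransfer k X Y S C)
    (h : ∃ 𝔐 : Set (CMFamily k X), IsParametrizingSet 𝔐) :
    ∃ 𝔐 : Set (CMFamily k Y), IsParametrizingSet 𝔐 ∧ ∀ r, {F ∈ 𝔐 | F.HasRank r}.ncard ≤
      ∑ r' ∈ Finset.range (C * r + 1), C * r' * familyCount k X r' := by
  classical
  obtain ⟨𝔐, h𝔐, hmin⟩ := exists_minimal_parametrizingSet h
  rw [isParametrizingSet_iff] at h𝔐
  choose 𝔊 h𝔊 using T.exists_finset
  let 𝔽 : ℕ → Finset (CMFamily k X) := fun r => (h𝔐 r).1.toFinset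
  have h𝔽 : ∀ r F, F ∈ 𝔽 r ↔ F ∈ 𝔐 ∧ F.HasRank r := fun r F => (h𝔐 r).1.mem_toFinset
  have hcard : ∀ r, (𝔽 r).card = familyCount k X r := fun r => by
    rw [← hmin, Set.ncard_eq_toFinset_card _ (h𝔐 r).1]
  let U : ℕ → Finset (CMFamily k Y) := fun r => (Finset.range (C * r + 1)).biUnion fun r' =>
    (𝔽 r').biUnion fun F => 𝔊 F r'
  have hU : ∀ r G, G ∈ U r ↔ ∃ r' < C * r + 1, ∃ F ∈ 𝔽 r', G ∈ 𝔊 F r' := fun r G => by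
    simp only [U, Finset.mem_biUnion, Finset.mem_range]
  have hsub : ∀ r, {G ∈ {G : CMFamily k Y | ∃ r, G.HasRank r ∧ G ∈ U r} | G.HasRank r} ⊆ U r := by
    rintro r G ⟨⟨r', h1, h2⟩, h3⟩
    rw [h3.unique h1]
    exact h2
  refine ⟨{G | ∃ r, G.HasRank r ∧ G ∈ U r}, isParametrizingSet_iff.2 fun r =>
    ⟨(U r).finite_toSet.subset (hsub r), ?_⟩, fun r => ?_⟩
  · have h1 := FinitelyMany.exists (ι := Fin (C * r + 1)) fun r' => T.finite_targets_of (h𝔐 r').2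
    have h2 := FinitelyMany.exists (ι := Fin (C * r + 1)) fun r' =>
      FinitelyMany.exists (ι := 𝔽 r') fun F => (h𝔊 F.1 r' ((h𝔽 _ _).1 F.2).2).2.2
    refine (h1.or h2).mono fun N ⟨h3, h4, h5, h6⟩ => ?_
    obtain ⟨M, hM, hMi, hr, hS⟩ := T.exists_source N h3 h4
    rw [h5] at hr
    by_cases hF : ∃ F ∈ 𝔐, F.HasRank (Module.finrank X M) ∧ F.IsFibre M
    · obtain ⟨F, hF, hFr, hFM⟩ := hF
      refine Or.inr ⟨⟨_, Nat.lt_succ_of_le hr⟩, ⟨F, (h𝔽 _ _).2 ⟨hF, hFr⟩⟩, h3, h4, ⟨M, hFM, hS⟩, ?_⟩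
      rintro ⟨G, hG, hGN⟩
      obtain ⟨r', hr'⟩ := (h𝔊 F _ hFr).2.1 G hG
      have : r' = r := by rw [← h5, hr'.finrank_eq hGN]
      subst this
      exact h6 ⟨G, ⟨r', hr', (hU _ _).2 ⟨_, Nat.lt_succ_of_le hr, F, (h𝔽 _ _).2 ⟨hF, hFr⟩, hG⟩⟩, hr', hGN⟩
    · exact Or.inl ⟨⟨_, Nat.lt_succ_of_le hr⟩, h3, h4, M, ⟨hM, hMi, rfl, hF⟩, hM, hS⟩
  · refine (Set.ncard_le_ncard (hsub r) (U r).finite_toSet).trans ?_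
    rw [Set.ncard_coe_finset]
    refine Finset.card_biUnion_le.trans (Finset.sum_le_sum fun r' _ => ?_)
    refine Finset.card_biUnion_le.trans ?_
    refine (Finset.sum_le_card_nsmul _ _ (C * r') fun F hF => (h𝔊 F r' ((h𝔽 _ _).1 hF).2).1).trans ?_
    rw [hcard, smul_eq_mul, mul_comm]

theorem familyCount_le (T : CMTransfer k X Y S C)
    (h : ∃ 𝔐 : Set (CMFamily k X), IsParametrizingSet 𝔐) (r : ℕ) :
    familyCount k Y r ≤ ∑ r' ∈ Finset.range (C * r + 1), C * r' * familyCount k X r' := by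
  obtain ⟨𝔐, h1, h2⟩ := T.exists_parametrizingSet h
  exact (_root_.familyCount_le h1 r).trans (h2 r)

end CMTransfer



/-! ### Growth rates under the summation estimate -/

section Growth

variable {C : ℕ} {d e : ℕ → ℕ}

/-- Replace the polynomial by the monotone majorant a(1 + x)^deg, so that every term of the sum is
bounded by its value at `C * r`. -/
theorem exists_polynomial_bound_of_sum (hd : ∀ r, e r ≤ ∑ r' ∈ Finset.range (C * r + 1), C * r' * d r')
    (h : ∃ φ : Polynomial ℝ, ∀ r : ℕ, (d r : ℝ) ≤ φ.eval (r : ℝ)) :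
    ∃ φ : Polynomial ℝ, ∀ r : ℕ, (e r : ℝ) ≤ φ.eval (r : ℝ) := by
  obtain ⟨φ, hφ⟩ := h
  let a : ℝ := ∑ i ∈ Finset.range (φ.natDegree + 1), |φ.coeff i|
  have ha : 0 ≤ a := Finset.sum_nonneg fun i _ => abs_nonneg _
  have h1 : ∀ x : ℝ, 0 ≤ x → φ.eval x ≤ a * (1 + x) ^ φ.natDegree := by
    intro x hx
    rw [Polynomial.eval_eq_sum_range, Finset.sum_mul]
    refine Finset.sum_le_sum fun i hi => ?_
    have h2 : x ^ i ≤ (1 + x) ^ φ.natDegree :=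
      (pow_le_pow_left₀ hx (by linarith) i).trans
        (pow_le_pow_right₀ (by linarith) (Nat.lt_succ_iff.1 (Finset.mem_range.1 hi)))
    calc φ.coeff i * x ^ i ≤ |φ.coeff i| * x ^ i :=
          mul_le_mul_of_nonneg_right (le_abs_self _) (pow_nonneg hx i)
      _ ≤ _ := mul_le_mul_of_nonneg_left h2 (abs_nonneg _)
  let y : Polynomial ℝ := Polynomial.C (C : ℝ) * Polynomial.X
  refine ⟨(y + 1) * (Polynomial.C (C : ℝ) * y * (Polynomial.C a * (1 + y) ^ φ.natDegree)), fun r => ?_⟩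
  have hy : y.eval (r : ℝ) = C * r := by simp [y]
  simp only [Polynomial.eval_mul, Polynomial.eval_add, Polynomial.eval_pow, Polynomial.eval_one,
    Polynomial.eval_C, hy]
  calc (e r : ℝ) ≤ ((∑ r' ∈ Finset.range (C * r + 1), C * r' * d r' : ℕ) : ℝ) := by
        exact_mod_cast hd r
    _ = ∑ r' ∈ Finset.range (C * r + 1), (C : ℝ) * r' * d r' := by push_cast; rfl
    _ ≤ ∑ r' ∈ Finset.range (C * r + 1),
        (C : ℝ) * (C * r) * (a * (1 + C * r) ^ φ.natDegree) := by
        refine Finset.sum_le_sum fun r' hr' => ?_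
        have h3 : (r' : ℝ) ≤ C * r := by
          exact_mod_cast Nat.lt_succ_iff.1 (Finset.mem_range.1 hr')
        have h4 : (d r' : ℝ) ≤ a * (1 + C * r) ^ φ.natDegree :=
          ((hφ r').trans (h1 _ (Nat.cast_nonneg _))).trans (mul_le_mul_of_nonneg_left
            (pow_le_pow_left₀ (by positivity) (by linarith) _) ha)
        gcongr
    _ = _ := by
        rw [Finset.sum_const, Finset.card_range, nsmul_eq_mul]
        push_cast
        ring

/-- Choose `p > 1` with `p ^ C < q`. If `d r < p ^ r` for all large `r`, then `d r ≤ D * p ^ r`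
throughout and `e r` is at most a quadratic polynomial times `p ^ (C * r)`, which falls below `q ^
r`. -/
theorem frequently_exponential_of_sum (hC : 0 < C)
    (hd : ∀ r, e r ≤ ∑ r' ∈ Finset.range (C * r + 1), C * r' * d r')
    (h : ∃ q : ℝ, 1 < q ∧ ∃ᶠ r : ℕ in Filter.atTop, q ^ r ≤ (e r : ℝ)) :
    ∃ q : ℝ, 1 < q ∧ ∃ᶠ r : ℕ in Filter.atTop, q ^ r ≤ (d r : ℝ) := by
  obtain ⟨q, hq, hfreq⟩ := h
  obtain ⟨p, hp, hpq⟩ : ∃ p : ℝ, 1 < p ∧ p ^ C < q := by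
    have hcont : ContinuousAt (fun p : ℝ => p ^ C) 1 := (continuous_pow C).continuousAt
    have h1 : ∀ᶠ p in nhds (1 : ℝ), p ^ C < q :=
      hcont.eventually_lt continuousAt_const (by simpa using hq)
    obtain ⟨δ, hδ, h2⟩ := Metric.eventually_nhds_iff.1 h1
    refine ⟨1 + δ / 2, by linarith, h2 ?_⟩
    rw [Real.dist_eq, add_sub_cancel_left, abs_of_pos (by linarith)]
    linarith
  refine ⟨p, hp, ?_⟩
  by_contra hnot
  rw [Filter.not_frequently] at hnot
  obtain ⟨r₀, hr₀⟩ := Filter.eventually_atTop.1 hnot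
  let D : ℝ := 1 + ∑ i ∈ Finset.range r₀, (d i : ℝ)
  have hD : 1 ≤ D := le_add_of_nonneg_right (Finset.sum_nonneg fun i _ => Nat.cast_nonneg _)
  have hb : ∀ r, (d r : ℝ) ≤ D * p ^ r := by
    intro r
    have hpr : 1 ≤ p ^ r := one_le_pow₀ hp.le
    rcases lt_or_ge r r₀ with h | h
    · have h1 : (d r : ℝ) ≤ ∑ i ∈ Finset.range r₀, (d i : ℝ) :=
        Finset.single_le_sum (f := fun i => (d i : ℝ)) (fun i _ => Nat.cast_nonneg _) (Finset.mem_range.2 h)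
      have h2 : (d r : ℝ) ≤ D := h1.trans (le_add_of_nonneg_left zero_le_one)
      exact h2.trans (le_mul_of_one_le_right (by linarith) hpr)
    · have := hr₀ r h
      push Not at this
      exact this.le.trans (le_mul_of_one_le_left (by linarith) hD)
  let Q : ℝ := q / p ^ C
  have hpC : 0 < p ^ C := pow_pos (by linarith) C
  have hQ : 1 < Q := (one_lt_div hpC).2 hpq
  have hmain : ∀ r : ℕ, 1 ≤ r → q ^ r ≤ (e r : ℝ) → 1 ≤ 2 * (C : ℝ) ^ 3 * D * ((r : ℝ) ^ 2 / Q ^ r) := by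
    intro r hr hqr
    have hr' : (1 : ℝ) ≤ r := by exact_mod_cast hr
    have hC' : (1 : ℝ) ≤ C := by exact_mod_cast hC
    have h1 : (e r : ℝ) ≤ 2 * (C : ℝ) ^ 3 * D * (r : ℝ) ^ 2 * (p ^ C) ^ r := by
      calc (e r : ℝ) ≤ ((∑ r' ∈ Finset.range (C * r + 1), C * r' * d r' : ℕ) : ℝ) := by
            exact_mod_cast hd r
        _ = ∑ r' ∈ Finset.range (C * r + 1), (C : ℝ) * r' * d r' := by push_cast; rfl
        _ ≤ ∑ r' ∈ Finset.range (C * r + 1), (C : ℝ) * (C * r) * (D * (p ^ C) ^ r) := by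
            refine Finset.sum_le_sum fun r' hr' => ?_
            have h5 : r' ≤ C * r := Nat.lt_succ_iff.1 (Finset.mem_range.1 hr')
            have h3 : (r' : ℝ) ≤ C * r := by exact_mod_cast h5
            have h4 : (d r' : ℝ) ≤ D * (p ^ C) ^ r := (hb r').trans (by
              rw [← pow_mul]
              exact mul_le_mul_of_nonneg_left (pow_le_pow_right₀ hp.le h5) (by linarith))
            gcongr
        _ = (C * r + 1) * ((C : ℝ) * (C * r) * (D * (p ^ C) ^ r)) := by
            rw [Finset.sum_const, Finset.card_range, nsmul_eq_mul]
            push_cast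
            ring
        _ ≤ (2 * (C * r)) * ((C : ℝ) * (C * r) * (D * (p ^ C) ^ r)) := by
            refine mul_le_mul_of_nonneg_right ?_ (by positivity)
            nlinarith
        _ = _ := by ring
    have h2 := hqr.trans h1
    have h3 : q ^ r = Q ^ r * (p ^ C) ^ r := by
      rw [← mul_pow, div_mul_cancel₀ _ hpC.ne']
    rw [h3] at h2
    have h4 := le_of_mul_le_mul_right h2 (pow_pos hpC r)
    have hQr : 0 < Q ^ r := pow_pos (by linarith) r
    rw [mul_div_assoc', le_div_iff₀ hQr, one_mul]
    exact h4
  have hlim : Filter.Tendsto (fun r : ℕ => 2 * (C : ℝ) ^ 3 * D * ((r : ℝ) ^ 2 / Q ^ r)) Filter.atTop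
      (nhds (2 * (C : ℝ) ^ 3 * D * 0)) :=
    (tendsto_pow_const_div_const_pow_of_one_lt 2 hQ).const_mul _
  rw [mul_zero] at hlim
  have hev := hlim.eventually (gt_mem_nhds (zero_lt_one (α := ℝ)))
  refine hfreq ?_
  filter_upwards [hev, Filter.eventually_ge_atTop 1] with r h1 h2 h3
  exact absurd (hmain r h2 h3) (not_le.2 h1)

end Growth

/-- Representation types transfer along correspondences in both directions. -/
theorem CMTransfer.tame_iff {k X Y : Type u} [Field k] [CommRing X] [IsLocalRing X] [Algebra k X]
    [CommRing Y] [IsLocalRing Y] [Algebra k Y] {S : ModuleCat.{u} X → ModuleCat.{u} Y → Prop} {C : ℕ}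
    {S' : ModuleCat.{u} Y → ModuleCat.{u} X → Prop} {C' : ℕ}
    (T : CMTransfer k X Y S C) (T' : CMTransfer k Y X S' C') :
    (IsCMTame k X ↔ IsCMTame k Y) ∧ (IsCMTameBounded k X ↔ IsCMTameBounded k Y) ∧
      (IsCMTameExponential k X ↔ IsCMTameExponential k Y) := by
  have h1 : IsCMTame k X → IsCMTame k Y := fun ⟨h, h'⟩ =>
    ⟨fun hY => h (T'.isCMFinite hY), (T.exists_parametrizingSet h').imp fun _ h => h.1⟩
  have h2 : IsCMTame k Y → IsCMTame k X := fun ⟨h, h'⟩ =>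
    ⟨fun hX => h (T.isCMFinite hX), (T'.exists_parametrizingSet h').imp fun _ h => h.1⟩
  exact ⟨⟨h1, h2⟩,
    ⟨fun ⟨h, h'⟩ => ⟨h1 h, exists_polynomial_bound_of_sum (T.familyCount_le h.2) h'⟩,
      fun ⟨h, h'⟩ => ⟨h2 h, exists_polynomial_bound_of_sum (T'.familyCount_le h.2) h'⟩⟩,
    -- Exponential growth moves against the estimate: the count for `X` is bounded through that for
    -- `Y`, so the latter must grow exponentially as well.
    ⟨fun ⟨h, h'⟩ => ⟨h1 h, frequently_exponential_of_sum T'.pos (T'.familyCount_le (h1 h).2) h'⟩,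
      fun ⟨h, h'⟩ => ⟨h2 h, frequently_exponential_of_sum T.pos (T.familyCount_le (h2 h).2) h'⟩⟩⟩



/-! ### Indecomposable summands of modules and of families -/

section Summands

variable {Y : Type u} [CommRing Y]

/-- An indecomposable summand of a Cohen-Macaulay module is a summand of an indecomposable summand. -/
theorem exists_isSummand_of_decomposition {N M : Type u} [AddCommGroup N] [Module Y N]
    [IsLocalRing (Module.End Y N)] [AddCommGroup M] [Module Y M] (h : IsSummand Y N M) {s : ℕ}
    (L : Fin s → ModuleCat.{u} Y) (i : ∀ j, L j →ₗ[Y] M) (p : ∀ j, M →ₗ[Y] L j)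
    (hsum : ∑ j, i j ∘ₗ p j = LinearMap.id) : ∃ j, IsSummand Y N (L j) := by
  obtain ⟨a, b, hab⟩ := h
  obtain ⟨j, -, hj⟩ := exists_isSummand_of_sum (N := N) Finset.univ (fun j => (L j : Type u))
    (fun j => p j ∘ₗ a) (fun j => b ∘ₗ i j) (by
      have : (∑ j, (b ∘ₗ i j) ∘ₗ (p j ∘ₗ a) : Module.End Y N) = 1 := by
        refine LinearMap.ext fun n => ?_
        have h1 := congrArg b (LinearMap.congr_fun hsum (a n))
        rw [LinearMap.sum_apply, map_sum] at h1
        rw [LinearMap.sum_apply]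
        exact h1.trans (LinearMap.congr_fun hab n)
      rw [this]
      exact isUnit_one)
  exact ⟨j, hj⟩

theorem finitelyMany_isSummand (k : Type u) {Y : Type u} [Field k] [CommRing Y] [IsDomain Y]
    [IsLocalRing Y] [Algebra k Y] [Algebra (PS k) Y] [SurfaceOver k Y] {M : Type u} [AddCommGroup M] [Module Y M]
    (hM : IsMaximalCohenMacaulay Y M) : FinitelyMany (Y := Y) fun N => IsMaximalCohenMacaulay Y N ∧
      IsIndecomposableModule Y N ∧ IsSummand Y N M := by
  obtain ⟨s, L, i, p, h1, h2, h3⟩ := exists_decomposition k M hM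
  refine ⟨s, L, fun N ⟨hN, hNi, hNM⟩ => ?_⟩
  have := hNi.isLocalRing_end k hN
  have := hNi.1
  obtain ⟨j, hj⟩ := exists_isSummand_of_decomposition hNM L i p h3
  exact ⟨j, hj.nonempty_equiv (h1 j)⟩

end Summands

open SeriesRep in
/-- The families required in a correspondence can be read off from a matrix representation. -/
theorem exists_families_of_seriesRep {k X Y : Type u} [Field k] [IsAlgClosed k] [CommRing X]
    [IsLocalRing X] [Algebra k X] [CommRing Y] [IsDomain Y] [IsLocalRing Y] [Algebra k Y]
    [Algebra (PS k) Y] [SurfaceOver k Y] {S : ModuleCat.{u} X → ModuleCat.{u} Y → Prop}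
    (hequiv : ∀ (M M' : ModuleCat.{u} X) N, Nonempty (M ≃ₗ[X] M') → S M N → S M' N)
    (hfin : ∀ M : ModuleCat.{u} X, IsMaximalCohenMacaulay X M → FinitelyMany fun N =>
      IsMaximalCohenMacaulay Y N ∧ IsIndecomposableModule Y N ∧ S M N)
    (F : CMFamily k X) {R : Type u} [CommRing R] [Algebra k R] [IsDedekindDomain R]
    [Algebra.FiniteType k R] (hR : ¬ IsField R) (i : F.R →ₐ[k] R) {g : F.R} (hg : g ≠ 0)
    (hext : ∀ ε : F.R →ₐ[k] k, ε g ≠ 0 → ∃ ε' : R →ₐ[k] k, ε'.comp i = ε) {l : ℕ}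
    (ρ : SeriesRep k Y R l)
    (hS : ∀ (ε' : R →ₐ[k] k) (N : ModuleCat.{u} Y), IsMaximalCohenMacaulay Y N → IsIndecomposableModule Y N →
      S (ModuleCat.of X (F.Fibre (RingHom.ker (ε'.comp i)))) N → IsSummand Y N (ρ.map ε').V) :
    ∃ (ι : Type) (_ : Fintype ι) (G : ι → CMFamily k Y), Fintype.card ι ≤ l ∧
      (∀ i, ∃ r', (G i).HasRank r') ∧ FinitelyMany fun N => IsMaximalCohenMacaulay Y N ∧
        IsIndecomposableModule Y N ∧ (∃ M, F.IsFibre M ∧ S M N) ∧ ¬ ∃ i, (G i).IsFibre N := by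
  have := F.isDedekindDomain
  have := F.finiteType
  obtain ⟨ι, _, R', _, _, s, ρ', g', hcard, hft, hded, hnf, hg', H⟩ := exists_generic_decomposition hR ρ
  refine ⟨ι, inferInstance, fun i => (ρ' i).family hft hded hnf, hcard,
    fun i => ⟨_, (ρ' i).family_hasRank hft hded hnf⟩, ?_⟩
  have hf1 : {ε : F.R →ₐ[k] k | ε g = 0}.Finite := finite_algHom_of_dedekind F.not_isField hg
  have hf2 : {ε : R →ₐ[k] k | ε g' = 0}.Finite := finite_algHom_of_dedekind hR hg'
  -- The finitely many points of the base curve over which the generic decomposition says nothing;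
  -- each contributes finitely many modules.
  let Z : Set (F.R →ₐ[k] k) := {ε : F.R →ₐ[k] k | ε g = 0} ∪ (fun ε => ε.comp i) '' {ε : R →ₐ[k] k | ε g' = 0}
  have hZ : Finite Z := (hf1.union (hf2.image _)).to_subtype
  have hlist := FinitelyMany.exists (ι := Z) fun ε =>
    hfin (ModuleCat.of X (F.Fibre (RingHom.ker ε.1))) (F.cohenMacaulay _ (isMaximal_ker_algHom ε.1))
  refine hlist.mono fun N ⟨hN, hNi, ⟨M, ⟨c, hc, he⟩, hMN⟩, hno⟩ => ?_
  obtain ⟨ε, rfl⟩ := exists_algHom_ker_eq (k := k) c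
  have hMN' := hequiv M (ModuleCat.of X (F.Fibre (RingHom.ker ε))) N he hMN
  by_cases hεZ : ε ∈ Z
  · exact ⟨⟨ε, hεZ⟩, hN, hNi, hMN'⟩
  refine absurd ?_ hno
  have h1 : ε g ≠ 0 := fun h => hεZ (Or.inl h)
  obtain ⟨ε', rfl⟩ := hext ε h1
  have h2 : ε' g' ≠ 0 := fun h => hεZ (Or.inr ⟨ε', h, rfl⟩)
  obtain ⟨ε'', h3⟩ := H ε' h2
  obtain ⟨j, ⟨e⟩⟩ := h3 N hN hNi (hS ε' N hN hNi hMN')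
  have : IsNoetherianRing R' := inferInstance
  obtain ⟨e'⟩ := (ρ' j).nonempty_fibre_equiv ε''
  exact ⟨j, RingHom.ker ε'', isMaximal_ker_algHom ε'', ⟨e.trans e'.symm⟩⟩



/-! ### Coinduction -/

/-- The coinduced module `Hom_B(A, N)`. -/
def Coind (B A N : Type*) [CommRing B] [CommRing A] [Algebra B A] [AddCommGroup N] [Module B N] :=
  A →ₗ[B] N

namespace Coind

variable {B A N N' : Type*} [CommRing B] [CommRing A] [Algebra B A] [AddCommGroup N] [Module B N]
  [AddCommGroup N'] [Module B N']

instance : FunLike (Coind B A N) A N := inferInstanceAs (FunLike (A →ₗ[B] N) A N)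

instance : AddCommGroup (Coind B A N) := inferInstanceAs (AddCommGroup (A →ₗ[B] N))

instance : Module B (Coind B A N) := inferInstanceAs (Module B (A →ₗ[B] N))

instance : LinearMapClass (Coind B A N) B A N := inferInstanceAs (LinearMapClass (A →ₗ[B] N) B A N)

@[ext] theorem ext {f g : Coind B A N} (h : ∀ a, f a = g a) : f = g := LinearMap.ext h

theorem base_smul_apply (b : B) (f : Coind B A N) (a : A) : (b • f) a = b • f a := rfl

instance : Module A (Coind B A N) where
  smul a f := (f : A →ₗ[B] N) ∘ₗ LinearMap.mulLeft B a
  one_smul f := ext fun a => congrArg f (one_mul a)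
  mul_smul a b f := ext fun c => congrArg f (by
    simp only [LinearMap.mulLeft_apply]; ring)
  smul_zero a := rfl
  smul_add a f g := rfl
  add_smul a b f := ext fun c => (congrArg f (add_mul a b c)).trans (map_add f _ _)
  zero_smul f := ext fun c => (congrArg f (zero_mul c)).trans (map_zero f)

theorem smul_apply (a : A) (f : Coind B A N) (c : A) : (a • f) c = f (a * c) := rfl

instance : IsScalarTower B A (Coind B A N) := ⟨fun b a f => ext fun c => by
  rw [smul_apply, smul_mul_assoc, map_smul, base_smul_apply, smul_apply]⟩

/-- Coinduction is a functor. -/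
def map (h : N →ₗ[B] N') : Coind B A N →ₗ[A] Coind B A N' where
  toFun f := h ∘ₗ (f : A →ₗ[B] N)
  map_add' _ _ := LinearMap.comp_add _ _ _
  map_smul' _ _ := rfl

theorem map_apply (h : N →ₗ[B] N') (f : Coind B A N) (a : A) : map h f a = h (f a) := rfl

end Coind

section Transfer

variable {k A B : Type u} [Field k] [CommRing A] [IsDomain A] [IsLocalRing A] [Algebra k A]
  [Algebra (PS k) A] [SurfaceOver k A] [CommRing B] [IsDomain B] [IsLocalRing B] [Algebra k B]
  [Algebra (PS k) B] [SurfaceOver k B] [Algebra B A] [IsScalarTower (PS k) B A]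

theorem SurfaceOver.finite_of_tower (k A B : Type u) [Field k] [CommRing A] [IsDomain A]
    [IsLocalRing A] [Algebra k A] [Algebra (PS k) A] [SurfaceOver k A] [CommRing B] [Algebra (PS k) B]
    [Algebra B A] [IsScalarTower (PS k) B A] : Module.Finite B A := by
  have := SurfaceOver.finite (k := k) (X := A)
  exact Module.Finite.of_restrictScalars_finite (PS k) B A

theorem SurfaceOver.isNoetherianRing (k : Type u) {X : Type u} [Field k] [CommRing X] [IsDomain X]
    [IsLocalRing X] [Algebra k X] [Algebra (PS k) X] [SurfaceOver k X] : IsNoetherianRing X := by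
  have := SurfaceOver.finite (k := k) (X := X)
  exact IsNoetherianRing.of_finite (PS k) X

theorem IsMaximalCohenMacaulay.restrict (k : Type u) {A B M : Type u} [Field k] [CommRing A] [IsDomain A]
    [IsLocalRing A] [Algebra k A] [Algebra (PS k) A] [SurfaceOver k A] [CommRing B] [IsDomain B]
    [IsLocalRing B] [Algebra k B] [Algebra (PS k) B] [SurfaceOver k B] [Algebra B A]
    [IsScalarTower (PS k) B A] [AddCommGroup M] [Module A M]
    [Module B M] [IsScalarTower B A M] (h : IsMaximalCohenMacaulay A M) : IsMaximalCohenMacaulay B M := by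
  have := SurfaceOver.finite_of_tower k A B
  rw [SurfaceOver.isMaximalCohenMacaulay_iff k] at h ⊢
  have := h.1
  have hx : ∀ (i : Fin 2) (m : M), algebraMap (PS k) B (MvPowerSeries.X i) • m =
      algebraMap (PS k) A (MvPowerSeries.X i) • m := fun i m => by
    rw [IsScalarTower.algebraMap_apply (PS k) B A, algebraMap_smul A (algebraMap (PS k) B _) m]
  refine ⟨Module.Finite.trans A M, ?_, ?_⟩
  · simp only [hx]
    exact h.2.1
  · simp only [hx]
    exact h.2.2

theorem Coind.exists_injective (B A : Type*) [CommRing B] [CommRing A] [Algebra B A] [Module.Finite B A] :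
    ∃ (p : ℕ) (a : Fin p → A), ∀ (N : Type u) [AddCommGroup N] [Module B N],
      ∀ f g : Coind B A N, (∀ j, f (a j) = g (a j)) → f = g := by
  obtain ⟨p, a, ha⟩ := Module.Finite.exists_fin (R := B) (M := A)
  refine ⟨p, a, fun N _ _ f g h => ?_⟩
  exact LinearMap.ext_on (s := Set.range a) ha (by rintro _ ⟨j, rfl⟩; exact h j)

/-- Depth two passes to `Hom_B(A, −)`: division by the first parameter is done value by value, and
it is unique, hence linear in the argument, because that parameter is regular on `N`. -/
theorem Coind.isMaximalCohenMacaulay (k : Type u) {A B : Type u} [Field k] [CommRing A] [IsDomain A]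
    [IsLocalRing A] [Algebra k A] [Algebra (PS k) A] [SurfaceOver k A] [CommRing B] [IsDomain B]
    [IsLocalRing B] [Algebra k B] [Algebra (PS k) B] [SurfaceOver k B] [Algebra B A]
    [IsScalarTower (PS k) B A] {N : Type u} [AddCommGroup N] [Module B N] (hN : IsMaximalCohenMacaulay B N) :
    IsMaximalCohenMacaulay A (Coind B A N) := by
  have := SurfaceOver.finite_of_tower k A B
  have := SurfaceOver.isNoetherianRing k (X := B)
  obtain ⟨h0, h1, h2⟩ := (SurfaceOver.isMaximalCohenMacaulay_iff k).1 hN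
  have hx : ∀ (i : Fin 2) (f : Coind B A N) (c : A), (algebraMap (PS k) A (MvPowerSeries.X i) • f) c =
      algebraMap (PS k) B (MvPowerSeries.X i) • f c := fun i f c => by
    rw [IsScalarTower.algebraMap_apply (PS k) B A, algebraMap_smul]
    rfl
  refine (SurfaceOver.isMaximalCohenMacaulay_iff k).2 ⟨?_, ?_, ?_⟩
  · obtain ⟨p, a, ha⟩ := Coind.exists_injective.{u} B A
    let φ : Coind B A N →ₗ[B] (Fin p → N) :=
      { toFun := fun f j => f (a j)
        map_add' := fun _ _ => rfl
        map_smul' := fun _ _ => rfl }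
    have : IsNoetherian B (Coind B A N) := isNoetherian_of_injective φ
      fun f g h => ha N f g fun j => congrFun h j
    exact Module.Finite.of_restrictScalars_finite B A _
  · intro f hf
    exact Coind.ext fun c => h1 _ (by rw [← hx, hf]; rfl)
  · intro f g hfg
    have h3 : ∀ c, ∃ n, f c = algebraMap (PS k) B (MvPowerSeries.X 0) • n := fun c =>
      h2 (f c) (g c) (by rw [← hx, hfg, hx])
    choose n hn using h3
    have hinj : ∀ a b : N, algebraMap (PS k) B (MvPowerSeries.X 0) • a =
        algebraMap (PS k) B (MvPowerSeries.X 0) • b → a = b := fun a b hab => by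
      rw [← sub_eq_zero]
      exact h1 _ (by rw [smul_sub, hab, sub_self])
    let m : A →ₗ[B] N :=
      { toFun := n
        map_add' := fun a b => hinj _ _ (by rw [← hn, map_add, hn, hn, smul_add])
        map_smul' := fun b a => hinj _ _ (by
          rw [← hn, map_smul, hn, RingHom.id_apply, smul_comm]) }
    exact ⟨m, Coind.ext fun c => (hn c).trans (hx 0 (show Coind B A N from m) c).symm⟩

/-- The rank over the power series ring, computed over a finite extension. -/
theorem IsMaximalCohenMacaulay.finrank_mul {k X M : Type u} [Field k] [CommRing X] [IsDomain X]
    [IsLocalRing X] [Algebra k X] [Algebra (PS k) X] [SurfaceOver k X] [AddCommGroup M] [Module X M]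
    [Module (PS k) M] [IsScalarTower (PS k) X M] (hM : IsMaximalCohenMacaulay X M) :
    Module.Free (PS k) M ∧ Module.Finite (PS k) M ∧
      Module.finrank X M * Module.finrank (PS k) X = Module.finrank (PS k) M := by
  have := SurfaceOver.finite (k := k) (X := X)
  have := SurfaceOver.free k X
  have := SurfaceOver.faithfulSMul k X
  have := hM.1
  refine ⟨?_, Module.Finite.trans X M, finrank_mul_finrank_of_isDomain⟩
  obtain ⟨l, n, hn⟩ := SurfaceOver.exists_basis (k := k) hM
  let f : (Fin l → PS k) →ₗ[PS k] M := Fintype.linearCombination (PS k) n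
  have hf : Function.Bijective f := by
    convert hn using 1
    funext v
    simp [f, Fintype.linearCombination_apply]
  exact Module.Free.of_equiv (LinearEquiv.ofBijective f hf)

section

variable (k) {M N : Type u} [AddCommGroup M] [Module A M] [AddCommGroup N] [Module B N]

/-- Compare ranks over the common subring of power series, where an injection cannot decrease the
rank. -/
theorem finrank_le_of_injective_pi {p : ℕ} (hM : IsMaximalCohenMacaulay A M) (hN : IsMaximalCohenMacaulay B N)
    (φ : M → Fin p → N) (hadd : ∀ m m', φ (m + m') = φ m + φ m')
    (hsmul : ∀ (b : B) m, φ (algebraMap B A b • m) = b • φ m) (hφ : Function.Injective φ) :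
    Module.finrank A M ≤ p * Module.finrank (PS k) B * Module.finrank B N := by
  let _ : Module (PS k) M := Module.compHom M (algebraMap (PS k) A)
  let _ : Module (PS k) N := Module.compHom N (algebraMap (PS k) B)
  have : IsScalarTower (PS k) A M := ⟨fun s x m => by rw [Algebra.smul_def, mul_smul]; rfl⟩
  have : IsScalarTower (PS k) B N := ⟨fun s x m => by rw [Algebra.smul_def, mul_smul]; rfl⟩
  obtain ⟨h1, h2, h3⟩ := hM.finrank_mul (k := k)
  obtain ⟨h4, h5, h6⟩ := hN.finrank_mul (k := k)
  let φ' : M →ₗ[PS k] (Fin p → N) :=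
    { toFun := φ
      map_add' := hadd
      map_smul' := fun s m => by
        rw [RingHom.id_apply, ← algebraMap_smul A s m, IsScalarTower.algebraMap_apply (PS k) B A, hsmul,
          algebraMap_smul] }
  have h7 := LinearMap.finrank_le_finrank_of_injective (f := φ') hφ
  rw [Module.finrank_pi_fintype, Finset.sum_const, Finset.card_univ, Fintype.card_fin, smul_eq_mul, ← h6,
    ← h3] at h7
  have h8 : 0 < Module.finrank (PS k) A := SeriesRep.finrank_pos k A
  calc Module.finrank A M ≤ Module.finrank A M * Module.finrank (PS k) A := Nat.le_mul_of_pos_right _ h8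
    _ ≤ _ := h7
    _ = _ := by ring

theorem finrank_le_of_injective_restrict (hM : IsMaximalCohenMacaulay A M) (hN : IsMaximalCohenMacaulay B N)
    (φ : N →+ M) (hsmul : ∀ (b : B) n, φ (b • n) = algebraMap B A b • φ n) (hφ : Function.Injective φ) :
    Module.finrank B N ≤ Module.finrank (PS k) A * Module.finrank A M := by
  let _ : Module (PS k) M := Module.compHom M (algebraMap (PS k) A)
  let _ : Module (PS k) N := Module.compHom N (algebraMap (PS k) B)
  have : IsScalarTower (PS k) A M := ⟨fun s x m => by rw [Algebra.smul_def, mul_smul]; rfl⟩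
  have : IsScalarTower (PS k) B N := ⟨fun s x m => by rw [Algebra.smul_def, mul_smul]; rfl⟩
  obtain ⟨h1, h2, h3⟩ := hM.finrank_mul (k := k)
  obtain ⟨h4, h5, h6⟩ := hN.finrank_mul (k := k)
  let φ' : N →ₗ[PS k] M :=
    { toFun := φ
      map_add' := map_add φ
      map_smul' := fun s m => by
        rw [RingHom.id_apply, ← algebraMap_smul B s m, hsmul, ← IsScalarTower.algebraMap_apply (PS k) B A,
          algebraMap_smul] }
  have h7 := LinearMap.finrank_le_finrank_of_injective (f := φ') hφ
  rw [← h6, ← h3] at h7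
  have h8 : 0 < Module.finrank (PS k) B := SeriesRep.finrank_pos k B
  calc Module.finrank B N ≤ Module.finrank B N * Module.finrank (PS k) B := Nat.le_mul_of_pos_right _ h8
    _ ≤ _ := h7
    _ = _ := by ring

end

end Transfer



/-! ### Restriction of scalars as a correspondence -/

/-- An affine open part of an affine curve is an affine curve. -/
theorem localization_away_curve {k R : Type u} [Field k] [IsAlgClosed k] [CommRing R] [Algebra k R]
    [IsDedekindDomain R] [Algebra.FiniteType k R] (hR : ¬ IsField R) {g : R} (hg : g ≠ 0) :
    IsDedekindDomain (Localization.Away g) ∧ Algebra.FiniteType k (Localization.Away g) ∧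
      ¬ IsField (Localization.Away g) ∧ ∀ ε : R →ₐ[k] k, ε g ≠ 0 → ∃ ε' : Localization.Away g →ₐ[k] k,
        ε'.comp (IsScalarTower.toAlgHom k R (Localization.Away g)) = ε := by
  have hle : Submonoid.powers g ≤ R⁰ := powers_le_nonZeroDivisors_of_noZeroDivisors hg
  have hdom : IsDomain (Localization.Away g) := IsLocalization.isDomain_localization hle
  have hd : IsDedekindDomain (Localization.Away g) := IsLocalization.isDedekindDomain R hle _
  have : Algebra.FiniteType R (Localization.Away g) :=
    IsLocalization.finiteType_of_monoid_fg (Submonoid.powers g) _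
  have hft : Algebra.FiniteType k (Localization.Away g) := Algebra.FiniteType.trans (S := R) inferInstance this
  refine ⟨hd, hft, fun hf => hR ?_, fun ε hε => ?_⟩
  · obtain ⟨ε', -⟩ := exists_algHom_ne_zero (k := k) (R := Localization.Away g) one_ne_zero
    let _ := hf.toField
    have hinj : Function.Injective (ε'.comp (IsScalarTower.toAlgHom k R (Localization.Away g))) :=
      (RingHom.injective (ε' : Localization.Away g →+* k)).comp
        (IsLocalization.injective (Localization.Away g) hle)
    have hsurj : Function.Surjective (ε'.comp (IsScalarTower.toAlgHom k R (Localization.Away g))) :=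
      fun a => ⟨algebraMap k R a, AlgHom.commutes _ _⟩
    exact (RingEquiv.ofBijective _ ⟨hinj, hsurj⟩).toMulEquiv.isField (Field.toIsField k)
  · exact ⟨IsLocalization.liftAlgHom (M := Submonoid.powers g) (f := ε) (by
      rintro ⟨_, n, rfl⟩
      rw [map_pow]
      exact (isUnit_iff_ne_zero.2 hε).pow n), AlgHom.ext fun r => IsLocalization.lift_eq _ _⟩

/-- The restriction of scalars of an `A`-module along `B → A`. -/
def Restr (_B _A M : Type u) : Type u := M

namespace Restr

variable {B A M : Type u} [CommRing B] [CommRing A] [Algebra B A] [AddCommGroup M] [Module A M]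

instance : AddCommGroup (Restr B A M) := inferInstanceAs (AddCommGroup M)

instance : Module A (Restr B A M) := inferInstanceAs (Module A M)

instance : Module B (Restr B A M) := Module.compHom M (algebraMap B A)

instance : IsScalarTower B A (Restr B A M) := ⟨fun b a m => by
  rw [Algebra.smul_def, mul_smul]
  rfl⟩

end Restr

section

variable {B A M N : Type u} [CommRing B] [CommRing A] [Algebra B A] [AddCommGroup M] [Module A M]
  [AddCommGroup N] [Module B N]

/-- A summand over `A` is a summand over `B`. -/
theorem isSummand_restrict_of_isSummand {M' : Type u} [AddCommGroup M'] [Module A M'] [Module B M']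
    [IsScalarTower B A M'] (h : IsSummand A M M') : IsSummand B (Restr B A M) M' := by
  obtain ⟨i, p, h⟩ := h
  exact ⟨⟨i.toAddHom, fun b m => (i.map_smul (algebraMap B A b) m).trans (algebraMap_smul A b _)⟩,
    ⟨p.toAddHom, fun b m => (congrArg p (algebraMap_smul A b m).symm).trans (p.map_smul _ m)⟩,
    LinearMap.ext fun m => LinearMap.congr_fun h m⟩

/-- The restriction of a sum decomposition. -/
theorem exists_isSummand_restrict {B A N M : Type u} [CommRing B] [CommRing A] [Algebra B A]
    [AddCommGroup M] [Module A M] [Module B M]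
    [IsScalarTower B A M] [AddCommGroup N] [Module B N] [IsLocalRing (Module.End B N)]
    (h : IsSummand B N M) {s : ℕ} (L : Fin s → ModuleCat.{u} A) (i : ∀ j, L j →ₗ[A] M)
    (p : ∀ j, M →ₗ[A] L j) (hsum : ∑ j, i j ∘ₗ p j = LinearMap.id) :
    ∃ j, IsSummand B N (Restr B A (L j)) := by
  refine exists_isSummand_of_decomposition h (fun j => ModuleCat.of B (Restr B A (L j)))
    (fun j => ⟨(i j).toAddHom, fun b m => ((i j).map_smul (algebraMap B A b) m).trans (algebraMap_smul A b _)⟩)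
    (fun j => ⟨(p j).toAddHom, fun b m =>
      (congrArg (p j) (algebraMap_smul A b m).symm).trans ((p j).map_smul _ m)⟩) ?_
  refine LinearMap.ext fun m => ?_
  have := LinearMap.congr_fun hsum m
  rw [LinearMap.sum_apply] at this ⊢
  exact this

end

section ResTransfer

variable {k A B : Type u} [Field k] [IsAlgClosed k] [CommRing A] [IsDomain A] [IsLocalRing A] [Algebra k A]
  [Algebra (PS k) A] [SurfaceOver k A] [CommRing B] [IsDomain B] [IsLocalRing B] [Algebra k B]
  [Algebra (PS k) B] [SurfaceOver k B] [Algebra B A] [IsScalarTower (PS k) B A]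

/-- A family of constant rank is given by matrices of the expected size. -/
theorem CMFamily.length_eq {F : CMFamily k A} {r : ℕ} (hF : F.HasRank r) {R : Type u} [CommRing R] [Algebra k R]
    [IsDomain R] [Algebra.FiniteType k R] (i : F.R →ₐ[k] R) {l : ℕ} (ρ : SeriesRep k A R l)
    (h : ∀ ε' : R →ₐ[k] k, Nonempty (F.Fibre (RingHom.ker (ε'.comp i)) ≃ₗ[A] (ρ.map ε').V)) :
    r * Module.finrank (PS k) A = l := by
  obtain ⟨ε', -⟩ := exists_algHom_ne_zero (k := k) (R := R) one_ne_zero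
  obtain ⟨e⟩ := h ε'
  rw [← (ρ.map ε').finrank_mul, ← e.finrank_eq, hF _ (isMaximal_ker_algHom _)]

/-- Restriction of scalars along `B → A` is a correspondence. -/
theorem exists_cmTransfer_restrict (π : A →ₗ[B] B) (hπ : π 1 = 1) :
    ∃ C, CMTransfer k A B (fun M N => IsSummand B N (Restr B A M)) C := by
  have hfinite := SurfaceOver.finite_of_tower k A B
  obtain ⟨p, a, ha⟩ := Coind.exists_injective.{u} B A
  have hpos : 0 < Module.finrank (PS k) A := SeriesRep.finrank_pos k A
  have hequiv : ∀ (M M' : ModuleCat.{u} A) (N : ModuleCat.{u} B), Nonempty (M ≃ₗ[A] M') →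
      IsSummand B N (Restr B A M) → IsSummand B N (Restr B A M') :=
    fun M M' N ⟨e⟩ h => h.trans (isSummand_restrict_of_isSummand
      (M' := Restr B A M') (IsSummand.of_equiv (show M ≃ₗ[A] Restr B A M' from e)))
  have hfin : ∀ M : ModuleCat.{u} A, IsMaximalCohenMacaulay A M → FinitelyMany fun N : ModuleCat.{u} B =>
      IsMaximalCohenMacaulay B N ∧ IsIndecomposableModule B N ∧ IsSummand B N (Restr B A M) :=
    fun M hM => finitelyMany_isSummand k (IsMaximalCohenMacaulay.restrict k (A := A)
      (M := Restr B A M) hM)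
  refine ⟨p * Module.finrank (PS k) B + Module.finrank (PS k) A, by omega, hequiv, fun N hN hNi => ?_,
    hfin, fun F r hF => ?_⟩
  · have hC := Coind.isMaximalCohenMacaulay k (A := A) hN
    obtain ⟨s, L, i, q, h1, h2, h3⟩ := exists_decomposition k (Coind B A N) hC
    have := hNi.isLocalRing_end k hN
    -- Evaluation at 1 is split by `n ↦ (a ↦ π a • n)`, because `π 1 = 1`.
    have hNC : IsSummand B N (Coind B A N) := by
      refine ⟨⟨⟨fun n => (LinearMap.toSpanSingleton B N n) ∘ₗ π, fun m n => ?_⟩, fun b n => ?_⟩,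
        ⟨⟨fun f => f 1, fun _ _ => rfl⟩, fun _ _ => rfl⟩, LinearMap.ext fun n => ?_⟩
      · exact LinearMap.ext fun c => smul_add _ _ _
      · exact LinearMap.ext fun c => smul_comm _ _ _
      · change π 1 • n = n
        rw [hπ, one_smul]
    obtain ⟨j, hj⟩ := exists_isSummand_restrict hNC L i q h3
    have hLj : IsSummand A (L j) (Coind B A N) := ⟨i j, q j, h2 j⟩
    have hL := hC.of_isSummand (k := k) hLj
    refine ⟨L j, hL, h1 j, ?_, hj⟩
    -- A map in the coinduced module is determined by its values at the `p` generators of `A`, which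
    -- embeds the summand into `p` copies of `N`.
    refine (finrank_le_of_injective_pi k (p := p) hL hN (fun m j' => i j m (a j')) ?_ ?_ ?_).trans
      (Nat.mul_le_mul_right _ (Nat.le_add_right _ _))
    · intro m m'
      rw [map_add]
      rfl
    · intro b m
      rw [map_smul, algebraMap_smul]
      rfl
    · intro m m' hmm
      have := ha N _ _ (fun j' => congrFun hmm j')
      have h4 := congrArg (q j) this
      exact (LinearMap.congr_fun (h2 j) m).symm.trans (h4.trans (LinearMap.congr_fun (h2 j) m'))
  · have := F.isDedekindDomain
    have := F.finiteType
    obtain ⟨g, hg, l, ρ, hρ⟩ := F.exists_seriesRep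
    obtain ⟨h1, h2, h3, h4⟩ := localization_away_curve (k := k) F.not_isField hg
    -- The number of new families is at most the size of the matrices, which is the rank `r` times
    -- the rank of `A` over the power series.
    have hl := CMFamily.length_eq hF _ ρ hρ
    obtain ⟨ι, inst, G, h5, h6⟩ := exists_families_of_seriesRep hequiv hfin F h3 _ hg h4
      (ρ.comap (IsScalarTower.toAlgHom (PS k) B A)) (fun ε' N hN hNi hS => hS.trans (by
        obtain ⟨e⟩ := hρ ε'
        exact IsSummand.of_equiv (LinearEquiv.mk ⟨e.toAddHom, fun b m =>
          (e.map_smul (algebraMap B A b) m)⟩ e.invFun e.left_inv e.right_inv)))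
    refine ⟨ι, inst, G, h5.trans ?_, h6⟩
    rw [← hl, add_mul, mul_comm r]
    exact Nat.le_add_left _ _

end ResTransfer



/-! ### Coinduction of families -/

section Presentation

variable {B A : Type*} [CommRing B] [CommRing A] [Algebra B A]

/-- Homomorphisms out of a finitely presented module. -/
theorem Coind.exists_presentation (B A : Type*) [CommRing B] [CommRing A] [Algebra B A]
    [Module.Finite B A] [IsNoetherianRing B] :
    ∃ (p m : ℕ) (a : Fin p → A) (c : Fin m → Fin p → B), (∀ q, ∑ j, c q j • a j = 0) ∧
      ∀ (N : Type u) [AddCommGroup N] [Module B N], (∀ f g : Coind B A N, (∀ j, f (a j) = g (a j)) → f = g) ∧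
        ∀ v : Fin p → N, (∀ q, ∑ j, c q j • v j = 0) → ∃ f : Coind B A N, ∀ j, f (a j) = v j := by
  obtain ⟨p, a, ha⟩ := Module.Finite.exists_fin (R := B) (M := A)
  let φ : (Fin p → B) →ₗ[B] A := Fintype.linearCombination B a
  have hφ : Function.Surjective φ := by
    intro x
    have hx : x ∈ Submodule.span B (Set.range a) := ha ▸ trivial
    obtain ⟨r, rfl⟩ := (Submodule.mem_span_range_iff_exists_fun B).1 hx
    exact ⟨r, Fintype.linearCombination_apply _ _ _⟩
  obtain ⟨m, c, hc⟩ := Submodule.fg_iff_exists_fin_generating_family.1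
    (IsNoetherian.noetherian (LinearMap.ker φ))
  have hcm : ∀ q, φ (c q) = 0 := fun q => by
    have : c q ∈ LinearMap.ker φ := hc ▸ Submodule.subset_span ⟨q, rfl⟩
    exact this
  refine ⟨p, m, a, c, fun q => (Fintype.linearCombination_apply _ _ _).symm.trans (hcm q), fun N _ _ =>
    ⟨fun f g h => ?_, fun v hv => ?_⟩⟩
  · exact LinearMap.ext_on (s := Set.range a) ha (by rintro _ ⟨j, rfl⟩; exact h j)
  · let ψ : (Fin p → B) →ₗ[B] N := Fintype.linearCombination B v
    have hle : LinearMap.ker φ ≤ LinearMap.ker ψ := by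
      rw [← hc, Submodule.span_le]
      rintro _ ⟨q, rfl⟩
      exact (Fintype.linearCombination_apply _ _ _).trans (hv q)
    let e := φ.quotKerEquivOfSurjective hφ
    let f : A →ₗ[B] N := (LinearMap.ker φ).liftQ ψ hle ∘ₗ e.symm
    have hf : ∀ w, f (φ w) = ψ w := fun w => by
      have : e.symm (φ w) = Submodule.Quotient.mk w := by
        rw [LinearEquiv.symm_apply_eq]
        rfl
      change (LinearMap.ker φ).liftQ ψ hle (e.symm (φ w)) = _
      rw [this]
      rfl
    refine ⟨f, fun j => ?_⟩
    classical
    have h1 : φ (Pi.single j 1) = a j := by simp [φ]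
    have h2 : ψ (Pi.single j 1) = v j := by simp [ψ]
    rw [← h2, ← hf, h1]
    rfl

end Presentation

section CoindFamily

open MvPowerSeries SeriesRep

variable {k A B R : Type u} [Field k] [IsAlgClosed k] [CommRing A] [IsDomain A] [IsLocalRing A] [Algebra k A]
  [Algebra (PS k) A] [SurfaceOver k A] [CommRing B] [IsDomain B] [IsLocalRing B] [Algebra k B]
  [Algebra (PS k) B] [SurfaceOver k B] [Algebra B A] [IsScalarTower (PS k) B A]
  [CommRing R] [Algebra k R] {l : ℕ} (ρ : SeriesRep k B R l)

noncomputable instance : Module R (Coind B A ρ.V) := inferInstanceAs (Module R (A →ₗ[B] ρ.V))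

instance : SMulCommClass A R (Coind B A ρ.V) := ⟨fun _ _ _ => rfl⟩

theorem Coind.series_smul_apply (r : R) (f : Coind B A ρ.V) (c : A) : (r • f) c = r • f c := rfl

theorem SurfaceOver.isScalarTower_of_tower (k A B : Type u) [Field k] [CommRing A] [IsDomain A]
    [IsLocalRing A] [Algebra k A] [Algebra (PS k) A] [SurfaceOver k A] [CommRing B] [IsDomain B]
    [IsLocalRing B] [Algebra k B] [Algebra (PS k) B] [SurfaceOver k B] [Algebra B A]
    [IsScalarTower (PS k) B A] : IsScalarTower k B A := IsScalarTower.of_algebraMap_eq fun t => by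
  rw [← SurfaceOver.algebraMap_C, ← SurfaceOver.algebraMap_C, IsScalarTower.algebraMap_apply (PS k) B A]

namespace Coind

variable {p m : ℕ} (a : Fin p → A) (c : Fin m → Fin p → B)

/-- The matrix of a system of linear relations. -/
noncomputable def relMap : (Fin p × Fin l → PS R) →ₗ[PS R] (Fin m × Fin l → PS R) where
  toFun w qi := ∑ j, (ρ.toRingHom (c qi.1 j)).mulVec (fun i => w (j, i)) qi.2
  map_add' w w' := by
    funext qi
    rw [Pi.add_apply, ← Finset.sum_add_distrib]
    refine Finset.sum_congr rfl fun j _ => ?_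
    rw [← Pi.add_apply, ← Matrix.mulVec_add]
    rfl
  map_smul' s w := by
    funext qi
    rw [Pi.smul_apply, RingHom.id_apply, Finset.smul_sum]
    refine Finset.sum_congr rfl fun j _ => ?_
    rw [← Pi.smul_apply, ← Matrix.mulVec_smul]
    rfl

theorem relMap_apply (w : Fin p × Fin l → PS R) (qi : Fin m × Fin l) :
    relMap ρ c w qi = ∑ j, (ρ.toRingHom (c qi.1 j)).mulVec (fun i => w (j, i)) qi.2 := rfl

theorem relMap_eq_zero_iff (v : Fin p → ρ.V) :
    relMap ρ c (fun ji => v ji.1 ji.2) = 0 ↔ ∀ q, ∑ j, c q j • v j = 0 := by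
  have h : ∀ q i, relMap ρ c (fun ji => v ji.1 ji.2) (q, i) = (∑ j, c q j • v j : ρ.V) i :=
    fun q i => (Finset.sum_apply i Finset.univ
      (fun j => (ρ.toRingHom (c q j)).mulVec (v j))).symm
  exact ⟨fun h' q => funext fun i => (h q i).symm.trans (congrFun h' (q, i)),
    fun h' => funext fun qi => (h qi.1 qi.2).trans (congrFun (h' qi.1) qi.2)⟩

theorem map_relMap (ε : R →ₐ[k] k) (w : Fin p × Fin l → PS R) (qi : Fin m × Fin l) :
    MvPowerSeries.map (ε : R →+* k) (relMap ρ c w qi) =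
      relMap (ρ.map ε) c (fun ji => MvPowerSeries.map (ε : R →+* k) (w ji)) qi := by
  rw [relMap_apply, relMap_apply, map_sum]
  refine Finset.sum_congr rfl fun j _ => ?_
  simp only [Matrix.mulVec, dotProduct, map_sum, map_mul, map_toRingHom_apply, Matrix.map_apply]

/-- The coordinates of an element of the coinduced module. -/
noncomputable def coords (f : Coind B A ρ.V) : Fin p × Fin l → PS R := fun ji => f (a ji.1) ji.2

theorem coords_add (f g : Coind B A ρ.V) : coords ρ a (f + g) = coords ρ a f + coords ρ a g := rfl

theorem coords_smul (r : R) (f : Coind B A ρ.V) : coords ρ a (r • f) = (C r : PS R) • coords ρ a f := by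
  funext ji
  exact MvPowerSeries.smul_eq_C_mul _ _

theorem coords_X_smul (i : Fin 2) (f : Coind B A ρ.V) :
    coords ρ a (algebraMap (PS k) A (MvPowerSeries.X i) • f) =
      (MvPowerSeries.X i : PS R) • coords ρ a f := by
  have h : ∀ b : A, (algebraMap (PS k) A (MvPowerSeries.X i) • f) b = (MvPowerSeries.X i : PS R) • f b :=
    fun b => by
      rw [IsScalarTower.algebraMap_apply (PS k) B A, _root_.algebraMap_smul A, Coind.base_smul_apply,
        SeriesRep.X_smul]
  exact funext fun ji => congrFun (h (a ji.1)) ji.2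

theorem coords_sum {n : ℕ} (f : Fin n → Coind B A ρ.V) : coords ρ a (∑ u, f u) = ∑ u, coords ρ a (f u) :=
  map_sum (AddMonoidHom.mk' (coords ρ a) (coords_add ρ a)) _ _

theorem coords_map (ε : R →ₐ[k] k) (f : Coind B A ρ.V) (ji : Fin p × Fin l) :
    coords (ρ.map ε) a (Coind.map (ρ.specialize ε) f) ji =
      MvPowerSeries.map (ε : R →+* k) (coords ρ a f ji) := rfl

variable {a c} (hca : ∀ q, ∑ j, c q j • a j = 0)
  (hcoind : ∀ (N : Type u) [AddCommGroup N] [Module B N],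
    (∀ f g : Coind B A N, (∀ j, f (a j) = g (a j)) → f = g) ∧
      ∀ v : Fin p → N, (∀ q, ∑ j, c q j • v j = 0) → ∃ f : Coind B A N, ∀ j, f (a j) = v j)

include hcoind in
theorem coords_injective : Function.Injective (coords ρ a) := fun f g h =>
  (hcoind ρ.V).1 f g fun j => funext fun i => congrFun h (j, i)

include hca in
theorem relMap_coords (f : Coind B A ρ.V) : relMap ρ c (coords ρ a f) = 0 := by
  refine (relMap_eq_zero_iff ρ c fun j => f (a j)).2 fun q => ?_
  have := congrArg f (hca q)
  rw [map_sum, map_zero] at this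
  rw [← this]
  exact Finset.sum_congr rfl fun j _ => (map_smul f (c q j) (a j)).symm

include hcoind in
theorem exists_coords_eq {w : Fin p × Fin l → PS R} (hw : relMap ρ c w = 0) :
    ∃ f : Coind B A ρ.V, coords ρ a f = w := by
  obtain ⟨f, hf⟩ := (hcoind ρ.V).2 (fun j i => w (j, i)) ((relMap_eq_zero_iff ρ c fun j i => w (j, i)).1 hw)
  exact ⟨f, funext fun ji => congrFun (hf ji.1) ji.2⟩

include hca hcoind in
-- The coordinates identify the coinduced module with the kernel of `relMap`, finitely generated
-- over the noetherian ring `R[[x,y]]`. Splitting its coefficients into constants and multiples of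
-- the variables gives the required form.
theorem exists_series_generators [IsNoetherianRing R] : ∃ (n : ℕ) (t : Fin n → Coind B A ρ.V), ∀ f,
    ∃ (r : Fin n → R) (m₁ m₂ : Coind B A ρ.V), f = ∑ j, r j • t j +
      algebraMap (PS k) A (MvPowerSeries.X 0) • m₁ + algebraMap (PS k) A (MvPowerSeries.X 1) • m₂ := by
  obtain ⟨n, t, ht⟩ := Submodule.fg_iff_exists_fin_generating_family.1
    (IsNoetherian.noetherian (LinearMap.ker (relMap ρ c)))
  have htm : ∀ u, relMap ρ c (t u) = 0 := fun u => by
    have : t u ∈ LinearMap.ker (relMap ρ c) := ht ▸ Submodule.subset_span ⟨u, rfl⟩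
    exact this
  choose ft hft using fun u => exists_coords_eq ρ hcoind (htm u)
  refine ⟨n, ft, fun f => ?_⟩
  have hf : coords ρ a f ∈ LinearMap.ker (relMap ρ c) := relMap_coords ρ hca f
  rw [← ht] at hf
  obtain ⟨s, hs⟩ := (Submodule.mem_span_range_iff_exists_fun (PS R)).1 hf
  choose s₀ s₁ hs' using fun u => PS.exists_eq_C_add (s u)
  have hsum : ∀ s : Fin n → PS R, relMap ρ c (∑ u, s u • t u) = 0 := fun s => by
    rw [map_sum]
    exact Finset.sum_eq_zero fun u _ => by rw [map_smul, htm, smul_zero]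
  obtain ⟨m₁, hm₁⟩ := exists_coords_eq ρ hcoind (hsum s₀)
  obtain ⟨m₂, hm₂⟩ := exists_coords_eq ρ hcoind (hsum s₁)
  refine ⟨fun u => constantCoeff (s u), m₁, m₂, coords_injective ρ hcoind ?_⟩
  rw [coords_add, coords_add, coords_X_smul, coords_X_smul, coords_sum, hm₁, hm₂, ← hs, Finset.smul_sum,
    Finset.smul_sum, ← Finset.sum_add_distrib, ← Finset.sum_add_distrib]
  refine Finset.sum_congr rfl fun u _ => ?_
  rw [coords_smul, hft, smul_smul, smul_smul, ← add_smul, ← add_smul, ← hs' u]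

include hca hcoind in
theorem map_specialize_surjective (ε : R →ₐ[k] k)
    (hε : ∀ w₀ : Fin p × Fin l → PS R, (∀ j, MvPowerSeries.map (ε : R →+* k) (relMap ρ c w₀ j) = 0) →
      ∃ w, relMap ρ c w = 0 ∧ ∀ i, MvPowerSeries.map (ε : R →+* k) (w i) =
        MvPowerSeries.map (ε : R →+* k) (w₀ i)) :
    Function.Surjective (Coind.map (A := A) (ρ.specialize ε)) := by
  intro f₀
  let w₀ : Fin p × Fin l → PS R := fun ji =>
    MvPowerSeries.map (algebraMap k R) (coords (ρ.map ε) a f₀ ji)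
  have hw₀ : ∀ ji, MvPowerSeries.map (ε : R →+* k) (w₀ ji) = coords (ρ.map ε) a f₀ ji := fun ji => by
    rw [MvPowerSeries.map_map, AlgHom.comp_algebraMap, SurfaceOver.map_self]
  obtain ⟨w, hw, hw'⟩ := hε w₀ (fun qi => by
    rw [map_relMap]
    simp only [hw₀]
    exact congrFun (relMap_coords (ρ.map ε) hca f₀) qi)
  obtain ⟨f, hf⟩ := exists_coords_eq ρ hcoind hw
  refine ⟨f, coords_injective (ρ.map ε) hcoind (funext fun ji => ?_)⟩
  rw [coords_map, hf, hw', hw₀]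

include hca hcoind in
theorem mem_ker_smul_top_of_map_eq_zero [IsDedekindDomain R] (ε : R →ₐ[k] k) (f : Coind B A ρ.V)
    (hf : Coind.map (ρ.specialize ε) f = 0) :
    f ∈ (RingHom.ker ε • ⊤ : Submodule R (Coind B A ρ.V)) := by
  obtain ⟨s, π, w', hs, hπ, hw', e⟩ := exists_eq_smul_add_smul_of_map_eq_zero (relMap ρ c) ε
    (coords ρ a f) (relMap_coords ρ hca f) fun ji => by
      rw [← coords_map, hf]
      rfl
  obtain ⟨f', hf'⟩ := exists_coords_eq ρ hcoind hw'
  have : f = s • f + π • f' := coords_injective ρ hcoind (by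
    rw [coords_add, coords_smul, coords_smul, hf']
    exact e)
  rw [this]
  exact Submodule.add_mem _ (Submodule.smul_mem_smul hs trivial) (Submodule.smul_mem_smul hπ trivial)

end Coind

/-- The coinduction of a family, over an open part of the curve. -/
theorem SeriesRep.exists_coind [IsDedekindDomain R] [Algebra.FiniteType k R] :
    ∃ g : R, g ≠ 0 ∧ ∃ (l' : ℕ) (τ : SeriesRep k A (Localization.Away g) l'),
      ∀ ε' : Localization.Away g →ₐ[k] k,
        Nonempty (Coind B A (ρ.map (ε'.comp (IsScalarTower.toAlgHom k R _))).V ≃ₗ[A] (τ.map ε').V) := by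
  have := SurfaceOver.finite_of_tower k A B
  have := SurfaceOver.isNoetherianRing k (X := B)
  have := SurfaceOver.isScalarTower_of_tower k A B
  obtain ⟨p, m, a, c, hca, hcoind⟩ := Coind.exists_presentation.{u} B A
  obtain ⟨g, hg, hg'⟩ := exists_kernel_lift (k := k) (Coind.relMap ρ c)
  obtain ⟨n, t, ht⟩ := Coind.exists_series_generators ρ hca hcoind
  refine SeriesRep.exists_of_family t ht hg (fun ε => Coind B A (ρ.map ε).V)
    (fun ε => Coind.map (ρ.specialize ε)) fun ε hε => ⟨Coind.isMaximalCohenMacaulay k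
      (ρ.map ε).isMaximalCohenMacaulay, Coind.map_specialize_surjective ρ hca hcoind ε (hg' ε hε),
      fun r f => Coind.ext fun b => ?_, Coind.mem_ker_smul_top_of_map_eq_zero ρ hca hcoind ε⟩
  rw [Coind.map_apply, Coind.series_smul_apply, specialize_smul, IsScalarTower.algebraMap_apply k B A,
    _root_.algebraMap_smul A, Coind.base_smul_apply, Coind.map_apply]

end CoindFamily



/-! ### Coinduction as a correspondence -/

section

variable {B A M N : Type u} [CommRing B] [CommRing A] [Algebra B A] [AddCommGroup M] [Module A M]
  [AddCommGroup N] [Module B N]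

theorem isSummand_coind {N' : Type u} [AddCommGroup N'] [Module B N'] (h : IsSummand B N N') :
    IsSummand A (Coind B A N) (Coind B A N') := by
  obtain ⟨i, p, h⟩ := h
  exact ⟨Coind.map i, Coind.map p, LinearMap.ext fun f => Coind.ext fun a => LinearMap.congr_fun h (f a)⟩

theorem exists_isSummand_coind [IsLocalRing (Module.End A M)] (h : IsSummand A M (Coind B A N)) {s : ℕ}
    (L : Fin s → ModuleCat.{u} B) (i : ∀ j, L j →ₗ[B] N) (p : ∀ j, N →ₗ[B] L j)
    (hsum : ∑ j, i j ∘ₗ p j = LinearMap.id) : ∃ j, IsSummand A M (Coind B A (L j)) := by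
  refine exists_isSummand_of_decomposition h (fun j => ModuleCat.of A (Coind B A (L j)))
    (fun j => Coind.map (i j)) (fun j => Coind.map (p j)) ?_
  refine LinearMap.ext fun f => ?_
  rw [LinearMap.sum_apply]
  refine Coind.ext fun a => ?_
  have h1 := LinearMap.congr_fun hsum (f a)
  rw [LinearMap.sum_apply] at h1
  let ev : Coind B A N →+ N := ⟨⟨fun f => f a, rfl⟩, fun _ _ => rfl⟩
  exact (map_sum ev _ _).trans h1

end

section CoindTransfer

variable {k A B : Type u} [Field k] [IsAlgClosed k] [CommRing A] [IsDomain A] [IsLocalRing A] [Algebra k A]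
  [Algebra (PS k) A] [SurfaceOver k A] [CommRing B] [IsDomain B] [IsLocalRing B] [Algebra k B]
  [Algebra (PS k) B] [SurfaceOver k B] [Algebra B A] [IsScalarTower (PS k) B A]

/-- Coinduction along `B → A` is a correspondence. -/
theorem exists_cmTransfer_coind (hsep : ∀ M : ModuleCat.{u} A, IsMaximalCohenMacaulay A M →
    IsSummand A M (Coind B A (Restr B A M))) :
    ∃ C, CMTransfer k B A (fun N M => IsSummand A M (Coind B A N)) C := by
  have hfinite := SurfaceOver.finite_of_tower k A B
  obtain ⟨p, a, ha⟩ := Coind.exists_injective.{u} B A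
  have hpos : 0 < Module.finrank (PS k) A := SeriesRep.finrank_pos k A
  have hequiv : ∀ (N N' : ModuleCat.{u} B) (M : ModuleCat.{u} A), Nonempty (N ≃ₗ[B] N') →
      IsSummand A M (Coind B A N) → IsSummand A M (Coind B A N') :=
    fun N N' M ⟨e⟩ h => h.trans (isSummand_coind (IsSummand.of_equiv e))
  have hfin : ∀ N : ModuleCat.{u} B, IsMaximalCohenMacaulay B N → FinitelyMany fun M : ModuleCat.{u} A =>
      IsMaximalCohenMacaulay A M ∧ IsIndecomposableModule A M ∧ IsSummand A M (Coind B A N) :=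
    fun N hN => finitelyMany_isSummand k (Coind.isMaximalCohenMacaulay k hN)
  refine ⟨p * Module.finrank (PS k) B * Module.finrank (PS k) A + Module.finrank (PS k) A, by omega,
    hequiv, fun M hM hMi => ?_, hfin, fun F r hF => ?_⟩
  · have hR : IsMaximalCohenMacaulay B (Restr B A M) := IsMaximalCohenMacaulay.restrict k (A := A)
      (M := Restr B A M) hM
    obtain ⟨s, L, i, q, h1, h2, h3⟩ := exists_decomposition k (Restr B A M) hR
    have := hMi.isLocalRing_end k hM
    obtain ⟨j, hj⟩ := exists_isSummand_coind (hsep M hM) L i q h3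
    have hLj : IsSummand B (L j) (Restr B A M) := ⟨i j, q j, h2 j⟩
    have hL := hR.of_isSummand (k := k) hLj
    refine ⟨L j, hL, h1 j, ?_, hj⟩
    refine (finrank_le_of_injective_restrict k (M := M) hM hL (i j).toAddMonoidHom (i j).map_smul ?_).trans
      (Nat.mul_le_mul_right _ (Nat.le_add_left _ _))
    intro m m' hmm
    have h4 := congrArg (q j) hmm
    exact (LinearMap.congr_fun (h2 j) m).symm.trans (h4.trans (LinearMap.congr_fun (h2 j) m'))
  · have := F.isDedekindDomain
    have := F.finiteType
    obtain ⟨g, hg, l, ρ, hρ⟩ := F.exists_seriesRep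
    obtain ⟨h1, h2, h3, h4⟩ := localization_away_curve (k := k) F.not_isField hg
    obtain ⟨h, hh, l', τ, hτ⟩ := ρ.exists_coind (A := A)
    obtain ⟨h5, h6, h7, h8⟩ := localization_away_curve (k := k) h3 hh
    -- The function `h` lives on the open set where `g` is invertible. A power of `g` clears its
    -- denominator, so the points to be avoided are zeros of `g * c` on the original curve.
    obtain ⟨n, c, hc⟩ := IsLocalization.Away.surj g h
    have hinj : Function.Injective (algebraMap F.R (Localization.Away g)) :=
      IsLocalization.injective _ (powers_le_nonZeroDivisors_of_noZeroDivisors hg)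
    have hc0 : c ≠ 0 := by
      rintro rfl
      rw [map_zero] at hc
      have := (map_ne_zero_iff _ hinj).2 hg
      exact mul_ne_zero hh (pow_ne_zero n this) hc
    obtain ⟨ι, inst, G, h9, h10⟩ := exists_families_of_seriesRep hequiv hfin F h7
      ((IsScalarTower.toAlgHom k (Localization.Away g) (Localization.Away h)).comp
        (IsScalarTower.toAlgHom k F.R (Localization.Away g))) (mul_ne_zero hg hc0) (fun ε hε => by
          rw [map_mul] at hε
          obtain ⟨ε₁, hε₁⟩ := h4 ε (left_ne_zero_of_mul hε)
          have : ε₁ h ≠ 0 := by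
            intro h0
            have h11 := congrArg ε₁ hc
            rw [map_mul, h0, zero_mul] at h11
            refine right_ne_zero_of_mul hε ?_
            rw [← hε₁]
            exact h11.symm
          obtain ⟨ε₂, hε₂⟩ := h8 ε₁ this
          exact ⟨ε₂, by rw [← AlgHom.comp_assoc, hε₂, hε₁]⟩) τ (fun ε' M hM hMi hS => by
        obtain ⟨e⟩ := hρ (ε'.comp (IsScalarTower.toAlgHom k (Localization.Away g) (Localization.Away h)))
        obtain ⟨e'⟩ := hτ ε'
        exact (hS.trans (isSummand_coind (IsSummand.of_equiv e))).trans (IsSummand.of_equiv e'))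
    refine ⟨ι, inst, G, h9.trans ?_, h10⟩
    obtain ⟨ε', -⟩ := exists_algHom_ne_zero (k := k) (R := Localization.Away h) one_ne_zero
    obtain ⟨e⟩ := hρ (ε'.comp (IsScalarTower.toAlgHom k (Localization.Away g) (Localization.Away h)))
    obtain ⟨e'⟩ := hτ ε'
    have hV := (ρ.map (ε'.comp (IsScalarTower.toAlgHom k (Localization.Away g)
      (Localization.Away h)))).isMaximalCohenMacaulay
    have hr := e.finrank_eq
    rw [hF _ (isMaximal_ker_algHom _)] at hr
    have h11 := finrank_le_of_injective_pi k (p := p) (Coind.isMaximalCohenMacaulay k (A := A) hV) hV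
      (fun f j => f (a j)) (fun _ _ => rfl) (fun b f => by rw [_root_.algebraMap_smul A]; rfl)
      (fun f f' hff => ha _ f f' fun j => congrFun hff j)
    rw [e'.finrank_eq, ← hr] at h11
    rw [← (τ.map ε').finrank_mul, add_mul]
    refine le_trans (Nat.mul_le_mul_right _ h11) (le_trans (le_of_eq (by ring)) (Nat.le_add_right _ _))

end CoindTransfer



/-! ### Dualizing modules -/

section Dualizing

open Abelian IsLocalRing

variable {X M : Type u} [CommRing X] [IsLocalRing X] [AddCommGroup M] [Module X M]

theorem IsDualizingModule.nontrivial (hd : ringKrullDim X = 2) (h : IsDualizingModule X M) :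
    Nontrivial M := by
  obtain ⟨e⟩ := (h.2 2).1 (by rw [hd]; rfl)
  by_contra hM
  rw [not_nontrivial_iff_subsingleton] at hM
  have hz : Limits.IsZero (ModuleCat.of X M) := ModuleCat.isZero_of_subsingleton _
  have : Subsingleton (Ext (ModuleCat.of X (ResidueField X)) (ModuleCat.of X M) 2) :=
    ⟨fun a b => by
      rw [← a.comp_mk₀_id, ← b.comp_mk₀_id, hz.eq_zero_of_src (𝟙 _), Ext.mk₀_zero, Ext.comp_zero,
        Ext.comp_zero]⟩
  exact not_subsingleton (ResidueField X) e.symm.toEquiv.subsingleton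

/-- Depth is read off from the first nonvanishing extension of the residue field: vanishing in
degrees 0 and 1 yields a regular sequence of length two. -/
theorem IsDualizingModule.isMaximalCohenMacaulay [IsNoetherianRing X] (hd : ringKrullDim X = 2)
    (h : IsDualizingModule X M) : IsMaximalCohenMacaulay X M := by
  have := h.nontrivial hd
  have := h.1
  obtain ⟨rs, h1, h2, h3⟩ := ModuleCat.exists_isRegular_of_exists_subsingleton_ext (maximalIdeal X) 2
    (ModuleCat.of X M) (lt_top_iff_ne_top.2 (Ne.symm (Submodule.top_ne_ideal_smul_of_le_jacobson_annihilator
      (maximalIdeal_le_jacobson _)))) (ModuleCat.of X (ResidueField X)) (by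
        have := Module.support_eq_zeroLocus (R := X) (M := ResidueField X)
        rw [this]
        congr 2
        exact Ideal.annihilator_quotient) (fun i hi => (h.2 i).2 (by
        rw [hd]
        exact_mod_cast hi.ne))
  refine ⟨h.1, rs, by rw [hd, h1]; rfl, h2, h3.toIsWeaklyRegular⟩

/-- The higher extensions of a module of finite length by a dualizing module vanish. -/
theorem IsDualizingModule.subsingleton_ext_of_smul_eq_zero [IsNoetherianRing X]
    (hd : ringKrullDim X = 2) (h : IsDualizingModule X M) {x y : X} {N : ℕ}
    (hN : maximalIdeal X ^ N ≤ Ideal.span {x, y}) {j : ℕ} (hj : 3 ≤ j)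
    {T : Type u} [AddCommGroup T] [Module X T] (hT : Module.Finite X T)
    (hx : ∀ t : T, x • t = 0) (hy : ∀ t : T, y • t = 0) :
    Subsingleton (Ext (ModuleCat.of X T) (ModuleCat.of X M) j) := by
  suffices H : (∀ t : T, x • t = 0) → (∀ t : T, y • t = 0) →
      Subsingleton (Ext (ModuleCat.of X T) (ModuleCat.of X M) j) from H hx hy
  clear hx hy
  induction hT using IsNoetherianRing.induction_on_isQuotientEquivQuotientPrime X with
  | subsingleton T =>
    intro _ _
    have hz : Limits.IsZero (ModuleCat.of X T) := ModuleCat.isZero_of_subsingleton _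
    exact ⟨fun a b => by
      rw [← a.mk₀_id_comp, ← b.mk₀_id_comp, hz.eq_zero_of_src (𝟙 _), Ext.mk₀_zero, Ext.zero_comp,
        Ext.zero_comp]⟩
  | quotient T p e =>
    intro hx hy
    have hmem : ∀ z : X, (∀ t : T, z • t = 0) → z ∈ p.1 := fun z hz => by
      have := congrArg e (hz (e.symm (Ideal.Quotient.mk _ 1)))
      rw [map_smul, e.apply_symm_apply, map_zero] at this
      rw [← Ideal.Quotient.eq_zero_iff_mem, ← this, Algebra.smul_def, map_one, mul_one]
      rfl
    -- Filter by cyclic quotients modulo primes. A quotient killed by both parameters has its prime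
    -- containing a power of the maximal ideal, so only the residue field occurs.
    have hp : p.1 = maximalIdeal X := by
      refine le_antisymm (le_maximalIdeal p.2.ne_top) (p.2.le_of_pow_le (hN.trans ?_))
      rw [Ideal.span_le]
      rintro z (rfl | rfl)
      exacts [hmem _ hx, hmem _ hy]
    have e' : T ≃ₗ[X] ResidueField X := e.trans (Submodule.quotEquivOfEq _ _ hp)
    have h1 : Subsingleton (Ext (ModuleCat.of X (ResidueField X)) (ModuleCat.of X M) j) :=
      (h.2 j).2 (by
        rw [hd]
        intro h2
        have : j = 2 := by exact_mod_cast h2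
        omega)
    let ι := e'.toModuleIso
    refine ⟨fun a b => ?_⟩
    have key : ∀ a : Ext (ModuleCat.of X T) (ModuleCat.of X M) j,
        a = (Ext.mk₀ ι.hom).comp ((Ext.mk₀ ι.inv).comp a (zero_add j)) (zero_add j) := fun a => by
      rw [Ext.mk₀_comp_mk₀_assoc, ι.hom_inv_id, Ext.mk₀_id_comp]
    rw [key a, key b, Subsingleton.elim ((Ext.mk₀ ι.inv).comp a (zero_add j))
      ((Ext.mk₀ ι.inv).comp b (zero_add j))]
  | exact T₁ T₂ T₃ f g hf hg hfg h1 h3 =>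
    intro hx hy
    have h1' := h1 (fun t => hf (by rw [map_smul, hx, map_zero])) (fun t => hf (by rw [map_smul, hy, map_zero]))
    have h3' := h3 (fun t => by obtain ⟨s, rfl⟩ := hg t; rw [← map_smul, hx, map_zero])
      (fun t => by obtain ⟨s, rfl⟩ := hg t; rw [← map_smul, hy, map_zero])
    let S := ModuleCat.shortComplexOfCompEqZero f g hfg.linearMap_comp_eq_zero
    have hS : S.ShortExact :=
      { exact := ModuleCat.shortComplex_exact _ hfg
        mono_f := (ModuleCat.mono_iff_injective _).2 hf
        epi_g := (ModuleCat.epi_iff_surjective _).2 hg }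
    suffices H : ∀ a : Ext S.X₂ (ModuleCat.of X M) j, a = 0 from ⟨fun a b => (H a).trans (H b).symm⟩
    intro a
    obtain ⟨b, rfl⟩ := Ext.contravariant_sequence_exact₂ hS _ a
      (Subsingleton.elim (α := Ext (ModuleCat.of X T₁) (ModuleCat.of X M) j) _ _)
    rw [Subsingleton.elim (α := Ext (ModuleCat.of X T₃) (ModuleCat.of X M) j) b 0, Ext.comp_zero]

/-- If `z ∈ 𝔪` is regular on `N` and `Ext^{j+1}(N / zN, M) = 0`, then `Ext^j(N, M) = 0`. -/
theorem subsingleton_ext_of_smul_regular [IsNoetherianRing X] [Module.Finite X M] {T : Type u}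
    [AddCommGroup T] [Module X T] [Module.Finite X T] {z : X} (hz : z ∈ maximalIdeal X)
    (hreg : ∀ t : T, z • t = 0 → t = 0) {j : ℕ}
    (h : Subsingleton (Ext (ModuleCat.of X (QuotSMulTop z T)) (ModuleCat.of X M) (j + 1))) :
    Subsingleton (Ext (ModuleCat.of X T) (ModuleCat.of X M) j) := by
  have hreg' : IsSMulRegular (ModuleCat.of X T) z := fun a b hab => by
    rw [← sub_eq_zero]
    exact hreg _ ((smul_sub z a b).trans (sub_eq_zero.2 hab))
  have hS := hreg'.smulShortComplex_shortExact
  -- Vanishing of the next extension group of the quotient makes multiplication by `z` surjective on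
  -- the finitely generated module `Ext^j`; Nakayama's lemma then kills it.
  have hsurj : ∀ a : Ext (ModuleCat.of X T) (ModuleCat.of X M) j, ∃ b, a = z • b := fun a => by
    obtain ⟨b, hb⟩ := Ext.contravariant_sequence_exact₁ hS (Y := ModuleCat.of X M) a (add_comm 1 j)
      (Subsingleton.elim (α := Ext (ModuleCat.of X (QuotSMulTop z T)) (ModuleCat.of X M) (j + 1)) _ _)
    refine ⟨b, hb.symm.trans ?_⟩
    have key : ∀ c : Ext (ModuleCat.of X T) (ModuleCat.of X M) j,
        (Ext.mk₀ (z • 𝟙 (ModuleCat.of X T))).comp c (zero_add j) = z • c := fun c => by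
      rw [Ext.mk₀_smul, Ext.smul_comp, Ext.mk₀_id_comp]
    exact key b
  have hfg : Module.Finite X (Ext (ModuleCat.of X T) (ModuleCat.of X M) j) := ModuleCat.finite_ext _ _ _ _
  rw [← Submodule.subsingleton_iff X, ← subsingleton_iff_bot_eq_top, eq_comm]
  refine Submodule.eq_bot_of_le_smul_of_le_jacobson_bot (maximalIdeal X) _ hfg.fg_top (fun a _ => ?_)
    (maximalIdeal_le_jacobson _)
  obtain ⟨b, rfl⟩ := hsurj a
  exact Submodule.smul_mem_smul hz Submodule.mem_top

/-- Divide by the two parameters in turn. The extensions of the double quotient vanish in degree `j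
+ 2 ≥ 3`, and the vanishing descends one degree for each parameter. -/
theorem IsDualizingModule.subsingleton_ext {k : Type u} [Field k] [IsDomain X] [Algebra k X]
    [Algebra (PS k) X] [SurfaceOver k X] (h : IsDualizingModule X M) {T : Type u} [AddCommGroup T]
    [Module X T] (hT : IsMaximalCohenMacaulay X T) {j : ℕ} (hj : 1 ≤ j) :
    Subsingleton (Ext (ModuleCat.of X T) (ModuleCat.of X M) j) := by
  have := SurfaceOver.isNoetherianRing k (X := X)
  have := h.1
  obtain ⟨N, hN⟩ := SurfaceOver.pow_le (k := k) (X := X)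
  obtain ⟨h1, h2, h3⟩ := (SurfaceOver.isMaximalCohenMacaulay_iff k).1 hT
  set x := algebraMap (PS k) X (MvPowerSeries.X 0)
  set y := algebraMap (PS k) X (MvPowerSeries.X 1)
  have hq : ∀ (z : X) (T' : Type u) [AddCommGroup T'] [Module X T'] (t : QuotSMulTop z T'), z • t = 0 := by
    intro z T' _ _ t
    obtain ⟨t, rfl⟩ := Submodule.Quotient.mk_surjective _ t
    rw [← Submodule.Quotient.mk_smul, Submodule.Quotient.mk_eq_zero]
    exact Submodule.smul_mem_pointwise_smul _ _ _ Submodule.mem_top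
  refine subsingleton_ext_of_smul_regular (SurfaceOver.mem (k := k) 0) h2
    (subsingleton_ext_of_smul_regular (SurfaceOver.mem (k := k) 1) (fun t ht => ?_)
      (h.subsingleton_ext_of_smul_eq_zero (SurfaceOver.dim (k := k)) hN (by omega) inferInstance
        (fun t => ?_) (hq _ _)))
  · obtain ⟨t, rfl⟩ := Submodule.Quotient.mk_surjective _ t
    rw [← Submodule.Quotient.mk_smul, Submodule.Quotient.mk_eq_zero,
      Submodule.mem_smul_pointwise_iff_exists] at ht
    obtain ⟨t', -, ht'⟩ := ht
    obtain ⟨s, rfl⟩ := h3 t t' ht'.symm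
    rw [Submodule.Quotient.mk_eq_zero]
    exact Submodule.smul_mem_pointwise_smul _ _ _ Submodule.mem_top
  · obtain ⟨t, rfl⟩ := Submodule.Quotient.mk_surjective _ t
    rw [← Submodule.Quotient.mk_smul]
    exact congrArg _ (hq x T t)

end Dualizing



/-! ### Duality for a finite extension with a trace form -/

section Duality

open Abelian IsLocalRing

variable {A B M : Type u} [CommRing A] [CommRing B] [Algebra B A] [AddCommGroup M] [Module B M]

/-- A linear form as a morphism. -/
noncomputable def traceHom (lam : A →ₗ[B] M) :
    (ModuleCat.restrictScalars (algebraMap B A)).obj (ModuleCat.of A A) ⟶ ModuleCat.of B M :=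
  ModuleCat.ofHom (X := (ModuleCat.restrictScalars (algebraMap B A)).obj (ModuleCat.of A A))
    { toFun := fun a => lam (show A from a)
      map_add' := fun _ _ => map_add lam _ _
      map_smul' := fun b a => (congrArg lam (Algebra.smul_def b (show A from a)).symm).trans
        (lam.map_smul b (show A from a)) }

/-- The comparison of extensions by `A` over `A` and extensions by `M` over `B`, given by a linear form. -/
noncomputable def extOfTrace (lam : A →ₗ[B] M) (T : ModuleCat.{u} A) (n : ℕ) :
    Ext T (ModuleCat.of A A) n →+
      Ext ((ModuleCat.restrictScalars (algebraMap B A)).obj T) (ModuleCat.of B M) n :=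
  ((Ext.mk₀ (traceHom lam)).postcomp _ (add_zero n)).comp
    ((ModuleCat.restrictScalars (algebraMap B A)).mapExtAddHom T (ModuleCat.of A A) n)

variable (lam : A →ₗ[B] M)

theorem extOfTrace_apply {T : ModuleCat.{u} A} {n : ℕ} (x : Ext T (ModuleCat.of A A) n) :
    extOfTrace lam T n x = (x.mapExactFunctor (ModuleCat.restrictScalars (algebraMap B A))).comp
      (Ext.mk₀ (traceHom lam)) (add_zero n) := rfl

theorem extOfTrace_comp {T T' : ModuleCat.{u} A} {a b n : ℕ} (x : Ext T T' a) (y : Ext T' (ModuleCat.of A A) b)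
    (h : a + b = n) : extOfTrace lam T n (x.comp y h) =
      (x.mapExactFunctor (ModuleCat.restrictScalars (algebraMap B A))).comp (extOfTrace lam T' b y) h := by
  rw [extOfTrace_apply, extOfTrace_apply, Ext.mapExactFunctor_comp, Ext.comp_assoc_of_third_deg_zero]

theorem extOfTrace_smul {T : ModuleCat.{u} A} {n : ℕ} (b : B) (x : Ext T (ModuleCat.of A A) n) :
    extOfTrace lam T n (algebraMap B A b • x) = b • extOfTrace lam T n x := by
  have h1 : algebraMap B A b • x = (Ext.mk₀ (algebraMap B A b • 𝟙 T)).comp x (zero_add n) := by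
    rw [Ext.mk₀_smul, Ext.smul_comp, Ext.mk₀_id_comp]
  rw [h1, extOfTrace_comp, Ext.mapExactFunctor_mk₀]
  have h2 : (ModuleCat.restrictScalars (algebraMap B A)).map (algebraMap B A b • 𝟙 T) = b • 𝟙 _ := by
    rfl
  rw [h2, Ext.mk₀_smul, Ext.smul_comp, Ext.mk₀_id_comp]

/-- The hypothesis identifies `A` with Hom_B(A, M), so this is the adjunction Hom_A(T, Hom_B(A, M))
= Hom_B(T, M). -/
theorem extOfTrace_zero_bijective (hlam : ∀ ψ : A →ₗ[B] M, ∃! f : A, ∀ a, ψ a = lam (a * f))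
    (T : ModuleCat.{u} A) : Function.Bijective (extOfTrace lam T 0) := by
  have h1 : ∀ f : T ⟶ ModuleCat.of A A, extOfTrace lam T 0 (Ext.mk₀ f) =
      Ext.mk₀ ((ModuleCat.restrictScalars (algebraMap B A)).map f ≫ traceHom lam) := fun f => by
    rw [extOfTrace_apply, Ext.mapExactFunctor_mk₀, Ext.mk₀_comp_mk₀]
  constructor
  · rw [injective_iff_map_eq_zero]
    intro x hx
    obtain ⟨f, rfl⟩ := (Ext.mk₀_bijective _ _).2 x
    rw [h1, Ext.mk₀_eq_zero_iff] at hx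
    have h2 : ∀ t : T, lam (f.hom t) = 0 := fun t => LinearMap.congr_fun (congrArg ModuleCat.Hom.hom hx) t
    rw [Ext.mk₀_eq_zero_iff]
    refine ModuleCat.hom_ext (LinearMap.ext fun t => ?_)
    refine (hlam 0).unique (fun a => ?_) fun a => ?_
    · rw [LinearMap.zero_apply]
      exact (h2 (a • t)).symm.trans (congrArg lam (f.hom.map_smul a t))
    · exact (congrArg lam (mul_zero a)).symm ▸ (map_zero lam).symm
  · intro y
    obtain ⟨g, rfl⟩ := (Ext.mk₀_bijective _ _).2 y
    let g' : T → M := fun t => g.hom t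
    have hadd : ∀ s t : T, g' (s + t) = g' s + g' t := fun s t => map_add g.hom s t
    have hsm : ∀ (b : B) (t : T), g' (algebraMap B A b • t) = b • g' t := fun b t => g.hom.map_smul b t
    let ψ : T → A →ₗ[B] M := fun t =>
      { toFun := fun a => g' (a • t)
        map_add' := fun a a' => by rw [add_smul, hadd]
        map_smul' := fun b a => by rw [Algebra.smul_def, mul_smul, hsm, RingHom.id_apply] }
    choose f hf using fun t => (hlam (ψ t)).exists
    have huniq : ∀ c d : A, (∀ a, lam (a * c) = lam (a * d)) → c = d := fun c d h =>
      (hlam (lam ∘ₗ LinearMap.mulRight B c)).unique (fun a => rfl) h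
    let f' : T →ₗ[A] A :=
      { toFun := f
        map_add' := fun s t => huniq _ _ fun a => by
          rw [mul_add, map_add, ← hf, ← hf, ← hf]
          change g' (a • (s + t)) = _
          rw [smul_add, hadd]
          rfl
        map_smul' := fun c t => huniq _ _ fun a => by
          rw [RingHom.id_apply, smul_eq_mul, ← mul_assoc, ← hf, ← hf]
          change g' (a • c • t) = g' ((a * c) • t)
          rw [mul_smul] }
    refine ⟨Ext.mk₀ (ModuleCat.ofHom (Y := A) f'), ?_⟩
    rw [h1]
    congr 1
    refine ModuleCat.hom_ext (LinearMap.ext fun t => ?_)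
    have := hf t 1
    rw [one_mul] at this
    refine this.symm.trans ?_
    change g' ((1 : A) • t) = g' t
    rw [one_smul]

/-- Dimension shifting along a free cover. Free modules have no higher extensions on either side:
over `A` since they are projective, over `B` by `hfree`. -/
theorem extOfTrace_bijective [IsNoetherianRing A]
    (hlam : ∀ ψ : A →ₗ[B] M, ∃! f : A, ∀ a, ψ a = lam (a * f))
    (hfree : ∀ (P : ModuleCat.{u} A), Module.Free A P → Module.Finite A P → ∀ j, Subsingleton
      (Ext ((ModuleCat.restrictScalars (algebraMap B A)).obj P) (ModuleCat.of B M) (j + 1)))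
    (n : ℕ) (T : ModuleCat.{u} A) [Module.Finite A T] : Function.Bijective (extOfTrace lam T n) := by
  induction n generalizing T with
  | zero => exact extOfTrace_zero_bijective lam hlam T
  | succ n ih =>
    obtain ⟨P, _, _, hPfree, hPfin, f, hf⟩ := Module.exists_finite_presentation A T
    let S : ShortComplex (ModuleCat.{u} A) := f.shortComplexKer
    have hS : S.ShortExact := LinearMap.shortExact_shortComplexKer hf
    have hS' := hS.map_of_exact (ModuleCat.restrictScalars (algebraMap B A))
    have h1 : Subsingleton (Ext S.X₂ (ModuleCat.of A A) (n + 1)) := Ext.subsingleton_of_projective _ _ _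
    have h2 : Subsingleton (Ext (S.map (ModuleCat.restrictScalars (algebraMap B A))).X₂
      (ModuleCat.of B M) (n + 1)) := hfree S.X₂ hPfree hPfin n
    have hX₁ : Module.Finite A S.X₁ := inferInstanceAs (Module.Finite A (LinearMap.ker f))
    have hb₂ := ih S.X₂
    have hb₁ := ih S.X₁
    have hcf : ∀ x : Ext S.X₂ (ModuleCat.of A A) n, extOfTrace lam S.X₁ n ((Ext.mk₀ S.f).comp x (zero_add n)) =
        (Ext.mk₀ (S.map (ModuleCat.restrictScalars (algebraMap B A))).f).comp (extOfTrace lam S.X₂ n x)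
          (zero_add n) := fun x => by
      rw [extOfTrace_comp, Ext.mapExactFunctor_mk₀]
      rfl
    have hcd : ∀ x : Ext S.X₁ (ModuleCat.of A A) n, extOfTrace lam S.X₃ (n + 1)
        (hS.extClass.comp x (add_comm 1 n)) = hS'.extClass.comp (extOfTrace lam S.X₁ n x) (add_comm 1 n) :=
      fun x => by
        rw [extOfTrace_comp, Ext.mapExactFunctor_extClass]
        rfl
    have hsurj : ∀ x : Ext S.X₃ (ModuleCat.of A A) (n + 1), ∃ y, hS.extClass.comp y (add_comm 1 n) = x :=
      fun x => Ext.contravariant_sequence_exact₃ hS _ x (Subsingleton.elim _ _) (add_comm 1 n)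
    constructor
    · rw [injective_iff_map_eq_zero]
      intro x hx
      obtain ⟨y, rfl⟩ := hsurj x
      rw [show extOfTrace lam T (n + 1) _ = _ from hcd y] at hx
      obtain ⟨z, hz⟩ := Ext.contravariant_sequence_exact₁ hS' (Y := ModuleCat.of B M)
        (extOfTrace lam S.X₁ n y) (add_comm 1 n) hx
      obtain ⟨w, rfl⟩ := hb₂.2 z
      rw [← hcf] at hz
      rw [← hb₁.1 hz]
      exact hS.extClass_comp_assoc w
    · intro y
      obtain ⟨z, hz⟩ := Ext.contravariant_sequence_exact₃ hS' (Y := ModuleCat.of B M) y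
        (Subsingleton.elim _ _) (add_comm 1 n)
      obtain ⟨w, rfl⟩ := hb₁.2 z
      exact ⟨_, (hcd w).trans hz⟩

/-- A finite extension of a singularity with a trace form to a dualizing module is Gorenstein. -/
theorem isGorensteinLocalRing_of_trace {k : Type u} [Field k] [IsDomain A] [IsLocalRing A] [Algebra k A]
    [Algebra (PS k) A] [SurfaceOver k A] [IsDomain B] [IsLocalRing B] [Algebra k B] [Algebra (PS k) B]
    [SurfaceOver k B] [IsScalarTower (PS k) B A] (hM : IsDualizingModule B M)
    (hlam : ∀ ψ : A →ₗ[B] M, ∃! f : A, ∀ a, ψ a = lam (a * f))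
    (hmem : ∀ b : B, algebraMap B A b ∈ maximalIdeal A ↔ b ∈ maximalIdeal B)
    (hres : ∀ a : A, ∃ b : B, a - algebraMap B A b ∈ maximalIdeal A) : IsGorensteinLocalRing A := by
  have := SurfaceOver.isNoetherianRing k (X := A)
  let κ := (ModuleCat.restrictScalars (algebraMap B A)).obj (ModuleCat.of A (ResidueField A))
  let f : B →ₗ[B] κ :=
    { toFun := fun b => residue A (algebraMap B A b)
      map_add' := fun b c => by
        rw [map_add, map_add]
        rfl
      map_smul' := fun b c => by
        rw [smul_eq_mul, map_mul, map_mul]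
        rfl }
  have hf : Function.Surjective f := fun t => by
    obtain ⟨a, rfl⟩ := residue_surjective (R := A) t
    obtain ⟨b, hb⟩ := hres a
    refine ⟨b, Eq.symm (sub_eq_zero.1 ?_)⟩
    exact (map_sub (residue A) _ _).symm.trans ((residue_eq_zero_iff _).2 hb)
  have hker : maximalIdeal B = LinearMap.ker f := by
    ext b
    exact (hmem b).symm.trans (residue_eq_zero_iff _).symm
  let eκ : ResidueField B ≃ₗ[B] κ :=
    (Submodule.quotEquivOfEq _ _ hker).trans (f.quotKerEquivOfSurjective hf)
  let ι : ModuleCat.of B (ResidueField B) ≅ κ := eκ.toModuleIso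
  let Φ : ∀ i, Ext (ModuleCat.of A (ResidueField A)) (ModuleCat.of A A) i →+
      Ext (ModuleCat.of B (ResidueField B)) (ModuleCat.of B M) i := fun i =>
    ((Ext.mk₀ ι.hom).precomp _ (zero_add i)).comp (extOfTrace lam _ i)
  have hΦ : ∀ i, Function.Bijective (Φ i) := fun i => by
    have h1 : Function.Bijective ((Ext.mk₀ ι.hom).precomp (ModuleCat.of B M) (zero_add i)) := by
      refine Function.bijective_iff_has_inverse.2 ⟨(Ext.mk₀ ι.inv).precomp (ModuleCat.of B M) (zero_add i),
        fun x => ?_, fun x => ?_⟩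
      · change (Ext.mk₀ ι.inv).comp ((Ext.mk₀ ι.hom).comp x (zero_add i)) (zero_add i) = x
        rw [Ext.mk₀_comp_mk₀_assoc, ι.inv_hom_id, Ext.mk₀_id_comp]
      · change (Ext.mk₀ ι.hom).comp ((Ext.mk₀ ι.inv).comp x (zero_add i)) (zero_add i) = x
        rw [Ext.mk₀_comp_mk₀_assoc, ι.hom_inv_id, Ext.mk₀_id_comp]
    refine h1.comp (extOfTrace_bijective lam hlam (fun P hPf hPfin j => ?_) i _)
    -- A finite free module over `A` is Cohen-Macaulay over `A`, hence over `B`, where its higher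
    -- extensions by the dualizing module vanish.
    have hP : IsMaximalCohenMacaulay A P := by
      rw [SurfaceOver.isMaximalCohenMacaulay_iff k]
      obtain ⟨h2, h3⟩ := (SurfaceOver.regular (k := k) (X := A))
      let b := Module.Free.chooseBasis A P
      refine ⟨hPfin, IsParamRegular.of_linearEquiv ⟨fun m hm => ?_, fun m m' hm => ?_⟩ b.equivFun.symm⟩
      · exact funext fun i => h2 _ (congrFun hm i)
      · choose w hw using fun i => h3 (m i) (m' i) (congrFun hm i)
        exact ⟨w, funext hw⟩
    exact hM.subsingleton_ext (k := k) (T := Restr B A P)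
      (IsMaximalCohenMacaulay.restrict k (A := A) (M := Restr B A P) hP) (by omega)
  have hdA := SurfaceOver.dim (k := k) (X := A)
  have hdB := SurfaceOver.dim (k := k) (X := B)
  refine ⟨inferInstance, fun i => ⟨fun hi => ?_, fun hi => ?_⟩⟩
  · obtain ⟨e⟩ := (hM.2 i).1 (by rw [hdB, ← hdA, hi])
    obtain ⟨ε, hε⟩ := (hΦ i).2 (e.symm 1)
    have hsm : ∀ (b : B) x, Φ i (algebraMap B A b • x) = b • Φ i x := fun b x => by
      change (Ext.mk₀ ι.hom).comp (extOfTrace lam _ i (algebraMap B A b • x)) (zero_add i) = _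
      rw [extOfTrace_smul, Ext.comp_smul]
      rfl
    -- The comparison is linear over `B`, and `B` maps onto the residue field. So the preimage `ε`
    -- of a generator generates the group over `A`, and its annihilator is exactly the maximal
    -- ideal.
    let g := LinearMap.toSpanSingleton A (Ext (ModuleCat.of A (ResidueField A)) (ModuleCat.of A A) i) ε
    have hg : Function.Surjective g := fun x => by
      obtain ⟨b, hb⟩ := residue_surjective (R := B) (e (Φ i x))
      refine ⟨algebraMap B A b, (hΦ i).1 ?_⟩
      rw [LinearMap.toSpanSingleton_apply, hsm, hε, ← map_smul, Algebra.smul_def, mul_one]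
      exact (congrArg e.symm hb).trans (e.symm_apply_apply _)
    have hk : maximalIdeal A = LinearMap.ker g := by
      refine (maximalIdeal.isMaximal A).eq_of_le (fun h => ?_) fun a ha => ?_
      · have h1 : g 1 = 0 := by
          rw [← LinearMap.mem_ker, h]
          trivial
        rw [LinearMap.toSpanSingleton_apply, one_smul] at h1
        rw [h1, map_zero, eq_comm, e.symm.map_eq_zero_iff] at hε
        exact one_ne_zero hε
      · rw [LinearMap.mem_ker, LinearMap.toSpanSingleton_apply]
        have h1 : a • ε = (Ext.mk₀ (a • 𝟙 (ModuleCat.of A (ResidueField A)))).comp ε (zero_add i) := by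
          rw [Ext.mk₀_smul, Ext.smul_comp, Ext.mk₀_id_comp]
        have h2 : a • 𝟙 (ModuleCat.of A (ResidueField A)) = 0 := by
          refine ModuleCat.hom_ext (LinearMap.ext fun t => ?_)
          change a • t = 0
          rw [Algebra.smul_def, show algebraMap A (ResidueField A) a = 0 from (residue_eq_zero_iff a).2 ha, zero_mul]
        rw [h1, h2, Ext.mk₀_zero, Ext.zero_comp]
    exact ⟨((Submodule.quotEquivOfEq _ _ hk).trans (g.quotKerEquivOfSurjective hg)).symm⟩
  · have := (hM.2 i).2 (by rw [hdB, ← hdA]; exact hi)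
    exact (hΦ i).1.subsingleton

end Duality



/-! ### Divisorial powers -/

section LocalSubring

open scoped Pointwise

variable {B : Type u} [CommRing B] [IsDomain B]

/-- The localization of `B` at `P`, as a subring of the fraction field. -/
def localSubring (P : Ideal B) [hP : P.IsPrime] : Subalgebra B (FractionRing B) where
  carrier := {z | ∃ s : B, s ∉ P ∧ ∃ b : B, s • z = algebraMap B _ b}
  mul_mem' := by
    rintro x y ⟨s, hs, b, hb⟩ ⟨t, ht, c, hc⟩
    refine ⟨s * t, P.primeCompl.mul_mem hs ht, b * c, ?_⟩
    rw [map_mul, ← hb, ← hc, smul_mul_smul_comm]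
  add_mem' := by
    rintro x y ⟨s, hs, b, hb⟩ ⟨t, ht, c, hc⟩
    refine ⟨s * t, P.primeCompl.mul_mem hs ht, t * b + s * c, ?_⟩
    rw [map_add, map_mul, map_mul, ← hb, ← hc, smul_add]
    simp only [Algebra.smul_def, map_mul]
    ring
  algebraMap_mem' b := ⟨1, P.primeCompl.one_mem, b, one_smul _ _⟩

variable {P : Ideal B} [hP : P.IsPrime]

theorem mem_of_pow_mem_algebraMap [IsIntegrallyClosed B] {n : ℕ} (hn : 0 < n) {z : FractionRing B}
    (hz : ∃ b : B, z ^ n = algebraMap B _ b) : ∃ b : B, z = algebraMap B _ b := by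
  obtain ⟨b, hb⟩ := hz
  obtain ⟨c, hc⟩ := IsIntegrallyClosed.isIntegral_iff.1
    (IsIntegral.of_pow hn (by rw [hb]; exact isIntegral_algebraMap) : IsIntegral B z)
  exact ⟨c, hc.symm⟩

theorem mem_localSubring_of_pow_mem [IsIntegrallyClosed B] {n : ℕ} (hn : 0 < n) {z : FractionRing B}
    (hz : z ^ n ∈ localSubring P) : z ∈ localSubring P := by
  obtain ⟨s, hs, b, hb⟩ := hz
  refine ⟨s, hs, mem_of_pow_mem_algebraMap hn ⟨s ^ (n - 1) * b, ?_⟩⟩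
  rw [smul_pow, map_mul, ← hb]
  conv_lhs => rw [show n = n - 1 + 1 by omega, pow_succ, mul_smul]
  rw [show n - 1 + 1 = n by omega, Algebra.smul_def]

/-- `a` generates the fractional ideal `ω` at `P`. -/
structure IsLocalGenerator (ω : FractionalIdeal B⁰ (FractionRing B)) (P : Ideal B) (a : FractionRing B) :
    Prop where
  mem : a ∈ ω
  ne_zero : a ≠ 0
  exists_smul : ∃ s : B, s ∉ P ∧ ∀ x ∈ ω, ∃ b : B, s • x = b • a

theorem IsLocalGenerator.div_pow_mem {ω : FractionalIdeal B⁰ (FractionRing B)} {a : FractionRing B}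
    (h : IsLocalGenerator ω P a) {i : ℕ} {x : FractionRing B} (hx : x ∈ ω ^ i) : x / a ^ i ∈ localSubring P := by
  have ha := h.ne_zero
  induction i generalizing x with
  | zero =>
    rw [pow_zero, FractionalIdeal.mem_one_iff] at hx
    obtain ⟨b, rfl⟩ := hx
    rw [pow_zero, div_one]
    exact (localSubring P).algebraMap_mem b
  | succ i ih =>
    rw [pow_succ] at hx
    refine FractionalIdeal.mul_induction_on hx (fun y hy z hz => ?_) fun y z hy hz => ?_
    · rw [pow_succ, mul_div_mul_comm]
      refine (localSubring P).mul_mem (ih hy) ?_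
      obtain ⟨s, hs, h1⟩ := h.exists_smul
      obtain ⟨b, hb⟩ := h1 z hz
      refine ⟨s, hs, b, ?_⟩
      rw [← smul_div_assoc, hb, Algebra.smul_def, mul_div_assoc, div_self ha, mul_one]
    · rw [add_div]
      exact (localSubring P).add_mem hy hz

/-- At a prime of height one the power `ω ^ i` is generated by the `i`-th power of a local
generator. -/
theorem mem_divisorialPower_iff {ω : FractionalIdeal B⁰ (FractionRing B)} {a : Ideal B → FractionRing B}
    (h : ∀ P : Ideal B, P.IsPrime → P.height = 1 → IsLocalGenerator ω P (a P)) {i : ℕ} {x : FractionRing B} :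
    x ∈ divisorialPower ω i ↔
      ∀ (P : Ideal B) (_ : P.IsPrime), P.height = 1 → x / a P ^ i ∈ localSubring P := by
  rw [mem_divisorialPower]
  refine forall_congr' fun P => forall_congr' fun hP => forall_congr' fun h1 => ?_
  have ha := (h P hP h1).ne_zero
  constructor
  · rintro ⟨s, hs, hx⟩
    obtain ⟨t, ht, b, hb⟩ := (h P hP h1).div_pow_mem hx
    refine ⟨t * s, P.primeCompl.mul_mem ht hs, b, ?_⟩
    rw [mul_smul, ← smul_div_assoc, hb]
  · rintro ⟨s, hs, b, hb⟩
    refine ⟨s, hs, ?_⟩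
    have : s • x = b • a P ^ i := by
      rw [← smul_div_assoc, div_eq_iff (pow_ne_zero _ ha)] at hb
      rw [hb, Algebra.smul_def]
    rw [this]
    refine Submodule.smul_mem (ω ^ i : FractionalIdeal B⁰ (FractionRing B)).val _ ?_
    change a P ^ i ∈ ((ω ^ i : FractionalIdeal B⁰ (FractionRing B)) : Submodule B (FractionRing B))
    rw [FractionalIdeal.coe_pow]
    exact Submodule.pow_mem_pow (ω : Submodule B (FractionRing B)) (h P hP h1).mem i

/-- A normal noetherian local domain of dimension one is a discrete valuation ring; height one
leaves no nonzero prime other than the maximal ideal. -/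
theorem isPrincipalIdealRing_localization [IsNoetherianRing B] [IsIntegrallyClosed B] (h : P.height = 1) :
    IsPrincipalIdealRing (Localization.AtPrime P) := by
  have hle : P.primeCompl ≤ B⁰ := P.primeCompl_le_nonZeroDivisors
  have : IsIntegrallyClosed (Localization.AtPrime P) := isIntegrallyClosed_of_isLocalization _ P.primeCompl hle
  have : IsNoetherianRing (Localization.AtPrime P) := IsLocalization.isNoetherianRing P.primeCompl _ inferInstance
  have : IsDomain (Localization.AtPrime P) := IsLocalization.isDomain_localization hle
  have tfae := (tfae_of_isNoetherianRing_of_isLocalRing_of_isDomain (Localization.AtPrime P)).out 3 0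
  refine tfae.1 ⟨inferInstance, fun Q hQ0 hQ => ?_⟩
  have h1 := IsLocalization.AtPrime.under_maximalIdeal (Localization.AtPrime P) P
  have hQP : Q.under B ≤ P := by
    exact (Ideal.comap_mono (IsLocalRing.le_maximalIdeal hQ.ne_top)).trans h1.le
  have hne : Q.under B ≠ ⊥ := fun h0 => hQ0 (by
    rw [← IsLocalization.map_under P.primeCompl (Localization.AtPrime P) Q, h0, Ideal.map_bot])
  have heq : Q.under B = P := by
    by_contra hne'
    have h2 := Ideal.height_strict_mono_of_isPrime (lt_of_le_of_ne hQP hne')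
    rw [h] at h2
    exact hne (Ideal.height_eq_zero_iff_eq_bot.1 (Order.lt_one_iff.1 h2))
  rw [← IsLocalization.map_under P.primeCompl (Localization.AtPrime P) Q, heq,
    Localization.AtPrime.map_eq_maximalIdeal]

/-- The numerator ideal becomes principal at `P`, with a generator `i` that may be taken from it.
One `t` outside `P` clears the denominators for finitely many generators, and division by the
denominator of `ω` gives the element. -/
theorem exists_isLocalGenerator [IsNoetherianRing B] [IsIntegrallyClosed B] (h : P.height = 1)
    {ω : FractionalIdeal B⁰ (FractionRing B)} (hω : ω ≠ 0) : ∃ a, IsLocalGenerator ω P a := by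
  have := isPrincipalIdealRing_localization h
  have hinj : Function.Injective (algebraMap B (Localization.AtPrime P)) :=
    IsLocalization.injective _ P.primeCompl_le_nonZeroDivisors
  obtain ⟨g, hg⟩ := (IsPrincipalIdealRing.principal (ω.num.map (algebraMap B (Localization.AtPrime P)))).principal
  have hgm : g ∈ ω.num.map (algebraMap B (Localization.AtPrime P)) := by
    rw [hg]
    exact Submodule.mem_span_singleton_self g
  obtain ⟨⟨⟨i, hi⟩, s⟩, his⟩ := (IsLocalization.mem_map_algebraMap_iff P.primeCompl _).1 hgm
  have key : ∀ x ∈ ω.num, ∃ t ∉ P, ∃ r, t * x = r * i := fun x hx => by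
    have h1 := Ideal.mem_map_of_mem (algebraMap B (Localization.AtPrime P)) hx
    rw [hg] at h1
    obtain ⟨c, hc⟩ := Submodule.mem_span_singleton.1 h1
    obtain ⟨⟨r, t⟩, hrt⟩ := IsLocalization.surj P.primeCompl c
    refine ⟨t * s, P.primeCompl.mul_mem t.2 s.2, r, hinj ?_⟩
    rw [map_mul, map_mul, map_mul, ← hc, ← hrt, smul_eq_mul]
    linear_combination (algebraMap B (Localization.AtPrime P) t) * c * his
  have hall : ∃ t ∉ P, ∀ x ∈ ω.num, ∃ r, t * x = r * i := by
    obtain ⟨G, hG⟩ := IsNoetherian.noetherian ω.num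
    choose! t ht r hr using key
    have hGm : ∀ x ∈ G, x ∈ ω.num := fun x hx => hG ▸ Submodule.subset_span hx
    refine ⟨∏ x ∈ G, t x, P.primeCompl.prod_mem fun x hx => ht x (hGm x hx), fun x hx => ?_⟩
    rw [← hG] at hx
    refine Submodule.span_induction (fun y hy => ?_) ⟨0, by simp⟩ ?_ ?_ hx
    · obtain ⟨c, hc⟩ := Finset.dvd_prod_of_mem t hy
      exact ⟨c * r y, by rw [hc, mul_comm (t y), mul_assoc, hr y (hGm y hy), mul_assoc]⟩
    · rintro y z - - ⟨r₁, h₁⟩ ⟨r₂, h₂⟩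
      exact ⟨r₁ + r₂, by rw [mul_add, h₁, h₂, add_mul]⟩
    · rintro c y - ⟨r₁, h₁⟩
      exact ⟨c * r₁, by rw [smul_eq_mul, mul_left_comm, h₁, mul_assoc]⟩
  obtain ⟨t, ht, htx⟩ := hall
  have hden : algebraMap B (FractionRing B) ω.den ≠ 0 :=
    IsFractionRing.to_map_ne_zero_of_mem_nonZeroDivisors ω.den.2
  have hmem : ∀ x, x ∈ ω ↔ ∃ j ∈ ω.num, algebraMap B _ j = (ω.den : B) • x := fun x => by
    have h1 := FractionalIdeal.den_mul_self_eq_num ω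
    constructor
    · intro hx
      have h2 : (ω.den : B) • x ∈ ω.den • (ω : Submodule B (FractionRing B)) :=
        Submodule.smul_mem_pointwise_smul x ω.den _ hx
      rw [h1] at h2
      exact h2
    · rintro ⟨j, hj, hjx⟩
      have h2 : (ω.den : B) • x ∈ ω.den • (ω : Submodule B (FractionRing B)) := by
        rw [h1]
        exact ⟨j, hj, hjx⟩
      obtain ⟨y, hy, hyx⟩ := h2
      have : y = x := by
        have h3 : (ω.den : B) • y = (ω.den : B) • x := hyx
        rw [Algebra.smul_def, Algebra.smul_def] at h3
        exact mul_left_cancel₀ hden h3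
      exact this ▸ hy
  have hi0 : i ≠ 0 := by
    rintro rfl
    refine hω (FractionalIdeal.eq_zero_iff.2 fun x hx => ?_)
    obtain ⟨j, hj, hjx⟩ := (hmem x).1 hx
    obtain ⟨r, hr⟩ := htx j hj
    rw [mul_zero, mul_eq_zero, or_iff_right (show t ≠ 0 from fun h0 => ht (h0 ▸ P.zero_mem))] at hr
    rw [hr, map_zero, Algebra.smul_def, eq_comm, mul_eq_zero, or_iff_right hden] at hjx
    exact hjx
  refine ⟨algebraMap B _ i / algebraMap B _ ω.den, (hmem _).2 ⟨i, hi, ?_⟩, ?_, t, ht, fun x hx => ?_⟩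
  · rw [Algebra.smul_def, mul_div_cancel₀ _ hden]
  · exact div_ne_zero ((map_ne_zero_iff _ (IsFractionRing.injective B _)).2 hi0) hden
  · obtain ⟨j, hj, hjx⟩ := (hmem x).1 hx
    obtain ⟨r, hr⟩ := htx j hj
    refine ⟨r, ?_⟩
    rw [Algebra.smul_def] at hjx
    rw [Algebra.smul_def, Algebra.smul_def, ← mul_div_assoc, ← map_mul, ← hr, map_mul, hjx]
    field_simp

end LocalSubring



/-! ### Fractional ideals of finite order in the class group -/

/-- The class of `ω` has order `n` in the divisor class group, and `ω^{(n)} = θB`. -/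
structure HasClassOrder {B : Type u} [CommRing B] [IsDomain B] (ω : FractionalIdeal B⁰ (FractionRing B))
    (n : ℕ) (θ : FractionRing B) : Prop where
  pos : 0 < n
  ne_zero : ω ≠ 0
  eq_span : divisorialPower ω n = Submodule.span B {θ}
  minimal : ∀ i, 0 < i → (divisorialPower ω i).IsPrincipal → n ≤ i

namespace HasClassOrder

variable {B : Type u} [CommRing B] [IsDomain B] {ω : FractionalIdeal B⁰ (FractionRing B)}
  {n : ℕ} {θ : FractionRing B} (h : HasClassOrder ω n θ)

include h

theorem mem_n_iff {x : FractionRing B} : x ∈ divisorialPower ω n ↔ ∃ b : B, b • θ = x := by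
  rw [h.eq_span, Submodule.mem_span_singleton]

theorem exists_ne_zero : ∃ x ∈ ω, x ≠ 0 := by
  by_contra! hx
  exact h.ne_zero (FractionalIdeal.eq_zero_iff.2 hx)

theorem pow_mem {x : FractionRing B} {i : ℕ} (hx : x ∈ divisorialPower ω i) (m : ℕ) :
    x ^ m ∈ divisorialPower ω (i * m) := by
  induction m with
  | zero =>
    rw [pow_zero]
    exact pow_le_divisorialPower ω 0 (by rw [pow_zero]; exact FractionalIdeal.one_mem_one _)
  | succ m ih =>
    rw [pow_succ, Nat.mul_succ]
    exact mul_mem_divisorialPower ih hx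

theorem mem_one_of_mem {x : FractionRing B} (hx : x ∈ ω) : x ∈ divisorialPower ω 1 :=
  pow_le_divisorialPower ω 1 (by rwa [pow_one])

theorem exists_mem_ne_zero (i : ℕ) : ∃ x ∈ divisorialPower ω i, x ≠ 0 := by
  obtain ⟨x, hx, h0⟩ := h.exists_ne_zero
  have := h.pow_mem (h.mem_one_of_mem hx) i
  rw [one_mul] at this
  exact ⟨_, this, pow_ne_zero i h0⟩

theorem theta_ne_zero : θ ≠ 0 := by
  rintro rfl
  obtain ⟨x, hx, h0⟩ := h.exists_mem_ne_zero n
  obtain ⟨b, rfl⟩ := h.mem_n_iff.1 hx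
  exact h0 (smul_zero b)

theorem theta_mem : θ ∈ divisorialPower ω n := h.mem_n_iff.2 ⟨1, one_smul _ _⟩

/-- Multiplication by `θ` carries `ω^{(0)}` into `ω^{(n)} = θB`, so the equality with `B` needs no
theorem on intersections of localizations. -/
theorem mem_zero_iff {x : FractionRing B} : x ∈ divisorialPower ω 0 ↔ ∃ b : B, x = algebraMap B _ b := by
  constructor
  · intro hx
    have h1 := mul_mem_divisorialPower h.theta_mem hx
    rw [add_zero] at h1
    obtain ⟨b, hb⟩ := h.mem_n_iff.1 h1
    refine ⟨b, mul_left_cancel₀ h.theta_ne_zero ?_⟩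
    rw [← hb, Algebra.smul_def, mul_comm]
  · rintro ⟨b, rfl⟩
    refine pow_le_divisorialPower ω 0 ?_
    rw [pow_zero]
    exact (FractionalIdeal.mem_one_iff _).2 ⟨b, rfl⟩

theorem exists_smul_theta_pow (i : ℕ) {x : FractionRing B} (hx : x ∈ divisorialPower ω (n * i)) :
    ∃ b : B, x = b • θ ^ i := by
  induction i generalizing x with
  | zero =>
    obtain ⟨b, rfl⟩ := h.mem_zero_iff.1 hx
    exact ⟨b, by rw [pow_zero, Algebra.smul_def, mul_one]⟩
  | succ i ih =>
    rw [Nat.mul_succ, add_comm] at hx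
    obtain ⟨b, hb⟩ := ih (div_mem_divisorialPower h.eq_span hx)
    refine ⟨b, ?_⟩
    rw [div_eq_iff h.theta_ne_zero] at hb
    rw [hb, pow_succ, smul_mul_assoc]

/-- At a prime of height one, `θ` is the `n`-th power of an element of `ω`, up to a unit. -/
theorem exists_pow_eq [IsNoetherianRing B] [IsIntegrallyClosed B] {P : Ideal B} [hP : P.IsPrime]
    (h1 : P.height = 1) : ∃ a, IsLocalGenerator ω P a ∧ ∃ c : B, c ∉ P ∧ a ^ n = c • θ := by
  have h' : ∀ P : Ideal B, P.IsPrime → P.height = 1 → ∃ a, IsLocalGenerator ω P a :=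
    fun P hP h1 => exists_isLocalGenerator h1 h.ne_zero
  choose! a ha using h'
  have h2 := h.pow_mem (h.mem_one_of_mem (ha P hP h1).mem) n
  rw [one_mul] at h2
  obtain ⟨c, hc⟩ := h.mem_n_iff.1 h2
  refine ⟨a P, ha P hP h1, c, fun hcP => ?_, hc.symm⟩
  -- Since `θ / a ^ n` lies in the local ring at `P`, some `s` outside `P` times it is an element
  -- `b` of `B`. With `a ^ n = c θ` this reads `s = b c`, so `c` is not in `P`.
  obtain ⟨s, hs, b, hb⟩ := (mem_divisorialPower_iff ha).1 h.theta_mem P hP h1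
  refine hs ?_
  have : s = b * c := by
    apply IsFractionRing.injective B (FractionRing B)
    rw [map_mul, ← hb, ← hc]
    have := h.theta_ne_zero
    rw [Algebra.smul_def, Algebra.smul_def]
    have h3 : algebraMap B (FractionRing B) c ≠ 0 := fun h0 => pow_ne_zero n (ha P hP h1).ne_zero (by
      rw [← hc, Algebra.smul_def, h0, zero_mul])
    field_simp
  rw [this]
  exact P.mul_mem_left b hcP

/-- At a prime of height one with local generator `a`, the `n`-th power of `x / a ^ i` is `b (θ / a
^ n) ^ i`, an element of the local ring, which is integrally closed. This one equation in `B` thus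
replaces the conditions at all primes of height one. -/
theorem mem_iff [IsNoetherianRing B] [IsIntegrallyClosed B] {i : ℕ} {x : FractionRing B} :
    x ∈ divisorialPower ω i ↔ ∃ b : B, x ^ n = b • θ ^ i := by
  refine ⟨fun hx => h.exists_smul_theta_pow i (by rw [mul_comm]; exact h.pow_mem hx n), fun ⟨b, hb⟩ => ?_⟩
  have h' : ∀ P : Ideal B, P.IsPrime → P.height = 1 → ∃ a, IsLocalGenerator ω P a :=
    fun P hP h1 => exists_isLocalGenerator h1 h.ne_zero
  choose! a ha using h'
  rw [mem_divisorialPower_iff ha]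
  intro P hP h1
  refine mem_localSubring_of_pow_mem h.pos ?_
  rw [div_pow, hb, ← pow_mul, mul_comm i, pow_mul, smul_div_assoc, ← div_pow]
  exact (localSubring P).smul_mem (_root_.pow_mem ((mem_divisorialPower_iff ha).1 h.theta_mem P hP h1) i) b

variable [IsNoetherianRing B] [IsIntegrallyClosed B]

theorem theta_pow_mul_mem_iff {i q : ℕ} {x : FractionRing B} :
    θ ^ q * x ∈ divisorialPower ω (i + n * q) ↔ x ∈ divisorialPower ω i := by
  have h0 := pow_ne_zero (n * q) h.theta_ne_zero
  rw [h.mem_iff, h.mem_iff]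
  refine exists_congr fun b => ?_
  rw [mul_pow, ← pow_mul, mul_comm q n, add_comm i, pow_add, ← mul_smul_comm]
  exact mul_right_inj' h0

/-- An element whose `n`-th power is `θ^i` up to a unit generates `ω^{(i)}`. -/
theorem le_of_pow_eq {i : ℕ} (hi : 0 < i) {x : FractionRing B} {u : B} (hu : IsUnit u)
    (hx : x ^ n = u • θ ^ i) : n ≤ i := by
  refine h.minimal i hi ⟨x, le_antisymm (fun z hz => ?_) ?_⟩
  · have hu0 : algebraMap B (FractionRing B) u ≠ 0 := (hu.map _).ne_zero
    have hθ := pow_ne_zero i h.theta_ne_zero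
    have hx0 : x ≠ 0 := by
      rintro rfl
      rw [zero_pow h.pos.ne', Algebra.smul_def, eq_comm] at hx
      exact mul_ne_zero hu0 hθ hx
    obtain ⟨b, hb⟩ := h.mem_iff.1 hz
    obtain ⟨v, rfl⟩ := hu
    obtain ⟨c, hc⟩ := mem_of_pow_mem_algebraMap h.pos (z := z / x) ⟨b * (v⁻¹ : Bˣ), by
      have hv : algebraMap B (FractionRing B) v * algebraMap B (FractionRing B) (v⁻¹ : Bˣ) = 1 := by
        rw [← map_mul, Units.mul_inv, map_one]
      rw [div_pow, hb, hx, Algebra.smul_def, Algebra.smul_def, map_mul]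
      field_simp
      rw [mul_assoc, hv, mul_one]⟩
    rw [Submodule.mem_span_singleton]
    exact ⟨c, by rw [Algebra.smul_def, ← hc, div_mul_cancel₀ _ hx0]⟩
  · rw [Submodule.span_singleton_le_iff_mem]
    exact h.mem_iff.2 ⟨u, hx⟩

/-- Multiplication by a power of `θ` reduces the exponent modulo `n`, and a nonzero remainder would
contradict minimality. It follows that `n` is prime to the characteristic whenever some such
exponent is. -/
theorem dvd_of_isPrincipal {m : ℕ} (hm : (divisorialPower ω m).IsPrincipal) : n ∣ m := by
  obtain ⟨c, hc⟩ := hm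
  by_contra hnm
  have hr : 0 < m % n := Nat.pos_of_ne_zero fun h0 => hnm (Nat.dvd_of_mod_eq_zero h0)
  have hθ := pow_ne_zero (m / n) h.theta_ne_zero
  refine (Nat.mod_lt m h.pos).not_ge (h.minimal (m % n) hr ⟨c / θ ^ (m / n), ?_⟩)
  ext x
  rw [← h.theta_pow_mul_mem_iff (q := m / n), Nat.mod_add_div, hc, Submodule.mem_span_singleton,
    Submodule.mem_span_singleton]
  refine exists_congr fun b => ?_
  rw [← smul_div_assoc, div_eq_iff hθ, mul_comm]

/-- Multiplication by a fixed nonzero element of `ω^{(i(n−1))}` lands in `ω^{(ni)} = θ^i B`, which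
embeds the module into a cyclic one. -/
theorem finite_divisorialPower (i : ℕ) : Module.Finite B (divisorialPower ω i) := by
  obtain ⟨z, hz, h0⟩ := h.exists_mem_ne_zero (i * (n - 1))
  have hle : divisorialPower ω i ≤ Submodule.span B {θ ^ i / z} := fun x hx => by
    have h1 := mul_mem_divisorialPower hx hz
    have hn := h.pos
    rw [show i + i * (n - 1) = n * i by
      conv_rhs => rw [show n = n - 1 + 1 by omega, add_mul, one_mul, mul_comm, add_comm]] at h1
    obtain ⟨b, hb⟩ := h.exists_smul_theta_pow i h1
    rw [Submodule.mem_span_singleton]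
    exact ⟨b, by rw [← smul_div_assoc, ← hb, mul_div_cancel_right₀ _ h0]⟩
  exact Module.Finite.iff_fg.2 (Submodule.FG.of_le_of_isNoetherian hle)

/-- A reflexive `ω` agrees with `ω^{(1)}`. -/
theorem mem_one_iff [IsLocalRing B] (hd : ringKrullDim B = 2) {x y : B} (hreg : IsParamRegular x y ω)
    (hx : x ∈ IsLocalRing.maximalIdeal B) (hy : y ∈ IsLocalRing.maximalIdeal B) {z : FractionRing B} :
    z ∈ divisorialPower ω 1 ↔ z ∈ ω := by
  refine ⟨fun hz => ?_, h.mem_one_of_mem⟩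
  -- The elements carrying `z` into `ω` form an ideal contained in no prime of height one, hence
  -- containing a power of the maximal ideal. As `ω` has depth two, the multiples of `z` glue to an
  -- element of `ω`.
  let J : Ideal B := (ω : Submodule B (FractionRing B)).comap (LinearMap.toSpanSingleton B _ z)
  have hJ : ∀ s, s ∈ J ↔ s • z ∈ ω := fun s => Iff.rfl
  have hz1 : ∀ P : Ideal B, P.IsPrime → P.height = 1 → ∃ s ∉ P, s ∈ J := fun P hP h1 => by
    obtain ⟨s, hs, h2⟩ := mem_divisorialPower.1 hz P hP h1
    rw [pow_one] at h2
    exact ⟨s, hs, h2⟩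
  have hJ0 : J ≠ ⊥ := by
    obtain ⟨w, hw, hw0⟩ := h.exists_ne_zero
    obtain ⟨c, d, hd, hcd⟩ := IsFractionRing.div_surjective (A := B) (z / w)
    have hd0 : algebraMap B (FractionRing B) d ≠ 0 :=
      IsFractionRing.to_map_ne_zero_of_mem_nonZeroDivisors hd
    intro h0
    have h1 : d ∈ J := by
      rw [hJ, Algebra.smul_def]
      have : algebraMap B (FractionRing B) d * z = c • w := by
        rw [Algebra.smul_def]
        field_simp at hcd
        exact hcd.symm
      rw [this]
      exact Submodule.smul_mem (ω : Submodule B (FractionRing B)) c hw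
    rw [h0, Ideal.mem_bot] at h1
    exact hd0 (by rw [h1, map_zero])
  obtain ⟨N, hN⟩ := exists_pow_le_of_forall_height_one hd hJ0 fun P hP h1 hle => by
    obtain ⟨s, hs, h2⟩ := hz1 P hP h1
    exact hs (hle h2)
  obtain ⟨w, hw⟩ := hreg.glue (fun s : J => (s : B)) (fun s : J => (⟨(s : B) • z, s.2⟩ : ω))
    (fun s t => Subtype.ext (smul_comm (s : B) (t : B) z)) (N := N)
    (Ideal.subset_span ⟨⟨_, hN (Ideal.pow_mem_pow hx N)⟩, rfl⟩)
    (Ideal.subset_span ⟨⟨_, hN (Ideal.pow_mem_pow hy N)⟩, rfl⟩)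
  obtain ⟨s, hs, hs0⟩ := (Submodule.ne_bot_iff J).1 hJ0
  have h1 : s • (w : FractionRing B) = s • z := congrArg Subtype.val (hw ⟨s, hs⟩)
  rw [Algebra.smul_def, Algebra.smul_def] at h1
  rw [← mul_left_cancel₀ ((map_ne_zero_iff _ (IsFractionRing.injective B _)).2 hs0) h1]
  exact w.2

end HasClassOrder



/-! ### The cyclic algebra -/

namespace CyclicAlgebra

variable {K : Type u} [Field K] {n : ℕ} {θ : K}

/-- The element `x` in degree `i`, for `i` not necessarily smaller than `n`. -/
noncomputable def hom (i : ℕ) (x : K) : CyclicAlgebra K n θ := fun m => if i % n = m then x * θ⁻¹ ^ (i / n) else 0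

theorem hom_apply (i : ℕ) (x : K) (m : Fin n) :
    (hom i x : CyclicAlgebra K n θ) m = if i % n = m then x * θ⁻¹ ^ (i / n) else 0 := rfl

theorem smul_hom {S : Type*} [CommSemiring S] [Algebra S K] (s : S) (i : ℕ) (x : K) :
    (hom i (s • x) : CyclicAlgebra K n θ) = s • hom i x := by
  funext m
  rw [smul_apply, hom_apply, hom_apply]
  split_ifs
  · rw [smul_mul_assoc]
  · rw [smul_zero]

theorem hom_coe_apply (j : Fin n) (x : K) (m : Fin n) :
    (hom j x : CyclicAlgebra K n θ) m = if j = m then x else 0 := by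
  rw [hom_apply, Nat.mod_eq_of_lt j.2, Nat.div_eq_of_lt j.2, pow_zero, mul_one]
  simp only [Fin.ext_iff]

/-- Coordinates commute with sums. -/
theorem sum_apply {ι : Type*} (s : Finset ι) (f : ι → CyclicAlgebra K n θ) (m : Fin n) :
    (∑ i ∈ s, f i) m = ∑ i ∈ s, f i m :=
  Finset.sum_apply m s (f : ι → Fin n → K)

theorem eq_sum_hom (f : CyclicAlgebra K n θ) : f = ∑ j : Fin n, hom j (f j) := by
  funext m
  rw [sum_apply, Finset.sum_eq_single m]
  · exact ((hom_coe_apply m (f m) m).trans (if_pos rfl)).symm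
  · exact fun j _ hj => (hom_coe_apply j (f j) m).trans (if_neg hj)
  · exact fun h => absurd (Finset.mem_univ _) h

theorem algebraMap_eq_hom {S : Type*} [CommSemiring S] [Algebra S K] (s : S) :
    algebraMap S (CyclicAlgebra K n θ) s = hom 0 (algebraMap S K s) := by
  funext m
  rw [Algebra.algebraMap_eq_smul_one, smul_apply, one_apply, hom_apply, Nat.zero_mod, Nat.zero_div, pow_zero,
    mul_one, Algebra.smul_def]
  simp only [eq_comm (a := 0), mul_ite, mul_one, mul_zero]

section Embedding

variable {E : Type u} [Field E] [Algebra K E] (y : E)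

/-- The map to a field extension containing an `n`-th root of `θ⁻¹`. -/
noncomputable def toField (f : CyclicAlgebra K n θ) : E := ∑ j : Fin n, algebraMap K E (f j) * y ^ (j : ℕ)

variable {y} (hy : y ^ n = algebraMap K E θ⁻¹)

include hy

theorem toField_mul (f g : CyclicAlgebra K n θ) : toField y (f * g) = toField y f * toField y g := by
  have key : ∀ i j : Fin n, ∑ m : Fin n, algebraMap K E (if ((i : ℕ) + j) % n = m then
      f i * g j * (θ⁻¹) ^ (((i : ℕ) + j) / n) else 0) * y ^ (m : ℕ) =
      algebraMap K E (f i) * y ^ (i : ℕ) * (algebraMap K E (g j) * y ^ (j : ℕ)) := fun i j => by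
    have hn : 0 < n := i.pos
    rw [Finset.sum_eq_single (⟨((i : ℕ) + j) % n, Nat.mod_lt _ hn⟩ : Fin n), if_pos rfl, map_mul, map_mul, map_pow,
      ← hy, ← pow_mul, mul_assoc, ← pow_add, Nat.div_add_mod, pow_add]
    · ring
    · intro m _ hm
      rw [if_neg fun h => hm (Fin.ext h.symm), map_zero, zero_mul]
    · exact fun h => absurd (Finset.mem_univ _) h
  rw [toField, toField, toField, Finset.sum_mul_sum]
  simp only [mul_apply', map_sum, Finset.sum_mul]
  rw [Finset.sum_comm]
  refine Finset.sum_congr rfl fun i _ => ?_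
  rw [Finset.sum_comm]
  exact Finset.sum_congr rfl fun j _ => key i j

omit hy in
theorem toField_injective (h : LinearIndependent K fun i : Fin n => y ^ (i : ℕ)) :
    Function.Injective (toField y : CyclicAlgebra K n θ → E) := fun f g hfg => by
  have h1 := Fintype.linearIndependent_iff.1 h (fun i => f i - g i) (by
    simp only [Algebra.smul_def, map_sub, sub_mul, Finset.sum_sub_distrib]
    exact sub_eq_zero.2 hfg)
  exact funext fun i => sub_eq_zero.1 (h1 i)

end Embedding

/-- Kummer theory: the powers of an `n`-th root of an element of order `n` are linearly independent. -/
theorem _root_.linearIndependent_pow_of_primitiveRoot {K E : Type*} [Field K] [Field E] [IsAlgClosed E] [Algebra K E]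
    [Algebra.IsAlgebraic K E] {n : ℕ} (hn : 0 < n) {ζ : K} (hζ : IsPrimitiveRoot ζ n) {a : K} (ha : a ≠ 0)
    (H : ∀ d, 0 < d → ∀ b : K, b ^ n = a ^ d → n ≤ d) {y : E} (hy : y ^ n = algebraMap K E a) :
    LinearIndependent K fun i : Fin n => y ^ (i : ℕ) := by
  have hy0 : y ≠ 0 := by
    rintro rfl
    rw [zero_pow hn.ne', eq_comm, map_eq_zero] at hy
    exact ha hy
  have hint : IsIntegral K y := Algebra.IsIntegral.isIntegral y
  set p := minpoly K y with hp
  -- All conjugates of `y` are multiples of `y` by roots of unity of `K`. The constant coefficient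
  -- of the minimal polynomial then puts `y ^ p.natDegree` into `K`.
  have hroot : ∀ z ∈ (p.map (algebraMap K E)).roots, ∃ c : K, c ≠ 0 ∧ z = algebraMap K E c * y := fun z hz => by
    have h1 : Polynomial.aeval z p = 0 := by
      have := Polynomial.isRoot_of_mem_roots hz
      rwa [Polynomial.IsRoot, Polynomial.eval_map_algebraMap] at this
    have h2 : p ∣ Polynomial.X ^ n - Polynomial.C a := minpoly.dvd K y (by
      rw [map_sub, map_pow, Polynomial.aeval_X, Polynomial.aeval_C, hy, sub_self])
    obtain ⟨q, hq⟩ := h2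
    have h3 := congrArg (Polynomial.aeval z) hq
    rw [map_mul, h1, zero_mul, map_sub, map_pow, Polynomial.aeval_X, Polynomial.aeval_C, ← hy, sub_eq_zero] at h3
    have h4 : (z / y) ^ n = 1 := by rw [div_pow, h3, div_self (pow_ne_zero n hy0)]
    have : NeZero n := ⟨hn.ne'⟩
    obtain ⟨i, -, hi⟩ := (hζ.map_of_injective (algebraMap K E).injective).eq_pow_of_pow_eq_one h4
    exact ⟨ζ ^ i, pow_ne_zero i (hζ.ne_zero hn.ne'), by rw [map_pow, hi, div_mul_cancel₀ _ hy0]⟩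
  have hprod : ∀ s : Multiset E, (∀ z ∈ s, ∃ c : K, c ≠ 0 ∧ z = algebraMap K E c * y) →
      ∃ c : K, c ≠ 0 ∧ s.prod = algebraMap K E c * y ^ s.card := fun s => by
    induction s using Multiset.induction with
    | empty => exact fun _ => ⟨1, one_ne_zero, by simp⟩
    | cons z s ih =>
      intro hs
      obtain ⟨c, hc, h1⟩ := ih fun w hw => hs w (Multiset.mem_cons_of_mem hw)
      obtain ⟨d, hd, h2⟩ := hs z (Multiset.mem_cons_self z s)
      refine ⟨d * c, mul_ne_zero hd hc, ?_⟩
      rw [Multiset.prod_cons, h1, h2, Multiset.card_cons, pow_succ, map_mul]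
      ring
  obtain ⟨c, hc, h1⟩ := hprod _ hroot
  have hsplit := IsAlgClosed.splits (p.map (algebraMap K E))
  have hmonic : (p.map (algebraMap K E)).Monic := (minpoly.monic hint).map _
  have h2 := hsplit.coeff_zero_eq_prod_roots_of_monic hmonic
  rw [h1, ← hsplit.natDegree_eq_card_roots, Polynomial.natDegree_map, Polynomial.coeff_map] at h2
  have hb : y ^ p.natDegree = algebraMap K E ((-1) ^ p.natDegree * p.coeff 0 / c) := by
    have hc' : algebraMap K E c ≠ 0 := (map_ne_zero _).2 hc
    rw [map_div₀, map_mul, h2, map_pow, map_neg, map_one, eq_div_iff hc', ← mul_assoc, ← mul_pow]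
    ring
  -- If `y ^ d` lies in `K`, its `n`-th power is `a ^ d`, so the order of `a` modulo `n`-th powers
  -- bounds the degree from below.
  have hle : n ≤ p.natDegree := H _ (minpoly.natDegree_pos hint) _ (by
    apply (algebraMap K E).injective
    rw [map_pow, ← hb, map_pow, ← hy, ← pow_mul, ← pow_mul, mul_comm])
  exact (linearIndependent_pow y).comp (Fin.castLE hle) (Fin.castLE_injective hle)

/-- The automorphism multiplying the component of degree `i` by `ξ^i`. -/
noncomputable def twist (S : Type*) [CommSemiring S] [Algebra S K] (ξ : K) (hξ : ξ ^ n = 1) :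
    CyclicAlgebra K n θ →ₐ[S] CyclicAlgebra K n θ :=
  AlgHom.ofLinearMap
    { toFun := fun f m => ξ ^ (m : ℕ) * f m
      map_add' := fun f g => funext fun m => mul_add (ξ ^ (m : ℕ)) (f m) (g m)
      map_smul' := fun s f => funext fun m => mul_smul_comm s (ξ ^ (m : ℕ)) (f m) }
    (funext fun m => by
      change ξ ^ (m : ℕ) * (1 : CyclicAlgebra K n θ) m = _
      rw [one_apply]
      split_ifs with h
      · rw [h, pow_zero, mul_one]
      · rw [mul_zero])
    (fun f g => funext fun m => by
      change ξ ^ (m : ℕ) * (f * g) m = _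
      rw [mul_apply', mul_apply', Finset.mul_sum]
      refine Finset.sum_congr rfl fun i _ => ?_
      rw [Finset.mul_sum]
      refine Finset.sum_congr rfl fun j _ => ?_
      change _ = if _ then ξ ^ (i : ℕ) * f i * (ξ ^ (j : ℕ) * g j) * _ else 0
      split_ifs with h
      · have h1 : ξ ^ (m : ℕ) = ξ ^ (i : ℕ) * ξ ^ (j : ℕ) := by
          rw [← h, ← pow_add]
          conv_rhs => rw [← Nat.div_add_mod ((i : ℕ) + j) n, pow_add, pow_mul, hξ, one_pow, one_mul]
        rw [h1]
        ring
      · rw [mul_zero])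

theorem twist_apply (S : Type*) [CommSemiring S] [Algebra S K] (ξ : K) (hξ : ξ ^ n = 1) (f : CyclicAlgebra K n θ)
    (m : Fin n) : twist S ξ hξ f m = ξ ^ (m : ℕ) * f m := rfl

/-- The homogeneous components of an integral element are integral. -/
theorem isIntegral_hom (S : Type*) [CommRing S] [Algebra S K] {ζ : K} (hζ : IsPrimitiveRoot ζ n)
    (hζS : IsIntegral S ζ) (hn : ∃ s : S, algebraMap S K s * n = 1) {f : CyclicAlgebra K n θ} (hf : IsIntegral S f)
    (i : Fin n) : IsIntegral S (hom i (f i) : CyclicAlgebra K n θ) := by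
  obtain ⟨s, hs⟩ := hn
  have hpow : ∀ j, (ζ ^ j) ^ n = 1 := fun j => by rw [← pow_mul, mul_comm, pow_mul, hζ.pow_eq_one, one_pow]
  -- Discrete Fourier inversion: the weight `ζ ^ (j * (n - i))` stands for `ζ ^ (-i * j)`, and `s`
  -- is the inverse of `n`.
  have h1 : (hom i (f i) : CyclicAlgebra K n θ) = s • ∑ j ∈ Finset.range n,
      algebraMap K (CyclicAlgebra K n θ) (ζ ^ (j * (n - i))) * twist S (ζ ^ j) (hpow j) f := by
    funext m
    rw [smul_apply, sum_apply]
    have h2 : ∀ j, (algebraMap K (CyclicAlgebra K n θ) (ζ ^ (j * (n - i))) * twist S (ζ ^ j) (hpow j) f) m =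
        (ζ ^ (n - i + m)) ^ j * f m := fun j => by
      rw [← Algebra.smul_def, smul_apply, twist_apply, smul_eq_mul, ← mul_assoc, ← pow_mul, ← pow_add, ← pow_mul]
      congr 2
      ring
    rw [hom_coe_apply, Finset.sum_congr rfl fun j _ => h2 j, ← Finset.sum_mul]
    split_ifs with him
    · subst him
      rw [show n - (i : ℕ) + i = n from Nat.sub_add_cancel i.2.le, hζ.pow_eq_one]
      simp only [one_pow, Finset.sum_const, Finset.card_range, nsmul_eq_mul, mul_one]
      rw [Algebra.smul_def, ← mul_assoc, hs, one_mul]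
    · have hne : ζ ^ (n - (i : ℕ) + m) ≠ 1 := fun h => by
        have h3 := hζ.dvd_of_pow_eq_one _ h
        have hi := i.2
        have hm := m.2
        have h4 : (i : ℕ) ≠ m := fun h => him (Fin.ext h)
        obtain ⟨q, hq⟩ := h3
        rcases q with _ | _ | q
        · omega
        · rw [zero_add, mul_one] at hq
          omega
        · rw [show n * (q + 1 + 1) = n * q + n + n by ring] at hq
          generalize n * q = N at hq
          omega
      have h5 := geom_sum_eq hne n
      rw [← pow_mul, mul_comm _ n, pow_mul, hζ.pow_eq_one, one_pow, sub_self, zero_div] at h5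
      rw [h5, zero_mul, smul_zero]
  rw [h1]
  refine (IsIntegral.sum _ fun j _ => ?_).smul s
  refine IsIntegral.mul ?_ (hf.map (twist S (ζ ^ j) (hpow j)))
  exact (hζS.pow _).map (IsScalarTower.toAlgHom S K (CyclicAlgebra K n θ))

end CyclicAlgebra



/-! ### The covering as a ring -/

namespace CyclicAlgebra

variable {K : Type u} [Field K] {n : ℕ} {θ : K}

theorem hom_mul_hom (hn : 0 < n) (i j : ℕ) (x y : K) :
    (hom i x * hom j y : CyclicAlgebra K n θ) = hom (i + j) (x * y) := by
  funext m
  rw [mul_apply', Finset.sum_eq_single (⟨i % n, Nat.mod_lt _ hn⟩ : Fin n),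
    Finset.sum_eq_single (⟨j % n, Nat.mod_lt _ hn⟩ : Fin n), hom_apply, hom_apply, hom_apply, if_pos rfl, if_pos rfl]
  · have hd : (i + j) / n = i / n + j / n + (i % n + j % n) / n := by
      conv_lhs => rw [← Nat.div_add_mod i n, ← Nat.div_add_mod j n,
        show n * (i / n) + i % n + (n * (j / n) + j % n) = n * (i / n + j / n) + (i % n + j % n) by ring,
        Nat.mul_add_div hn]
    rw [hd, ← Nat.add_mod]
    refine if_congr Iff.rfl ?_ rfl
    rw [pow_add, pow_add]
    ring
  · intro q _ hq
    rw [hom_apply j, if_neg (show ¬ j % n = q from fun h => hq (Fin.ext h.symm)), mul_zero, zero_mul, ite_self]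
  · exact fun h => absurd (Finset.mem_univ _) h
  · intro p _ hp
    refine Finset.sum_eq_zero fun q _ => ?_
    rw [hom_apply i, if_neg (show ¬ i % n = p from fun h => hp (Fin.ext h.symm)), zero_mul, zero_mul, ite_self]
  · exact fun h => absurd (Finset.mem_univ _) h

theorem hom_pow (hn : 0 < n) (i : ℕ) (x : K) (m : ℕ) :
    (hom i x ^ m : CyclicAlgebra K n θ) = hom (i * m) (x ^ m) := by
  induction m with
  | zero =>
    rw [pow_zero, pow_zero, mul_zero]
    have := algebraMap_eq_hom (n := n) (θ := θ) (1 : K)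
    rwa [map_one, map_one] at this
  | succ m ih => rw [pow_succ, ih, hom_mul_hom hn, pow_succ, mul_add, mul_one]

/-- Multiplying the degree by `n` corresponds to division by `θ`. -/
theorem hom_add_mul (hn : 0 < n) (i q : ℕ) (x : K) :
    (hom (i + n * q) x : CyclicAlgebra K n θ) = hom i (x * θ⁻¹ ^ q) := by
  funext m
  rw [hom_apply, hom_apply, Nat.add_mul_mod_self_left, Nat.add_mul_div_left _ _ hn, pow_add]
  refine if_congr Iff.rfl ?_ rfl
  ring

theorem hom_injective (hn : 0 < n) (hθ : θ ≠ 0) (i : ℕ) :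
    Function.Injective (hom i : K → CyclicAlgebra K n θ) := fun x y hxy => by
  have h1 := congrFun hxy ⟨i % n, Nat.mod_lt _ hn⟩
  rw [hom_apply, hom_apply, if_pos rfl, if_pos rfl] at h1
  exact mul_right_cancel₀ (pow_ne_zero _ (inv_ne_zero hθ)) h1

end CyclicAlgebra

namespace HasClassOrder

open CyclicAlgebra

variable {B : Type u} [CommRing B] [IsDomain B] {ω : FractionalIdeal B⁰ (FractionRing B)}
  {n : ℕ} {θ : FractionRing B} (h : HasClassOrder ω n θ)

include h

theorem mem_covering_iff {f : CyclicAlgebra (FractionRing B) n θ} :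
    f ∈ gorensteinCovering ω n θ h.eq_span ↔ ∀ i : Fin n, f i ∈ divisorialPower ω i := Iff.rfl

/-- The covering is finite over the base. -/
theorem finite_covering [IsNoetherianRing B] [IsIntegrallyClosed B] :
    Module.Finite B (gorensteinCovering ω n θ h.eq_span) := by
  have := fun i : Fin n => h.finite_divisorialPower i
  let φ : gorensteinCovering ω n θ h.eq_span →ₗ[B] ∀ i : Fin n, divisorialPower ω i :=
    { toFun := fun f i => ⟨f.1 i, f.2 i⟩
      map_add' := fun f g => rfl
      map_smul' := fun b f => rfl }
  refine Module.Finite.of_injective φ fun f g hfg => Subtype.ext (funext fun i => ?_)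
  exact congrArg Subtype.val (congrFun hfg i)

variable [IsNoetherianRing B] [IsIntegrallyClosed B]

theorem hom_mem_covering_iff {i : ℕ} {x : FractionRing B} :
    hom i x ∈ gorensteinCovering ω n θ h.eq_span ↔ x ∈ divisorialPower ω i := by
  have hθ := pow_ne_zero (i / n) h.theta_ne_zero
  have key : x * θ⁻¹ ^ (i / n) ∈ divisorialPower ω (i % n) ↔ x ∈ divisorialPower ω i := by
    rw [← h.theta_pow_mul_mem_iff (q := i / n), Nat.mod_add_div]
    have : θ ^ (i / n) * (x * θ⁻¹ ^ (i / n)) = x := by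
      rw [inv_pow]
      field_simp
    rw [this]
  rw [← key, h.mem_covering_iff]
  constructor
  · intro h1
    have := h1 ⟨i % n, Nat.mod_lt _ h.pos⟩
    rwa [hom_apply, if_pos rfl] at this
  · intro h1 m
    rw [hom_apply]
    split_ifs with hm
    · rwa [← hm]
    · exact Submodule.zero_mem _

/-- The element `x ∈ ω^{(i)}` in degree `i` of the covering. -/
noncomputable def cov (h : HasClassOrder ω n θ) (i : ℕ) (x : divisorialPower ω i) :
    gorensteinCovering ω n θ h.eq_span :=
  ⟨hom i x.1, h.hom_mem_covering_iff.2 x.2⟩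

theorem coe_cov (i : ℕ) (x : divisorialPower ω i) :
    (h.cov i x : CyclicAlgebra (FractionRing B) n θ) = hom i x.1 := rfl

theorem cov_pow (i : ℕ) (x : divisorialPower ω i) {b : B} (hb : x.1 ^ n = b • θ ^ i) :
    h.cov i x ^ n = algebraMap B (gorensteinCovering ω n θ h.eq_span) b := by
  apply Subtype.ext
  change (hom i x.1 : CyclicAlgebra (FractionRing B) n θ) ^ n = algebraMap B _ b
  have hθ := pow_ne_zero i h.theta_ne_zero
  have h1 := hom_add_mul h.pos 0 i (x.1 ^ n) (θ := θ)
  rw [zero_add] at h1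
  rw [hom_pow h.pos, mul_comm i n, h1, hb, algebraMap_eq_hom, Algebra.smul_def, inv_pow, mul_inv_cancel_right₀ hθ]

theorem eq_sum_cov (f : gorensteinCovering ω n θ h.eq_span) :
    f = ∑ j : Fin n, h.cov j ⟨f.1 j, f.2 j⟩ := by
  apply Subtype.ext
  rw [AddSubmonoidClass.coe_finsetSum]
  exact eq_sum_hom f.1

section Domain

variable {ζ : B} (hζ : IsPrimitiveRoot ζ n)

include hζ

/-- Send degree `i` to multiples of the `i`-th power of an `n`-th root of `θ⁻¹`. Kummer theory
applies because `b ^ n = θ⁻¹ ^ d` makes `b⁻¹` a generator of `ω^{(d)}`, which forces `n ≤ d`. -/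
theorem exists_injective_ringHom : ∃ φ : CyclicAlgebra (FractionRing B) n θ → AlgebraicClosure (FractionRing B),
    Function.Injective φ ∧ (∀ f g, φ (f * g) = φ f * φ g) ∧ φ 0 = 0 := by
  obtain ⟨y, hy⟩ := IsAlgClosed.exists_pow_nat_eq
    (algebraMap (FractionRing B) (AlgebraicClosure (FractionRing B)) θ⁻¹) h.pos
  have hζ' := hζ.map_of_injective (IsFractionRing.injective B (FractionRing B))
  refine ⟨toField y, toField_injective (linearIndependent_pow_of_primitiveRoot h.pos hζ'
    (inv_ne_zero h.theta_ne_zero) (fun d hd b hb => ?_) hy), toField_mul hy, ?_⟩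
  · refine h.le_of_pow_eq hd isUnit_one (x := b⁻¹) ?_
    rw [inv_pow, hb, inv_pow, inv_inv, one_smul]
  · exact Finset.sum_eq_zero fun j _ => (congrArg (· * y ^ (j : ℕ)) (map_zero _)).trans (zero_mul _)

theorem isDomain_cyclicAlgebra : IsDomain (CyclicAlgebra (FractionRing B) n θ) := by
  obtain ⟨φ, hinj, hmul, h0⟩ := h.exists_injective_ringHom hζ
  have : Nontrivial (CyclicAlgebra (FractionRing B) n θ) := by
    refine ⟨1, 0, fun h1 => ?_⟩
    have := congrFun h1 ⟨0, h.pos⟩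
    rw [one_apply, if_pos rfl] at this
    exact one_ne_zero this
  have : NoZeroDivisors (CyclicAlgebra (FractionRing B) n θ) := by
    refine ⟨fun {f g} hfg => ?_⟩
    have h1 := hmul f g
    rw [hfg, h0, eq_comm, mul_eq_zero] at h1
    exact h1.imp (fun h2 => hinj (h2.trans h0.symm)) fun h2 => hinj (h2.trans h0.symm)
  exact NoZeroDivisors.to_isDomain _

theorem isDomain_covering : IsDomain (gorensteinCovering ω n θ h.eq_span) := by
  have := h.isDomain_cyclicAlgebra hζ
  infer_instance

/-- The cyclic algebra is a domain of finite dimension over the fraction field of `B`, hence a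
field. Dividing each component by a nonzero element of `ω^{(j)}` and clearing denominators moves any
element into the covering. -/
theorem isFractionRing_covering :
    IsFractionRing (gorensteinCovering ω n θ h.eq_span) (CyclicAlgebra (FractionRing B) n θ) := by
  have := h.isDomain_cyclicAlgebra hζ
  have hfin : Module.Finite (FractionRing B) (CyclicAlgebra (FractionRing B) n θ) :=
    inferInstanceAs (Module.Finite (FractionRing B) (Fin n → FractionRing B))
  have hfield : IsField (CyclicAlgebra (FractionRing B) n θ) :=
    isField_of_isIntegral_of_isField' (Field.toIsField (FractionRing B))
  refine ⟨fun s => ?_, fun f => ?_, fun {a b} hab => ⟨1, congrArg _ (Subtype.ext hab)⟩⟩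
  · obtain ⟨c, hc⟩ := hfield.mul_inv_cancel (a := (s : gorensteinCovering ω n θ h.eq_span).1)
      (fun h0 => nonZeroDivisors.ne_zero s.2 (Subtype.ext h0))
    exact IsUnit.of_mul_eq_one c hc
  · choose x hx h0 using fun j : Fin n => h.exists_mem_ne_zero j
    obtain ⟨b, hb⟩ := IsLocalization.exist_integer_multiples_of_finite B⁰ (fun j => f j / x j)
    have hf : (b : B) • f ∈ gorensteinCovering ω n θ h.eq_span := fun j => by
      obtain ⟨c, hc⟩ := hb j
      have h1 : (b : B) • f j = c • x j := by
        rw [Algebra.smul_def c, hc, smul_mul_assoc, div_mul_cancel₀ _ (h0 j)]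
      rw [CyclicAlgebra.smul_apply, h1]
      exact Submodule.smul_mem _ _ (hx j)
    have hinj : Function.Injective (algebraMap B (CyclicAlgebra (FractionRing B) n θ)) := by
      rw [IsScalarTower.algebraMap_eq B (FractionRing B)]
      exact (algebraMap (FractionRing B) _).injective.comp (IsFractionRing.injective B _)
    refine ⟨⟨⟨_, hf⟩, ⟨algebraMap B _ b, ?_⟩⟩, ?_⟩
    · refine mem_nonZeroDivisors_of_ne_zero fun hb0 => nonZeroDivisors.ne_zero b.2 (hinj ?_)
      rw [map_zero]
      exact congrArg Subtype.val hb0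
    · change f * algebraMap B _ (b : B) = (b : B) • f
      rw [mul_comm, Algebra.smul_def]

/-- The homogeneous components of an integral element are integral. The component x of degree i has
n-th power x^n θ^{−i} in the fraction field of B, hence in B, and `mem_iff` places x in ω^{(i)}. -/
theorem isIntegrallyClosed_covering (hn : IsUnit (n : B)) :
    IsIntegrallyClosed (gorensteinCovering ω n θ h.eq_span) := by
  have := h.isFractionRing_covering hζ
  have := h.finite_covering
  have hζ' := hζ.map_of_injective (IsFractionRing.injective B (FractionRing B))
  obtain ⟨s, hs⟩ := hn.exists_left_inv
  have hs' : ∃ s : B, algebraMap B (FractionRing B) s * n = 1 :=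
    ⟨s, by rw [← map_natCast (algebraMap B (FractionRing B)) n, ← map_mul, hs, map_one]⟩
  refine (isIntegrallyClosed_iff (CyclicAlgebra (FractionRing B) n θ)).2 fun {f} hf => ?_
  have hfB : IsIntegral B f := isIntegral_trans f hf
  refine ⟨⟨f, fun i => ?_⟩, rfl⟩
  have h1 := (isIntegral_hom B hζ' isIntegral_algebraMap hs' hfB i).pow n
  have h2 := hom_add_mul h.pos 0 i (f i ^ n) (θ := θ)
  rw [zero_add] at h2
  rw [hom_pow h.pos, mul_comm (i : ℕ) n, h2] at h1
  have h3 := algebraMap_eq_hom (n := n) (θ := θ) (f i ^ n * θ⁻¹ ^ (i : ℕ))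
  rw [Algebra.algebraMap_self, RingHom.id_apply] at h3
  have := h.isDomain_cyclicAlgebra hζ
  rw [← h3, isIntegral_algebraMap_iff (algebraMap (FractionRing B) _).injective] at h1
  obtain ⟨b, hb⟩ := IsIntegrallyClosed.isIntegral_iff.1 h1
  rw [h.mem_iff]
  have hθ := pow_ne_zero i h.theta_ne_zero
  refine ⟨b, ?_⟩
  rw [Algebra.smul_def, hb, inv_pow, inv_mul_cancel_right₀ hθ]

end Domain

end HasClassOrder



/-! ### Finite extensions of surface singularities -/

section FiniteExtension

open IsLocalRing

theorem IsAdicComplete.of_linearEquiv {R M N : Type*} [CommRing R] {I : Ideal R} [AddCommGroup M] [AddCommGroup N]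
    [Module R M] [Module R N] (e : M ≃ₗ[R] N) (h : IsAdicComplete I M) : IsAdicComplete I N := by
  rw [← AdicCompletion.of_bijective_iff] at h ⊢
  have h1 : ⇑(AdicCompletion.of I N) = AdicCompletion.congr I e ∘ AdicCompletion.of I M ∘ e.symm := by
    funext x
    change _ = AdicCompletion.map I e.toLinearMap (AdicCompletion.of I M (e.symm x))
    rw [AdicCompletion.map_of]
    exact congrArg _ (e.apply_symm_apply x).symm
  rw [h1]
  exact (AdicCompletion.congr I e).bijective.comp (h.comp e.symm.bijective)

variable {A B : Type*} [CommRing A] [CommRing B] [IsDomain A] [IsDomain B] [IsLocalRing A] [IsLocalRing B]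
  [Algebra B A]

/-- Incomparability gives the upper bound. For the lower one, a prime of `B` strictly between zero
and the maximal ideal is lifted to `A`, where it is again strictly between them. -/
theorem ringKrullDim_eq_two_of_isIntegral [IsNoetherianRing A] [Algebra.IsIntegral B A] [FaithfulSMul B A]
    (hd : ringKrullDim B = 2) : ringKrullDim A = 2 := by
  apply le_antisymm
  · rw [← hd]
    refine Order.krullDim_le_of_strictMono (PrimeSpectrum.comap (algebraMap B A)) fun P Q hPQ => ?_
    exact Ideal.IsIntegral.comap_lt_comap hPQ
  · obtain ⟨p, hp, h0, hm⟩ : ∃ p : Ideal B, p.IsPrime ∧ p ≠ ⊥ ∧ ¬ p.IsMaximal := by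
      by_contra! hcon
      have h1 : Ring.KrullDimLE 1 B := Ring.krullDimLE_one_iff_of_noZeroDivisors.2 fun I h2 h3 => hcon I h3 h2
      have h2 := Ring.krullDimLE_iff.1 h1
      rw [hd] at h2
      exact absurd h2 (by decide)
    obtain ⟨P, -, hP, hPp⟩ := Ideal.exists_ideal_over_prime_of_isIntegral p (⊥ : Ideal A) (by
      rw [Ideal.comap_bot_of_injective _ (FaithfulSMul.algebraMap_injective B A)]
      exact bot_le)
    have h1 : P.height ≠ 0 := fun h => h0 (by
      rw [← hPp, Ideal.height_eq_zero_iff_eq_bot.1 h]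
      exact Ideal.comap_bot_of_injective _ (FaithfulSMul.algebraMap_injective B A))
    have h2 : P < maximalIdeal A := lt_of_le_of_ne (le_maximalIdeal hP.ne_top) fun h => hm (by
      have := Ideal.isMaximal_comap_of_isIntegral_of_isMaximal (R := B) (maximalIdeal A)
      rwa [← h, hPp] at this)
    have h3 := Ideal.height_strict_mono_of_isPrime h2
    have h4 : (2 : ℕ∞) ≤ (maximalIdeal A).height := by
      have h5 := Order.add_one_le_of_lt h3
      have h6 := Order.add_one_le_of_lt (pos_iff_ne_zero.2 h1)
      refine le_trans ?_ h5
      calc (2 : ℕ∞) = 0 + 1 + 1 := by norm_num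
        _ ≤ _ := by gcongr
    rw [← IsLocalRing.maximalIdeal_height_eq_ringKrullDim]
    exact WithBot.coe_le_coe.2 h4

end FiniteExtension

section SurfaceOver

open IsLocalRing

variable {k A B : Type u} [Field k] [CommRing A] [CommRing B] [IsDomain A] [IsDomain B] [IsLocalRing A]
  [IsLocalRing B] [Algebra B A] [Algebra k A] [Algebra k B] [Algebra (PS k) A] [Algebra (PS k) B]

/-- A prime of `A` containing the two parameters contracts to the maximal ideal of `B`, so it is
maximal; hence they are parameters in `A`. Depth two follows from normality. -/
theorem SurfaceOver.of_finite [SurfaceOver k B] [IsScalarTower k B A] [IsScalarTower (PS k) B A] [Module.Finite B A]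
    [FaithfulSMul B A] [IsIntegrallyClosed A]
    (hmem : ∀ b ∈ maximalIdeal B, algebraMap B A b ∈ maximalIdeal A) : SurfaceOver k A := by
  have := SurfaceOver.isScalarTower (k := k) (X := B)
  have := SurfaceOver.finite (k := k) (X := B)
  have := SurfaceOver.isNoetherianRing k (X := B)
  have : IsNoetherianRing A := IsNoetherianRing.of_finite B A
  have hdim : ringKrullDim A = 2 := ringKrullDim_eq_two_of_isIntegral (SurfaceOver.dim (k := k) (X := B))
  have hx0 : algebraMap (PS k) A (MvPowerSeries.X 0) ≠ 0 := by
    rw [IsScalarTower.algebraMap_apply (PS k) B A, ← map_zero (algebraMap B A)]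
    exact fun h => SurfaceOver.ne_zero (k := k) (X := B) (FaithfulSMul.algebraMap_injective B A h)
  have hpow : ∃ N, maximalIdeal A ^ N ≤ Ideal.span {algebraMap (PS k) A (MvPowerSeries.X 0),
      algebraMap (PS k) A (MvPowerSeries.X 1)} := by
    set J := Ideal.span {algebraMap (PS k) A (MvPowerSeries.X 0), algebraMap (PS k) A (MvPowerSeries.X 1)} with hJ
    obtain ⟨N, hN⟩ := Ideal.exists_radical_pow_le_of_fg J (IsNoetherian.noetherian _)
    refine ⟨N, le_trans (Ideal.pow_right_mono ?_ N) hN⟩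
    rw [Ideal.radical_eq_sInf]
    refine le_sInf ?_
    rintro P ⟨hJP, hP⟩
    have h1 : maximalIdeal B ≤ P.comap (algebraMap B A) := by
      obtain ⟨M, hM⟩ := SurfaceOver.pow_le (k := k) (X := B)
      have hprime : (P.comap (algebraMap B A)).IsPrime := hP.comap _
      refine hprime.le_of_pow_le (hM.trans (Ideal.span_le.2 ?_))
      rintro z (rfl | rfl)
      · refine hJP ?_
        rw [← IsScalarTower.algebraMap_apply]
        exact Ideal.subset_span (by simp)
      · refine hJP ?_
        rw [← IsScalarTower.algebraMap_apply]
        exact Ideal.subset_span (by simp)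
    have h2 : (P.comap (algebraMap B A)).IsMaximal := by
      have h3 : maximalIdeal B = P.comap (algebraMap B A) :=
        (maximalIdeal.isMaximal B).eq_of_le (hP.comap (algebraMap B A)).ne_top h1
      rw [← h3]
      exact maximalIdeal.isMaximal B
    exact (eq_maximalIdeal (Ideal.isMaximal_of_isIntegral_of_isMaximal_comap P h2)).ge
  obtain ⟨N, hN⟩ := hpow
  exact
    { isScalarTower := ⟨fun t s a => by
        rw [← algebraMap_smul B (t • s) a, ← IsScalarTower.toAlgHom_apply k (PS k) B, map_smul, smul_assoc,
          IsScalarTower.toAlgHom_apply, algebraMap_smul]⟩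
      finite := Module.Finite.trans B A
      dim := hdim
      mem := fun i => by
        rw [IsScalarTower.algebraMap_apply (PS k) B A]
        exact hmem _ (SurfaceOver.mem i)
      ne_zero := hx0
      pow_le := ⟨N, hN⟩
      regular := isParamRegular_of_isIntegrallyClosed hdim hx0 hN }

theorem SurfaceOver.isNormalSurfaceSingularity [SurfaceOver k A] [IsIntegrallyClosed A]
    (hres : ∀ a : A, ∃ t : k, a - algebraMap k A t ∈ maximalIdeal A) : IsNormalSurfaceSingularity k A where
  isNoetherianRing := SurfaceOver.isNoetherianRing k
  isDomain := inferInstance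
  isIntegrallyClosed := inferInstance
  isAdicComplete := by
    have hA : IsMaximalCohenMacaulay A A :=
      (SurfaceOver.isMaximalCohenMacaulay_iff k).2 ⟨inferInstance, SurfaceOver.regular⟩
    obtain ⟨l, ρ, ⟨e⟩⟩ := SurfaceOver.exists_seriesRep (k := k) hA
    exact ρ.isAdicComplete.of_linearEquiv e
  ringKrullDim_eq_two := SurfaceOver.dim (k := k)
  residue_bijective := by
    refine ⟨(algebraMap k (ResidueField A)).injective, fun z => ?_⟩
    obtain ⟨a, rfl⟩ := residue_surjective z
    obtain ⟨t, ht⟩ := hres a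
    refine ⟨t, ?_⟩
    rw [IsScalarTower.algebraMap_apply k A (ResidueField A)]
    change residue A _ = _
    rw [eq_comm, ← sub_eq_zero, ← map_sub]
    exact (residue_eq_zero_iff _).2 ht

end SurfaceOver

/-! ### The covering as a local ring -/

namespace HasClassOrder

open CyclicAlgebra IsLocalRing

variable {B : Type u} [CommRing B] [IsDomain B] {ω : FractionalIdeal B⁰ (FractionRing B)}
  {n : ℕ} {θ : FractionRing B} (h : HasClassOrder ω n θ) [IsNoetherianRing B] [IsIntegrallyClosed B]

include h

theorem faithfulSMul_covering : FaithfulSMul B (gorensteinCovering ω n θ h.eq_span) := by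
  rw [faithfulSMul_iff_algebraMap_injective]
  intro b c hbc
  have h1 : (algebraMap B (CyclicAlgebra (FractionRing B) n θ)) b = algebraMap B _ c := congrArg Subtype.val hbc
  rw [algebraMap_eq_hom, algebraMap_eq_hom] at h1
  exact IsFractionRing.injective B _ (hom_injective h.pos h.theta_ne_zero 0 h1)

variable [IsLocalRing B]

theorem algebraMap_mem_iff (M : Ideal (gorensteinCovering ω n θ h.eq_span)) [M.IsMaximal] (b : B) :
    algebraMap B _ b ∈ M ↔ b ∈ maximalIdeal B := by
  have := h.finite_covering
  have := Ideal.isMaximal_comap_of_isIntegral_of_isMaximal (R := B) M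
  rw [← eq_maximalIdeal this, Ideal.mem_comap]

/-- The `n`-th power of the element is some `b` in `B`. Were `b` a unit, `x` would generate
`ω^{(i)}`, contrary to the minimality of `n`. -/
theorem cov_mem_of_isMaximal (M : Ideal (gorensteinCovering ω n θ h.eq_span)) [hM : M.IsMaximal] {i : ℕ} (hi : 0 < i)
    (hin : i < n) (x : divisorialPower ω i) : h.cov i x ∈ M := by
  obtain ⟨b, hb⟩ := h.mem_iff.1 x.2
  refine hM.isPrime.mem_of_pow_mem n ?_
  rw [h.cov_pow i x hb, h.algebraMap_mem_iff]
  exact (mem_maximalIdeal b).2 fun hu => hin.not_ge (h.le_of_pow_eq hi hu hb)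

/-- Modulo a maximal ideal, an element of the covering is its component in degree zero. -/
theorem exists_sub_mem_of_isMaximal (f : gorensteinCovering ω n θ h.eq_span) : ∃ b : B,
    f.1 ⟨0, h.pos⟩ = algebraMap B (FractionRing B) b ∧
    ∀ (M : Ideal (gorensteinCovering ω n θ h.eq_span)) [M.IsMaximal], f - algebraMap B _ b ∈ M := by
  obtain ⟨b, hb⟩ := h.mem_zero_iff.1 (f.2 ⟨0, h.pos⟩)
  refine ⟨b, hb, fun M hM => ?_⟩
  have h1 : algebraMap B (gorensteinCovering ω n θ h.eq_span) b =
      h.cov ((⟨0, h.pos⟩ : Fin n) : ℕ) ⟨f.1 ⟨0, h.pos⟩, f.2 ⟨0, h.pos⟩⟩ := by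
    apply Subtype.ext
    rw [coe_cov]
    refine (algebraMap_eq_hom b).trans ?_
    rw [← hb]
  have h2 := h.eq_sum_cov f
  rw [← Finset.add_sum_erase _ _ (Finset.mem_univ (⟨0, h.pos⟩ : Fin n)), ← h1] at h2
  rw [sub_eq_iff_eq_add'.2 h2]
  refine Ideal.sum_mem _ fun j hj => h.cov_mem_of_isMaximal M (Nat.pos_of_ne_zero fun h0 => ?_) j.2 _
  exact (Finset.mem_erase.1 hj).1 (Fin.ext h0)

/-- Membership in a maximal ideal depends only on the component of degree zero, which has to lie in
the maximal ideal of `B`; so all maximal ideals coincide. -/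
theorem isLocalRing_covering [Nontrivial (gorensteinCovering ω n θ h.eq_span)] :
    IsLocalRing (gorensteinCovering ω n θ h.eq_span) := by
  refine IsLocalRing.of_unique_max_ideal ?_
  obtain ⟨M, hM⟩ := Ideal.exists_maximal (gorensteinCovering ω n θ h.eq_span)
  refine ⟨M, hM, fun M' hM' => hM'.eq_of_le hM.ne_top fun f hf => ?_⟩
  obtain ⟨b, -, hb⟩ := h.exists_sub_mem_of_isMaximal f
  have h1 : algebraMap B _ b ∈ M' := by
    have := M'.sub_mem hf (hb M')
    rwa [sub_sub_cancel] at this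
  have h2 := M.add_mem (hb M) ((h.algebraMap_mem_iff M b).2 ((h.algebraMap_mem_iff M' b).1 h1))
  rwa [sub_add_cancel] at h2

end HasClassOrder



/-! ### The covering group -/

namespace HasClassOrder

open CyclicAlgebra IsLocalRing

variable {B : Type u} [CommRing B] [IsDomain B] {ω : FractionalIdeal B⁰ (FractionRing B)}
  {n : ℕ} {θ : FractionRing B} (h : HasClassOrder ω n θ) [IsNoetherianRing B] [IsIntegrallyClosed B]

section Deck

variable (k : Type u) [Field k] [Algebra k B]

omit [IsNoetherianRing B] [IsIntegrallyClosed B] in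
theorem algebraMap_pow_eq_one (t : rootsOfUnity n k) : algebraMap k (FractionRing B) ((t : kˣ) : k) ^ n = 1 := by
  rw [← map_pow, ← Units.val_pow_eq_pow_val, (mem_rootsOfUnity n (t : kˣ)).1 t.2, Units.val_one, map_one]

/-- The roots of unity act on the covering: in degree `i`, the root of unity `t` acts by `t^i`. -/
noncomputable def deckHom : rootsOfUnity n k →*
    (gorensteinCovering ω n θ h.eq_span →ₐ[B] gorensteinCovering ω n θ h.eq_span) where
  toFun t := ((twist B _ (algebraMap_pow_eq_one (B := B) k t)).comp (gorensteinCovering ω n θ h.eq_span).val).codRestrict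
    (gorensteinCovering ω n θ h.eq_span) fun f i => by
      change algebraMap k (FractionRing B) ((t : kˣ) : k) ^ (i : ℕ) * f.1 i ∈ divisorialPower ω i
      rw [IsScalarTower.algebraMap_apply k B (FractionRing B), ← map_pow, ← Algebra.smul_def]
      exact Submodule.smul_mem _ _ (f.2 i)
  map_one' := AlgHom.ext fun f => Subtype.ext (funext fun i => by
    change algebraMap k (FractionRing B) 1 ^ (i : ℕ) * f.1 i = f.1 i
    rw [map_one, one_pow, one_mul])
  map_mul' := fun s t => AlgHom.ext fun f => Subtype.ext (funext fun i => by
    change algebraMap k (FractionRing B) (((s : kˣ) : k) * ((t : kˣ) : k)) ^ (i : ℕ) * f.1 i =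
      algebraMap k (FractionRing B) ((s : kˣ) : k) ^ (i : ℕ) *
        (algebraMap k (FractionRing B) ((t : kˣ) : k) ^ (i : ℕ) * f.1 i)
    rw [map_mul, mul_pow, mul_assoc])

/-- The roots of unity as automorphisms of the covering. -/
noncomputable def deck : rootsOfUnity n k →*
    (gorensteinCovering ω n θ h.eq_span ≃ₐ[B] gorensteinCovering ω n θ h.eq_span) :=
  (AlgEquiv.algHomUnitsEquiv B _).toMonoidHom.comp (h.deckHom k).toHomUnits

theorem deck_apply (t : rootsOfUnity n k) (f : gorensteinCovering ω n θ h.eq_span) (i : Fin n) :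
    (h.deck k t f).1 i = algebraMap k (FractionRing B) ((t : kˣ) : k) ^ (i : ℕ) * f.1 i := rfl

include h

theorem deck_cov (t : rootsOfUnity n k) (i : ℕ) (x : divisorialPower ω i) :
    h.deck k t (h.cov i x) = algebraMap B _ (algebraMap k B ((t : kˣ) : k) ^ i) * h.cov i x := by
  apply Subtype.ext
  rw [← Algebra.smul_def]
  funext m
  refine (h.deck_apply k t _ m).trans ?_
  change _ * (hom i x.1 : CyclicAlgebra (FractionRing B) n θ) m =
    (algebraMap k B ((t : kˣ) : k) ^ i) • (hom i x.1 : CyclicAlgebra (FractionRing B) n θ) m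
  rw [hom_apply]
  split_ifs with hm
  · rw [Algebra.smul_def, map_pow, ← IsScalarTower.algebraMap_apply, ← hm]
    rw [pow_eq_pow_mod i (algebraMap_pow_eq_one (B := B) k t)]
  · rw [mul_zero, smul_zero]

theorem cov_ne_zero {i : ℕ} {x : divisorialPower ω i} (hx : x.1 ≠ 0) : h.cov i x ≠ 0 := fun h0 => by
  have h1 : (hom i x.1 : CyclicAlgebra (FractionRing B) n θ) = hom i 0 := by
    have h2 : (hom i (0 : FractionRing B) : CyclicAlgebra (FractionRing B) n θ) = 0 := by
      funext m
      rw [hom_apply, zero_mul, ite_self]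
      rfl
    rw [h2]
    exact congrArg Subtype.val h0
  exact hx (hom_injective h.pos h.theta_ne_zero i h1)

/-- The covering group. -/
theorem exists_deckGroup [IsLocalRing B] [IsLocalRing (gorensteinCovering ω n θ h.eq_span)]
    (hd : ringKrullDim B = 2) {ζ : k} (hζ : IsPrimitiveRoot ζ n) :
    ∃ G : Subgroup (gorensteinCovering ω n θ h.eq_span ≃ₐ[B] gorensteinCovering ω n θ h.eq_span),
      IsCyclic G ∧ Nat.card G = n ∧
      (∀ a : gorensteinCovering ω n θ h.eq_span,
        (∀ g ∈ G, g a = a) ↔ a ∈ Set.range (algebraMap B (gorensteinCovering ω n θ h.eq_span))) ∧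
      ActsFreelyInCodimOne G := by
  have : NeZero n := ⟨h.pos.ne'⟩
  have hζB := hζ.map_of_injective (algebraMap k B).injective
  have := h.isDomain_covering hζB
  have := h.faithfulSMul_covering
  have := h.finite_covering
  have : IsNoetherianRing (gorensteinCovering ω n θ h.eq_span) := IsNoetherianRing.of_finite B _
  have hdA := ringKrullDim_eq_two_of_isIntegral (A := gorensteinCovering ω n θ h.eq_span) hd
  obtain ⟨x, hx, hx0⟩ := h.exists_mem_ne_zero 1
  have hmul : ∀ t : rootsOfUnity n k, ((t : kˣ) : k) = 1 → t = 1 := fun t ht => Subtype.ext (Units.ext ht)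
  have hinj : Function.Injective (h.deck k) := (injective_iff_map_eq_one _).2 fun t ht => hmul t (by
    have h1 := h.deck_cov k t 1 ⟨x, hx⟩
    rw [ht, pow_one] at h1
    have h2 := mul_right_cancel₀ (h.cov_ne_zero hx0) ((one_mul _).trans h1)
    rw [← map_one (algebraMap B _)] at h2
    have h3 := FaithfulSMul.algebraMap_injective B _ h2
    rw [← map_one (algebraMap k B)] at h3
    exact ((algebraMap k B).injective h3).symm)
  refine ⟨(h.deck k).range, isCyclic_of_surjective _ (h.deck k).rangeRestrict_surjective, ?_, fun a => ⟨fun ha => ?_, ?_⟩, ?_⟩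
  · rw [← Nat.card_congr (MonoidHom.ofInjective hinj).toEquiv, hζ.card_rootsOfUnity]
  · obtain ⟨b, hb⟩ := h.mem_zero_iff.1 (a.2 ⟨0, h.pos⟩)
    refine ⟨b, Subtype.ext (funext fun i => ?_)⟩
    have h1 := ha _ ⟨hζ.toRootsOfUnity, rfl⟩
    have h2 := h.deck_apply k hζ.toRootsOfUnity a i
    rw [h1] at h2
    refine (congrFun (algebraMap_eq_hom b) i).trans ?_
    rw [hom_apply, Nat.zero_mod, Nat.zero_div, pow_zero, mul_one]
    split_ifs with hi
    · rw [← hb]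
      exact congrArg a.1 (Fin.ext hi)
    · by_contra hne
      have h3 := mul_right_cancel₀ (Ne.symm hne) ((one_mul _).trans h2)
      rw [← map_pow, ← map_one (algebraMap k (FractionRing B))] at h3
      have h4 := (algebraMap k (FractionRing B)).injective h3
      exact hζ.pow_ne_one_of_pos_of_lt (Ne.symm hi) i.2 h4.symm
  · rintro ⟨b, rfl⟩ g -
    exact g.commutes b
  · rintro P hP h1 _ ⟨t, rfl⟩ - hPt
    by_contra hne
    have ht : ((t : kˣ) : k) ≠ 1 := fun ht => hne (by rw [hmul t ht, map_one])
    have hP0 : P ≠ ⊥ := fun h0 => by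
      rw [h0, Ideal.height_bot] at h1
      exact zero_ne_one h1
    have hp : (P.comap (algebraMap B (gorensteinCovering ω n θ h.eq_span))).IsPrime := hP.comap _
    have hp1 : (P.comap (algebraMap B (gorensteinCovering ω n θ h.eq_span))).height = 1 := by
      refine height_eq_one_of_ne hd (fun h0 => hP0 (Ideal.eq_bot_of_comap_eq_bot h0)) fun hm => ?_
      have h2 : P.IsMaximal := Ideal.isMaximal_of_isIntegral_of_isMaximal_comap P (by
        rw [hm]
        exact maximalIdeal.isMaximal B)
      rw [eq_maximalIdeal h2, height_maximalIdeal_of_dim_two hdA] at h1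
      exact absurd h1 (by decide)
    -- If `t` acts trivially modulo `P`, then `(t − 1) a` in degree one lies in `P`. The nonzero
    -- constant `t − 1` is invertible, so `P` contains the element `a` of degree one and its `n`-th
    -- power `c`, which was chosen outside `P`.
    obtain ⟨a, ha, c, hc, hac⟩ := h.exists_pow_eq hp1
    refine hc ?_
    rw [← pow_one θ] at hac
    rw [Ideal.mem_comap, ← h.cov_pow 1 ⟨a, h.mem_one_of_mem ha.mem⟩ hac]
    refine Ideal.pow_mem_of_mem _ ?_ n h.pos
    have h3 := hPt (h.cov 1 ⟨a, h.mem_one_of_mem ha.mem⟩)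
    rw [h.deck_cov, pow_one, ← sub_one_mul] at h3
    refine (hP.mem_or_mem h3).resolve_left fun h4 => ?_
    rw [← map_one (algebraMap B _), ← map_sub, ← map_one (algebraMap k B), ← map_sub] at h4
    exact hP.ne_top (Ideal.eq_top_of_isUnit_mem _ h4 (((sub_ne_zero.2 ht).isUnit.map (algebraMap k B)).map _))

end Deck

end HasClassOrder



/-! ### The covering is Gorenstein -/

/-- A homogeneous map from a submodule of the field of fractions is the multiplication by an element. -/
theorem exists_eq_mul_of_map_smul {B K : Type*} [CommRing B] [IsDomain B] [Field K] [Algebra B K] [IsFractionRing B K]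
    {D : Submodule B K} (hD : ∃ x ∈ D, x ≠ 0) {φ : D → K} (hφ : ∀ (b : B) (x : D), φ (b • x) = b • φ x) :
    ∃ c : K, ∀ x : D, φ x = c * x := by
  obtain ⟨x, hx, hx0⟩ := hD
  refine ⟨φ ⟨x, hx⟩ / x, fun y => ?_⟩
  obtain ⟨a, s, hs, ha⟩ := IsFractionRing.div_surjective (A := B) (y.1 / x)
  have hs0 : algebraMap B K s ≠ 0 := fun h =>
    nonZeroDivisors.ne_zero hs (IsFractionRing.injective B K (h.trans (map_zero _).symm))
  have h1 : s • y = a • (⟨x, hx⟩ : D) := Subtype.ext (by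
    change s • y.1 = a • x
    rw [div_eq_div_iff hs0 hx0] at ha
    rw [Algebra.smul_def, Algebra.smul_def, ha, mul_comm])
  have h2 := hφ s y
  rw [h1, hφ, Algebra.smul_def, Algebra.smul_def] at h2
  rw [div_mul_eq_mul_div, mul_div_assoc, ← ha, mul_comm, div_mul_eq_mul_div, h2, mul_div_cancel_left₀ _ hs0]

/-- Degree `n + 1 - l` pairs into degree one only with degree `l`; the summand `n` avoids negative
degrees. -/
theorem Nat.eq_of_add_sub_mod_eq {n l l' : ℕ} (hl : l < n) (hl' : l' < n) (h : (n + 1 - l + l') % n = 1 % n) :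
    l' = l := by
  obtain ⟨q, hq⟩ := (Nat.modEq_iff_dvd' (by omega : 1 ≤ n + 1 - l + l')).1 (Eq.symm h)
  rcases q with _ | _ | q
  · omega
  · omega
  · rw [show n * (q + 1 + 1) = n * q + n + n by ring] at hq
    generalize n * q = N at hq
    omega

/-- The component of an element of the cyclic algebra, as a linear map. -/
def CyclicAlgebra.coord {K : Type u} [Field K] {n : ℕ} {θ : K} (S : Type*) [CommSemiring S] [Algebra S K] (m : Fin n) :
    CyclicAlgebra K n θ →ₗ[S] K where
  toFun f := f m
  map_add' _ _ := rfl
  map_smul' _ _ := rfl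

namespace HasClassOrder

open CyclicAlgebra IsLocalRing

variable {B : Type u} [CommRing B] [IsDomain B] {ω : FractionalIdeal B⁰ (FractionRing B)}
  {n : ℕ} {θ : FractionRing B} (h : HasClassOrder ω n θ) [IsNoetherianRing B] [IsIntegrallyClosed B]

theorem cov_smul (i : ℕ) (b : B) (x : divisorialPower ω i) : h.cov i (b • x) = b • h.cov i x :=
  Subtype.ext (smul_hom b i x.1)

theorem cov_mul_cov (i j : ℕ) (x : divisorialPower ω i) (y : divisorialPower ω j) :
    h.cov i x * h.cov j y = h.cov (i + j) ⟨x.1 * y.1, mul_mem_divisorialPower x.2 y.2⟩ :=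
  Subtype.ext (hom_mul_hom h.pos i j x.1 y.1)

include h in
-- At a prime of height one it suffices to test on the `i`-th power of a local generator.
theorem mem_of_forall_mul_mem {i j : ℕ} {z : FractionRing B}
    (hz : ∀ x ∈ divisorialPower ω i, z * x ∈ divisorialPower ω (i + j)) : z ∈ divisorialPower ω j := by
  have h' : ∀ P : Ideal B, P.IsPrime → P.height = 1 → ∃ a, IsLocalGenerator ω P a :=
    fun P hP h1 => exists_isLocalGenerator h1 h.ne_zero
  choose! a ha using h'
  rw [mem_divisorialPower_iff ha]
  intro P hP h1
  have h2 := h.pow_mem (h.mem_one_of_mem (ha P hP h1).mem) i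
  rw [one_mul] at h2
  have h3 := (mem_divisorialPower_iff ha).1 (hz _ h2) P hP h1
  have h4 := (ha P hP h1).ne_zero
  rwa [add_comm i j, pow_add, mul_div_mul_right _ _ (pow_ne_zero i h4)] at h3

/-- The component of degree one. -/
noncomputable def compOne (h : HasClassOrder ω n θ) :
    gorensteinCovering ω n θ h.eq_span →ₗ[B] divisorialPower ω 1 :=
  -- The terms `1 % n` and `1 / n` matter for `n = 1`, where degree one coincides with degree zero
  -- up to the factor `θ`. For larger `n` the factor is 1.
  LinearMap.codRestrict (divisorialPower ω 1) ((LinearMap.mulLeft B (θ ^ (1 / n))).comp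
    ((coord B ⟨1 % n, Nat.mod_lt _ h.pos⟩).comp (gorensteinCovering ω n θ h.eq_span).val.toLinearMap)) fun f => by
    have h1 := h.theta_pow_mul_mem_iff (q := 1 / n) (i := 1 % n) (x := f.1 ⟨1 % n, Nat.mod_lt _ h.pos⟩)
    rw [Nat.mod_add_div] at h1
    exact h1.2 (f.2 ⟨1 % n, Nat.mod_lt _ h.pos⟩)

theorem coe_compOne (f : gorensteinCovering ω n θ h.eq_span) :
    ((h.compOne f : divisorialPower ω 1) : FractionRing B) = θ ^ (1 / n) * f.1 ⟨1 % n, Nat.mod_lt _ h.pos⟩ := rfl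

theorem compOne_cov_eq_zero {i : ℕ} (hi : i % n ≠ 1 % n) (x : divisorialPower ω i) : h.compOne (h.cov i x) = 0 :=
  Subtype.ext (by
    rw [coe_compOne, coe_cov, hom_apply, if_neg hi, mul_zero]
    rfl)

theorem compOne_cov {i : ℕ} (hi : i = n + 1) (x : divisorialPower ω i) :
    ((h.compOne (h.cov i x) : divisorialPower ω 1) : FractionRing B) = x * θ⁻¹ := by
  have hθ := pow_ne_zero (1 / n) h.theta_ne_zero
  have h1 : i % n = 1 % n := by rw [hi, Nat.add_mod_left]
  have h2 : i / n = 1 / n + 1 := by rw [hi, Nat.add_div_left _ h.pos]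
  rw [coe_compOne, coe_cov, hom_apply, if_pos h1, h2, pow_succ, inv_pow]
  field_simp

/-- On degree `l` the map is multiplication by some `c l` carrying `ω^{(l)}` into `ω^{(1)}`, so `θ *
c l` lies in `ω^{(n+1−l)}`. Placed in degree `n + 1 - l`, these elements add up to `f`; the factor
`θ` cancels the division in the wrapped product. Uniqueness holds since a nonzero element of the
complementary degree detects each component. -/
theorem existsUnique_compOne (ψ : gorensteinCovering ω n θ h.eq_span →ₗ[B] divisorialPower ω 1) :
    ∃! f, ∀ a, ψ a = h.compOne (a * f) := by
  refine existsUnique_of_exists_of_unique ?_ fun f g hf hg => ?_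
  · have h1 : ∀ l : Fin n, ∃ c : FractionRing B, ∀ x : divisorialPower ω l,
        ((ψ (h.cov l x) : divisorialPower ω 1) : FractionRing B) = c * x := fun l =>
      exists_eq_mul_of_map_smul (h.exists_mem_ne_zero l) (φ := fun x => ((ψ (h.cov l x) : divisorialPower ω 1) :
        FractionRing B)) fun b x => by
        rw [h.cov_smul, map_smul]
        rfl
    choose c hc using h1
    have h2 : ∀ l : Fin n, θ * c l ∈ divisorialPower ω (n + 1 - l) := fun l =>
      h.mem_of_forall_mul_mem (i := l) fun x hx => by
        rw [mul_assoc, show (l : ℕ) + (n + 1 - l) = n + 1 by omega, ← hc l ⟨x, hx⟩]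
        exact mul_mem_divisorialPower h.theta_mem (ψ _).2
    refine ⟨∑ l : Fin n, h.cov (n + 1 - l) ⟨θ * c l, h2 l⟩, fun a => ?_⟩
    have h3 : ∀ (l : Fin n) (y : divisorialPower ω l), ψ (h.cov l y) =
        h.compOne (h.cov l y * ∑ l : Fin n, h.cov (n + 1 - l) ⟨θ * c l, h2 l⟩) := fun l y => by
      have hl := l.2
      rw [Finset.mul_sum, map_sum, Finset.sum_eq_single l]
      · apply Subtype.ext
        rw [h.cov_mul_cov, h.compOne_cov (by omega), hc]
        have hθ := h.theta_ne_zero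
        change _ = y.1 * (θ * c l) * θ⁻¹
        field_simp
      · intro m _ hm
        rw [h.cov_mul_cov]
        refine h.compOne_cov_eq_zero (fun h4 => hm ?_) _
        rw [add_comm] at h4
        exact (Fin.ext (Nat.eq_of_add_sub_mod_eq m.2 hl h4)).symm
      · exact fun h => absurd (Finset.mem_univ _) h
    conv_lhs => rw [h.eq_sum_cov a]
    conv_rhs => rw [h.eq_sum_cov a]
    rw [map_sum, Finset.sum_mul, map_sum]
    exact Finset.sum_congr rfl fun l _ => h3 l _
  · have h1 : ∀ a, h.compOne (a * (f - g)) = 0 := fun a => by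
      rw [mul_sub, map_sub, ← hf, ← hg, sub_self]
    rw [← sub_eq_zero]
    refine Subtype.ext (funext fun j => ?_)
    obtain ⟨x, hx, hx0⟩ := h.exists_mem_ne_zero (n + 1 - j)
    have h2 := h1 (h.cov (n + 1 - j) ⟨x, hx⟩)
    have hj := j.2
    generalize f - g = e at h2
    rw [h.eq_sum_cov e, Finset.mul_sum, map_sum, Finset.sum_eq_single j] at h2
    · have h3 := congrArg Subtype.val h2
      rw [h.cov_mul_cov, h.compOne_cov (by omega)] at h3
      exact (mul_eq_zero.1 ((mul_eq_zero.1 h3).resolve_right (inv_ne_zero h.theta_ne_zero))).resolve_left hx0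
    · intro m _ hm
      rw [h.cov_mul_cov]
      exact h.compOne_cov_eq_zero (fun h4 => hm (Fin.ext (Nat.eq_of_add_sub_mod_eq hj m.2 h4))) _
    · exact fun h => absurd (Finset.mem_univ _) h

end HasClassOrder


set_option linter.overlappingInstances false

/-! ### Cohen-Macaulay modules over the covering are relatively projective -/

theorem Finset.sum_range_add_of_periodic {M : Type*} [AddCommMonoid M] {n : ℕ} {f : ℕ → M}
    (hf : ∀ i, f (i + n) = f i) (j : ℕ) : ∑ i ∈ range n, f (i + j) = ∑ i ∈ range n, f i := by
  induction j with
  | zero => rfl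
  | succ j ih =>
    rw [← ih]
    have h1 := sum_range_succ (fun i => f (i + j)) n
    rw [sum_range_succ', zero_add, add_comm n j, hf j] at h1
    have h2 : ∀ i, f (i + (j + 1)) = f (i + 1 + j) := fun i => congrArg f (by ring)
    rw [sum_congr rfl fun i _ => h2 i]
    rcases n with _ | n
    · rfl
    · rw [sum_range_succ, sum_range_succ']
      refine congrArg₂ (· + ·) rfl ?_
      rw [zero_add, add_right_comm, add_assoc, add_comm n, add_assoc, add_comm 1 n, hf]

namespace HasClassOrder

open CyclicAlgebra IsLocalRing

variable {B : Type u} [CommRing B] [IsDomain B] {ω : FractionalIdeal B⁰ (FractionRing B)}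
  {n : ℕ} {θ : FractionRing B} (h : HasClassOrder ω n θ) [IsNoetherianRing B] [IsIntegrallyClosed B]

theorem cov_mul_cov_eq_algebraMap {i j l : ℕ} (hij : i + j = n * l) (x : divisorialPower ω i) (y : divisorialPower ω j)
    {b : B} (hb : x.1 * y.1 = b • θ ^ l) : h.cov i x * h.cov j y = algebraMap B _ b := by
  rw [h.cov_mul_cov]
  apply Subtype.ext
  have h1 := hom_add_mul h.pos 0 l (x.1 * y.1) (θ := θ)
  rw [zero_add, ← hij] at h1
  rw [coe_cov]
  refine (h1.trans ?_).trans (algebraMap_eq_hom b).symm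
  rw [hb]
  rw [Algebra.smul_def, inv_pow, mul_inv_cancel_right₀ (pow_ne_zero l h.theta_ne_zero)]

theorem exists_cov_mul_cov {i j l : ℕ} (hij : i + j = n * l) (x : divisorialPower ω i) (y : divisorialPower ω j) :
    ∃ b : B, x.1 * y.1 = b • θ ^ l ∧ h.cov i x * h.cov j y = algebraMap B _ b := by
  have h1 := mul_mem_divisorialPower x.2 y.2
  rw [hij] at h1
  obtain ⟨b, hb⟩ := h.exists_smul_theta_pow l h1
  exact ⟨b, hb, h.cov_mul_cov_eq_algebraMap hij x y hb⟩

/-- The elements of degree `i` generate an ideal that contains powers of the maximal ideal of the base. -/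
theorem exists_pow_mem_span_cov [IsLocalRing B] (hd : ringKrullDim B = 2) (i : ℕ) :
    ∃ N, ∀ x ∈ maximalIdeal B, algebraMap B (gorensteinCovering ω n θ h.eq_span) x ^ N ∈
      Ideal.span (Set.range (h.cov i)) := by
  set I := Ideal.span (Set.range (h.cov i)) with hI
  have hn := h.pos
  have hij : i + i * (n - 1) = n * i := by
    rw [Nat.mul_sub_one, mul_comm n, Nat.add_sub_cancel' (Nat.le_mul_of_pos_right i hn)]
  -- The degrees `i` and `i * (n - 1)` add up to a multiple of `n`, so products of such elements lie
  -- in `B` and in the ideal generated by degree `i`.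
  have key : ∀ (x : divisorialPower ω i) (y : divisorialPower ω (i * (n - 1))) (b : B), x.1 * y.1 = b • θ ^ i →
      b ∈ I.comap (algebraMap B (gorensteinCovering ω n θ h.eq_span)) := fun x y b hb => by
    rw [Ideal.mem_comap, ← h.cov_mul_cov_eq_algebraMap hij x y hb]
    exact I.mul_mem_right _ (Ideal.subset_span ⟨x, rfl⟩)
  have h0 : I.comap (algebraMap B (gorensteinCovering ω n θ h.eq_span)) ≠ ⊥ := by
    obtain ⟨x, hx, hx0⟩ := h.exists_mem_ne_zero i
    obtain ⟨y, hy, hy0⟩ := h.exists_mem_ne_zero (i * (n - 1))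
    obtain ⟨b, hb, -⟩ := h.exists_cov_mul_cov hij ⟨x, hx⟩ ⟨y, hy⟩
    intro hbot
    have h1 := key ⟨x, hx⟩ ⟨y, hy⟩ b hb
    rw [hbot, Ideal.mem_bot] at h1
    rw [h1, zero_smul] at hb
    exact mul_ne_zero hx0 hy0 hb
  obtain ⟨N, hN⟩ := exists_pow_le_of_forall_height_one hd h0 fun P hP h1 hle => by
    -- With a local generator `a` at `P`, the product of its powers of degrees `i` and `i * (n - 1)`
    -- is `c ^ i`, which is outside `P`.
    obtain ⟨a, ha, c, hc, hac⟩ := h.exists_pow_eq h1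
    have h2 : ∀ j, a ^ j ∈ divisorialPower ω j := fun j => by
      have := h.pow_mem (h.mem_one_of_mem ha.mem) j
      rwa [one_mul] at this
    have h3 := key ⟨_, h2 i⟩ ⟨_, h2 (i * (n - 1))⟩ (c ^ i) (by
      change a ^ i * a ^ (i * (n - 1)) = _
      rw [← pow_add, hij, pow_mul, hac, smul_pow])
    exact hc (hP.mem_of_pow_mem _ (hle h3))
  refine ⟨N, fun x hx => ?_⟩
  rw [← map_pow]
  exact hN (Ideal.pow_mem_pow hx N)

section Retraction

variable {k : Type u} [Field k] [Algebra k B] [Algebra (PS k) B] [IsLocalRing B] [SurfaceOver k B]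
  [IsDomain (gorensteinCovering ω n θ h.eq_span)] [IsLocalRing (gorensteinCovering ω n θ h.eq_span)]
  [SurfaceOver k (gorensteinCovering ω n θ h.eq_span)]
  {M : Type u} [AddCommGroup M] [Module (gorensteinCovering ω n θ h.eq_span) M]

include k

variable (k) in
theorem smul_ne_zero_of_isMaximalCohenMacaulay (hM : IsMaximalCohenMacaulay (gorensteinCovering ω n θ h.eq_span) M)
    {a : gorensteinCovering ω n θ h.eq_span} (ha : a ≠ 0) {m m' : M} (e : a • m = a • m') : m = m' := by
  have := SurfaceOver.isNoetherianRing k (X := gorensteinCovering ω n θ h.eq_span)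
  obtain ⟨hfin, hreg⟩ := (SurfaceOver.isMaximalCohenMacaulay_iff k).1 hM
  rw [← sub_eq_zero]
  refine smul_ne_zero_of_isParamRegular (SurfaceOver.dim (k := k) (X := gorensteinCovering ω n θ h.eq_span))
    (SurfaceOver.mem (k := k) 0) (SurfaceOver.mem (k := k) 1) hreg ha ?_
  rw [smul_sub, e, sub_self]

variable (k) in
/-- A linear map on the covering is a multiplication in each degree. -/
theorem exists_eq_cov_smul (hM : IsMaximalCohenMacaulay (gorensteinCovering ω n θ h.eq_span) M) (i : ℕ)
    (φ : gorensteinCovering ω n θ h.eq_span → M)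
    (hφ : ∀ (b : B) a, φ (algebraMap B _ b * a) = algebraMap B (gorensteinCovering ω n θ h.eq_span) b • φ a) :
    ∃ z : M, ∀ x : divisorialPower ω i, h.cov i x • z = φ (h.cov i x) := by
  obtain ⟨hfin, hreg⟩ := (SurfaceOver.isMaximalCohenMacaulay_iff k).1 hM
  obtain ⟨N, hN⟩ := h.exists_pow_mem_span_cov (SurfaceOver.dim (k := k) (X := B)) i
  obtain ⟨e, he, he0⟩ := h.exists_mem_ne_zero (i * (n - 1))
  have hij : i * (n - 1) + i = n * i := by
    rw [Nat.mul_sub_one, mul_comm n, Nat.sub_add_cancel (Nat.le_mul_of_pos_right i h.pos)]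
  simp only [IsScalarTower.algebraMap_apply (PS k) B (gorensteinCovering ω n θ h.eq_span)] at hreg
  refine hreg.glue (h.cov i) (fun x => φ (h.cov i x)) (fun x y => ?_) (hN _ (SurfaceOver.mem (k := k) 0))
    (hN _ (SurfaceOver.mem (k := k) 1))
  -- Compatibility is checked after multiplication by a nonzero element `e` of complementary degree:
  -- its products with elements of degree `i` lie in `B` and pass through `φ`. As `M` is
  -- torsion-free, `e` can be cancelled.
  refine h.smul_ne_zero_of_isMaximalCohenMacaulay k hM (h.cov_ne_zero (x := ⟨e, he⟩) he0) ?_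
  obtain ⟨b, -, hb⟩ := h.exists_cov_mul_cov hij ⟨e, he⟩ x
  obtain ⟨c, -, hc⟩ := h.exists_cov_mul_cov hij ⟨e, he⟩ y
  rw [← mul_smul, hb, ← mul_smul, hc, ← hφ, ← hφ, ← hb, ← hc]
  congr 1
  ring

variable (k) in
/-- Maximal Cohen-Macaulay modules over the covering are relatively projective over the base. -/
theorem isSummand_coind (hn : IsUnit (n : B)) (hM : IsMaximalCohenMacaulay (gorensteinCovering ω n θ h.eq_span) M) :
    IsSummand (gorensteinCovering ω n θ h.eq_span) M
      (Coind B (gorensteinCovering ω n θ h.eq_span) (Restr B (gorensteinCovering ω n θ h.eq_span) M)) := by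
  obtain ⟨s, hs⟩ := hn.exists_left_inv
  have hs' : algebraMap B (gorensteinCovering ω n θ h.eq_span) s * n = 1 := by
    rw [← map_natCast (algebraMap B (gorensteinCovering ω n θ h.eq_span)), ← map_mul, hs, map_one]
  -- In degree `i` the map `φ` is multiplication by an element `z i φ` of `M`. Homogeneous elements
  -- of degree `j` shift `z i` to `z (i + j)`, so the sum over a period of degrees is linear over
  -- the covering.
  have h1 : ∀ (i : ℕ) (φ : Coind B (gorensteinCovering ω n θ h.eq_span)
      (Restr B (gorensteinCovering ω n θ h.eq_span) M)),
      ∃ z : M, ∀ x : divisorialPower ω i, h.cov i x • z = φ (h.cov i x) := fun i φ =>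
    h.exists_eq_cov_smul k hM i φ fun b a => by
      rw [← Algebra.smul_def]
      exact map_smul φ b a
  choose z hz using h1
  have huniq : ∀ (i : ℕ) (φ : Coind B (gorensteinCovering ω n θ h.eq_span)
      (Restr B (gorensteinCovering ω n θ h.eq_span) M)) (w : M),
      (∀ x : divisorialPower ω i, h.cov i x • w = φ (h.cov i x)) → z i φ = w := fun i φ w hw => by
    obtain ⟨e, he, he0⟩ := h.exists_mem_ne_zero i
    exact h.smul_ne_zero_of_isMaximalCohenMacaulay k hM (h.cov_ne_zero (x := ⟨e, he⟩) he0) ((hz i φ _).trans (hw _).symm)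
  have hadd : ∀ i φ ψ, z i (φ + ψ) = z i φ + z i ψ := fun i φ ψ => huniq _ _ _ fun x => by
    rw [smul_add, hz, hz]
    rfl
  -- Multiplication by `θ` identifies `ω^{(i)}` with `ω^{(i+n)}`, and both give the same component
  -- of the covering.
  have hperiod : ∀ φ i, z (i + n) φ = z i φ := fun φ i => (huniq _ _ _ fun x => by
    have hθx := mul_mem_divisorialPower x.2 h.theta_mem
    have h2 : h.cov i x = h.cov (i + n) ⟨_, hθx⟩ := Subtype.ext (by
      rw [coe_cov, coe_cov]
      have h3 := hom_add_mul h.pos i 1 (x.1 * θ) (θ := θ)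
      rw [mul_one, pow_one, mul_inv_cancel_right₀ h.theta_ne_zero] at h3
      exact h3.symm)
    rw [h2, hz]).symm
  have hcov : ∀ (i j : ℕ) (y : divisorialPower ω j) φ, z i (h.cov j y • φ) = h.cov j y • z (i + j) φ :=
    fun i j y φ => huniq _ _ _ fun x => by
      rw [smul_smul, h.cov_mul_cov, hz, ← h.cov_mul_cov, mul_comm]
      rfl
  let r : Coind B (gorensteinCovering ω n θ h.eq_span) (Restr B (gorensteinCovering ω n θ h.eq_span) M) →+ M :=
    AddMonoidHom.mk' (fun φ => ∑ i ∈ Finset.range n, z i φ) fun φ ψ => by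
      rw [← Finset.sum_add_distrib]
      exact Finset.sum_congr rfl fun i _ => hadd i φ ψ
  have hrcov : ∀ (j : ℕ) (y : divisorialPower ω j) φ, r (h.cov j y • φ) = h.cov j y • r φ := fun j y φ => by
    change ∑ i ∈ Finset.range n, z i (h.cov j y • φ) = h.cov j y • ∑ i ∈ Finset.range n, z i φ
    rw [← Finset.sum_range_add_of_periodic (f := fun i => z i φ) (hperiod φ) j, Finset.smul_sum]
    exact Finset.sum_congr rfl fun i _ => hcov i j y φ
  have hr : ∀ a φ, r (a • φ) = a • r φ := fun a φ => by
    rw [h.eq_sum_cov a, Finset.sum_smul, Finset.sum_smul, map_sum]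
    exact Finset.sum_congr rfl fun j _ => hrcov j _ φ
  let ι : M →ₗ[gorensteinCovering ω n θ h.eq_span]
      Coind B (gorensteinCovering ω n θ h.eq_span) (Restr B (gorensteinCovering ω n θ h.eq_span) M) :=
    { toFun := fun m =>
        ((LinearMap.toSpanSingleton (gorensteinCovering ω n θ h.eq_span)
          (Restr B (gorensteinCovering ω n θ h.eq_span) M) m).restrictScalars B :)
      map_add' := fun m m' => Coind.ext fun a => smul_add a m m'
      map_smul' := fun c m => Coind.ext fun a => by
        change a • c • m = (c * a) • m
        rw [smul_smul, mul_comm] }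
  -- For the map `a ↦ a • m` every `z i` is `m`, so the sum over the degrees is `n • m`; the factor
  -- `s` divides by `n`.
  have hι : ∀ i m, z i (ι m) = m := fun i m => huniq _ _ _ fun x => rfl
  refine ⟨ι, algebraMap B (gorensteinCovering ω n θ h.eq_span) s • ({ r with map_smul' := hr } :
    Coind B (gorensteinCovering ω n θ h.eq_span) (Restr B (gorensteinCovering ω n θ h.eq_span) M)
      →ₗ[gorensteinCovering ω n θ h.eq_span] M), LinearMap.ext fun m => ?_⟩
  change algebraMap B (gorensteinCovering ω n θ h.eq_span) s • ∑ i ∈ Finset.range n, z i (ι m) = m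
  rw [Finset.sum_congr rfl fun i _ => hι i m, Finset.sum_const, Finset.card_range,
    ← Nat.cast_smul_eq_nsmul (gorensteinCovering ω n θ h.eq_span), smul_smul, hs', one_smul]

end Retraction

end HasClassOrder


set_option linter.overlappingInstances false

namespace HasClassOrder

variable {B : Type u} [CommRing B] [IsDomain B] {ω : FractionalIdeal B⁰ (FractionRing B)}
  {n : ℕ} {θ : FractionRing B} (h : HasClassOrder ω n θ) [IsNoetherianRing B] [IsIntegrallyClosed B]

/-- The component of degree zero. -/
theorem exists_projection : ∃ π : gorensteinCovering ω n θ h.eq_span →ₗ[B] B, π 1 = 1 := by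
  have hinj : Function.Injective (Algebra.linearMap B (FractionRing B)) := IsFractionRing.injective B _
  let e := LinearEquiv.ofInjective _ hinj
  let p : gorensteinCovering ω n θ h.eq_span →ₗ[B] LinearMap.range (Algebra.linearMap B (FractionRing B)) :=
    ((CyclicAlgebra.coord B ⟨0, h.pos⟩).comp (gorensteinCovering ω n θ h.eq_span).val.toLinearMap).codRestrict _
      fun f => by
        obtain ⟨b, hb⟩ := h.mem_zero_iff.1 (f.2 ⟨0, h.pos⟩)
        exact ⟨b, hb.symm⟩
  refine ⟨e.symm.toLinearMap.comp p, (LinearEquiv.symm_apply_eq e).2 (Subtype.ext ?_)⟩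
  change (1 : CyclicAlgebra (FractionRing B) n θ) ⟨0, h.pos⟩ = algebraMap B (FractionRing B) 1
  rw [CyclicAlgebra.one_apply, if_pos rfl, map_one]

end HasClassOrder

/-- A dualizing ideal of a `ℚ`-Gorenstein singularity defines a class of finite order. -/
theorem IsDualizingIdeal.hasClassOrder {B : Type u} [CommRing B] [IsDomain B] [IsLocalRing B]
    (hd : ringKrullDim B = 2) {ω : FractionalIdeal B⁰ (FractionRing B)} (hω : IsDualizingIdeal ω) {n : ℕ}
    (hn : IsLeast {m : ℕ | 0 < m ∧ (divisorialPower ω m).IsPrincipal} n)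
    {θ : FractionRing B} (hθ : divisorialPower ω n = Submodule.span B {θ}) : HasClassOrder ω n θ where
  pos := hn.1.1
  ne_zero h0 := by
    obtain ⟨x, hx⟩ := (nontrivial_iff_exists_ne (0 : (ω : Submodule B (FractionRing B)))).1
      (IsDualizingModule.nontrivial hd hω)
    have h1 : x.1 ∈ (0 : FractionalIdeal B⁰ (FractionRing B)) := h0 ▸ x.2
    exact hx (Subtype.ext ((FractionalIdeal.mem_zero_iff _).1 h1))
  eq_span := hθ
  minimal _ hi hp := hn.2 ⟨hi, hp⟩


/-! ### The theorem -/

theorem mainTheorem11 {k B : Type u} [Field k] [IsAlgClosed k] [CommRing B] [IsDomain B]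
    [IsLocalRing B] [Algebra k B] (hB : IsNormalSurfaceSingularity k B)
    (ω : FractionalIdeal B⁰ (FractionRing B)) (hω : IsDualizingIdeal ω)
    (hQ : IsQGorenstein k ω)
    (n : ℕ) (hn : IsLeast {m : ℕ | 0 < m ∧ (divisorialPower ω m).IsPrincipal} n)
    (θ : FractionRing B) (hθ : divisorialPower ω n = Submodule.span B {θ}) :
    ∃ _ : IsLocalRing (gorensteinCovering ω n θ hθ),
      IsNormalSurfaceSingularity k (gorensteinCovering ω n θ hθ) ∧
      IsGorensteinLocalRing (gorensteinCovering ω n θ hθ) ∧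
      Function.Injective (algebraMap B (gorensteinCovering ω n θ hθ)) ∧
      (∃ G : Subgroup (gorensteinCovering ω n θ hθ ≃ₐ[B] gorensteinCovering ω n θ hθ),
        IsCyclic G ∧ Nat.card G = n ∧
        (∀ a : gorensteinCovering ω n θ hθ,
          (∀ g ∈ G, g a = a) ↔ a ∈ Set.range (algebraMap B (gorensteinCovering ω n θ hθ))) ∧
        ActsFreelyInCodimOne G) ∧
      (IsCMTame k (gorensteinCovering ω n θ hθ) ↔ IsCMTame k B) ∧
      (IsCMTameBounded k (gorensteinCovering ω n θ hθ) ↔ IsCMTameBounded k B) ∧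
      (IsCMTameExponential k (gorensteinCovering ω n θ hθ) ↔ IsCMTameExponential k B) := by
  have := hB.isNoetherianRing
  have := hB.isIntegrallyClosed
  have hd := hB.ringKrullDim_eq_two
  obtain ⟨_, _⟩ := hB.exists_surfaceOver
  have h := hω.hasClassOrder hd hn hθ
  obtain ⟨m, -, hm, hmp⟩ := hQ
  -- The least exponent divides every exponent with principal divisorial power, in particular one
  -- that is prime to the characteristic.
  have hnk : (n : k) ≠ 0 := fun h0 => hm (by
    obtain ⟨q, rfl⟩ := h.dvd_of_isPrincipal hmp
    rw [Nat.cast_mul, h0, zero_mul])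
  have hnB : IsUnit (n : B) := by
    rw [← map_natCast (algebraMap k B)]
    exact (IsUnit.mk0 _ hnk).map _
  have : NeZero (n : k) := ⟨hnk⟩
  obtain ⟨ζ, hζ⟩ := HasEnoughRootsOfUnity.exists_primitiveRoot k n
  have hζB := hζ.map_of_injective (algebraMap k B).injective
  have := h.isDomain_covering hζB
  have := h.isLocalRing_covering
  have := h.isIntegrallyClosed_covering hζB hnB
  have := h.finite_covering
  have := h.faithfulSMul_covering
  have hmem := h.algebraMap_mem_iff (IsLocalRing.maximalIdeal (gorensteinCovering ω n θ hθ))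
  have hS : SurfaceOver k (gorensteinCovering ω n θ hθ) :=
    SurfaceOver.of_finite (B := B) fun b hb => (hmem b).2 hb
  have hres : ∀ a : gorensteinCovering ω n θ hθ, ∃ b : B,
      a - algebraMap B _ b ∈ IsLocalRing.maximalIdeal (gorensteinCovering ω n θ hθ) := fun a => by
    obtain ⟨b, -, hb⟩ := h.exists_sub_mem_of_isMaximal a
    exact ⟨b, hb _⟩
  refine ⟨inferInstance, ?_, ?_, FaithfulSMul.algebraMap_injective _ _, h.exists_deckGroup k hd hζ, ?_⟩
  · refine SurfaceOver.isNormalSurfaceSingularity fun a => ?_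
    obtain ⟨b, hb⟩ := hres a
    obtain ⟨t, ht⟩ := hB.residue_bijective.2 (IsLocalRing.residue B b)
    have h1 : b - algebraMap k B t ∈ IsLocalRing.maximalIdeal B := by
      rw [← IsLocalRing.residue_eq_zero_iff, map_sub, ← ht, sub_eq_zero]
      rfl
    refine ⟨t, ?_⟩
    have h2 := Ideal.add_mem _ hb ((hmem _).2 h1)
    rw [map_sub, sub_add_sub_cancel, ← IsScalarTower.algebraMap_apply k B] at h2
    exact h2
  · have hreg := ((SurfaceOver.isMaximalCohenMacaulay_iff k).1 (IsDualizingModule.isMaximalCohenMacaulay hd hω)).2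
    -- A dualizing module has depth two, so `ω` is already divisorial; the component of degree one
    -- takes values in the dualizing module itself.
    have h1 : divisorialPower ω 1 = ω := by
      ext z
      exact h.mem_one_iff hd hreg (SurfaceOver.mem 0) (SurfaceOver.mem 1)
    have hdual : IsDualizingModule B (divisorialPower ω 1) := by
      rw [h1]
      exact hω
    exact isGorensteinLocalRing_of_trace (k := k) h.compOne hdual h.existsUnique_compOne hmem hres
  · obtain ⟨π, hπ⟩ := h.exists_projection
    obtain ⟨C, hC⟩ := exists_cmTransfer_restrict (k := k) π hπ
    obtain ⟨C', hC'⟩ := exists_cmTransfer_coind (k := k) (A := gorensteinCovering ω n θ hθ) (B := B)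
      fun M hM => h.isSummand_coind k hnB hM
    exact hC.tame_iff hC'
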